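/- **Setting.** Let $N\ge 2$, $a\in(0,\infty)^N$, and let $\mathbb T=\prod_i\mathbb R/2\pi a_i\mathbb Z$, with volume $|\mathbb T|$ and frequencies $k\in\widetilde{\mathbb Z}^N=\prod_i\mathbb Z/a_i$. Let $p(\rho,\theta)$, $e(\rho,\theta)$ be $C^2$ on $\{\rho,\theta>0\}$ with $p_\rho>0$, $e_\theta>0$ and $\rho^2e_\rho=p-\theta p_\theta$. Fix $\rho^\circ,\theta^\circ>0$; a superscript $\circ$ denotes the value at $(\rho^\circ,\theta^\circ)$. Let $\mu^\circ>0$, $\lambda^\circ\ge0$, $\kappa^\circ>0$. Put $(c^\circ)^2=p^\circ_\rho+\frac{\theta^\circ(p_\theta^\circ)^2}{(\rho^\circ)^2e_\theta^\circ}$. On mean-zero fields $V=(\rho,u,\theta)\in L^2(\mathbb T)^{N+2}$ use the inner product $$\langle V,W\rangle=\int_{\mathbb T}V^T\,\mathrm{diag}\Big(\tfrac{p_\rho^\circ}{\rho^\circ\theta^\circ},\tfrac{\rho^\circ}{\theta^\circ}I,\tfrac{\rho^\circ e_\theta^\circ}{(\theta^\circ)^2}\Big)\overline W\,dx .$$ The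 norms $\|V\|_{L^2}$, $\|\nabla V\|_{L^2}$, $\|\Delta_qV\|_{L^2}$ below are taken in this weighted sense. All fields $\mathcal U,V$ are real-valued. The acoustic operator is $$\mathcal A(\rho,u,\theta)=\Big(\rho^\circ\nabla\!\cdot u,\ \tfrac{p_\rho^\circ}{\rho^\circ}\nabla\rho+\tfrac{p_\theta^\circ}{\rho^\circ}\nabla\theta,\ \tfrac{\theta^\circ p_\theta^\circ}{\rho^\circ e_\theta^\circ}\nabla\!\cdot u\Big).$$ Let $\mathcal P,\mathcal P^\perp$ be the orthogonal projections onto $\mathrm{Null}(\mathcal A)$ and $\mathrm{Null}(\mathcal A)^\perp$ in the space of mean-zero fields. For $k\ne0$, $\alpha=\pm1$, the normalized eigenfunctions of $\mathcal A$ are $$H^\alpha_k=\tfrac{1}{c^\circ|\mathbb T|^{1/2}}\sqrt{\tfrac{\theta^\circ}{2\rho^\circ}}\Big(\rho^\circ,\ c^\circ\alpha\,\mathrm{sg}(k)\tfrac{k}{|k|},\ \tfrac{\theta^\circ p_\theta^\circ}{\rho^\circ e_\theta^\circ}\Big)e^{ik\cdot x},\qquad \lambda^\alpha_k=ic^\circ\alpha\,\mathrm{sg}(k)|k|,$$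 where $\mathrm{sg}(k)=1$ if the first nonzero component of $k$ is positive and $-1$ otherwise. Put $V^\alpha_k=\langle V,H^\alpha_k\rangle$. Let $\mathcal Q$ be the symmetric bilinear operator with $$\mathcal Q(U,U)=\big(\nabla\!\cdot(\rho u),\ u\!\cdot\!\nabla u+C_1\rho\nabla\rho+C_2\theta\nabla\theta+C_3\theta\nabla\rho+C_4\rho\nabla\theta,\ u\!\cdot\!\nabla\theta+(C_5\theta+C_6\rho)\nabla\!\cdot u\big),$$ $$C_1=\tfrac{p^\circ_{\rho\rho}}{\rho^\circ}-\tfrac{p^\circ_\rho}{(\rho^\circ)^2},\quad C_2=\tfrac{p^\circ_{\theta\theta}}{\rho^\circ},\quad C_3=\tfrac{p^\circ_{\rho\theta}}{\rho^\circ},\quad C_4=\tfrac{p^\circ_{\rho\theta}}{\rho^\circ}-\tfrac{p^\circ_\theta}{(\rho^\circ)^2},$$ $$C_5=\partial_\theta\Big(\frac{\theta p_\theta}{\rho e_\theta}\Big)^{\!\circ},\qquad C_6=\partial_\rho\Big(\frac{\theta p_\theta}{\rho e_\theta}\Big)^{\!\circ}$$ (these two derivatives expanded by the product rule), and let $$\mathcal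 D(\rho,u,\theta)=\Big(0,\ \tfrac{\mu^\circ}{\rho^\circ}\Delta u+\tfrac{\frac{N-2}{N}\mu^\circ+\lambda^\circ}{\rho^\circ}\nabla\nabla\!\cdot u,\ \tfrac{\kappa^\circ}{\rho^\circ e_\theta^\circ}\Delta\theta\Big).$$ The averaged operators are $$\mathcal Q_{2r}(\mathcal U,V)=\sum_{\gamma,m}\ \sum_{\alpha,\,k:\ \lambda^\alpha_k=\lambda^\gamma_m}2\big\langle\mathcal Q(\widehat{\mathcal U}_{m-k}e^{i(m-k)\cdot x},H^\alpha_k),H^\gamma_m\big\rangle V^\alpha_k\,H^\gamma_m,$$ $$\mathcal Q_{3r}(V,V)=\sum_{\gamma,m}\ \sum_{\substack{\alpha,\beta,\ k+l=m\\ \lambda^\alpha_k+\lambda^\beta_l=\lambda^\gamma_m}}\big\langle\mathcal Q(H^\alpha_k,H^\beta_l),H^\gamma_m\big\rangle V^\alpha_kV^\beta_l\,H^\gamma_m ,$$ and the averaged viscosity is $$\bar\mu=\frac{\theta^\circ}{2\rho^\circ}\Big(\frac{\frac{2N-2}{N}\mu^\circ+\lambda^\circ}{\theta^\circ}+\kappa^\circ\Big(\frac{p_\theta^\circ}{\rho^\circ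 c^\circ e_\theta^\circ}\Big)^2\Big),\qquad\text{so that}\quad\langle\mathcal DH^\alpha_k,H^\alpha_k\rangle=-\bar\mu|k|^2 .$$ Fix a smooth even $\varphi$ supported in $\{\frac56\le|r|\le\frac{12}5\}$ with $\sum_{q\in\mathbb Z}\varphi(2^{-q}r)=1$ for $r\neq0$, and let $\Delta_q$ be the Fourier multiplier $\varphi(2^{-q}|k|)$. Put $\|V\|_{B^s}=|\widehat V_0|+\sum_{q\in\mathbb Z}2^{qs}\|\Delta_qV\|_{L^2}$. Let $F^s$ be the set of $V\in C([0,\infty);B^{s-1})\cap L^1(0,\infty;B^{s+1})$ such that $\sup_t|\widehat V_0(t)|+\sum_q2^{q(s-1)}\sup_{t\ge0}\|\Delta_qV(t)\|_{L^2}<\infty$. Equations are understood in the sense of distributions, that is, for each Fourier coefficient. **Theorem.** Let $s\ge1$. There are $c>0$ depending only on $s,N$ and $C>0$ depending only on $s$, $N$, $a$, $(\rho^\circ,\theta^\circ)$ and the equations of state $p,e$ (and both on the fixed $\varphi$) such that the following holds for all $\mu^\circ,\lambda^\circ,\kappa^\circ$. Let $V_{in}\in B^{s-1}\cap\mathrm{Null}(\mathcal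 A)^\perp$, and let $\mathcal U\in F^s$ be a $\mathrm{Null}(\mathcal A)$-valued solution of the incompressible Navier–Stokes–Fourier system $\partial_t\mathcal U+\mathcal P\mathcal Q(\mathcal U,\mathcal U)-\mathcal P\mathcal D\,\mathcal U=0$ on $[0,\infty)$. Then the limit system $$\partial_tV+\mathcal Q_{2r}(\mathcal U,V)+\mathcal Q_{3r}(V,V)-\bar\mu\Delta V=0,\qquad V|_{t=0}=V_{in}\tag{LS}$$ has a unique solution $V\in F^s$, and $V(t)\in\mathrm{Null}(\mathcal A)^\perp$ for all $t\ge 0$. Moreover, for all $t\in(0,\infty]$ (for $t=\infty$ the terms evaluated at time $t$ are omitted), $$\|V(t)\|_{L^2}^2+2\bar\mu\int_0^t\|\nabla V(\tau)\|_{L^2}^2\,d\tau\le\|V_{in}\|_{L^2}^2,$$ $$\|V(t)\|_{B^{s-1}}+c\bar\mu\int_0^t\|V(\tau)\|_{B^{s+1}}\,d\tau\le\exp\Big(\frac{C}{\bar\mu^2}\|V_{in}\|_{L^2}^2\Big)\|V_{in}\|_{B^{s-1}} .$$ Finally, for every $T>0$, two solutions of the equation in (LS) on $[0,T]$ that belong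 to $C([0,T];L^2)\cap L^2(0,T;H^1)$ and have the same initial value coincide on $[0,T]$. -/

import Mathlib

open MeasureTheory Filter Topology Set
open scoped ENNReal ComplexConjugate

noncomputable section

namespace LowMach

/-! ### The periodic box and its function spaces

A point `x` of the box `∏ ℝ / (2π aᵢ ℤ)` is written `xᵢ = 2π aᵢ yᵢ` with `y` in the unit torus, so that
`dx = |𝕋| dy` with `|𝕋| = ∏ 2π aᵢ`, and the character `exp (i k · x)` with `kᵢ = nᵢ / aᵢ`, `n ∈ ℤᴺ`,
is `UnitAddTorus.mFourier n y`. -/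

/-- The Haar probability measure `dy` of the unit torus. -/
abbrev torusMeasure (N : ℕ) : Measure (UnitAddTorus (Fin N)) :=
  Measure.pi fun _ => AddCircle.haarAddCircle

/-- Real square integrable functions on the torus. -/
abbrev L2 (N : ℕ) : Type := Lp ℝ 2 (torusMeasure N)

/-- Real fields `(ρ, u, θ)` in `L²(𝕋; ℝ^{N+2})`. -/
abbrev State (N : ℕ) : Type := L2 N × (Fin N → L2 N) × L2 N

/-- Amplitudes `(ρ, u, θ) ∈ ℂ^{N+2}` of a single Fourier mode. -/
abbrev Mode (N : ℕ) : Type := ℂ × (Fin N → ℂ) × ℂ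

/-- Fourier coefficient `(1/|𝕋|) ∫ f(x) exp (-i k · x) dx` of a real function. -/
def coeff {N : ℕ} (f : L2 N) (n : Fin N → ℤ) : ℂ :=
  ∫ y, UnitAddTorus.mFourier (-n) y * ((f y : ℝ) : ℂ) ∂(torusMeasure N)

/-- Fourier coefficient of a field. -/
def State.hat {N : ℕ} (U : State N) (n : Fin N → ℤ) : Mode N :=
  (coeff U.1 n, fun i => coeff (U.2.1 i) n, coeff U.2.2 n)

/-- Smooth even dyadic cut-off with `∑_q φ(2^{-q} r) = 1` for `r ≠ 0`. -/
structure DyadicCutoff where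
  φ : ℝ → ℝ
  smooth : ContDiff ℝ (⊤ : ℕ∞) φ
  even : ∀ r, φ (-r) = φ r
  support_subset : Function.support φ ⊆ {r | 5 / 6 ≤ |r| ∧ |r| ≤ 12 / 5}
  sum_eq_one : ∀ r, r ≠ 0 → HasSum (fun q : ℤ => φ ((2 : ℝ) ^ (-q) * r)) 1

/-! ### Thermodynamics and the reference state -/

/-- Equations of state for the pressure `p(ρ,θ)` and the specific internal energy `e(ρ,θ)`. -/
structure EquationOfState where
  p : ℝ → ℝ → ℝ
  e : ℝ → ℝ → ℝ
  p_smooth : ContDiffOn ℝ 2 (fun z : ℝ × ℝ => p z.1 z.2) (Ioi 0 ×ˢ Ioi 0)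
  e_smooth : ContDiffOn ℝ 2 (fun z : ℝ × ℝ => e z.1 z.2) (Ioi 0 ×ˢ Ioi 0)
  p_rho_pos : ∀ r > 0, ∀ t > 0, 0 < deriv (fun x => p x t) r
  e_theta_pos : ∀ r > 0, ∀ t > 0, 0 < deriv (fun x => e r x) t
  /-- The Maxwell relation `ρ² e_ρ = p - θ p_θ`. -/
  maxwell : ∀ r > 0, ∀ t > 0,
    r ^ 2 * deriv (fun x => e x t) r = p r t - t * deriv (fun x => p r x) t

/-- A fluid with a constant reference state `(ρ°, 0, θ°)` in the box with aspect ratio `a`. -/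
structure Setting (N : ℕ) extends EquationOfState where
  a : Fin N → ℝ
  a_pos : ∀ i, 0 < a i
  rho : ℝ
  rho_pos : 0 < rho
  theta : ℝ
  theta_pos : 0 < theta

/-- Values at the reference state of the shear viscosity, the bulk viscosity and the heat
conductivity. -/
structure Transport where
  mu : ℝ
  mu_pos : 0 < mu
  lam : ℝ
  lam_nonneg : 0 ≤ lam
  kappa : ℝ
  kappa_pos : 0 < kappa

namespace Setting

variable {N : ℕ} (S : Setting N)

/-! Derivatives of `p` and `e` at the reference state. -/

def pr : ℝ := deriv (fun r => S.p r S.theta) S.rho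
def pt : ℝ := deriv (fun t => S.p S.rho t) S.theta
def et : ℝ := deriv (fun t => S.e S.rho t) S.theta
def prr : ℝ := deriv (fun r => deriv (fun r' => S.p r' S.theta) r) S.rho
def prt : ℝ := deriv (fun t => deriv (fun r => S.p r t) S.rho) S.theta
def ptt : ℝ := deriv (fun t => deriv (fun t' => S.p S.rho t') t) S.theta
def ett : ℝ := deriv (fun t => deriv (fun t' => S.e S.rho t') t) S.theta
def etr : ℝ := deriv (fun r => deriv (fun t => S.e r t) S.theta) S.rho

/-- Sound speed `c°`. -/
def c : ℝ := √(S.pr + S.theta * S.pt ^ 2 / (S.rho ^ 2 * S.et))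

def C1 : ℝ := S.prr / S.rho - S.pr / S.rho ^ 2
def C2 : ℝ := S.ptt / S.rho
def C3 : ℝ := S.prt / S.rho
def C4 : ℝ := S.prt / S.rho - S.pt / S.rho ^ 2
def C5 : ℝ := S.pt / (S.rho * S.et) + S.theta * S.ptt / (S.rho * S.et)
  - S.theta * S.pt * S.ett / (S.rho * S.et ^ 2)
def C6 : ℝ := S.theta * S.prt / (S.rho * S.et) - S.theta * S.pt / (S.rho ^ 2 * S.et)
  - S.theta * S.pt * S.etr / (S.rho * S.et ^ 2)

/-- The volume `|𝕋|` of the box. -/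
def vol : ℝ := ∏ i, 2 * Real.pi * S.a i

/-- The wave vector `k = (nᵢ / aᵢ)ᵢ`. -/
def wave (n : Fin N → ℤ) (i : Fin N) : ℝ := n i / S.a i

/-- `|k|`. -/
def wabs (n : Fin N → ℤ) : ℝ := √(∑ i, S.wave n i ^ 2)

/-- `k · X`. -/
def dot (n : Fin N → ℤ) (X : Fin N → ℂ) : ℂ := ∑ i, (S.wave n i : ℂ) * X i

/-! ### The entropy inner product -/

/-- `Xᵀ M Ȳ` for the entropy matrix `M = diag (p_ρ/(ρθ), (ρ/θ) I, ρ e_θ/θ²)`. -/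
def pairing (X Y : Mode N) : ℂ :=
  (S.pr / (S.rho * S.theta) : ℝ) * (X.1 * conj Y.1)
    + (S.rho / S.theta : ℝ) * ∑ i, X.2.1 i * conj (Y.2.1 i)
    + (S.rho * S.et / S.theta ^ 2 : ℝ) * (X.2.2 * conj Y.2.2)

/-- `Xᵀ M X̄`. -/
def modeSq (X : Mode N) : ℝ :=
  S.pr / (S.rho * S.theta) * ‖X.1‖ ^ 2 + S.rho / S.theta * ∑ i, ‖X.2.1 i‖ ^ 2
    + S.rho * S.et / S.theta ^ 2 * ‖X.2.2‖ ^ 2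

/-- The inner product `∫ Vᵀ M W dx` of real fields. -/
def innerH (V W : State N) : ℝ :=
  S.vol * (S.pr / (S.rho * S.theta) * inner ℝ V.1 W.1
    + S.rho / S.theta * ∑ i, inner ℝ (V.2.1 i) (W.2.1 i)
    + S.rho * S.et / S.theta ^ 2 * inner ℝ V.2.2 W.2.2)

/-- `‖V‖²`, the square of the `L²` norm of the entropy inner product. -/
def normSq (V : State N) : ℝ := S.innerH V V

/-- `‖∇V‖²` in the same `L²` norm. -/
def gradSq (V : State N) : ℝ≥0∞ :=
  ENNReal.ofReal S.vol * ∑' n, ENNReal.ofReal (S.wabs n ^ 2 * S.modeSq (V.hat n))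

/-- `‖Δ_q V‖` in the same `L²` norm. -/
def blockNorm (χ : DyadicCutoff) (q : ℤ) (V : State N) : ℝ≥0∞ :=
  (ENNReal.ofReal S.vol *
    ∑' n, ENNReal.ofReal (χ.φ ((2 : ℝ) ^ (-q) * S.wabs n) ^ 2 * S.modeSq (V.hat n))) ^ (1 / 2 : ℝ)

/-- Size of the mean of `V`. -/
def meanNorm (V : State N) : ℝ≥0∞ := ENNReal.ofReal √(S.modeSq (V.hat 0))

/-- The norm of the Besov space `B^s = B^s_{2,1}`. -/
def besov (χ : DyadicCutoff) (s : ℝ) (V : State N) : ℝ≥0∞ :=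
  S.meanNorm V + ∑' q : ℤ, ENNReal.ofReal ((2 : ℝ) ^ ((q : ℝ) * s)) * S.blockNorm χ q V

/-- Membership in `F^s = C̃([0,∞); B^{s-1}) ∩ L¹(0,∞; B^{s+1})`, for fields with values in `L²`
(which is no restriction if `1 ≤ s`). -/
structure MemF (χ : DyadicCutoff) (s : ℝ) (V : ℝ → State N) : Prop where
  finite : ∀ t, 0 ≤ t → S.besov χ (s - 1) (V t) ≠ ⊤
  continuous : ∀ t₀, 0 ≤ t₀ →
    Tendsto (fun t => S.besov χ (s - 1) (V t - V t₀)) (𝓝[Ici 0] t₀) (𝓝 0)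
  /-- The sum over dyadic blocks of the suprema in time is finite. -/
  tilde : (⨆ t ∈ Ici (0 : ℝ), S.meanNorm (V t))
    + ∑' q : ℤ, ENNReal.ofReal ((2 : ℝ) ^ ((q : ℝ) * (s - 1))) *
        (⨆ t ∈ Ici (0 : ℝ), S.blockNorm χ q (V t)) ≠ ⊤
  integrable : ∫⁻ t in Ioi (0 : ℝ), S.besov χ (s + 1) (V t) ≠ ⊤

/-- Membership in `C([0,T]; L²) ∩ L²(0,T; H¹)`. -/
structure MemEnergy (T : ℝ) (V : ℝ → State N) : Prop where
  continuous : ContinuousOn V (Icc 0 T)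
  integrable : ∫⁻ t in Ioc (0 : ℝ) T, S.gradSq (V t) ≠ ⊤

/-! ### The acoustic operator -/

/-- The acoustic operator `𝒜` acting on `X exp (i k · x)`. -/
def acoustic (n : Fin N → ℤ) (X : Mode N) : Mode N :=
  (S.rho * (Complex.I * S.dot n X.2.1),
   fun i => Complex.I * S.wave n i * ((S.pr / S.rho : ℝ) * X.1 + (S.pt / S.rho : ℝ) * X.2.2),
   (S.theta * S.pt / (S.rho * S.et) : ℝ) * (Complex.I * S.dot n X.2.1))

/-- `Null(𝒜)` in the space of fields of mean zero. -/
def nullA : Set (State N) := {U | U.hat 0 = 0 ∧ ∀ n, S.acoustic n (U.hat n) = 0}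

/-- The orthogonal complement of `Null(𝒜)` in the space of fields of mean zero. -/
def nullAPerp : Set (State N) := {V | V.hat 0 = 0 ∧ ∀ W ∈ S.nullA, S.innerH V W = 0}

/-- Generalized sign: `1` if the first nonzero component is positive, `-1` otherwise. -/
def sg (n : Fin N → ℤ) : ℝ :=
  open Classical in if ∃ i, 0 < n i ∧ ∀ j < i, n j = 0 then 1 else -1

/-- The normalization constant `c_N`. -/
def cN : ℝ := 1 / (S.c * √S.vol) * √(S.theta / (2 * S.rho))

/-- The amplitude of the normalized eigenfunction `H^α_k` of `𝒜` (for `k ≠ 0`, `α = ±1`). -/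
def eigvec (α : ℤˣ) (n : Fin N → ℤ) : Mode N :=
  ((S.cN * S.rho : ℝ),
   fun i => (S.cN * (S.c * ((α : ℤ) : ℝ) * sg n * (S.wave n i / S.wabs n)) : ℝ),
   (S.cN * (S.theta * S.pt / (S.rho * S.et)) : ℝ))

/-- The eigenvalue `λ^α_k = i c° α sg(k) |k|`. -/
def eigval (α : ℤˣ) (n : Fin N → ℤ) : ℂ :=
  Complex.I * (S.c * ((α : ℤ) : ℝ) * sg n * S.wabs n : ℝ)

/-- `V^α_k = ⟨V, H^α_k⟩`, computed from the Fourier coefficient of `V`. -/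
def coord (V : State N) (α : ℤˣ) (n : Fin N → ℤ) : ℂ :=
  S.vol * S.pairing (V.hat n) (S.eigvec α n)

/-! ### The quadratic and the dissipative operator -/

/-- The amplitude of `(∇·(ρ₁ u₂), u₁·∇u₂ + C₁ρ₁∇ρ₂ + C₂θ₁∇θ₂ + C₃θ₁∇ρ₂ + C₄ρ₁∇θ₂,
u₁·∇θ₂ + (C₅θ₁ + C₆ρ₁)∇·u₂)` for the fields `X exp (i k · x)` and `Y exp (i l · x)`. -/
def preQ (k : Fin N → ℤ) (X : Mode N) (l : Fin N → ℤ) (Y : Mode N) : Mode N :=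
  (Complex.I * (X.1 * S.dot (k + l) Y.2.1),
   fun i => Complex.I * (S.dot l X.2.1 * Y.2.1 i
      + S.wave l i * (S.C1 * X.1 * Y.1 + S.C2 * X.2.2 * Y.2.2
        + S.C3 * X.2.2 * Y.1 + S.C4 * X.1 * Y.2.2)),
   Complex.I * (S.dot l X.2.1 * Y.2.2 + (S.C5 * X.2.2 + S.C6 * X.1) * S.dot l Y.2.1))

/-- The polarized quadratic operator: amplitude of `𝒬(X exp (i k · x), Y exp (i l · x))`. -/
def quad (k : Fin N → ℤ) (X : Mode N) (l : Fin N → ℤ) (Y : Mode N) : Mode N :=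
  (1 / 2 : ℂ) • (S.preQ k X l Y + S.preQ l Y k X)

/-- The operator `𝒟` acting on `X exp (i k · x)`. -/
def dissip (τ : Transport) (n : Fin N → ℤ) (X : Mode N) : Mode N :=
  (0,
   fun i => -((τ.mu / S.rho * S.wabs n ^ 2 : ℝ) * X.2.1 i)
      - ((((N : ℝ) - 2) / N * τ.mu + τ.lam) / S.rho : ℝ) * (S.wave n i * S.dot n X.2.1),
   -((τ.kappa / (S.rho * S.et) * S.wabs n ^ 2 : ℝ) * X.2.2))

/-! ### The incompressible Navier-Stokes-Fourier system -/

/-- The component `ϑ` of an amplitude. -/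
def entropyPart (X : Mode N) : ℂ :=
  (S.pr / S.c ^ 2 : ℝ) * X.2.2
    - (S.theta * S.pt * S.pr / (S.rho ^ 2 * S.et * S.c ^ 2) : ℝ) * X.1

/-- The projection `𝒫` onto the mean-free part of `Null(𝒜)` acting on `X exp (i k · x)`; the velocity
component is the Leray projection. -/
def projNull (n : Fin N → ℤ) (X : Mode N) : Mode N :=
  if n = 0 then 0 else
    (-((S.pt / S.pr : ℝ) * S.entropyPart X),
     fun i => X.2.1 i - S.wave n i * S.dot n X.2.1 / (S.wabs n ^ 2 : ℝ),
     S.entropyPart X)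

/-- `U` takes values in `Null(𝒜)` and solves `∂ₜU + 𝒫𝒬(U,U) - 𝒫𝒟U = 0`, tested against each
character, on `[0,∞)`. -/
structure SolvesINSF (τ : Transport) (U : ℝ → State N) : Prop where
  mem_null : ∀ t, 0 ≤ t → U t ∈ S.nullA
  equation : ∀ n : Fin N → ℤ, ∀ t, 0 ≤ t →
    HasDerivWithinAt (fun t' => (U t').hat n)
      (S.projNull n (S.dissip τ n ((U t).hat n)
        - ∑' l : Fin N → ℤ, S.quad l ((U t).hat l) (n - l) ((U t).hat (n - l))))
      (Ici 0) t

/-! ### The averaged acoustic system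

`𝒬_{2r}` and `𝒬_{3r}` keep, in `2 e^{τ𝒜} 𝒫^⊥ 𝒬(U, e^{-τ𝒜} V)` and `e^{τ𝒜} 𝒫^⊥ 𝒬(e^{-τ𝒜} V, e^{-τ𝒜} V)`,
exactly the interactions that do not oscillate in `τ`. -/

open Classical in
/-- The coefficient of `𝒬_{2r}(U,V)` along `H^γ_m`: the sum over the `(α,k)` with `k ≠ 0` and
`λ^α_k = λ^γ_m` of `2 ⟨𝒬(Û_{m-k} e^{i(m-k)·x}, H^α_k), H^γ_m⟩ V^α_k`. -/
def q2r (U V : State N) (γ : ℤˣ) (m : Fin N → ℤ) : ℂ :=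
  ∑' z : ℤˣ × (Fin N → ℤ),
    if z.2 ≠ 0 ∧ S.eigval z.1 z.2 = S.eigval γ m then
      2 * (S.vol * S.pairing (S.quad (m - z.2) (U.hat (m - z.2)) z.2 (S.eigvec z.1 z.2))
        (S.eigvec γ m)) * S.coord V z.1 z.2
    else 0

open Classical in
/-- The coefficient of `𝒬_{3r}(V,W)` along `H^γ_m`: the sum over the `(α,k)`, `(β,l)` with `k, l ≠ 0`,
`k + l = m` and `λ^α_k + λ^β_l = λ^γ_m` of `⟨𝒬(H^α_k, H^β_l), H^γ_m⟩ V^α_k W^β_l`. -/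
def q3r (V W : State N) (γ : ℤˣ) (m : Fin N → ℤ) : ℂ :=
  ∑' z : ℤˣ × ℤˣ × (Fin N → ℤ),
    if z.2.2 ≠ 0 ∧ m - z.2.2 ≠ 0 ∧
        S.eigval z.1 z.2.2 + S.eigval z.2.1 (m - z.2.2) = S.eigval γ m then
      S.vol * S.pairing
          (S.quad z.2.2 (S.eigvec z.1 z.2.2) (m - z.2.2) (S.eigvec z.2.1 (m - z.2.2)))
          (S.eigvec γ m)
        * S.coord V z.1 z.2.2 * S.coord W z.2.1 (m - z.2.2)
    else 0

/-- The Fourier coefficient of `𝒬_{2r}(U,V) = ∑ q2r H^γ_m`. -/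
def Q2rHat (U V : State N) (m : Fin N → ℤ) : Mode N :=
  if m = 0 then 0 else ∑ γ : ℤˣ, S.q2r U V γ m • S.eigvec γ m

/-- The Fourier coefficient of `𝒬_{3r}(V,W) = ∑ q3r H^γ_m`. -/
def Q3rHat (V W : State N) (m : Fin N → ℤ) : Mode N :=
  if m = 0 then 0 else ∑ γ : ℤˣ, S.q3r V W γ m • S.eigvec γ m

/-- The averaged viscosity: `⟨𝒟 H^α_k, H^α_k⟩ = -μ̄ |k|²`. -/
def muBar (τ : Transport) : ℝ :=
  (((2 * (N : ℝ) - 2) / N * τ.mu + τ.lam) / S.theta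
    + τ.kappa * (S.pt / (S.rho * S.c * S.et)) ^ 2) * (S.cN * S.c) ^ 2 * S.vol

/-- On the time set `I`, `V` solves `∂ₜV + 𝒬_{2r}(U,V) + 𝒬_{3r}(V,V) - μ̄ΔV = 0`, tested against each
character. -/
def SolvesLS (τ : Transport) (U : ℝ → State N) (I : Set ℝ) (V : ℝ → State N) : Prop :=
  ∀ n : Fin N → ℤ, ∀ t ∈ I,
    HasDerivWithinAt (fun t' => (V t').hat n)
      (-S.Q2rHat (U t) (V t) n - S.Q3rHat (V t) (V t) n
        - ((S.muBar τ * S.wabs n ^ 2 : ℝ) : ℂ) • (V t).hat n) I t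

end Setting

end LowMach

end

noncomputable section

namespace LowMach

/-! ### Fourier series of real square integrable functions -/

/-! In the orthonormal basis of acoustic eigenfunctions the limit system becomes an infinite system
of ODEs for the coordinates x(γ, m). Viscosity is diagonal there, and each of the two nonlinear
terms has a rigid structure.

The two-wave term couples only frequencies of equal length, and since 𝒰 is divergence-free its
matrix is skew-Hermitian (`couple_skew`). It therefore drops out of every energy identity whose
weight depends on |m| alone (`re_sum_couple_eq_zero`): the L² energy, the energy of a dyadic block,
the energy of a difference of two solutions. This is why no norm of 𝒰 enters the estimates.

In the three-wave term, k + l = m together with ±|k| ± |l| = ±|m| is the equality case of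
Cauchy–Schwarz. So k, l, m are collinear, and the convention for sg makes the three signs α, β, γ
agree (`resonant_iff`). On one lattice line all eigenvectors of a given sign have the same
amplitude, and the interaction coefficient is a constant times iγ sg(m)|m|
(`vol_pairing_quad_eigvec`). Hence 𝒬_{3r} is a family of Burgers nonlinearities, one for each
lattice line through the origin. Symmetrizing over the three frequencies -m, k, m - k shows that it
conserves energy (`sum_conj_mul_burgers_eq_zero`). Since the sum over k runs along a line, estimates
have one-dimensional strength whatever N is: `exists_trilinear_le` bounds the resonant trilinear
form by L² · L² · Ḣ¹, because ∑ |k|^{-3/2} converges on a line, and it leaves a quarter of a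
derivative to spare.

Existence uses truncation to |m| ≤ R, which is compatible with the two-wave term. The energy
identity bounds μ̄ ∫ ‖∇x‖² by the data. For two truncations R ≤ R', viscosity absorbs the gradient
of the difference, the Gronwall weight ‖∇x‖² + ‖∇y‖² is integrable over all times, and the discarded
frequencies contribute an error of order R^{-1/4} (`exists_galerkin_sub_le`). So the truncated
solutions form a Cauchy sequence in L², uniformly on bounded time intervals, and no compactness
argument is needed.

For the Besov bound, an output at frequency about 2^q needs an input of at least half that size.
Thus the block norms n_q satisfy n_q' + cμ̄4^q n_q ≤ C‖∇x‖ 2^q ∑_{p ≥ q-2} n_p. Summing with weights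
2^{q(s-1)}, Young's inequality and Gronwall give the exponent (C/μ̄) ∫ ‖∇x‖² ≤ (C/μ̄²)‖V_in‖²
(`exists_galerkin_besov_le`), and the bounds pass to the limit (`exists_approx_besov_le`).

Uniqueness repeats the difference estimate for frequency-truncated energies of two solutions in the
energy class (`coord_unique`). Both nonlinear terms see a solution only through its acoustic
coordinates, so the remaining components of the difference solve a homogeneous heat equation
(`SolvesLS.hat_eq`). Uniqueness in F^s follows because F^s embeds in the energy class
(`MemF.memEnergy`). -/

/-- The complexification of a real square integrable function. -/
def complexify {N : ℕ} (f : L2 N) : Lp ℂ 2 (torusMeasure N) :=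
  Complex.ofRealCLM.compLp f

lemma complexify_ae {N : ℕ} (f : L2 N) :
    complexify f =ᵐ[torusMeasure N] fun y => ((f y : ℝ) : ℂ) :=
  Complex.ofRealCLM.coeFn_compLp f

/-- The trigonometric Hilbert basis for the measure `torusMeasure`. -/
def trigBasis (N : ℕ) : HilbertBasis (Fin N → ℤ) ℂ (Lp ℂ 2 (torusMeasure N)) :=
  UnitAddTorus.mFourierBasis (d := Fin N)

lemma trigBasis_repr {N : ℕ} (g : Lp ℂ 2 (torusMeasure N)) (n : Fin N → ℤ) :
    (trigBasis N).repr g n = ∫ y, UnitAddTorus.mFourier (-n) y * g y ∂(torusMeasure N) :=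
  UnitAddTorus.mFourierBasis_repr g n

lemma trigBasis_repr_complexify {N : ℕ} (f : L2 N) (n : Fin N → ℤ) :
    (trigBasis N).repr (complexify f) n = coeff f n := by
  rw [trigBasis_repr, coeff]
  apply integral_congr_ae
  filter_upwards [complexify_ae f] with y hy
  rw [hy]

lemma complexify_sub {N : ℕ} (f g : L2 N) :
    complexify (f - g) = complexify f - complexify g := by
  simpa only [complexify] using! (Complex.ofRealCLM.compLpₗ 2 (torusMeasure N)).map_sub f g

lemma coeff_sub {N : ℕ} (f g : L2 N) (n : Fin N → ℤ) :
    coeff (f - g) n = coeff f n - coeff g n := by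
  simp only [← trigBasis_repr_complexify, complexify_sub, map_sub]
  rfl

lemma coeff_neg_index {N : ℕ} (f : L2 N) (n : Fin N → ℤ) :
    coeff f (-n) = conj (coeff f n) := by
  rw [coeff, coeff, ← integral_conj]
  congr 1 with y
  rw [map_mul, Complex.conj_ofReal, ← UnitAddTorus.mFourier_neg]

lemma inner_complexify {N : ℕ} (f g : L2 N) :
    inner ℂ (complexify f) (complexify g) = ((inner ℝ f g : ℝ) : ℂ) := by
  rw [L2.inner_def, L2.inner_def, ← integral_complex_ofReal]
  apply integral_congr_ae
  filter_upwards [complexify_ae f, complexify_ae g] with y hf hg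
  rw [hf, hg]
  simp

lemma hasSum_coeff_inner {N : ℕ} (f g : L2 N) :
    HasSum (fun n => (coeff f n * conj (coeff g n)).re) (inner ℝ f g) := by
  have h := (trigBasis N).hasSum_inner_mul_inner (complexify f) (complexify g)
  rw [inner_complexify] at h
  have h2 := Complex.hasSum_re h
  rw [Complex.ofReal_re] at h2
  convert! h2 using 2 with n
  rw [← trigBasis_repr_complexify, ← trigBasis_repr_complexify, HilbertBasis.repr_apply_apply,
    HilbertBasis.repr_apply_apply, ← inner_conj_symm (complexify f)]
  simp only [Complex.mul_re, Complex.conj_re, Complex.conj_im]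
  ring

lemma coeff_injective {N : ℕ} {f g : L2 N} (h : ∀ n, coeff f n = coeff g n) : f = g := by
  have h1 := hasSum_coeff_inner (f - g) (f - g)
  have h0 : ∀ n, coeff (f - g) n = 0 := fun n => by rw [coeff_sub, h, sub_self]
  simp only [h0, zero_mul, Complex.zero_re] at h1
  have := h1.unique hasSum_zero
  rw [inner_self_eq_zero] at this
  exact sub_eq_zero.1 this

/-- Riesz–Fischer gives a complex function with coefficients c. The coefficient of its real part at
n is the mean of c n and the conjugate of c (-n), and these are equal by `hs`. -/
lemma exists_coeff_eq {N : ℕ} (c : (Fin N → ℤ) → ℂ) (hc : Summable fun n => ‖c n‖ ^ 2)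
    (hs : ∀ n, c (-n) = conj (c n)) : ∃ f : L2 N, ∀ n, coeff f n = c n := by
  have hmem : Memℓp c 2 := by
    rw [memℓp_gen_iff (by simp)]
    simpa using hc
  set g : Lp ℂ 2 (torusMeasure N) := (trigBasis N).repr.symm ⟨c, hmem⟩ with hg
  have hgc : ∀ n, ∫ y, UnitAddTorus.mFourier (-n) y * g y ∂(torusMeasure N) = c n := by
    intro n
    rw [← trigBasis_repr, hg, LinearIsometryEquiv.apply_symm_apply]
  refine ⟨Complex.reCLM.compLp g, fun n => ?_⟩
  have hint : ∀ n : Fin N → ℤ,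
      Integrable (fun y => UnitAddTorus.mFourier (-n) y * g y) (torusMeasure N) := by
    intro n
    have hg1 : Integrable g (torusMeasure N) := (Lp.memLp g).integrable (by norm_num)
    refine hg1.bdd_mul (c := 1)
      (UnitAddTorus.mFourier (-n)).continuous.aestronglyMeasurable ?_
    refine Filter.Eventually.of_forall fun y => ?_
    exact ((UnitAddTorus.mFourier (-n)).norm_coe_le_norm y).trans UnitAddTorus.mFourier_norm.le
  have h1 : coeff (Complex.reCLM.compLp g) n
      = ∫ y, (1 / 2 : ℂ) * (UnitAddTorus.mFourier (-n) y * g y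
        + conj (UnitAddTorus.mFourier (-(-n)) y * g y)) ∂(torusMeasure N) := by
    rw [coeff]
    apply integral_congr_ae
    filter_upwards [Complex.reCLM.coeFn_compLp g] with y hy
    rw [hy, map_mul, ← UnitAddTorus.mFourier_neg, neg_neg]
    have : ((Complex.reCLM (g y) : ℝ) : ℂ) = (1 / 2 : ℂ) * (g y + conj (g y)) := by
      rw [Complex.add_conj]; simp
    rw [this]; ring
  have hint2 : Integrable (fun y => conj (UnitAddTorus.mFourier (-(-n)) y * g y))
      (torusMeasure N) := (Complex.conjCLE.toContinuousLinearMap).integrable_comp (hint (-n))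
  rw [h1, integral_const_mul, integral_add (hint n) hint2, hgc, integral_conj, hgc, hs, Complex.conj_conj]
  ring

namespace Setting

variable {N : ℕ} (S : Setting N)

/-! ### Positivity of the parameters -/

lemma pr_pos : 0 < S.pr := S.p_rho_pos _ S.rho_pos _ S.theta_pos

lemma et_pos : 0 < S.et := S.e_theta_pos _ S.rho_pos _ S.theta_pos

lemma c_sq : S.c ^ 2 = S.pr + S.theta * S.pt ^ 2 / (S.rho ^ 2 * S.et) := by
  have := S.pr_pos
  have := S.et_pos
  have := S.rho_pos
  have := S.theta_pos
  rw [c, Real.sq_sqrt (by positivity)]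

lemma c_pos : 0 < S.c := by
  have := S.pr_pos
  have := S.et_pos
  have := S.rho_pos
  have := S.theta_pos
  rw [c]
  positivity

lemma vol_pos : 0 < S.vol :=
  Finset.prod_pos fun i _ => mul_pos (mul_pos two_pos Real.pi_pos) (S.a_pos i)

lemma cN_pos : 0 < S.cN := by
  have := S.c_pos
  have := S.vol_pos
  have := S.rho_pos
  have := S.theta_pos
  rw [cN]
  positivity

lemma cN_sq : S.vol * S.cN ^ 2 * (2 * S.rho * S.c ^ 2) = S.theta := by
  have h1 := S.c_pos
  have h2 := S.vol_pos
  have h3 := S.rho_pos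
  have h4 := S.theta_pos
  rw [cN, mul_pow, Real.sq_sqrt (by positivity), div_pow, mul_pow, Real.sq_sqrt h2.le]
  field_simp

lemma muBar_pos (hN : 2 ≤ N) (τ : Transport) : 0 < S.muBar τ := by
  have h1 := S.c_pos
  have h2 := S.vol_pos
  have h3 := S.cN_pos
  have h4 := S.theta_pos
  have h5 := τ.mu_pos
  have h6 := τ.lam_nonneg
  have h7 := τ.kappa_pos
  have hN' : (2 : ℝ) ≤ N := by exact_mod_cast hN
  have h8 : 0 < 2 * (N : ℝ) - 2 := by linarith
  rw [muBar]
  positivity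

/-! ### Wave vectors -/

lemma wave_neg (n : Fin N → ℤ) (i : Fin N) : S.wave (-n) i = -S.wave n i := by
  simp [wave, neg_div]

lemma wave_add (n m : Fin N → ℤ) (i : Fin N) : S.wave (n + m) i = S.wave n i + S.wave m i := by
  simp [wave, add_div]

lemma wave_sub (n m : Fin N → ℤ) (i : Fin N) : S.wave (n - m) i = S.wave n i - S.wave m i := by
  simp [wave, sub_div]

lemma wabs_nonneg (n : Fin N → ℤ) : 0 ≤ S.wabs n := Real.sqrt_nonneg _

lemma wabs_sq (n : Fin N → ℤ) : S.wabs n ^ 2 = ∑ i, S.wave n i ^ 2 :=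
  Real.sq_sqrt (Finset.sum_nonneg fun _ _ => sq_nonneg _)

@[simp] lemma wabs_zero : S.wabs 0 = 0 := by simp [wabs, wave]

@[simp] lemma wabs_neg (n : Fin N → ℤ) : S.wabs (-n) = S.wabs n := by
  simp [wabs, wave_neg]

lemma abs_wave_le (n : Fin N → ℤ) (i : Fin N) : |S.wave n i| ≤ S.wabs n := by
  rw [wabs]
  apply Real.le_sqrt_of_sq_le
  rw [sq_abs]
  exact Finset.single_le_sum (f := fun i => S.wave n i ^ 2) (fun _ _ => sq_nonneg _)
    (Finset.mem_univ i)

lemma wabs_pos {n : Fin N → ℤ} (hn : n ≠ 0) : 0 < S.wabs n := by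
  obtain ⟨i, hi⟩ := Function.ne_iff.1 hn
  refine lt_of_lt_of_le ?_ (S.abs_wave_le n i)
  rw [abs_pos, wave]
  have := S.a_pos i
  have h : ((n i : ℤ) : ℝ) ≠ 0 := by exact_mod_cast hi
  positivity

lemma wabs_eq_norm (n : Fin N → ℤ) :
    S.wabs n = ‖(WithLp.toLp 2 (fun i => S.wave n i) : EuclideanSpace ℝ (Fin N))‖ := by
  rw [EuclideanSpace.norm_eq]
  simp [wabs]

lemma wabs_add_le (n m : Fin N → ℤ) : S.wabs (n + m) ≤ S.wabs n + S.wabs m := by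
  simp only [wabs_eq_norm]
  refine le_trans (le_of_eq ?_) (norm_add_le _ _)
  congr 1
  ext i
  simp [wave_add]

/-- The nonzero frequencies are bounded away from zero. -/
lemma exists_wabs_ge : ∃ r : ℝ, 0 < r ∧ ∀ n : Fin N → ℤ, n ≠ 0 → r ≤ S.wabs n := by
  refine ⟨1 / (1 + ∑ i, S.a i), ?_, fun n hn => ?_⟩
  · have : 0 ≤ ∑ i, S.a i := Finset.sum_nonneg fun i _ => (S.a_pos i).le
    positivity
  obtain ⟨i, hi⟩ := Function.ne_iff.1 hn
  refine le_trans ?_ (S.abs_wave_le n i)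
  have ha := S.a_pos i
  rw [wave, abs_div, abs_of_pos ha]
  have h1 : (1 : ℝ) ≤ |((n i : ℤ) : ℝ)| := by
    have : (1 : ℤ) ≤ |n i| := Int.one_le_abs hi
    exact_mod_cast this
  have h2 : S.a i ≤ ∑ i, S.a i :=
    Finset.single_le_sum (f := S.a) (fun i _ => (S.a_pos i).le) (Finset.mem_univ i)
  calc 1 / (1 + ∑ i, S.a i) ≤ 1 / S.a i := one_div_le_one_div_of_le ha (by linarith)
    _ ≤ _ := by gcongr

lemma finite_wabs_le (R : ℝ) : {n : Fin N → ℤ | S.wabs n ≤ R}.Finite := by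
  refine (Set.Finite.pi' (fun i : Fin N => (Set.finite_Icc (-⌈R * S.a i⌉) ⌈R * S.a i⌉))).subset ?_
  intro n hn i
  have ha := S.a_pos i
  have h1 : |S.wave n i| ≤ R := (S.abs_wave_le n i).trans hn
  rw [wave, abs_div, abs_of_pos ha, div_le_iff₀ ha, abs_le] at h1
  constructor
  · have : -((⌈R * S.a i⌉ : ℤ) : ℝ) ≤ n i := by
      have := Int.le_ceil (R * S.a i)
      linarith [h1.1]
    exact_mod_cast this
  · have : ((n i : ℤ) : ℝ) ≤ ⌈R * S.a i⌉ := h1.2.trans (Int.le_ceil _)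
    exact_mod_cast this

/-! ### The generalized sign -/

lemma exists_first_ne_zero {n : Fin N → ℤ} (hn : n ≠ 0) : ∃ i, n i ≠ 0 ∧ ∀ j < i, n j = 0 := by
  classical
  obtain ⟨i, hi⟩ := Function.ne_iff.1 hn
  have hne : (Finset.univ.filter fun i => n i ≠ 0).Nonempty := ⟨i, by simpa using hi⟩
  refine ⟨Finset.min' _ hne, by simpa using Finset.min'_mem _ hne, fun j hj => ?_⟩
  by_contra h
  exact absurd (Finset.min'_le _ j (by simpa using h)) (not_le.2 hj)

lemma sg_eq (n : Fin N → ℤ) : sg n = 1 ∨ sg n = -1 := by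
  unfold sg
  split_ifs <;> simp

lemma sg_mul_self (n : Fin N → ℤ) : sg n * sg n = 1 := by
  rcases sg_eq n with h | h <;> simp [h]

lemma sg_mul_pos {n : Fin N → ℤ} {i : Fin N} (hi : n i ≠ 0) (hj : ∀ j < i, n j = 0) :
    0 < sg n * n i := by
  rcases lt_or_gt_of_ne hi with h | h
  · have : sg n = -1 := by
      unfold sg
      rw [if_neg]
      rintro ⟨i', h1, h2⟩
      rcases lt_trichotomy i i' with h3 | h3 | h3
      · exact hi (h2 i h3)
      · subst h3; omega
      · have := hj i' h3; omega
    rw [this]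
    have : ((n i : ℤ) : ℝ) < 0 := by exact_mod_cast h
    linarith
  · have : sg n = 1 := by
      unfold sg
      rw [if_pos ⟨i, h, hj⟩]
    rw [this, one_mul]
    exact_mod_cast h

/-- Two nonzero lattice vectors on one line have the same first nonzero index, so comparing their
generalized signs reads off whether they point in the same direction. -/
lemma sg_mul_sg_pos {k m : Fin N → ℤ} (hk : k ≠ 0) {a b : ℝ} (ha : a ≠ 0) (hb : b ≠ 0)
    (h : ∀ i, a * S.wave k i = b * S.wave m i) : 0 < (a * sg k) * (b * sg m) := by
  have h' : ∀ i, a * k i = b * m i := by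
    intro i
    have := h i
    have hai := S.a_pos i
    simp only [wave] at this
    field_simp at this
    exact this
  obtain ⟨i, hi, hj⟩ := exists_first_ne_zero hk
  have hki : ((k i : ℤ) : ℝ) ≠ 0 := by exact_mod_cast hi
  have hmi : m i ≠ 0 := by
    intro h0
    have := h' i
    rw [h0, Int.cast_zero, mul_zero] at this
    exact (mul_ne_zero ha hki) this
  have hmj : ∀ j < i, m j = 0 := by
    intro j hji
    have := h' j
    rw [hj j hji, Int.cast_zero, mul_zero] at this
    have := (mul_eq_zero.1 this.symm).resolve_left hb
    exact_mod_cast this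
  have h1 := sg_mul_pos hi hj
  have h2 := sg_mul_pos hmi hmj
  have h3 : 0 < (a * k i) * (b * m i) := by
    rw [← h' i, ← sq]
    have := mul_ne_zero ha hki
    positivity
  have h4 : 0 < ((a * sg k) * (b * sg m)) * ((sg k * k i) * (sg m * m i)) := by
    have : ((a * sg k) * (b * sg m)) * ((sg k * k i) * (sg m * m i))
        = (sg k * sg k) * (sg m * sg m) * ((a * k i) * (b * m i)) := by ring
    rw [this, sg_mul_self, sg_mul_self]
    linarith
  exact (pos_iff_pos_of_mul_pos h4).2 (mul_pos h1 h2)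

lemma sg_neg {n : Fin N → ℤ} (hn : n ≠ 0) : sg (-n) = -sg n := by
  obtain ⟨i, hi, hj⟩ := exists_first_ne_zero hn
  have h1 := sg_mul_pos hi hj
  have h2 := sg_mul_pos (n := -n) (i := i) (by simpa using hi) (fun j h => by simp [hj j h])
  have h3 : ((-n) i : ℤ) = -(n i) := rfl
  rw [h3, Int.cast_neg] at h2
  rcases sg_eq n with h | h <;> rcases sg_eq (-n) with h' | h' <;> rw [h] at h1 <;>
    rw [h'] at h2 <;> first | (exfalso; linarith) | simp [h, h']

/-- The signed length `sg(n) |n|`. -/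
def lam (n : Fin N → ℤ) : ℝ := sg n * S.wabs n

@[simp] lemma lam_zero : S.lam 0 = 0 := by simp [lam]

@[simp] lemma lam_neg (n : Fin N → ℤ) : S.lam (-n) = -S.lam n := by
  by_cases hn : n = 0
  · simp [hn]
  · simp [lam, sg_neg hn]

lemma lam_sq (n : Fin N → ℤ) : S.lam n ^ 2 = S.wabs n ^ 2 := by
  rw [lam, mul_pow, sq (sg n), sg_mul_self, one_mul]

lemma abs_lam (n : Fin N → ℤ) : |S.lam n| = S.wabs n := by
  rw [← abs_of_nonneg (S.wabs_nonneg n), ← sq_eq_sq_iff_abs_eq_abs]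
  exact S.lam_sq n

lemma lam_ne_zero {n : Fin N → ℤ} (hn : n ≠ 0) : S.lam n ≠ 0 := by
  rw [← abs_pos, abs_lam]
  exact S.wabs_pos hn

/-! ### Resonances -/

/-- The resonant pairs `(k, m - k)` for the frequency `m`. -/
def Res (m k : Fin N → ℤ) : Prop :=
  k ≠ 0 ∧ m - k ≠ 0 ∧ m ≠ 0 ∧ S.lam k + S.lam (m - k) = S.lam m

/-- Resonance is a condition on the triple -m, k, m - k: both the frequencies and their signed
lengths sum to zero. This lemma and the next two generate the permutations and the common sign
change of such a triple. -/
lemma Res.symm {m k : Fin N → ℤ} (h : S.Res m k) : S.Res m (m - k) :=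
  ⟨h.2.1, by simpa using h.1, h.2.2.1, by simpa [add_comm] using h.2.2.2⟩

lemma Res.swap {m k : Fin N → ℤ} (h : S.Res m k) : S.Res k m := by
  refine ⟨h.2.2.1, ?_, h.1, ?_⟩
  · rw [← neg_sub, neg_ne_zero]; exact h.2.1
  · rw [← neg_sub m k, lam_neg]
    linarith [h.2.2.2]

lemma Res.neg {m k : Fin N → ℤ} (h : S.Res m k) : S.Res (-m) (-k) := by
  refine ⟨neg_ne_zero.2 h.1, ?_, neg_ne_zero.2 h.2.2.1, ?_⟩
  · rw [neg_sub_neg, ← neg_sub, neg_ne_zero]; exact h.2.1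
  · rw [neg_sub_neg, ← neg_sub m k, lam_neg, lam_neg, lam_neg]
    linarith [h.2.2.2]

/-- This is the equality case of Cauchy–Schwarz: the hypotheses force k · l = pq, and then |qk -
pl|² expands to zero. -/
lemma wave_collinear {k l : Fin N → ℤ} {p q : ℝ} (hp : p ^ 2 = S.wabs k ^ 2)
    (hq : q ^ 2 = S.wabs l ^ 2) (h : (p + q) ^ 2 = S.wabs (k + l) ^ 2) (i : Fin N) :
    q * S.wave k i = p * S.wave l i := by
  have h1 : ∑ i, (q * S.wave k i - p * S.wave l i) ^ 2 = 0 := by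
    have e1 : ∑ i, S.wave k i * S.wave l i = p * q := by
      have : S.wabs (k + l) ^ 2
          = S.wabs k ^ 2 + 2 * ∑ i, S.wave k i * S.wave l i + S.wabs l ^ 2 := by
        rw [wabs_sq, wabs_sq, wabs_sq, Finset.mul_sum, ← Finset.sum_add_distrib,
          ← Finset.sum_add_distrib]
        refine Finset.sum_congr rfl fun i _ => ?_
        rw [wave_add]; ring
      nlinarith
    have e2 : ∑ i, (q * S.wave k i - p * S.wave l i) ^ 2
        = q ^ 2 * S.wabs k ^ 2 - 2 * (p * q) * (∑ i, S.wave k i * S.wave l i)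
          + p ^ 2 * S.wabs l ^ 2 := by
      rw [wabs_sq, wabs_sq, Finset.mul_sum, Finset.mul_sum, Finset.mul_sum,
        ← Finset.sum_sub_distrib, ← Finset.sum_add_distrib]
      refine Finset.sum_congr rfl fun i _ => ?_
      ring
    rw [e2, e1, ← hp, ← hq]; ring
  have h2 := (Finset.sum_eq_zero_iff_of_nonneg (fun i _ => sq_nonneg _)).1 h1 i (Finset.mem_univ i)
  have := pow_eq_zero_iff (two_ne_zero) |>.1 h2
  linarith

lemma Res.collinear {m k : Fin N → ℤ} (h : S.Res m k) (i : Fin N) :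
    S.lam m * S.wave k i = S.lam k * S.wave m i := by
  have := S.wave_collinear (k := k) (l := m - k) (S.lam_sq k) (S.lam_sq (m - k))
    (by rw [h.2.2.2, lam_sq]; simp) i
  rw [wave_sub] at this
  linear_combination this - S.wave k i * h.2.2.2

lemma unit_cast_sq (α : ℤˣ) : (((α : ℤ) : ℝ)) ^ 2 = 1 := by
  rcases Int.units_eq_one_or α with h | h <;> simp [h]

lemma eq_of_mul_cast_pos {α β : ℤˣ} (h : 0 < ((α : ℤ) : ℝ) * ((β : ℤ) : ℝ)) : α = β := by
  rcases Int.units_eq_one_or α with h1 | h1 <;> rcases Int.units_eq_one_or β with h2 | h2 <;>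
    simp [h1, h2] at h ⊢
  all_goals norm_num at h

lemma eigval_eq (α : ℤˣ) (n : Fin N → ℤ) :
    S.eigval α n = Complex.I * ((S.c * (((α : ℤ) : ℝ) * S.lam n) : ℝ) : ℂ) := by
  rw [eigval, lam]; congr 2; ring

lemma eigval_eq_iff (α γ : ℤˣ) (k m : Fin N → ℤ) :
    S.eigval α k = S.eigval γ m ↔ ((α : ℤ) : ℝ) * S.lam k = ((γ : ℤ) : ℝ) * S.lam m := by
  rw [eigval_eq, eigval_eq, mul_right_inj' Complex.I_ne_zero, Complex.ofReal_inj,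
    mul_right_inj' S.c_pos.ne']

/-- Resonant triads of acoustic modes have collinear wave vectors and equal signs. -/
lemma resonant_iff (α β γ : ℤˣ) {k m : Fin N → ℤ} (hm : m ≠ 0) :
    (k ≠ 0 ∧ m - k ≠ 0 ∧ S.eigval α k + S.eigval β (m - k) = S.eigval γ m) ↔
      α = γ ∧ β = γ ∧ S.Res m k := by
  have hsum : S.eigval α k + S.eigval β (m - k) = S.eigval γ m ↔
      ((α : ℤ) : ℝ) * S.lam k + ((β : ℤ) : ℝ) * S.lam (m - k) = ((γ : ℤ) : ℝ) * S.lam m := by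
    rw [eigval_eq, eigval_eq, eigval_eq, ← mul_add, mul_right_inj' Complex.I_ne_zero,
      ← Complex.ofReal_add, Complex.ofReal_inj, ← mul_add, mul_right_inj' S.c_pos.ne']
  rw [hsum]
  constructor
  · rintro ⟨hk, hl, h⟩
    set p := ((α : ℤ) : ℝ) * S.lam k with hp
    set q := ((β : ℤ) : ℝ) * S.lam (m - k) with hq
    set s := ((γ : ℤ) : ℝ) * S.lam m with hs
    have hp2 : p ^ 2 = S.wabs k ^ 2 := by rw [hp, mul_pow, unit_cast_sq, one_mul, lam_sq]
    have hq2 : q ^ 2 = S.wabs (m - k) ^ 2 := by rw [hq, mul_pow, unit_cast_sq, one_mul, lam_sq]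
    have hs2 : s ^ 2 = S.wabs m ^ 2 := by rw [hs, mul_pow, unit_cast_sq, one_mul, lam_sq]
    have hp0 : p ≠ 0 := by
      intro h0; rw [h0] at hp2
      exact (S.wabs_pos hk).ne' (by simpa using hp2.symm)
    have hq0 : q ≠ 0 := by
      intro h0; rw [h0] at hq2
      exact (S.wabs_pos hl).ne' (by simpa using hq2.symm)
    have hs0 : s ≠ 0 := by
      intro h0; rw [h0] at hs2
      exact (S.wabs_pos hm).ne' (by simpa using hs2.symm)
    have hcol := S.wave_collinear hp2 hq2 (by rw [h, hs2]; simp)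
    have hcol2 : ∀ i, s * S.wave k i = p * S.wave m i := by
      intro i
      have := hcol i
      rw [wave_sub] at this
      linear_combination this - S.wave k i * h
    have hcol3 : ∀ i, s * S.wave (m - k) i = q * S.wave m i := by
      intro i
      rw [wave_sub]
      linear_combination S.wave m i * (-h) - hcol2 i
    have e1 := S.sg_mul_sg_pos hk hs0 hp0 hcol2
    have e2 := S.sg_mul_sg_pos hl hs0 hq0 hcol3
    have hα : α = γ := by
      apply eq_of_mul_cast_pos
      have : s * sg k * (p * sg m) = (((α : ℤ) : ℝ) * ((γ : ℤ) : ℝ)) * (S.wabs k * S.wabs m) := by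
        rw [hs, hp, lam, lam]
        linear_combination (((α : ℤ) : ℝ) * ((γ : ℤ) : ℝ)) * (S.wabs k * S.wabs m)
          * (sg_mul_self m * (sg k * sg k) + sg_mul_self k)
      rw [this] at e1
      exact (pos_iff_pos_of_mul_pos e1).2 (mul_pos (S.wabs_pos hk) (S.wabs_pos hm))
    have hβ : β = γ := by
      apply eq_of_mul_cast_pos
      have : s * sg (m - k) * (q * sg m)
          = (((β : ℤ) : ℝ) * ((γ : ℤ) : ℝ)) * (S.wabs (m - k) * S.wabs m) := by
        rw [hs, hq, lam, lam]
        linear_combination (((β : ℤ) : ℝ) * ((γ : ℤ) : ℝ)) * (S.wabs (m - k) * S.wabs m)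
          * (sg_mul_self m * (sg (m - k) * sg (m - k)) + sg_mul_self (m - k))
      rw [this] at e2
      exact (pos_iff_pos_of_mul_pos e2).2 (mul_pos (S.wabs_pos hl) (S.wabs_pos hm))
    refine ⟨hα, hβ, hk, hl, hm, ?_⟩
    rw [hp, hq, hs, hα, hβ, ← mul_add] at h
    exact mul_left_cancel₀ (by rcases Int.units_eq_one_or γ with h | h <;> simp [h]) h
  · rintro ⟨rfl, rfl, h⟩
    exact ⟨h.1, h.2.1, by rw [← mul_add, h.2.2.2]⟩

end Setting

/-- Indices `(γ, m)` of the acoustic eigenfunctions. -/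
abbrev Idx (N : ℕ) : Type := ℤˣ × (Fin N → ℤ)

namespace Setting

variable {N : ℕ} (S : Setting N)

/-! ### The entropy pairing -/

lemma pairing_add_left (X X' Y : Mode N) :
    S.pairing (X + X') Y = S.pairing X Y + S.pairing X' Y := by
  simp only [pairing, Prod.fst_add, Prod.snd_add, Pi.add_apply, add_mul, Finset.sum_add_distrib]
  ring

lemma pairing_smul_left (z : ℂ) (X Y : Mode N) : S.pairing (z • X) Y = z * S.pairing X Y := by
  have : ∑ i, (z * X.2.1 i) * conj (Y.2.1 i) = z * ∑ i, X.2.1 i * conj (Y.2.1 i) := by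
    rw [Finset.mul_sum]; exact Finset.sum_congr rfl fun i _ => by ring
  simp only [pairing, Prod.smul_fst, Prod.smul_snd, Pi.smul_apply, smul_eq_mul, this]
  ring

lemma pairing_neg_left (X Y : Mode N) : S.pairing (-X) Y = -S.pairing X Y := by
  rw [← neg_one_smul ℂ, pairing_smul_left]; ring

lemma pairing_sub_left (X X' Y : Mode N) :
    S.pairing (X - X') Y = S.pairing X Y - S.pairing X' Y := by
  rw [sub_eq_add_neg, pairing_add_left, pairing_neg_left]; ring

lemma pairing_zero_left (Y : Mode N) : S.pairing 0 Y = 0 := by simp [pairing]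

lemma pairing_conj_symm (X Y : Mode N) : conj (S.pairing X Y) = S.pairing Y X := by
  simp only [pairing, map_add, map_mul, Complex.conj_ofReal, map_sum, Complex.conj_conj]
  simp only [mul_comm]

lemma pairing_self (X : Mode N) : S.pairing X X = (S.modeSq X : ℂ) := by
  simp only [pairing, modeSq, Complex.mul_conj, Complex.normSq_eq_norm_sq]
  push_cast
  ring

lemma pairing_re_eq (X Y : Mode N) : (S.pairing X Y).re =
    S.pr / (S.rho * S.theta) * (X.1 * conj Y.1).re
    + S.rho / S.theta * ∑ i, (X.2.1 i * conj (Y.2.1 i)).re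
    + S.rho * S.et / S.theta ^ 2 * (X.2.2 * conj Y.2.2).re := by
  rw [pairing, Complex.add_re, Complex.add_re, Complex.re_ofReal_mul, Complex.re_ofReal_mul,
    Complex.re_ofReal_mul, Complex.re_sum]

lemma modeSq_nonneg (X : Mode N) : 0 ≤ S.modeSq X := by
  have := S.pr_pos
  have := S.et_pos
  have := S.rho_pos
  have := S.theta_pos
  rw [modeSq]
  positivity

lemma modeSq_eq_zero {X : Mode N} (h : S.modeSq X = 0) : X = 0 := by
  have h1 := S.pr_pos
  have h2 := S.et_pos
  have h3 := S.rho_pos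
  have h4 := S.theta_pos
  rw [modeSq] at h
  have e1 : 0 ≤ S.pr / (S.rho * S.theta) * ‖X.1‖ ^ 2 := by positivity
  have e2 : 0 ≤ S.rho / S.theta * ∑ i, ‖X.2.1 i‖ ^ 2 := by positivity
  have e3 : 0 ≤ S.rho * S.et / S.theta ^ 2 * ‖X.2.2‖ ^ 2 := by positivity
  have f1 : S.pr / (S.rho * S.theta) * ‖X.1‖ ^ 2 = 0 := by linarith
  have f2 : S.rho / S.theta * ∑ i, ‖X.2.1 i‖ ^ 2 = 0 := by linarith
  have f3 : S.rho * S.et / S.theta ^ 2 * ‖X.2.2‖ ^ 2 = 0 := by linarith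
  have g1 : X.1 = 0 := by
    simpa [h1.ne', h2.ne', h3.ne', h4.ne'] using f1
  have g3 : X.2.2 = 0 := by
    simpa [h1.ne', h2.ne', h3.ne', h4.ne'] using f3
  have g2 : ∀ i, X.2.1 i = 0 := by
    have : ∑ i, ‖X.2.1 i‖ ^ 2 = 0 := by
      rcases mul_eq_zero.1 f2 with h | h
      · exact absurd h (by positivity)
      · exact h
    intro i
    simpa using (Finset.sum_eq_zero_iff_of_nonneg (fun i _ => sq_nonneg _)).1 this i
      (Finset.mem_univ i)
  ext i
  · exact g1
  · exact g2 i
  · exact g3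

/-! ### The acoustic eigenvectors -/

/-- The factor `a` with `u = a k` for the velocity of `H^α_k`. -/
def velFactor (α : ℤˣ) (n : Fin N → ℤ) : ℝ :=
  S.cN * S.c * (((α : ℤ) : ℝ) * sg n) / S.wabs n

lemma eigvec_eq (α : ℤˣ) (n : Fin N → ℤ) :
    S.eigvec α n = (((S.cN * S.rho : ℝ) : ℂ),
      (fun i => ((S.velFactor α n : ℝ) : ℂ) * ((S.wave n i : ℝ) : ℂ)),
      ((S.cN * (S.theta * S.pt / (S.rho * S.et)) : ℝ) : ℂ)) := by
  rw [eigvec]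
  congr 2
  ext i
  rw [← Complex.ofReal_mul, velFactor]
  congr 1
  ring

lemma pairing_eigvec_right (X : Mode N) (γ : ℤˣ) (m : Fin N → ℤ) :
    S.pairing X (S.eigvec γ m) =
      ((S.cN * S.pr / S.theta : ℝ) : ℂ) * X.1
      + ((S.rho / S.theta * S.velFactor γ m : ℝ) : ℂ) * S.dot m X.2.1
      + ((S.cN * S.pt / S.theta : ℝ) : ℂ) * X.2.2 := by
  have h2 := S.et_pos.ne'
  have h3 := S.rho_pos.ne'
  have h4 := S.theta_pos.ne'
  rw [pairing, eigvec_eq]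
  simp only [map_mul, Complex.conj_ofReal, dot]
  have : ∑ i, X.2.1 i * (((S.velFactor γ m : ℝ) : ℂ) * ((S.wave m i : ℝ) : ℂ))
      = ((S.velFactor γ m : ℝ) : ℂ) * ∑ i, ((S.wave m i : ℝ) : ℂ) * X.2.1 i := by
    rw [Finset.mul_sum]; exact Finset.sum_congr rfl fun i _ => by ring
  rw [this]
  have h2' : ((S.et : ℝ) : ℂ) ≠ 0 := by exact_mod_cast h2
  have h3' : ((S.rho : ℝ) : ℂ) ≠ 0 := by exact_mod_cast h3
  have h4' : ((S.theta : ℝ) : ℂ) ≠ 0 := by exact_mod_cast h4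
  push_cast
  field_simp

lemma dot_eigvec (k n : Fin N → ℤ) (α : ℤˣ) :
    S.dot k (S.eigvec α n).2.1
      = ((S.velFactor α n * ∑ i, S.wave k i * S.wave n i : ℝ) : ℂ) := by
  rw [eigvec_eq, dot]
  push_cast
  rw [Finset.mul_sum]
  exact Finset.sum_congr rfl fun i _ => by ring

lemma velFactor_mul (α β : ℤˣ) {n : Fin N → ℤ} (hn : n ≠ 0) :
    S.velFactor α n * S.velFactor β n * S.wabs n ^ 2
      = (S.cN * S.c) ^ 2 * (((α : ℤ) : ℝ) * ((β : ℤ) : ℝ)) := by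
  have := (S.wabs_pos hn).ne'
  have h : ∀ w x y : ℝ, w ≠ 0 → x / w * (y / w) * w ^ 2 = x * y := by
    intro w x y hw; field_simp
  rw [velFactor, velFactor, h _ _ _ this]
  linear_combination (S.cN * S.c) ^ 2 * (((α : ℤ) : ℝ) * ((β : ℤ) : ℝ)) * sg_mul_self n

/-- By the formula for c², the density and temperature parts of the pairing together contribute 1/2,
and the velocity part contributes αβ/2. The sum is 1 for equal signs and 0 for opposite ones. -/
lemma vol_pairing_eigvec (α β : ℤˣ) {n : Fin N → ℤ} (hn : n ≠ 0) :
    S.vol * S.pairing (S.eigvec α n) (S.eigvec β n) = if α = β then 1 else 0 := by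
  have h1 := S.c_pos.ne'
  have h2 := S.et_pos.ne'
  have h3 := S.rho_pos.ne'
  have h4 := S.theta_pos.ne'
  have key : S.vol * (S.cN * S.pr / S.theta * (S.cN * S.rho)
      + S.rho / S.theta * S.velFactor β n * (S.velFactor α n * S.wabs n ^ 2)
      + S.cN * S.pt / S.theta * (S.cN * (S.theta * S.pt / (S.rho * S.et))))
      = (1 + ((α : ℤ) : ℝ) * ((β : ℤ) : ℝ)) / 2 := by
    have e1 := S.velFactor_mul α β hn
    have e2 := S.cN_sq
    have e3 : S.cN * S.pr / S.theta * (S.cN * S.rho)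
        + S.cN * S.pt / S.theta * (S.cN * (S.theta * S.pt / (S.rho * S.et)))
        = S.cN ^ 2 * S.rho / S.theta * S.c ^ 2 := by
      rw [c_sq]; field_simp
    have e4 : S.vol * S.cN ^ 2 * S.rho / S.theta * S.c ^ 2 = 1 / 2 := by
      field_simp
      linear_combination e2
    linear_combination S.vol * e3 + S.vol * (S.rho / S.theta) * e1
      + (1 + ((α : ℤ) : ℝ) * ((β : ℤ) : ℝ)) * e4
  rw [pairing_eigvec_right, dot_eigvec]
  simp only [← sq, ← S.wabs_sq]
  have hfst : (S.eigvec α n).1 = ((S.cN * S.rho : ℝ) : ℂ) := rfl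
  have hthd : (S.eigvec α n).2.2 = ((S.cN * (S.theta * S.pt / (S.rho * S.et)) : ℝ) : ℂ) := rfl
  rw [hfst, hthd]
  simp only [← Complex.ofReal_mul, ← Complex.ofReal_add]
  rw [key]
  rcases Int.units_eq_one_or α with h | h <;> rcases Int.units_eq_one_or β with h' | h' <;>
    simp [h, h']

/-- Both sg and the direction change sign. Because the amplitude is even and real, reality of a
field becomes the plain symmetry x(γ, -n) = conj x(γ, n) of its coordinates. -/
lemma eigvec_neg (α : ℤˣ) {n : Fin N → ℤ} (hn : n ≠ 0) : S.eigvec α (-n) = S.eigvec α n := by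
  rw [eigvec_eq, eigvec_eq]
  congr 2
  ext i
  rw [velFactor, velFactor, wave_neg, wabs_neg, sg_neg hn]
  push_cast
  ring

/-- The amplitude depends on the frequency only through sg(k)k/|k|, which is constant along a
lattice line. -/
lemma Res.eigvec_eq {m k : Fin N → ℤ} (h : S.Res m k) (γ : ℤˣ) :
    S.eigvec γ k = S.eigvec γ m := by
  rw [Setting.eigvec_eq, Setting.eigvec_eq]
  congr 2
  ext i
  rw [← Complex.ofReal_mul, ← Complex.ofReal_mul]
  congr 1
  have hk := (S.wabs_pos h.1).ne'
  have hm := (S.wabs_pos h.2.2.1).ne'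
  have h1 := h.collinear S i
  rw [lam, lam] at h1
  rw [velFactor, velFactor]
  field_simp
  linear_combination S.cN * S.c * (sg m * sg k) * h1
    + S.cN * S.c * (- sg k * S.wabs m * S.wave k i * sg_mul_self m
      + sg m * S.wabs k * S.wave m i * sg_mul_self k)

lemma dot_add_left (k l : Fin N → ℤ) (X : Fin N → ℂ) :
    S.dot (k + l) X = S.dot k X + S.dot l X := by
  rw [dot, dot, dot, ← Finset.sum_add_distrib]
  refine Finset.sum_congr rfl fun i _ => ?_
  rw [wave_add]; push_cast; ring

lemma dot_sub_left (k l : Fin N → ℤ) (X : Fin N → ℂ) :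
    S.dot (k - l) X = S.dot k X - S.dot l X := by
  rw [dot, dot, dot, ← Finset.sum_sub_distrib]
  refine Finset.sum_congr rfl fun i _ => ?_
  rw [wave_sub]; push_cast; ring

lemma dot_neg_left (k : Fin N → ℤ) (X : Fin N → ℂ) : S.dot (-k) X = -S.dot k X := by
  rw [dot, dot, ← Finset.sum_neg_distrib]
  refine Finset.sum_congr rfl fun i _ => ?_
  rw [wave_neg]; push_cast; ring

/-- The strength of the self-interaction of a simple acoustic wave. -/
def gam : ℝ :=
  S.vol * (S.cN * S.c) * (S.cN * S.pr / S.theta * (S.cN * S.rho)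
    + S.rho / S.theta * (1 / 2) * ((S.cN * S.c) ^ 2
      + (S.C1 * (S.cN * S.rho) * (S.cN * S.rho)
        + S.C2 * (S.cN * (S.theta * S.pt / (S.rho * S.et)))
          * (S.cN * (S.theta * S.pt / (S.rho * S.et)))
        + S.C3 * (S.cN * (S.theta * S.pt / (S.rho * S.et))) * (S.cN * S.rho)
        + S.C4 * (S.cN * S.rho) * (S.cN * (S.theta * S.pt / (S.rho * S.et)))))
    + S.cN * S.pt / S.theta * (1 / 2) * ((S.cN * (S.theta * S.pt / (S.rho * S.et)))
      + S.C5 * (S.cN * (S.theta * S.pt / (S.rho * S.et))) + S.C6 * (S.cN * S.rho)))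

lemma dot_add_right (k : Fin N → ℤ) (X Y : Fin N → ℂ) :
    S.dot k (X + Y) = S.dot k X + S.dot k Y := by
  simp only [dot, Pi.add_apply, mul_add, Finset.sum_add_distrib]

lemma dot_smul_right (k : Fin N → ℤ) (z : ℂ) (X : Fin N → ℂ) :
    S.dot k (z • X) = z * S.dot k X := by
  simp only [dot, Pi.smul_apply, smul_eq_mul, Finset.mul_sum]
  exact Finset.sum_congr rfl fun i _ => by ring

lemma dot_momentum (m l : Fin N → ℤ) (A P : ℂ) (Y : Fin N → ℂ) :
    S.dot m (fun i => Complex.I * (A * Y i + S.wave l i * P))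
      = Complex.I * (A * S.dot m Y + ((∑ i, S.wave m i * S.wave l i : ℝ) : ℂ) * P) := by
  simp only [dot]
  push_cast
  rw [Finset.mul_sum, Finset.sum_mul, ← Finset.sum_add_distrib, Finset.mul_sum]
  exact Finset.sum_congr rfl fun i _ => by ring

lemma dot_quad (m k l : Fin N → ℤ) (X Y : Mode N) :
    S.dot m (S.quad k X l Y).2.1 = Complex.I * (1 / 2) * (
      S.dot l X.2.1 * S.dot m Y.2.1 + S.dot k Y.2.1 * S.dot m X.2.1
      + (∑ i, S.wave m i * S.wave l i : ℝ) * (S.C1 * X.1 * Y.1 + S.C2 * X.2.2 * Y.2.2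
        + S.C3 * X.2.2 * Y.1 + S.C4 * X.1 * Y.2.2)
      + (∑ i, S.wave m i * S.wave k i : ℝ) * (S.C1 * Y.1 * X.1 + S.C2 * Y.2.2 * X.2.2
        + S.C3 * Y.2.2 * X.1 + S.C4 * Y.1 * X.2.2)) := by
  have : (S.quad k X l Y).2.1 = (1 / 2 : ℂ) • ((S.preQ k X l Y).2.1 + (S.preQ l Y k X).2.1) := rfl
  rw [this, dot_smul_right, dot_add_right, preQ, preQ, dot_momentum, dot_momentum]
  ring

lemma quad_fst (k l : Fin N → ℤ) (X Y : Mode N) :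
    (S.quad k X l Y).1
      = Complex.I * (1 / 2) * (X.1 * S.dot (k + l) Y.2.1 + Y.1 * S.dot (l + k) X.2.1) := by
  change (1 / 2 : ℂ) * (Complex.I * (X.1 * S.dot (k + l) Y.2.1)
    + Complex.I * (Y.1 * S.dot (l + k) X.2.1)) = _
  ring

lemma quad_thd (k l : Fin N → ℤ) (X Y : Mode N) :
    (S.quad k X l Y).2.2 = Complex.I * (1 / 2) * (
      S.dot l X.2.1 * Y.2.2 + (S.C5 * X.2.2 + S.C6 * X.1) * S.dot l Y.2.1
      + (S.dot k Y.2.1 * X.2.2 + (S.C5 * Y.2.2 + S.C6 * Y.1) * S.dot k X.2.1)) := by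
  change (1 / 2 : ℂ) * (Complex.I * _ + Complex.I * _) = _
  ring

lemma velFactor_mul_sq (γ : ℤˣ) {m : Fin N → ℤ} (hm : m ≠ 0) :
    S.velFactor γ m * S.wabs m ^ 2 = S.cN * S.c * (((γ : ℤ) : ℝ) * S.lam m) := by
  have := (S.wabs_pos hm).ne'
  have h : ∀ w x : ℝ, w ≠ 0 → x / w * w ^ 2 = x * w := by
    intro w x hw; field_simp
  rw [velFactor, lam, h _ _ this]
  ring

/-- The interaction coefficient of a resonant triad. -/
lemma vol_pairing_quad_eigvec {m k : Fin N → ℤ} (h : S.Res m k) (γ : ℤˣ) :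
    S.vol * S.pairing (S.quad k (S.eigvec γ k) (m - k) (S.eigvec γ (m - k))) (S.eigvec γ m)
      = Complex.I * ((S.gam * (((γ : ℤ) : ℝ) * S.lam m) : ℝ) : ℂ) := by
  have hm := h.2.2.1
  -- All three amplitudes are equal, so after symmetrization the contributions of k and m - k enter
  -- only through their sums. Those are expressed by m alone, which `e3'` and `e4` exploit by
  -- eliminating one of the two.
  rw [h.eigvec_eq, h.symm.eigvec_eq, pairing_eigvec_right, quad_fst, quad_thd, dot_quad]
  have e0 : k + (m - k) = m := by abel
  have e0' : m - k + k = m := by abel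
  have e1 : S.dot k (S.eigvec γ m).2.1 + S.dot (m - k) (S.eigvec γ m).2.1
      = S.dot m (S.eigvec γ m).2.1 := by rw [← dot_add_left, e0]
  have e2 : S.dot m (S.eigvec γ m).2.1 = ((S.cN * S.c * (((γ : ℤ) : ℝ) * S.lam m) : ℝ) : ℂ) := by
    rw [dot_eigvec, ← S.velFactor_mul_sq γ hm, wabs_sq]
    simp only [← sq]
  have e3 : (∑ i, S.wave m i * S.wave (m - k) i) + (∑ i, S.wave m i * S.wave k i)
      = S.wabs m ^ 2 := by
    rw [wabs_sq, ← Finset.sum_add_distrib]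
    refine Finset.sum_congr rfl fun i _ => ?_
    rw [wave_sub]; ring
  have e3' : ((∑ i, S.wave m i * S.wave (m - k) i : ℝ) : ℂ)
      = ((S.wabs m ^ 2 : ℝ) : ℂ) - ((∑ i, S.wave m i * S.wave k i : ℝ) : ℂ) := by
    rw [← e3]; push_cast; ring
  have e4 : S.dot k (S.eigvec γ m).2.1 = ((S.cN * S.c * (((γ : ℤ) : ℝ) * S.lam m) : ℝ) : ℂ)
      - S.dot (m - k) (S.eigvec γ m).2.1 := by rw [← e2, ← e1]; ring
  have e5 : ((S.velFactor γ m : ℝ) : ℂ) * ((S.wabs m ^ 2 : ℝ) : ℂ)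
      = ((S.cN * S.c * (((γ : ℤ) : ℝ) * S.lam m) : ℝ) : ℂ) := by
    rw [← S.velFactor_mul_sq γ hm]; push_cast; ring
  have e6 : ((S.velFactor γ m : ℝ) : ℂ) * ((S.cN * S.c * (((γ : ℤ) : ℝ) * S.lam m) : ℝ) : ℂ)
      * ((S.cN * S.c * (((γ : ℤ) : ℝ) * S.lam m) : ℝ) : ℂ)
      = (S.cN * S.c) ^ 2 * ((S.cN * S.c * (((γ : ℤ) : ℝ) * S.lam m) : ℝ) : ℂ) := by
    have := S.velFactor_mul γ γ hm
    rw [← sq ((γ : ℤ) : ℝ), unit_cast_sq, mul_one] at this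
    rw [← S.velFactor_mul_sq γ hm]
    have h2 := congrArg (fun x : ℝ => (x : ℂ)) this
    push_cast at h2 ⊢
    linear_combination (S.velFactor γ m : ℂ) * (S.wabs m : ℂ) ^ 2 * h2
  rw [e0, e0', e3', e2, e4]
  set D := S.dot (m - k) (S.eigvec γ m).2.1
  set E := ((∑ i, S.wave m i * S.wave k i : ℝ) : ℂ)
  have hfst : (S.eigvec γ m).1 = ((S.cN * S.rho : ℝ) : ℂ) := rfl
  have hthd : (S.eigvec γ m).2.2 = ((S.cN * (S.theta * S.pt / (S.rho * S.et)) : ℝ) : ℂ) := rfl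
  rw [hfst, hthd]
  rw [gam]
  set h1 := S.cN * S.rho
  set h3 := S.cN * (S.theta * S.pt / (S.rho * S.et))
  set L := ((γ : ℤ) : ℝ) * S.lam m
  push_cast at *
  linear_combination (S.vol : ℂ) * Complex.I * (1 / 2) * (S.rho / S.theta : ℂ) * (
    (S.C1 * h1 * h1 + S.C2 * h3 * h3 + S.C3 * h3 * h1 + S.C4 * h1 * h3 : ℂ) * e5 + e6)

/-! ### The quadratic coefficient of the two-wave resonances -/

/-- Matrix of `𝒬_{2r}(U, ·)` in acoustic coordinates. -/
def couple (U : State N) (i j : Idx N) : ℂ :=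
  open Classical in
  if j.2 ≠ 0 ∧ S.eigval j.1 j.2 = S.eigval i.1 i.2 then
    2 * (S.vol * S.pairing (S.quad (i.2 - j.2) (U.hat (i.2 - j.2)) j.2 (S.eigvec j.1 j.2))
      (S.eigvec i.1 i.2))
  else 0

lemma q2r_eq (U V : State N) (γ : ℤˣ) (m : Fin N → ℤ) :
    S.q2r U V γ m = ∑' j : Idx N, S.couple U (γ, m) j * S.coord V j.1 j.2 := by
  rw [q2r]
  refine tsum_congr fun j => ?_
  rw [couple]
  split_ifs <;> simp

/-- Both entries of the two-wave matrix that link k and m are instances of this formula. In terms of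
a, m · k, |k|² and m · X, the bracket is symmetric in k and m once |k| = |m|. The divergence
condition `hX` enters as k · X = m · X. -/
lemma couple_formula {m k : Fin N → ℤ} {α γ : ℤˣ} (X : Mode N)
    (hX : S.dot (m - k) X.2.1 = 0) {a : ℝ} (hk : S.velFactor α k = a) (hm : S.velFactor γ m = a)
    {s r : ℝ} (hs : ∑ i, S.wave m i * S.wave k i = s) (hr : S.wabs k ^ 2 = r) :
    S.pairing (S.quad (m - k) X k (S.eigvec α k)) (S.eigvec γ m)
      = Complex.I * (1 / 2) * (
        ((S.cN * S.pr / S.theta : ℝ) : ℂ)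
          * (X.1 * ((a * s : ℝ) : ℂ) + ((S.cN * S.rho : ℝ) : ℂ) * S.dot m X.2.1)
        + ((S.rho / S.theta * a : ℝ) : ℂ) * (
          S.dot m X.2.1 * ((a * s : ℝ) : ℂ) + ((a * (s - r) : ℝ) : ℂ) * S.dot m X.2.1
          + (s : ℂ) * (S.C1 * X.1 * (S.cN * S.rho : ℝ)
            + S.C2 * X.2.2 * (S.cN * (S.theta * S.pt / (S.rho * S.et)) : ℝ)
            + S.C3 * X.2.2 * (S.cN * S.rho : ℝ)
            + S.C4 * X.1 * (S.cN * (S.theta * S.pt / (S.rho * S.et)) : ℝ))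
          + ((∑ i, S.wave m i ^ 2 - s : ℝ) : ℂ) * (S.C1 * (S.cN * S.rho : ℝ) * X.1
            + S.C2 * (S.cN * (S.theta * S.pt / (S.rho * S.et)) : ℝ) * X.2.2
            + S.C3 * (S.cN * (S.theta * S.pt / (S.rho * S.et)) : ℝ) * X.1
            + S.C4 * (S.cN * S.rho : ℝ) * X.2.2))
        + ((S.cN * S.pt / S.theta : ℝ) : ℂ) * (
          S.dot m X.2.1 * (S.cN * (S.theta * S.pt / (S.rho * S.et)) : ℝ)
          + (S.C5 * X.2.2 + S.C6 * X.1) * ((a * r : ℝ) : ℂ)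
          + ((a * (s - r) : ℝ) : ℂ) * X.2.2)) := by
  have e0 : m - k + k = m := by abel
  have e0' : k + (m - k) = m := by abel
  have e1 : S.dot k X.2.1 = S.dot m X.2.1 := by
    rw [dot_sub_left] at hX; linear_combination -hX
  have e2 : S.dot m (S.eigvec α k).2.1 = ((a * s : ℝ) : ℂ) := by rw [dot_eigvec, hk, hs]
  have e3 : S.dot k (S.eigvec α k).2.1 = ((a * r : ℝ) : ℂ) := by
    rw [dot_eigvec, hk, ← hr, wabs_sq]; simp only [← sq]
  have e4 : S.dot (m - k) (S.eigvec α k).2.1 = ((a * (s - r) : ℝ) : ℂ) := by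
    rw [dot_sub_left, e2, e3]; push_cast; ring
  have e5 : ∑ i, S.wave m i * S.wave (m - k) i = ∑ i, S.wave m i ^ 2 - s := by
    rw [← hs, ← Finset.sum_sub_distrib]
    refine Finset.sum_congr rfl fun i _ => ?_
    rw [wave_sub]; ring
  have hfst : (S.eigvec α k).1 = ((S.cN * S.rho : ℝ) : ℂ) := rfl
  have hthd : (S.eigvec α k).2.2 = ((S.cN * (S.theta * S.pt / (S.rho * S.et)) : ℝ) : ℂ) := rfl
  rw [pairing_eigvec_right, quad_fst, quad_thd, dot_quad, e0, e0', hX, e1, e2, e3, e4, e5, hs, hm,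
    hfst, hthd]
  ring

end Setting

/-! ### Reality of the Fourier coefficients -/

/-- Complex conjugation of amplitudes. -/
def Mode.conj {N : ℕ} (X : Mode N) : Mode N :=
  (starRingEnd ℂ X.1, fun i => starRingEnd ℂ (X.2.1 i), starRingEnd ℂ X.2.2)

lemma State.hat_neg {N : ℕ} (U : State N) (n : Fin N → ℤ) : U.hat (-n) = (U.hat n).conj := by
  simp only [State.hat, coeff_neg_index, Mode.conj]

lemma State.hat_sub {N : ℕ} (U V : State N) (n : Fin N → ℤ) :
    (U - V).hat n = U.hat n - V.hat n := by
  ext i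
  · exact coeff_sub _ _ _
  · exact coeff_sub _ _ _
  · exact coeff_sub _ _ _

lemma State.ext_hat {N : ℕ} {U V : State N} (h : ∀ n, U.hat n = V.hat n) : U = V := by
  ext1
  · exact coeff_injective fun n => congrArg Prod.fst (h n)
  ext1
  · ext1 i
    exact coeff_injective fun n => congrFun (congrArg (fun X : Mode N => X.2.1) (h n)) i
  · exact coeff_injective fun n => congrArg (fun X : Mode N => X.2.2) (h n)

lemma State.exists_hat_eq {N : ℕ} (X : (Fin N → ℤ) → Mode N) (h1 : Summable fun n => ‖(X n).1‖ ^ 2)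
    (h2 : ∀ i, Summable fun n => ‖(X n).2.1 i‖ ^ 2) (h3 : Summable fun n => ‖(X n).2.2‖ ^ 2)
    (hs : ∀ n, X (-n) = (X n).conj) : ∃ U : State N, ∀ n, U.hat n = X n := by
  obtain ⟨f, hf⟩ := exists_coeff_eq (fun n => (X n).1) h1 fun n => congrArg Prod.fst (hs n)
  choose g hg using fun i => exists_coeff_eq (fun n => (X n).2.1 i) (h2 i)
    fun n => congrFun (congrArg (fun X : Mode N => X.2.1) (hs n)) i
  obtain ⟨h, hh⟩ := exists_coeff_eq (fun n => (X n).2.2) h3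
    fun n => congrArg (fun X : Mode N => X.2.2) (hs n)
  refine ⟨(f, g, h), fun n => ?_⟩
  ext i
  · exact hf n
  · exact hg i n
  · exact hh n

namespace Setting

variable {N : ℕ} (S : Setting N)

lemma dot_conj (k : Fin N → ℤ) (X : Fin N → ℂ) :
    S.dot k (fun i => conj (X i)) = conj (S.dot k X) := by
  simp only [dot, map_sum, map_mul, Complex.conj_ofReal]

lemma preQ_conj (k l : Fin N → ℤ) (X Y : Mode N) :
    S.preQ (-k) X.conj (-l) Y.conj = (S.preQ k X l Y).conj := by
  have h : -k + -l = -(k + l) := by abel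
  simp only [preQ, Mode.conj, h, dot_neg_left, dot_conj, wave_neg, map_mul, map_add, map_neg,
    Complex.conj_I, Complex.conj_ofReal]
  ext i
  · simp only []; ring
  · simp only []; push_cast; ring
  · simp only []; ring

lemma quad_conj (k l : Fin N → ℤ) (X Y : Mode N) :
    S.quad (-k) X.conj (-l) Y.conj = (S.quad k X l Y).conj := by
  rw [quad, quad, preQ_conj, preQ_conj]
  have : conj (1 / 2 : ℂ) = 1 / 2 := by
    rw [map_div₀, map_one, map_ofNat]
  ext i <;> simp [Mode.conj, map_ofNat] <;> ring

lemma pairing_conj (X Y : Mode N) : S.pairing X.conj Y.conj = conj (S.pairing X Y) := by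
  simp only [pairing, Mode.conj, map_add, map_mul, Complex.conj_ofReal, map_sum]

lemma eigvec_conj (α : ℤˣ) (n : Fin N → ℤ) : (S.eigvec α n).conj = S.eigvec α n := by
  simp only [eigvec, Mode.conj, Complex.conj_ofReal]

lemma coord_neg (V : State N) (α : ℤˣ) {n : Fin N → ℤ} (hn : n ≠ 0) :
    S.coord V α (-n) = conj (S.coord V α n) := by
  rw [coord, coord, map_mul, Complex.conj_ofReal, ← pairing_conj, eigvec_conj, State.hat_neg,
    eigvec_neg _ _ hn]

lemma nullA_dot {U : State N} (hU : U ∈ S.nullA) (n : Fin N → ℤ) : S.dot n (U.hat n).2.1 = 0 := by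
  have h := congrArg Prod.fst (hU.2 n)
  have : (S.rho : ℂ) * (Complex.I * S.dot n (U.hat n).2.1) = 0 := h
  have h3 : ((S.rho : ℝ) : ℂ) ≠ 0 := by exact_mod_cast S.rho_pos.ne'
  simpa [h3, Complex.I_ne_zero] using this

lemma eigval_eq_data {α γ : ℤˣ} {k m : Fin N → ℤ}
    (h : S.eigval α k = S.eigval γ m) :
    S.wabs k = S.wabs m ∧ (k ≠ 0 → S.velFactor α k = S.velFactor γ m) := by
  rw [eigval_eq_iff] at h
  have h1 : S.wabs k = S.wabs m := by
    have : (((α : ℤ) : ℝ) * S.lam k) ^ 2 = (((γ : ℤ) : ℝ) * S.lam m) ^ 2 := by rw [h]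
    rw [mul_pow, mul_pow, unit_cast_sq, unit_cast_sq, one_mul, one_mul, lam_sq, lam_sq] at this
    exact (pow_left_inj₀ (S.wabs_nonneg k) (S.wabs_nonneg m) two_ne_zero).1 this
  refine ⟨h1, fun hk => ?_⟩
  have h2 := (S.wabs_pos hk).ne'
  rw [lam, lam, ← h1, ← mul_assoc, ← mul_assoc] at h
  rw [velFactor, velFactor, ← h1, mul_right_cancel₀ h2 h]

lemma couple_ne_zero {U : State N} {i j : Idx N} (h : S.couple U i j ≠ 0) :
    j.2 ≠ 0 ∧ S.eigval j.1 j.2 = S.eigval i.1 i.2 := by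
  rw [couple] at h
  by_contra h'
  rw [if_neg h'] at h
  exact h rfl

lemma couple_wabs {U : State N} {i j : Idx N} (h : S.couple U i j ≠ 0) :
    S.wabs j.2 = S.wabs i.2 :=
  (S.eigval_eq_data (S.couple_ne_zero h).2).1

/-- The two-wave resonances conserve energy. -/
lemma couple_skew {U : State N} (hU : U ∈ S.nullA) {i j : Idx N} (hi : i.2 ≠ 0) (hj : j.2 ≠ 0) :
    S.couple U i j = -conj (S.couple U j i) := by
  obtain ⟨γ, m⟩ := i
  obtain ⟨α, k⟩ := j
  simp only at hi hj
  by_cases h : S.eigval α k = S.eigval γ m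
  · obtain ⟨h1, h2⟩ := S.eigval_eq_data h
    have h2 := h2 hj
    rw [couple, couple, if_pos ⟨hj, h⟩, if_pos ⟨hi, h.symm⟩]
    simp only
    have e1 := S.couple_formula (X := U.hat (m - k)) (S.nullA_dot hU _) (h2) rfl rfl rfl
    have e2 := S.couple_formula (X := U.hat (k - m)) (S.nullA_dot hU _) (h2.symm) rfl rfl rfl
    -- Exchanging k and m conjugates the amplitude of 𝒰 by reality. After `hd` the two brackets from
    -- `couple_formula` are conjugate to each other, and conjugating the common factor i supplies
    -- the minus sign.
    have hX : U.hat (k - m) = (U.hat (m - k)).conj := by rw [← neg_sub, State.hat_neg]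
    have hd : S.dot k (U.hat (k - m)).2.1 = conj (S.dot m (U.hat (m - k)).2.1) := by
      rw [hX, Mode.conj, dot_conj]
      congr 1
      have := S.nullA_dot hU (m - k)
      rw [dot_sub_left] at this
      linear_combination -this
    have hs : ∑ i, S.wave k i * S.wave m i = ∑ i, S.wave m i * S.wave k i :=
      Finset.sum_congr rfl fun i _ => mul_comm _ _
    rw [e1, e2, hd, hs, ← S.wabs_sq, ← S.wabs_sq, h1, h2]
    rw [hX]
    simp only [Mode.conj, map_mul, map_add, Complex.conj_ofReal, Complex.conj_I,
      Complex.conj_conj, map_div₀, map_one, map_ofNat]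
    push_cast
    ring
  · rw [couple, couple, if_neg (fun h' => h h'.2), if_neg (fun h' => h h'.2.symm)]
    simp

lemma couple_neg (U : State N) {γ α : ℤˣ} {m k : Fin N → ℤ} (hm : m ≠ 0) (hk : k ≠ 0) :
    S.couple U (γ, -m) (α, -k) = conj (S.couple U (γ, m) (α, k)) := by
  have hiff : S.eigval α (-k) = S.eigval γ (-m) ↔ S.eigval α k = S.eigval γ m := by
    rw [eigval_eq_iff, eigval_eq_iff, lam_neg, lam_neg, mul_neg, mul_neg, neg_inj]
  rw [couple, couple]
  simp only [hiff, neg_ne_zero]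
  split_ifs with h
  · have h1 : -m - -k = -(m - k) := by abel
    rw [h1, State.hat_neg, ← S.eigvec_conj α (-k), quad_conj, ← S.eigvec_conj γ (-m), pairing_conj,
      eigvec_neg _ _ hm, eigvec_neg _ _ hk]
    simp only [map_mul, Complex.conj_ofReal, map_ofNat]
  · simp

/-! ### The three-wave resonances in acoustic coordinates -/

/-- The coefficients of `𝒬_{3r}` in acoustic coordinates. -/
def burgers (x y : Idx N → ℂ) (i : Idx N) : ℂ :=
  open Classical in
  Complex.I * ((S.gam * (((i.1 : ℤ) : ℝ) * S.lam i.2) : ℝ) : ℂ)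
    * ∑' k : Fin N → ℤ, if S.Res i.2 k then x (i.1, k) * y (i.1, i.2 - k) else 0

/-- By `resonant_iff` only terms with α = β = γ survive, so the sum over (α, β, k) lives on the
image of k ↦ (γ, γ, k). -/
lemma q3r_eq (V W : State N) (γ : ℤˣ) {m : Fin N → ℤ} (hm : m ≠ 0) :
    S.q3r V W γ m
      = S.burgers (fun i => S.coord V i.1 i.2) (fun i => S.coord W i.1 i.2) (γ, m) := by
  classical
  have hinj : Function.Injective (fun k : Fin N → ℤ => ((γ, γ, k) : ℤˣ × ℤˣ × (Fin N → ℤ))) := by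
    intro k k' h
    simpa using h
  rw [q3r, burgers, ← tsum_mul_left, ← hinj.tsum_eq]
  · refine tsum_congr fun k => ?_
    simp only [S.resonant_iff γ γ γ hm, true_and]
    split_ifs with h
    · rw [S.vol_pairing_quad_eigvec h]; ring
    · simp
  · intro z hz
    rw [Function.mem_support] at hz
    have h : z.2.2 ≠ 0 ∧ m - z.2.2 ≠ 0 ∧
        S.eigval z.1 z.2.2 + S.eigval z.2.1 (m - z.2.2) = S.eigval γ m := by
      by_contra h
      rw [if_neg h] at hz
      exact hz rfl
    rw [S.resonant_iff _ _ _ hm] at h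
    exact ⟨z.2.2, Prod.ext h.1.symm (Prod.ext h.2.1.symm rfl)⟩

/-! ### Decomposition of amplitudes -/

/-- The part of an amplitude that is orthogonal to the acoustic eigenvectors. -/
def nullPart (n : Fin N → ℤ) (X : Mode N) : Mode N :=
  X - ∑ γ : ℤˣ, (S.vol * S.pairing X (S.eigvec γ n)) • S.eigvec γ n

lemma sum_pairing_left {ι : Type*} (s : Finset ι) (X : ι → Mode N) (Y : Mode N) :
    S.pairing (∑ i ∈ s, X i) Y = ∑ i ∈ s, S.pairing (X i) Y := by
  classical
  induction s using Finset.induction_on with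
  | empty => simp [pairing_zero_left]
  | insert a s ha ih => rw [Finset.sum_insert ha, Finset.sum_insert ha, pairing_add_left, ih]

lemma vol_pairing_sum {n : Fin N → ℤ} (hn : n ≠ 0) (x : ℤˣ → ℂ) (γ : ℤˣ) :
    S.vol * S.pairing (∑ α : ℤˣ, x α • S.eigvec α n) (S.eigvec γ n) = x γ := by
  rw [sum_pairing_left, Finset.mul_sum]
  have : ∀ α : ℤˣ, (S.vol : ℂ) * S.pairing (x α • S.eigvec α n) (S.eigvec γ n)
      = if α = γ then x α else 0 := by
    intro α
    rw [pairing_smul_left, mul_left_comm, vol_pairing_eigvec _ _ _ hn]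
    simp
  rw [Finset.sum_congr rfl fun α _ => this α, Finset.sum_ite_eq', if_pos (Finset.mem_univ _)]

lemma pairing_nullPart {n : Fin N → ℤ} (hn : n ≠ 0) (X : Mode N) (γ : ℤˣ) :
    S.pairing (S.nullPart n X) (S.eigvec γ n) = 0 := by
  have hv : ((S.vol : ℝ) : ℂ) ≠ 0 := by exact_mod_cast S.vol_pos.ne'
  apply mul_left_cancel₀ hv
  rw [nullPart, pairing_sub_left, mul_sub,
    S.vol_pairing_sum hn (fun α => S.vol * S.pairing X (S.eigvec α n))]
  ring

lemma vol_modeSq_sum {n : Fin N → ℤ} (hn : n ≠ 0) (x : ℤˣ → ℂ) :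
    S.vol * S.modeSq (∑ α : ℤˣ, x α • S.eigvec α n) = ∑ α, ‖x α‖ ^ 2 := by
  have h : ((S.vol * S.modeSq (∑ α : ℤˣ, x α • S.eigvec α n) : ℝ) : ℂ)
      = ((∑ α, ‖x α‖ ^ 2 : ℝ) : ℂ) := by
    rw [Complex.ofReal_mul, ← pairing_self]
    nth_rewrite 1 [sum_pairing_left]
    rw [Finset.mul_sum]
    push_cast
    refine Finset.sum_congr rfl fun α _ => ?_
    rw [pairing_smul_left, ← pairing_conj_symm, mul_left_comm, ← Complex.conj_ofReal S.vol,
      ← map_mul, S.vol_pairing_sum hn x α, Complex.mul_conj, Complex.normSq_eq_norm_sq]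
    push_cast; rfl
  exact_mod_cast h

/-- Bessel's equality for the acoustic coordinates of an amplitude. -/
lemma vol_modeSq_eq {n : Fin N → ℤ} (hn : n ≠ 0) (X : Mode N) :
    S.vol * S.modeSq X = (∑ α : ℤˣ, ‖S.vol * S.pairing X (S.eigvec α n)‖ ^ 2)
      + S.vol * S.modeSq (S.nullPart n X) := by
  set A := ∑ γ : ℤˣ, (S.vol * S.pairing X (S.eigvec γ n)) • S.eigvec γ n with hA
  set B := S.nullPart n X with hB
  have hX : X = A + B := by rw [hB, nullPart]; abel
  have hBA : S.pairing A B = 0 := by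
    rw [hA, sum_pairing_left]
    refine Finset.sum_eq_zero fun γ _ => ?_
    have h0 : S.pairing (S.eigvec γ n) B = 0 := by
      rw [← pairing_conj_symm, hB, S.pairing_nullPart hn, map_zero]
    rw [pairing_smul_left, h0, mul_zero]
  have hAB : S.pairing B A = 0 := by rw [← pairing_conj_symm, hBA, map_zero]
  have h2 : S.pairing X X = S.pairing A A + S.pairing B B := by
    have : S.pairing X X = S.pairing A (A + B) + S.pairing B (A + B) := by
      rw [← pairing_add_left, ← hX]
    rw [this, ← S.pairing_conj_symm (A + B) A, ← S.pairing_conj_symm (A + B) B, pairing_add_left,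
      pairing_add_left, map_add, map_add, pairing_conj_symm, pairing_conj_symm, pairing_conj_symm,
      pairing_conj_symm, hBA, hAB]
    ring
  rw [pairing_self, pairing_self, pairing_self] at h2
  have h3 : S.modeSq X = S.modeSq A + S.modeSq B := by exact_mod_cast h2
  rw [h3, mul_add, hA, S.vol_modeSq_sum hn]

lemma sq_coord_le {n : Fin N → ℤ} (hn : n ≠ 0) (V : State N) :
    ∑ γ : ℤˣ, ‖S.coord V γ n‖ ^ 2 ≤ S.vol * S.modeSq (V.hat n) := by
  rw [S.vol_modeSq_eq hn]
  have := mul_nonneg S.vol_pos.le (S.modeSq_nonneg (S.nullPart n (V.hat n)))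
  simp only [coord]
  linarith

/-- An amplitude is in the kernel of the acoustic operator if and only if it is orthogonal to both
eigenvectors. -/
lemma acoustic_eq_zero_iff {n : Fin N → ℤ} (hn : n ≠ 0) (X : Mode N) :
    S.acoustic n X = 0 ↔ ∀ γ, S.pairing X (S.eigvec γ n) = 0 := by
  have h1 : ((S.c : ℝ) : ℂ) ≠ 0 := by exact_mod_cast S.c_pos.ne'
  have h2 : ((S.et : ℝ) : ℂ) ≠ 0 := by exact_mod_cast S.et_pos.ne'
  have h3 : ((S.rho : ℝ) : ℂ) ≠ 0 := by exact_mod_cast S.rho_pos.ne'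
  have h4 : ((S.theta : ℝ) : ℂ) ≠ 0 := by exact_mod_cast S.theta_pos.ne'
  have h5 : ((S.cN : ℝ) : ℂ) ≠ 0 := by exact_mod_cast S.cN_pos.ne'
  have h6 : ((S.wabs n : ℝ) : ℂ) ≠ 0 := by exact_mod_cast (S.wabs_pos hn).ne'
  have h7 : ((sg n : ℝ) : ℂ) ≠ 0 := by
    rcases sg_eq n with h | h <;> simp [h]
  have key : ∀ γ : ℤˣ, S.pairing X (S.eigvec γ n)
      = S.cN / S.theta * (S.pr * X.1 + S.pt * X.2.2)
        + ((γ : ℤ) : ℂ) * (S.rho / S.theta * S.cN * S.c * sg n / S.wabs n * S.dot n X.2.1) := by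
    intro γ
    rw [pairing_eigvec_right, velFactor]
    push_cast
    ring
  constructor
  · intro h γ
    have e1 : (S.rho : ℂ) * (Complex.I * S.dot n X.2.1) = 0 := congrArg Prod.fst h
    have e2 : S.dot n X.2.1 = 0 := by simpa [h3, Complex.I_ne_zero] using e1
    obtain ⟨i, hi⟩ := Function.ne_iff.1 hn
    have e3 : Complex.I * S.wave n i * ((S.pr / S.rho : ℝ) * X.1 + (S.pt / S.rho : ℝ) * X.2.2) = 0 :=
      congrFun (congrArg (fun X : Mode N => X.2.1) h) i
    have hw : ((S.wave n i : ℝ) : ℂ) ≠ 0 := by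
      have : S.wave n i ≠ 0 := div_ne_zero (by exact_mod_cast hi) (S.a_pos i).ne'
      exact_mod_cast this
    have e4 := (mul_eq_zero.1 e3).resolve_left (mul_ne_zero Complex.I_ne_zero hw)
    have e5 : S.pr * X.1 + S.pt * X.2.2 = 0 := by
      push_cast at e4
      field_simp at e4
      simpa using e4
    rw [key, e5, e2]; ring
  · intro h
    -- The pairings for γ = 1 and γ = -1 are the sum and the difference of a pressure part and a
    -- divergence part, so adding and subtracting them isolates each part.
    have k1 := h 1
    have k2 := h (-1)
    rw [key] at k1 k2
    simp only [Units.val_one, Int.cast_one, Units.val_neg, Int.cast_neg, one_mul, neg_mul] at k1 k2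
    have e5 : S.pr * X.1 + S.pt * X.2.2 = 0 := by
      have : (2 * S.cN / S.theta : ℂ) * (S.pr * X.1 + S.pt * X.2.2) = 0 := by
        linear_combination k1 + k2
      exact (mul_eq_zero.1 this).resolve_left
        (div_ne_zero (mul_ne_zero two_ne_zero h5) h4)
    have e2 : S.dot n X.2.1 = 0 := by
      have : (2 * (S.rho / S.theta * S.cN * S.c * sg n / S.wabs n) : ℂ) * S.dot n X.2.1 = 0 := by
        linear_combination k1 - k2
      exact (mul_eq_zero.1 this).resolve_left (mul_ne_zero two_ne_zero
        (div_ne_zero (mul_ne_zero (mul_ne_zero (mul_ne_zero (div_ne_zero h3 h4) h5) h1) h7) h6))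
    have e6 : ((S.pr / S.rho : ℝ) : ℂ) * X.1 + ((S.pt / S.rho : ℝ) : ℂ) * X.2.2 = 0 := by
      push_cast
      linear_combination (1 / S.rho : ℂ) * e5
    rw [acoustic, e2, e6]
    simp only [mul_zero]
    rfl

end Setting

namespace Setting

variable {N : ℕ} (S : Setting N)

/-! ### Summation over resonant lines -/

lemma Res.apply_ne_zero {m k : Fin N → ℤ} (h : S.Res m k) {i : Fin N} (hi : m i ≠ 0) :
    k i ≠ 0 := by
  intro h0
  have h1 := h.collinear S i
  have hw : S.wave m i ≠ 0 := div_ne_zero (by exact_mod_cast hi) (S.a_pos i).ne'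
  have : S.wave k i = 0 := by simp [wave, h0]
  rw [this, mul_zero] at h1
  exact (mul_ne_zero (S.lam_ne_zero h.1) hw) h1.symm

lemma Res.eq_of_apply_eq {m k k' : Fin N → ℤ} (h : S.Res m k) (h' : S.Res m k') {i : Fin N}
    (hi : m i ≠ 0) (hk : k i = k' i) : k = k' := by
  have h1 := h.collinear S i
  have h2 := h'.collinear S i
  have hw : S.wave m i ≠ 0 := div_ne_zero (by exact_mod_cast hi) (S.a_pos i).ne'
  have e : S.wave k i = S.wave k' i := by simp [wave, hk]
  rw [e] at h1
  have h3 : S.lam k = S.lam k' := mul_right_cancel₀ hw (h1.symm.trans h2)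
  ext j
  have h4 := h.collinear S j
  have h5 := h'.collinear S j
  rw [h3, ← h5] at h4
  have h6 := mul_left_cancel₀ (S.lam_ne_zero h.2.2.1) h4
  rw [wave, wave, div_left_inj' (S.a_pos j).ne'] at h6
  exact_mod_cast h6

/-- All k resonant with m lie on the line of m, so a coordinate with m i ≠ 0 embeds them in the
nonzero integers, where the exponent 3/2 > 1 is summable. The bound |k| ≥ |k i| / a i, followed by
summing a i^{3/2} over all i, makes the constant independent of m. -/
lemma exists_line_sum_le : ∃ C : ℝ, 0 < C ∧ ∀ (m : Fin N → ℤ) (F : Finset (Fin N → ℤ)),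
    (∀ k ∈ F, S.Res m k) → ∑ k ∈ F, S.wabs k ^ (-(3 / 2) : ℝ) ≤ C := by
  classical
  have hsum : Summable fun j : ℤ => |(j : ℝ)| ^ (-(3 / 2) : ℝ) :=
    Real.summable_abs_int_rpow (by norm_num)
  set Z := ∑' j : ℤ, |(j : ℝ)| ^ (-(3 / 2) : ℝ) with hZ
  have hZ0 : 0 ≤ Z := tsum_nonneg fun j => Real.rpow_nonneg (abs_nonneg _) _
  have hA : ∀ i, 0 ≤ S.a i ^ (3 / 2 : ℝ) := fun i => Real.rpow_nonneg (S.a_pos i).le _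
  refine ⟨(∑ i, S.a i ^ (3 / 2 : ℝ)) * Z + 1, by
    have := Finset.sum_nonneg fun i (_ : i ∈ Finset.univ) => hA i
    positivity, fun m F hF => ?_⟩
  rcases F.eq_empty_or_nonempty with rfl | ⟨k₀, hk₀⟩
  · have := Finset.sum_nonneg fun i (_ : i ∈ Finset.univ) => hA i
    simp only [Finset.sum_empty]
    positivity
  obtain ⟨i, hi⟩ := Function.ne_iff.1 (hF k₀ hk₀).2.2.1
  have hi' : m i ≠ 0 := hi
  have hinj : Set.InjOn (fun k : Fin N → ℤ => k i) F := fun k hk k' hk' h =>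
    (hF k hk).eq_of_apply_eq S (hF k' hk') hi' h
  calc ∑ k ∈ F, S.wabs k ^ (-(3 / 2) : ℝ)
      ≤ ∑ k ∈ F, S.a i ^ (3 / 2 : ℝ) * |((k i : ℤ) : ℝ)| ^ (-(3 / 2) : ℝ) := by
        refine Finset.sum_le_sum fun k hk => ?_
        have ha := S.a_pos i
        have hki : (0 : ℝ) < |((k i : ℤ) : ℝ)| := by
          rw [abs_pos]; exact_mod_cast (hF k hk).apply_ne_zero S hi'
        have h1 : |((k i : ℤ) : ℝ)| / S.a i ≤ S.wabs k := by
          have := S.abs_wave_le k i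
          rwa [wave, abs_div, abs_of_pos ha] at this
        calc S.wabs k ^ (-(3 / 2) : ℝ) ≤ (|((k i : ℤ) : ℝ)| / S.a i) ^ (-(3 / 2) : ℝ) :=
              Real.rpow_le_rpow_of_nonpos (by positivity) h1 (by norm_num)
          _ = _ := by
              rw [Real.div_rpow hki.le ha.le, Real.rpow_neg ha.le, div_inv_eq_mul, mul_comm]
    _ = S.a i ^ (3 / 2 : ℝ) * ∑ j ∈ F.image (fun k : Fin N → ℤ => k i), |((j : ℤ) : ℝ)| ^ (-(3 / 2) : ℝ) := by
        rw [Finset.sum_image hinj, Finset.mul_sum]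
    _ ≤ S.a i ^ (3 / 2 : ℝ) * Z := by
        gcongr
        · exact hA i
        · exact hsum.sum_le_tsum _ fun j _ => Real.rpow_nonneg (abs_nonneg _) _
    _ ≤ (∑ i, S.a i ^ (3 / 2 : ℝ)) * Z := by
        gcongr
        exact Finset.single_le_sum (f := fun i => S.a i ^ (3 / 2 : ℝ)) (fun i _ => hA i)
          (Finset.mem_univ i)
    _ ≤ _ := by linarith

/-- The basic trilinear estimate over resonant triads. -/
lemma exists_trilinear_le : ∃ C : ℝ, 0 < C ∧ ∀ (K : ℝ), 0 < K → ∀ (h f g : Idx N → ℝ) (H F G : ℝ),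
    0 ≤ H → 0 ≤ F → 0 ≤ G →
    (∀ s : Finset (Idx N), ∑ i ∈ s, h i ^ 2 ≤ H ^ 2) →
    (∀ s : Finset (Idx N), ∑ i ∈ s, f i ^ 2 ≤ F ^ 2) →
    (∀ s : Finset (Idx N), ∑ i ∈ s, S.wabs i.2 ^ 2 * g i ^ 2 ≤ G ^ 2) →
    (∀ i, i.2 ≠ 0 → g i ≠ 0 → K ≤ S.wabs i.2) →
    ∀ P : Finset (Idx N × (Fin N → ℤ)), (∀ p ∈ P, S.Res p.1.2 p.2) →
    ∑ p ∈ P, h p.1 * f (p.1.1, p.2) * g (p.1.1, p.1.2 - p.2)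
      ≤ C * K ^ (-(1 / 4) : ℝ) * H * F * G := by
  classical
  obtain ⟨C, hC, hline⟩ := S.exists_line_sum_le
  refine ⟨√C, Real.sqrt_pos.2 hC, fun K hK h f g H F G hH hF hG hh hf hg hsupp P hP => ?_⟩
  -- Cauchy–Schwarz with the weight |m - k|^{3/4}. In the first factor m is fixed and the sum over k
  -- is a line sum of |m - k|^{-3/2}. In the second, |l|^{3/2} ≤ K^{-1/2}|l|² on the support of g,
  -- and the square root of K^{-1/2} is the gain K^{-1/4}.
  obtain ⟨W, hW⟩ : ∃ W : Idx N × (Fin N → ℤ) → ℝ, W = fun p => S.wabs (p.1.2 - p.2) := ⟨_, rfl⟩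
  have hw : ∀ p ∈ P, 0 < W p := fun p hp => by rw [hW]; exact S.wabs_pos (hP p hp).2.1
  have e1 : ∑ p ∈ P, h p.1 * f (p.1.1, p.2) * g (p.1.1, p.1.2 - p.2)
      = ∑ p ∈ P, (h p.1 * W p ^ (-(3 / 4) : ℝ))
        * (f (p.1.1, p.2) * (W p ^ (3 / 4 : ℝ) * g (p.1.1, p.1.2 - p.2))) := by
    refine Finset.sum_congr rfl fun p hp => ?_
    have : W p ^ (-(3 / 4) : ℝ) * W p ^ (3 / 4 : ℝ) = 1 := by
      rw [← Real.rpow_add (hw p hp)]; norm_num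
    linear_combination -(h p.1 * f (p.1.1, p.2) * g (p.1.1, p.1.2 - p.2)) * this
  have e2 : ∑ p ∈ P, (h p.1 * W p ^ (-(3 / 4) : ℝ)) ^ 2 ≤ H ^ 2 * C := by
    calc ∑ p ∈ P, (h p.1 * W p ^ (-(3 / 4) : ℝ)) ^ 2
        = ∑ p ∈ P, h p.1 ^ 2 * W p ^ (-(3 / 2) : ℝ) := by
          refine Finset.sum_congr rfl fun p hp => ?_
          rw [mul_pow, ← Real.rpow_natCast (W p ^ (-(3 / 4) : ℝ)) 2, ← Real.rpow_mul (hw p hp).le]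
          norm_num
      _ = ∑ i ∈ P.image Prod.fst, ∑ p ∈ P.filter (fun p => p.1 = i),
            h p.1 ^ 2 * W p ^ (-(3 / 2) : ℝ) :=
          (Finset.sum_fiberwise_of_maps_to (fun p hp => Finset.mem_image_of_mem _ hp) _).symm
      _ ≤ ∑ i ∈ P.image Prod.fst, h i ^ 2 * C := by
          refine Finset.sum_le_sum fun i _ => ?_
          have h1 : ∑ p ∈ P.filter (fun p => p.1 = i), h p.1 ^ 2 * W p ^ (-(3 / 2) : ℝ)
              = h i ^ 2 * ∑ p ∈ P.filter (fun p => p.1 = i), W p ^ (-(3 / 2) : ℝ) := by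
            rw [Finset.mul_sum]
            refine Finset.sum_congr rfl fun p hp => ?_
            rw [(Finset.mem_filter.1 hp).2]
          rw [h1]
          gcongr
          have hinj : Set.InjOn (fun p : Idx N × (Fin N → ℤ) => p.1.2 - p.2)
              (P.filter (fun p => p.1 = i)) := by
            intro p hp q hq hpq
            have hp' := (Finset.mem_filter.1 hp).2
            have hq' := (Finset.mem_filter.1 hq).2
            simp only [hp', hq', sub_right_inj] at hpq
            exact Prod.ext (hp'.trans hq'.symm) hpq
          rw [hW, ← Finset.sum_image (f := fun l => S.wabs l ^ (-(3 / 2) : ℝ)) hinj]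
          apply hline i.2
          intro l hl
          obtain ⟨p, hp, rfl⟩ := Finset.mem_image.1 hl
          have hp' := Finset.mem_filter.1 hp
          have := (hP p hp'.1).symm
          rw [hp'.2] at this ⊢
          exact this
      _ = (∑ i ∈ P.image Prod.fst, h i ^ 2) * C := by rw [Finset.sum_mul]
      _ ≤ _ := by gcongr; exact hh _
  have e3 : ∑ p ∈ P, (f (p.1.1, p.2) * (W p ^ (3 / 4 : ℝ) * g (p.1.1, p.1.2 - p.2))) ^ 2
      ≤ F ^ 2 * (K ^ (-(1 / 2) : ℝ) * G ^ 2) := by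
    -- The map from (m, k) to (k, m - k) is injective at fixed sign, so the sum over resonant pairs
    -- is at most the unrestricted product of a sum over `A` and a sum over `B`.
    set A := P.image fun p => ((p.1.1, p.2) : Idx N) with hA
    set B := P.image fun p => ((p.1.1, p.1.2 - p.2) : Idx N) with hB
    have hKp := Real.rpow_pos_of_pos hK (-(1 / 2) : ℝ)
    calc ∑ p ∈ P, (f (p.1.1, p.2) * (W p ^ (3 / 4 : ℝ) * g (p.1.1, p.1.2 - p.2))) ^ 2
        ≤ ∑ p ∈ P, f (p.1.1, p.2) ^ 2 *
            (K ^ (-(1 / 2) : ℝ) * (W p ^ 2 * g (p.1.1, p.1.2 - p.2) ^ 2)) := by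
          refine Finset.sum_le_sum fun p hp => ?_
          rw [mul_pow]
          gcongr
          by_cases hg0 : g (p.1.1, p.1.2 - p.2) = 0
          · simp [hg0]
          have hKW : K ≤ W p := by rw [hW]; exact hsupp (p.1.1, p.1.2 - p.2) (hP p hp).2.1 hg0
          rw [mul_pow, ← mul_assoc]
          gcongr
          have hWp := hw p hp
          calc (W p ^ (3 / 4 : ℝ)) ^ 2 = W p ^ (-(1 / 2) : ℝ) * W p ^ 2 := by
                rw [← Real.rpow_natCast (W p ^ (3 / 4 : ℝ)) 2, ← Real.rpow_mul hWp.le,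
                  ← Real.rpow_natCast (W p) 2, ← Real.rpow_add hWp]
                norm_num
            _ ≤ _ := by
                exact mul_le_mul_of_nonneg_right
                  (Real.rpow_le_rpow_of_nonpos hK hKW (by norm_num)) (sq_nonneg _)
      _ = ∑ z ∈ P.image fun p => (((p.1.1, p.2), (p.1.1, p.1.2 - p.2)) : Idx N × Idx N),
            f z.1 ^ 2 * (K ^ (-(1 / 2) : ℝ) * (S.wabs z.2.2 ^ 2 * g z.2 ^ 2)) := by
          rw [hW, Finset.sum_image]
          rintro ⟨⟨a, b⟩, c⟩ _ ⟨⟨a', b'⟩, c'⟩ _ hpq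
          simp only [Prod.mk.injEq] at hpq
          obtain ⟨⟨h1, h2⟩, _, h3⟩ := hpq
          subst h1; subst h2
          simp only [sub_left_inj] at h3
          rw [h3]
      _ ≤ ∑ z ∈ A ×ˢ B, f z.1 ^ 2 * (K ^ (-(1 / 2) : ℝ) * (S.wabs z.2.2 ^ 2 * g z.2 ^ 2)) := by
          apply Finset.sum_le_sum_of_subset_of_nonneg
          · intro z hz
            obtain ⟨p, hp, rfl⟩ := Finset.mem_image.1 hz
            exact Finset.mem_product.2 ⟨Finset.mem_image_of_mem _ hp, Finset.mem_image_of_mem _ hp⟩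
          · intro z _ _
            positivity
      _ = (∑ i ∈ A, f i ^ 2) * (K ^ (-(1 / 2) : ℝ) * ∑ i ∈ B, S.wabs i.2 ^ 2 * g i ^ 2) := by
          rw [Finset.mul_sum, Finset.sum_mul_sum, Finset.sum_product]
      _ ≤ _ := by
          gcongr
          · exact hf _
          · exact hg _
  rw [e1]
  refine (Real.sum_mul_le_sqrt_mul_sqrt _ _ _).trans ?_
  calc _ ≤ √(H ^ 2 * C) * √(F ^ 2 * (K ^ (-(1 / 2) : ℝ) * G ^ 2)) := by gcongr
    _ = _ := by
      have hK4 : √(K ^ (-(1 / 2) : ℝ)) = K ^ (-(1 / 4) : ℝ) := by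
        rw [Real.sqrt_eq_rpow, ← Real.rpow_mul hK.le]; norm_num
      rw [Real.sqrt_mul (sq_nonneg _), Real.sqrt_mul (sq_nonneg _),
        Real.sqrt_mul (Real.rpow_nonneg hK.le _), Real.sqrt_sq hH, Real.sqrt_sq hF,
        Real.sqrt_sq hG, hK4]
      ring

/-- The convolution over resonant pairs. -/
def conv (f g : Idx N → ℝ) (i : Idx N) : ℝ :=
  open Classical in
  ∑' k : Fin N → ℤ, if S.Res i.2 k then f (i.1, k) * g (i.1, i.2 - k) else 0

lemma summable_mul_shift {f g : Idx N → ℝ} (hf : Summable fun i => f i ^ 2)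
    (hg : Summable fun i => g i ^ 2) (i : Idx N) :
    Summable fun k : Fin N → ℤ => |f (i.1, k) * g (i.1, i.2 - k)| := by
  have h1 : Summable fun k : Fin N → ℤ => f (i.1, k) ^ 2 :=
    hf.comp_injective (i := fun k : Fin N → ℤ => ((i.1, k) : Idx N)) fun k k' h => by simpa using h
  have h2 : Summable fun k : Fin N → ℤ => g (i.1, i.2 - k) ^ 2 :=
    hg.comp_injective (i := fun k : Fin N → ℤ => ((i.1, i.2 - k) : Idx N))
      fun k k' h => by simpa using h
  refine Summable.of_nonneg_of_le (fun k => abs_nonneg _) (fun k => ?_) (h1.add h2)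
  rw [abs_mul]
  nlinarith [sq_nonneg (|f (i.1, k)| - |g (i.1, i.2 - k)|), sq_abs (f (i.1, k)),
    sq_abs (g (i.1, i.2 - k)), sq_nonneg (f (i.1, k)), sq_nonneg (g (i.1, i.2 - k))]

open Classical in
lemma summable_conv {f g : Idx N → ℝ} (hf : Summable fun i => f i ^ 2)
    (hg : Summable fun i => g i ^ 2) (i : Idx N) :
    Summable fun k : Fin N → ℤ => if S.Res i.2 k then f (i.1, k) * g (i.1, i.2 - k) else 0 := by
  refine Summable.of_norm_bounded (summable_mul_shift hf hg i) fun k => ?_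
  split_ifs
  · exact le_of_eq (Real.norm_eq_abs _)
  · rw [norm_zero]; exact abs_nonneg _

lemma conv_nonneg {f g : Idx N → ℝ} (hf : ∀ i, 0 ≤ f i) (hg : ∀ i, 0 ≤ g i) (i : Idx N) :
    0 ≤ S.conv f g i := by
  refine tsum_nonneg fun k => ?_
  split_ifs
  · exact mul_nonneg (hf _) (hg _)
  · exact le_rfl

lemma res_sub_iff {m k : Fin N → ℤ} : S.Res m (m - k) ↔ S.Res m k :=
  ⟨fun h => by simpa using h.symm, fun h => h.symm⟩

lemma conv_comm (f g : Idx N → ℝ) (i : Idx N) : S.conv f g i = S.conv g f i := by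
  rw [conv, conv, ← (Equiv.subLeft i.2).tsum_eq]
  refine tsum_congr fun k => ?_
  rw [Equiv.subLeft_apply]
  by_cases h : S.Res i.2 k
  · rw [if_pos h, if_pos h.symm, sub_sub_cancel, mul_comm]
  · rw [if_neg h, if_neg (fun h' => h (S.res_sub_iff.1 h'))]

-- The convolution is an infinite sum and the trilinear estimates concern finite sets of resonant
-- pairs; this passes from the second to the first.
open Classical in
lemma sum_mul_conv_le {h f g : Idx N → ℝ} (hf : Summable fun i => f i ^ 2)
    (hg : Summable fun i => g i ^ 2) {M : ℝ} (A : Finset (Idx N))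
    (hM : ∀ P : Finset (Idx N × (Fin N → ℤ)), (∀ p ∈ P, S.Res p.1.2 p.2) → (∀ p ∈ P, p.1 ∈ A) →
      ∑ p ∈ P, h p.1 * f (p.1.1, p.2) * g (p.1.1, p.1.2 - p.2) ≤ M) :
    ∑ i ∈ A, h i * S.conv f g i ≤ M := by
  have h1 : HasSum (fun k : Fin N → ℤ => ∑ i ∈ A, h i *
      (if S.Res i.2 k then f (i.1, k) * g (i.1, i.2 - k) else 0)) (∑ i ∈ A, h i * S.conv f g i) :=
    hasSum_sum fun i _ => (S.summable_conv hf hg i).hasSum.mul_left _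
  refine hasSum_le_of_sum_le h1 fun B => ?_
  have := hM ((A ×ˢ B).filter fun p => S.Res p.1.2 p.2) (fun p hp => (Finset.mem_filter.1 hp).2)
    (fun p hp => (Finset.mem_product.1 (Finset.mem_filter.1 hp).1).1)
  refine le_trans (le_of_eq ?_) this
  rw [Finset.sum_filter, Finset.sum_product, Finset.sum_comm]
  refine Finset.sum_congr rfl fun i _ => Finset.sum_congr rfl fun k _ => ?_
  split_ifs
  · ring
  · simp

lemma norm_burgers_le {x y : Idx N → ℂ} (hx : Summable fun i => ‖x i‖ ^ 2)
    (hy : Summable fun i => ‖y i‖ ^ 2) (i : Idx N) :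
    ‖S.burgers x y i‖
      ≤ |S.gam| * (S.wabs i.2 * S.conv (fun i => ‖x i‖) (fun i => ‖y i‖) i) := by
  classical
  rw [burgers, norm_mul, norm_mul, Complex.norm_I, one_mul, Complex.norm_real, Real.norm_eq_abs,
    abs_mul, abs_mul, abs_lam]
  have h1 : |((i.1 : ℤ) : ℝ)| = 1 := by
    rcases Int.units_eq_one_or i.1 with h | h <;> simp [h]
  rw [h1, one_mul, mul_assoc]
  gcongr
  · exact S.wabs_nonneg _
  rw [conv]
  have hs := S.summable_conv hx hy i
  refine tsum_of_norm_bounded hs.hasSum fun k => ?_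
  split_ifs
  · rw [norm_mul]
  · simp

open Classical in
lemma summable_burgers {x y : Idx N → ℂ} (hx : Summable fun i => ‖x i‖ ^ 2)
    (hy : Summable fun i => ‖y i‖ ^ 2) (i : Idx N) :
    Summable fun k : Fin N → ℤ => if S.Res i.2 k then x (i.1, k) * y (i.1, i.2 - k) else 0 := by
  refine Summable.of_norm_bounded (S.summable_conv hx hy i) fun k => ?_
  split_ifs
  · rw [norm_mul]
  · simp

lemma burgers_sub_burgers {x y : Idx N → ℂ} (hx : Summable fun i => ‖x i‖ ^ 2)
    (hy : Summable fun i => ‖y i‖ ^ 2) (hw : Summable fun i => ‖(x - y) i‖ ^ 2) (i : Idx N) :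
    S.burgers x x i - S.burgers y y i = S.burgers x (x - y) i + S.burgers (x - y) y i := by
  classical
  rw [burgers, burgers, burgers, burgers, ← mul_sub, ← mul_add,
    ← (S.summable_burgers hx hx i).tsum_sub (S.summable_burgers hy hy i),
    ← (S.summable_burgers hx hw i).tsum_add (S.summable_burgers hw hy i)]
  congr 2
  ext k
  split_ifs
  · simp only [Pi.sub_apply]; ring
  · simp

/-- The permuted trilinear estimate, with the gain on the output frequency. -/
lemma exists_trilinear_output_le : ∃ C : ℝ, 0 < C ∧ ∀ (K : ℝ), 0 < K →
    ∀ (h f g : Idx N → ℝ) (H F G : ℝ), 0 ≤ H → 0 ≤ F → 0 ≤ G →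
    (∀ s : Finset (Idx N), ∑ i ∈ s, h i ^ 2 ≤ H ^ 2) →
    (∀ s : Finset (Idx N), ∑ i ∈ s, f i ^ 2 ≤ F ^ 2) →
    (∀ s : Finset (Idx N), ∑ i ∈ s, S.wabs i.2 ^ 2 * g i ^ 2 ≤ G ^ 2) →
    (∀ i, i.2 ≠ 0 → g i ≠ 0 → K ≤ S.wabs i.2) →
    ∀ P : Finset (Idx N × (Fin N → ℤ)), (∀ p ∈ P, S.Res p.1.2 p.2) →
    ∑ p ∈ P, g p.1 * h (p.1.1, p.2) * f (p.1.1, p.1.2 - p.2)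
      ≤ C * K ^ (-(1 / 4) : ℝ) * H * F * G := by
  classical
  obtain ⟨C, hC, htri⟩ := S.exists_trilinear_le
  refine ⟨C, hC, fun K hK h f g H F G hH hF hG hh hf hg hsupp P hP => ?_⟩
  have hf' : ∀ s : Finset (Idx N), ∑ i ∈ s, (fun i : Idx N => f (i.1, -i.2)) i ^ 2 ≤ F ^ 2 := by
    intro s
    have hinj : Set.InjOn (fun i : Idx N => ((i.1, -i.2) : Idx N)) s := by
      rintro ⟨a, b⟩ _ ⟨a', b'⟩ _ hab
      simpa using hab
    have := hf (s.image fun i : Idx N => ((i.1, -i.2) : Idx N))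
    rwa [Finset.sum_image hinj] at this
  -- Relabelling (m, k) as (k, k - m) turns the difference frequency into k - (k - m) = m, so g now
  -- sits on the output. The factor f, evaluated at m - k = -(k - m), has to be reflected.
  have := htri K hK h (fun i => f (i.1, -i.2)) g H F G hH hF hG hh hf' hg hsupp
    (P.image fun p => (((p.1.1, p.2), p.2 - p.1.2) : Idx N × (Fin N → ℤ))) ?_
  · rw [Finset.sum_image] at this
    · refine le_trans (le_of_eq ?_) this
      refine Finset.sum_congr rfl fun p _ => ?_
      simp only [neg_sub, sub_sub_cancel]
      ring
    · rintro ⟨⟨a, b⟩, c⟩ _ ⟨⟨a', b'⟩, c'⟩ _ hpq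
      simp only [Prod.mk.injEq] at hpq
      obtain ⟨⟨h1, h2⟩, h3⟩ := hpq
      subst h1; subst h2
      simp only [sub_right_inj] at h3
      rw [h3]
  · intro p hp
    obtain ⟨q, hq, rfl⟩ := Finset.mem_image.1 hp
    exact ((hP q hq).swap S).symm

end Setting

/-- The reflection `(γ, m) ↦ (γ, -m)`. -/
def Idx.flip {N : ℕ} (i : Idx N) : Idx N := (i.1, -i.2)

@[simp] lemma Idx.flip_flip {N : ℕ} (i : Idx N) : i.flip.flip = i := by simp [Idx.flip]

/-- The reality condition for acoustic coordinates. -/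
def IsReal {N : ℕ} (x : Idx N → ℂ) : Prop := ∀ i, x i.flip = conj (x i)

namespace Setting

variable {N : ℕ} (S : Setting N)

/-- The indices with frequency in the ball of radius `R` (without the origin). -/
def ball (R : ℝ) : Finset (Idx N) :=
  Finset.univ ×ˢ ((S.finite_wabs_le R).toFinset.erase 0)

@[simp] lemma mem_ball {R : ℝ} {i : Idx N} : i ∈ S.ball R ↔ i.2 ≠ 0 ∧ S.wabs i.2 ≤ R := by
  simp only [ball, Finset.mem_product, Finset.mem_univ, true_and, Finset.mem_erase,
    Set.Finite.mem_toFinset, Set.mem_ofPred_eq, ne_eq]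

lemma flip_mem_ball {R : ℝ} {i : Idx N} : i.flip ∈ S.ball R ↔ i ∈ S.ball R := by
  simp [Idx.flip]

/-! ### Conservation of energy and reality -/

/-- The weight depends only on |m|, and a nonzero entry of the coupling matrix joins frequencies of
equal length. So the weighted matrix is still skew-Hermitian and its quadratic form is purely
imaginary. -/
lemma re_sum_couple_eq_zero {U : State N} (hU : U ∈ S.nullA) {A : Finset (Idx N)}
    (hA : ∀ i ∈ A, i.2 ≠ 0) (w : ℝ → ℝ) (x : Idx N → ℂ) :
    (∑ i ∈ A, w (S.wabs i.2) * (conj (x i) * ∑ j ∈ A, S.couple U i j * x j)).re = 0 := by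
  set Z := ∑ i ∈ A, w (S.wabs i.2) * (conj (x i) * ∑ j ∈ A, S.couple U i j * x j) with hZ
  have h1 : Z = ∑ i ∈ A, ∑ j ∈ A, w (S.wabs i.2) * (conj (x i) * (S.couple U i j * x j)) := by
    rw [hZ]
    refine Finset.sum_congr rfl fun i _ => ?_
    rw [Finset.mul_sum, Finset.mul_sum]
  have h2 : conj Z = -Z := by
    have h4 : conj Z = ∑ i ∈ A, ∑ j ∈ A,
        conj (w (S.wabs j.2) * (conj (x j) * (S.couple U j i * x i)) : ℂ) := by
      rw [h1]
      simp only [map_sum]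
      exact Finset.sum_comm
    rw [h4, h1, ← Finset.sum_neg_distrib]
    refine Finset.sum_congr rfl fun i hi => ?_
    rw [← Finset.sum_neg_distrib]
    refine Finset.sum_congr rfl fun j hj => ?_
    by_cases h0 : S.couple U i j = 0
    · have h3 := S.couple_skew hU (hA j hj) (hA i hi)
      rw [h0] at h3
      simp [h0, h3]
    · rw [S.couple_skew hU (hA i hi) (hA j hj), ← S.couple_wabs h0]
      simp only [map_mul, Complex.conj_ofReal, Complex.conj_conj]
      ring
  have h3 := congrArg Complex.re h2
  rw [Complex.conj_re, Complex.neg_re] at h3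
  linarith

lemma Res.rotate {m k : Fin N → ℤ} (h : S.Res m k) : S.Res (k - m) k := by
  have := (((h.symm).swap S).neg S).symm
  simpa using this

-- This is the Burgers identity ∫ u ∂ₓ(u²) = 0. Reality rewrites the conjugate of x(γ, m) as x(γ,
-- -m), so each term is a product symmetric in -m, k, m - k, multiplied by the signed length of m.
-- Averaging over the three roles produces lam m - lam k - lam (m - k), which vanishes at resonance.
open Classical in
lemma sum_conj_mul_burgers_eq_zero {A : Finset (Idx N)} {x : Idx N → ℂ} (hx : IsReal x)
    (hA : ∀ i, i ∉ A → x i = 0) : (∑ i ∈ A, conj (x i) * S.burgers x x i) = 0 := by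
  set τ : Idx N × (Fin N → ℤ) → ℂ := fun p =>
    if S.Res p.1.2 p.2 then x p.1.flip * (x (p.1.1, p.2) * x (p.1.1, p.1.2 - p.2)) else 0 with hτ
  set B := A.image Prod.snd with hB
  have hflip : ∀ i, i ∉ A → x i.flip = 0 := fun i hi => by rw [hx, hA i hi, map_zero]
  have hsupp : ∀ p, p ∉ A ×ˢ B → τ p = 0 := by
    intro p hp
    simp only [hτ]
    split_ifs
    · by_cases h1 : p.1 ∈ A
      · have h2 : p.2 ∉ B := fun h2 => hp (Finset.mem_product.2 ⟨h1, h2⟩)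
        have : ((p.1.1, p.2) : Idx N) ∉ A := fun h3 => h2 (Finset.mem_image_of_mem Prod.snd h3)
        rw [hA _ this]; ring
      · rw [hflip _ h1]; ring
    · rfl
  have key : ∀ c : Idx N × (Fin N → ℤ) → ℂ, Summable fun p => c p * τ p := fun c =>
    summable_of_ne_finset_zero (s := A ×ˢ B) fun p hp => by rw [hsupp p hp, mul_zero]
  have hT : ∑' p : Idx N × (Fin N → ℤ), ((((p.1.1 : ℤ) : ℝ) * S.lam p.1.2 : ℝ) : ℂ) * τ p = 0 := by
    set T := ∑' p : Idx N × (Fin N → ℤ), ((((p.1.1 : ℤ) : ℝ) * S.lam p.1.2 : ℝ) : ℂ) * τ p with hTd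
    -- The change of variables exchanges the roles of -m and k. The one in `e2` exchanges -m and m -
    -- k.
    have e1 : T = ∑' p : Idx N × (Fin N → ℤ),
        ((((p.1.1 : ℤ) : ℝ) * -S.lam p.2 : ℝ) : ℂ) * τ p := by
      let φ : Idx N × (Fin N → ℤ) ≃ Idx N × (Fin N → ℤ) :=
        { toFun := fun p => ((p.1.1, -p.2), -p.1.2)
          invFun := fun p => ((p.1.1, -p.2), -p.1.2)
          left_inv := fun p => by simp
          right_inv := fun p => by simp }
      rw [hTd, ← φ.tsum_eq]
      refine tsum_congr fun p => ?_
      have : τ (φ p) = τ p := by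
        simp only [hτ, φ, Equiv.coe_fn_mk, Idx.flip, neg_neg]
        have hiff : S.Res (-p.2) (-p.1.2) ↔ S.Res p.1.2 p.2 :=
          ⟨fun h => by simpa using ((h.neg S).swap S), fun h => (h.swap S).neg S⟩
        simp only [hiff]
        have e : -p.2 - -p.1.2 = p.1.2 - p.2 := by abel
        rw [e]
        split_ifs
        · ring
        · rfl
      rw [this]
      simp [φ]
    have e2 : T = ∑' p : Idx N × (Fin N → ℤ),
        ((((p.1.1 : ℤ) : ℝ) * -S.lam (p.1.2 - p.2) : ℝ) : ℂ) * τ p := by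
      let φ : Idx N × (Fin N → ℤ) ≃ Idx N × (Fin N → ℤ) :=
        { toFun := fun p => ((p.1.1, p.2 - p.1.2), p.2)
          invFun := fun p => ((p.1.1, p.2 - p.1.2), p.2)
          left_inv := fun p => by simp
          right_inv := fun p => by simp }
      rw [hTd, ← φ.tsum_eq]
      refine tsum_congr fun p => ?_
      have : τ (φ p) = τ p := by
        simp only [hτ, φ, Equiv.coe_fn_mk, Idx.flip]
        have hiff : S.Res (p.2 - p.1.2) p.2 ↔ S.Res p.1.2 p.2 :=
          ⟨fun h => by simpa using (h.rotate S), fun h => h.rotate S⟩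
        simp only [hiff]
        have e : p.2 - p.1.2 - p.2 = -p.1.2 := by abel
        rw [e, neg_sub]
        split_ifs
        · ring
        · rfl
      rw [this]
      simp only [φ, Equiv.coe_fn_mk]
      rw [← neg_sub p.1.2 p.2, lam_neg]
    have e3 : 3 * T = 0 := by
      have : 3 * T = T + (T + T) := by ring
      rw [this]
      nth_rewrite 2 [e1]
      nth_rewrite 2 [e2]
      rw [hTd, ← (key _).tsum_add (key _), ← (key _).tsum_add ((key _).add (key _))]
      · rw [← tsum_zero]
        refine tsum_congr fun p => ?_
        simp only [hτ]
        split_ifs with h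
        · have := h.2.2.2
          have h' : S.lam p.1.2 = S.lam p.2 + S.lam (p.1.2 - p.2) := this.symm
          rw [h']
          push_cast
          ring
        · ring
    simpa using e3
  have h2 : ∀ i ∈ A, conj (x i) * S.burgers x x i = Complex.I * S.gam *
      ∑ k ∈ B, ((((i.1 : ℤ) : ℝ) * S.lam i.2 : ℝ) : ℂ) * τ (i, k) := by
    intro i _
    rw [burgers, tsum_eq_sum (s := B)]
    · rw [Finset.mul_sum, Finset.mul_sum, Finset.mul_sum]
      refine Finset.sum_congr rfl fun k _ => ?_
      simp only [hτ]
      rw [← hx]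
      split_ifs
      · push_cast; ring
      · ring
    · intro k hk
      split_ifs
      · have : ((i.1, k) : Idx N) ∉ A := fun h3 => hk (Finset.mem_image_of_mem Prod.snd h3)
        rw [hA _ this, zero_mul]
      · rfl
  rw [tsum_eq_sum (s := A ×ˢ B) (fun p hp => by rw [hsupp p hp, mul_zero]),
    Finset.sum_product] at hT
  rw [Finset.sum_congr rfl h2, ← Finset.mul_sum, hT, mul_zero]

lemma burgers_flip {x y : Idx N → ℂ} (hx : IsReal x) (hy : IsReal y) (i : Idx N) :
    S.burgers x y i.flip = conj (S.burgers x y i) := by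
  classical
  have h1 : conj (∑' k : Fin N → ℤ, if S.Res i.2 k then x (i.1, k) * y (i.1, i.2 - k) else 0)
      = ∑' k : Fin N → ℤ, if S.Res i.flip.2 k then x (i.1, k) * y (i.1, i.flip.2 - k) else 0 := by
    rw [Complex.conj_tsum, ← (Equiv.neg (Fin N → ℤ)).tsum_eq]
    refine tsum_congr fun k => ?_
    have hiff : S.Res i.2 (-k) ↔ S.Res i.flip.2 k :=
      ⟨fun h => by simpa [Idx.flip] using h.neg S, fun h => by simpa [Idx.flip] using h.neg S⟩
    rw [Equiv.neg_apply]
    by_cases h : S.Res i.flip.2 k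
    · rw [if_pos (hiff.2 h), if_pos h, map_mul]
      congr 1
      · rw [← hx]; simp [Idx.flip]
      · rw [← hy]; simp only [Idx.flip]; congr 2; abel
    · rw [if_neg (fun h' => h (hiff.1 h')), if_neg h, map_zero]
  rw [burgers, burgers, map_mul, map_mul, h1, Complex.conj_I, Complex.conj_ofReal]
  simp only [Idx.flip, lam_neg]
  push_cast
  ring

lemma sum_couple_flip (U : State N) {x : Idx N → ℂ} (hx : IsReal x) {R : ℝ} {i : Idx N}
    (hi : i.2 ≠ 0) :
    ∑ j ∈ S.ball R, S.couple U i.flip j * x j = conj (∑ j ∈ S.ball R, S.couple U i j * x j) := by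
  rw [map_sum]
  refine Finset.sum_nbij' Idx.flip Idx.flip (fun j hj => S.flip_mem_ball.2 hj)
    (fun j hj => S.flip_mem_ball.2 hj) (fun j _ => j.flip_flip) (fun j _ => j.flip_flip) ?_
  intro j hj
  have hj2 : j.flip.2 ≠ 0 := ((S.mem_ball).1 (S.flip_mem_ball.2 hj)).1
  have := S.couple_neg U (γ := i.1) (α := j.flip.1) hi hj2
  rw [map_mul, ← this, ← hx, Idx.flip_flip]
  simp [Idx.flip]

/-- Since the coupling preserves |m|, the series is a finite sum inside any ball that contains the
output. Frequency truncation thus leaves the two-wave term intact. -/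
lemma tsum_couple_eq (U : State N) (x : Idx N → ℂ) {R : ℝ} {i : Idx N} (hi : S.wabs i.2 ≤ R) :
    ∑' j, S.couple U i j * x j = ∑ j ∈ S.ball R, S.couple U i j * x j := by
  refine tsum_eq_sum fun j hj => ?_
  by_contra h
  have h0 : S.couple U i j ≠ 0 := fun h0 => h (by rw [h0, zero_mul])
  exact hj (S.mem_ball.2 ⟨(S.couple_ne_zero h0).1, (S.couple_wabs h0).trans_le hi⟩)

end Setting

/-! ### Solving the frequency-truncated system -/

/-- Global existence for a bounded, uniformly Lipschitz time-dependent vector field. -/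
lemma exists_hasDerivWithinAt_of_bounded {E : Type*} [NormedAddCommGroup E] [NormedSpace ℝ E]
    [CompleteSpace E] (f : ℝ → E → E) {T : ℝ} (hT : 0 ≤ T) (K L : NNReal)
    (hlip : ∀ t ∈ Icc 0 T, LipschitzWith K (f t))
    (hcont : ∀ y, ContinuousOn (fun t => f t y) (Icc 0 T))
    (hbd : ∀ t ∈ Icc 0 T, ∀ y, ‖f t y‖ ≤ L) (y₀ : E) :
    ∃ y : ℝ → E, y 0 = y₀ ∧ ∀ t ∈ Icc 0 T, HasDerivWithinAt y (f t (y t)) (Icc 0 T) t := by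
  -- A path of speed at most L cannot leave the ball of radius LT within time T, so a single
  -- Picard–Lindelöf step covers the whole interval.
  have hPL : IsPicardLindelof f (⟨0, left_mem_Icc.2 hT⟩ : Icc (0 : ℝ) T) y₀ (L * T.toNNReal) 0 L K :=
    { lipschitzOnWith := fun t ht => (hlip t ht).lipschitzOnWith
      continuousOn := fun y _ => hcont y
      norm_le := fun t ht y _ => hbd t ht y
      mul_max_le := by
        simp [Real.coe_toNNReal _ hT, hT] }
  obtain ⟨y, h0, hy⟩ := hPL.exists_eq_forall_mem_Icc_hasDerivWithinAt₀
  exact ⟨y, h0, hy⟩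

namespace Setting

variable {N : ℕ} (S : Setting N)

lemma continuousOn_couple {U : ℝ → State N} {I : Set ℝ}
    (hU : ∀ n, ContinuousOn (fun t => (U t).hat n) I) (i j : Idx N) :
    ContinuousOn (fun t => S.couple (U t) i j) I := by
  simp only [couple]
  split_ifs
  · have : Continuous fun X : Mode N => 2 * ((S.vol : ℂ) *
        S.pairing (S.quad (i.2 - j.2) X j.2 (S.eigvec j.1 j.2)) (S.eigvec i.1 i.2)) := by
      simp only [pairing, quad, preQ, dot, Prod.smul_fst, Prod.smul_snd, Pi.smul_apply,
        Prod.fst_add, Prod.snd_add, Pi.add_apply]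
      fun_prop
    exact this.comp_continuousOn (hU (i.2 - j.2))
  · exact continuousOn_const

open Classical in
/-- Extension by zero of a finite family of coordinates. -/
def extend {A : Finset (Idx N)} (y : A → ℂ) (i : Idx N) : ℂ :=
  if h : i ∈ A then y ⟨i, h⟩ else 0

lemma extend_of_mem {A : Finset (Idx N)} (y : A → ℂ) {i : Idx N} (h : i ∈ A) :
    extend y i = y ⟨i, h⟩ := dif_pos h

lemma extend_of_notMem {A : Finset (Idx N)} (y : A → ℂ) {i : Idx N} (h : i ∉ A) :
    extend y i = 0 := dif_neg h

lemma contDiff_extend {A : Finset (Idx N)} (i : Idx N) :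
    ContDiff ℝ 1 fun y : A → ℂ => extend y i := by
  by_cases h : i ∈ A
  · simp only [extend_of_mem _ h]
    fun_prop
  · simp only [extend_of_notMem _ h]
    fun_prop

lemma contDiff_burgers {A : Finset (Idx N)} (i : Idx N) :
    ContDiff ℝ 1 fun y : A → ℂ => S.burgers (extend y) (extend y) i := by
  classical
  have : ∀ y : A → ℂ, S.burgers (extend y) (extend y) i =
      Complex.I * ((S.gam * (((i.1 : ℤ) : ℝ) * S.lam i.2) : ℝ) : ℂ) * ∑ k ∈ A.image Prod.snd,
        if S.Res i.2 k then extend y (i.1, k) * extend y (i.1, i.2 - k) else 0 := by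
    intro y
    rw [burgers, tsum_eq_sum (s := A.image Prod.snd)]
    intro k hk
    split_ifs
    · have : ((i.1, k) : Idx N) ∉ A := fun h3 => hk (Finset.mem_image_of_mem Prod.snd h3)
      rw [extend_of_notMem y this, zero_mul]
    · rfl
  simp only [this]
  refine contDiff_const.mul (ContDiff.sum fun k _ => ?_)
  split_ifs
  · exact (contDiff_extend _).mul (contDiff_extend _)
  · exact contDiff_const

/-- The truncated vector field without the two-wave interactions. -/
def selfField (A : Finset (Idx N)) (μ : ℝ) (y : A → ℂ) (i : A) : ℂ :=
  -S.burgers (extend y) (extend y) i - ((μ * S.wabs i.1.2 ^ 2 : ℝ) : ℂ) * y i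

lemma contDiff_selfField (A : Finset (Idx N)) (μ : ℝ) : ContDiff ℝ 1 (S.selfField A μ) := by
  rw [contDiff_pi]
  intro i
  unfold selfField
  exact (S.contDiff_burgers i.1).neg.sub (contDiff_const.mul (contDiff_apply ℝ ℂ i))

/-- The linear part of the truncated vector field. -/
def coupleField {A : Finset (Idx N)} (U : State N) (y : A → ℂ) (i : A) : ℂ :=
  -∑ j : A, S.couple U i j * y j

lemma continuousOn_coupleField {A : Finset (Idx N)} {U : ℝ → State N} {I : Set ℝ}
    (hU : ∀ n, ContinuousOn (fun t => (U t).hat n) I) (y : A → ℂ) :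
    ContinuousOn (fun t => S.coupleField (U t) y) I := by
  rw [continuousOn_pi]
  intro i
  simp only [coupleField]
  refine ContinuousOn.neg (continuousOn_finsetSum _ fun j _ => ?_)
  exact (S.continuousOn_couple hU i j).mul continuousOn_const

/-- The real part of a family of acoustic coordinates. -/
def realify {R : ℝ} (y : S.ball R → ℂ) (i : S.ball R) : ℂ :=
  (1 / 2 : ℂ) * (y i + conj (y ⟨i.1.flip, S.flip_mem_ball.2 i.2⟩))

lemma realify_isReal {R : ℝ} (y : S.ball R → ℂ) : IsReal (extend (S.realify y)) := by
  intro i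
  by_cases h : i ∈ S.ball R
  · rw [extend_of_mem _ h, extend_of_mem _ (S.flip_mem_ball.2 h), realify, realify]
    simp only [Idx.flip_flip, map_mul, map_add, Complex.conj_conj, map_div₀, map_one, map_ofNat]
    ring
  · rw [extend_of_notMem _ h, extend_of_notMem _ (fun h' => h (S.flip_mem_ball.1 h')), map_zero]

lemma realify_lipschitz {R : ℝ} : LipschitzWith 1 (S.realify : (S.ball R → ℂ) → S.ball R → ℂ) := by
  apply LipschitzWith.of_dist_le_mul
  intro y z
  rw [NNReal.coe_one, one_mul, dist_pi_le_iff dist_nonneg]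
  intro i
  have h1 := dist_le_pi_dist y z i
  have h2 := dist_le_pi_dist y z ⟨i.1.flip, S.flip_mem_ball.2 i.2⟩
  rw [dist_eq_norm] at h1 h2 ⊢
  have e : S.realify y i - S.realify z i = (1 / 2 : ℂ) * ((y i - z i)
      + conj (y ⟨i.1.flip, S.flip_mem_ball.2 i.2⟩ - z ⟨i.1.flip, S.flip_mem_ball.2 i.2⟩)) := by
    rw [realify, realify, map_sub]; ring
  rw [e, norm_mul]
  have h3 := norm_add_le (y i - z i)
    (conj (y ⟨i.1.flip, S.flip_mem_ball.2 i.2⟩ - z ⟨i.1.flip, S.flip_mem_ball.2 i.2⟩))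
  rw [RCLike.norm_conj] at h3
  have h4 : ‖(1 / 2 : ℂ)‖ = 1 / 2 := by simp
  rw [h4]
  linarith

/-- The truncated field is quadratic, hence only locally Lipschitz, and its energy law needs real
data. A bump function and the composition with `realify` make it bounded and globally Lipschitz;
`exists_galerkin` then shows that both modifications are invisible along the solution. -/
lemma exists_cutoff_solution {U : ℝ → State N}
    (hUc : ∀ n, ContinuousOn (fun t => (U t).hat n) (Ici 0)) (μ : ℝ) (R : ℝ) {T : ℝ}
    (hT : 0 ≤ T) (M : ℝ) (hM : 0 < M) (y₀ : S.ball R → ℂ) :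
    ∃ (ψ : (S.ball R → ℂ) → ℝ), (∀ y, 0 ≤ ψ y) ∧ (∀ y, ‖y‖ ≤ M → ψ y = 1) ∧
    ∃ y : ℝ → S.ball R → ℂ, y 0 = y₀ ∧ ∀ t ∈ Icc 0 T, HasDerivWithinAt y
      (ψ (S.realify (y t)) • (S.coupleField (U t) (S.realify (y t))
        + S.selfField (S.ball R) μ (S.realify (y t)))) (Icc 0 T) t := by
  let ψ : ContDiffBump (0 : S.ball R → ℂ) := ⟨M, M + 1, hM, by linarith⟩
  refine ⟨ψ, fun y => ψ.nonneg, fun y hy => ψ.one_of_mem_closedBall (by simpa using hy), ?_⟩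
  have hψ : ContDiff ℝ 1 ψ := ψ.contDiff
  have hcs : HasCompactSupport ψ := ψ.hasCompactSupport
  set g₁ : (S.ball R → ℂ) → S.ball R → ℂ := fun y => ψ y • y with hg₁
  set g₂ : (S.ball R → ℂ) → S.ball R → ℂ := fun y => ψ y • S.selfField (S.ball R) μ y with hg₂
  have hg₁d : ContDiff ℝ 1 g₁ := hψ.smul contDiff_id
  have hg₂d : ContDiff ℝ 1 g₂ := hψ.smul (S.contDiff_selfField _ μ)
  have hg₁s : HasCompactSupport g₁ := hcs.smul_right
  have hg₂s : HasCompactSupport g₂ := hcs.smul_right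
  obtain ⟨K₁, hK₁⟩ := hg₁d.lipschitzWith_of_hasCompactSupport hg₁s one_ne_zero
  obtain ⟨K₂, hK₂⟩ := hg₂d.lipschitzWith_of_hasCompactSupport hg₂s one_ne_zero
  obtain ⟨M₁, hM₁⟩ := hg₁d.continuous.bounded_above_of_compact_support hg₁s
  obtain ⟨M₂, hM₂⟩ := hg₂d.continuous.bounded_above_of_compact_support hg₂s
  have hM₁0 : 0 ≤ M₁ := (norm_nonneg _).trans (hM₁ 0)
  have hM₂0 : 0 ≤ M₂ := (norm_nonneg _).trans (hM₂ 0)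
  have hbc : ContinuousOn (fun t => ∑ i : S.ball R, ∑ j : S.ball R, ‖S.couple (U t) i j‖) (Icc 0 T) :=
    continuousOn_finsetSum _ fun i _ => continuousOn_finsetSum _ fun j _ =>
      ((S.continuousOn_couple hUc i j).mono Icc_subset_Ici_self).norm
  obtain ⟨b, hb⟩ := isCompact_Icc.exists_bound_of_continuousOn hbc
  have hb0 : 0 ≤ b := (norm_nonneg _).trans (hb 0 (left_mem_Icc.2 hT))
  have hlin : ∀ t ∈ Icc 0 T, ∀ y : S.ball R → ℂ, ‖S.coupleField (U t) y‖ ≤ b * ‖y‖ := by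
    intro t ht y
    rw [pi_norm_le_iff_of_nonneg (by positivity)]
    intro i
    have h1 : ‖S.coupleField (U t) y i‖ ≤ (∑ j : S.ball R, ‖S.couple (U t) i j‖) * ‖y‖ := by
      rw [coupleField, norm_neg, Finset.sum_mul]
      refine (norm_sum_le _ _).trans (Finset.sum_le_sum fun j _ => ?_)
      rw [norm_mul]
      gcongr
      exact norm_le_pi_norm y j
    refine h1.trans ?_
    gcongr
    have h2 := hb t ht
    rw [Real.norm_of_nonneg (by positivity)] at h2
    refine le_trans ?_ h2
    exact Finset.single_le_sum (f := fun i : S.ball R => ∑ j : S.ball R, ‖S.couple (U t) i j‖)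
      (fun i _ => by positivity) (Finset.mem_univ i)
  have hsub : ∀ t, ∀ y z : S.ball R → ℂ,
      S.coupleField (U t) y - S.coupleField (U t) z = S.coupleField (U t) (y - z) := by
    intro t y z
    ext i
    simp only [coupleField, Pi.sub_apply, mul_sub, Finset.sum_sub_distrib]
    ring
  have hsmul : ∀ t, ∀ (r : ℝ) (y : S.ball R → ℂ),
      S.coupleField (U t) (r • y) = r • S.coupleField (U t) y := by
    intro t r y
    ext i
    simp only [coupleField, Pi.smul_apply, Complex.real_smul, Finset.mul_sum, mul_neg]
    congr 1
    exact Finset.sum_congr rfl fun j _ => by ring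
  -- By linearity of the coupling the cut-off can be moved onto its argument. The compactly
  -- supported maps `g₁` and `g₂` do not depend on time, so one Lipschitz constant serves all times.
  have heq : ∀ t y, ψ y • (S.coupleField (U t) y + S.selfField (S.ball R) μ y)
      = S.coupleField (U t) (g₁ y) + g₂ y := by
    intro t y
    rw [smul_add, hg₁, hg₂]
    simp only [hsmul]
  simp only [heq]
  have hlipt : ∀ t ∈ Icc 0 T, LipschitzWith ⟨b, hb0⟩ (S.coupleField (A := S.ball R) (U t)) := by
    intro t ht
    apply LipschitzWith.of_dist_le_mul
    intro y z
    rw [dist_eq_norm, dist_eq_norm, hsub]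
    exact hlin t ht _
  refine exists_hasDerivWithinAt_of_bounded
    (fun t y => S.coupleField (U t) (g₁ (S.realify y)) + g₂ (S.realify y)) hT
    ((⟨b, hb0⟩ * K₁ + K₂) * 1) ⟨b * M₁ + M₂, by positivity⟩ ?_ ?_ ?_ y₀
  · intro t ht
    exact (((hlipt t ht).comp hK₁).add hK₂).comp S.realify_lipschitz
  · intro y
    refine ContinuousOn.add ?_ continuousOn_const
    exact (S.continuousOn_coupleField hUc _).mono Icc_subset_Ici_self
  · intro t ht y
    refine (norm_add_le _ _).trans ?_
    refine add_le_add ((hlin t ht _).trans ?_) (hM₂ _)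
    exact mul_le_mul_of_nonneg_left (hM₁ _) hb0

end Setting

/-- Only the majorant φ has to be integrable, not g'. The uniqueness argument needs this, since it
controls the derivative of a truncated energy by a function that is merely integrable in time. -/
lemma sub_le_integral_of_hasDerivWithinAt_Icc {g g' φ : ℝ → ℝ} {T : ℝ}
    (hd : ∀ t ∈ Icc 0 T, HasDerivWithinAt g (g' t) (Icc 0 T) t)
    (hφ : IntegrableOn φ (Icc 0 T)) (hle : ∀ t ∈ Icc 0 T, g' t ≤ φ t) {t : ℝ} (ht : t ∈ Icc 0 T) :
    g t - g 0 ≤ ∫ r in (0 : ℝ)..t, φ r := by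
  have hsub : Icc 0 t ⊆ Icc 0 T := Icc_subset_Icc_right ht.2
  refine intervalIntegral.sub_le_integral_of_hasDeriv_right_of_le (g' := g') ht.1
    (fun r hr => ((hd r (hsub hr)).continuousWithinAt).mono hsub) (fun r hr => ?_)
    (hφ.mono_set hsub) (fun r hr => hle r (hsub (Ioo_subset_Icc_self hr)))
  have hr' : r ∈ Icc 0 T := hsub (Ioo_subset_Icc_self hr)
  refine ((hd r hr').hasDerivAt (Icc_mem_nhds hr.1 (hr.2.trans_le ht.2))).hasDerivWithinAt

lemma hasDerivWithinAt_norm_sq {x : ℝ → ℂ} {x' : ℂ} {I : Set ℝ} {t : ℝ}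
    (h : HasDerivWithinAt x x' I t) :
    HasDerivWithinAt (fun t => ‖x t‖ ^ 2) (2 * (conj (x t) * x').re) I t := by
  have := h.norm_sq
  rwa [Complex.inner, mul_comm (x' : ℂ)] at this

namespace Setting

variable {N : ℕ} (S : Setting N)

/-- The right-hand side of the truncated system in acoustic coordinates. -/
def truncRhs (U : State N) (μ R : ℝ) (x : Idx N → ℂ) (i : Idx N) : ℂ :=
  -(∑ j ∈ S.ball R, S.couple U i j * x j) - S.burgers x x i - ((μ * S.wabs i.2 ^ 2 : ℝ) : ℂ) * x i

/-- Solutions of the system truncated to frequencies of size at most `R`. -/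
structure Galerkin (U : ℝ → State N) (μ R T : ℝ) (x : ℝ → Idx N → ℂ) : Prop where
  supp : ∀ t, ∀ i, i ∉ S.ball R → x t i = 0
  real : ∀ t ∈ Icc 0 T, IsReal (x t)
  deriv : ∀ i ∈ S.ball R, ∀ t ∈ Icc 0 T,
    HasDerivWithinAt (fun t => x t i) (S.truncRhs (U t) μ R (x t) i) (Icc 0 T) t

/-- The two-wave term has no real part against any weight that depends on |m|, so only viscosity and
the three-wave term remain. The weight 1 gives the energy, and the squared dyadic symbol gives the
energy of a block. -/
lemma weighted_energy_rhs {U : State N} (hU : U ∈ S.nullA) (μ R : ℝ) (w : ℝ → ℝ) (x : Idx N → ℂ) :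
    ∑ i ∈ S.ball R, w (S.wabs i.2) * (2 * (conj (x i) * S.truncRhs U μ R x i).re)
      = -2 * μ * (∑ i ∈ S.ball R, w (S.wabs i.2) * (S.wabs i.2 ^ 2 * ‖x i‖ ^ 2))
        - 2 * ∑ i ∈ S.ball R, w (S.wabs i.2) * (conj (x i) * S.burgers x x i).re := by
  have h := S.re_sum_couple_eq_zero hU (A := S.ball R) (fun i hi => (S.mem_ball.1 hi).1) w x
  rw [Complex.re_sum] at h
  have h1 : ∀ i ∈ S.ball R, w (S.wabs i.2) * (2 * (conj (x i) * S.truncRhs U μ R x i).re)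
      = -2 * (w (S.wabs i.2) * (conj (x i) * ∑ j ∈ S.ball R, S.couple U i j * x j)).re
        + -2 * μ * (w (S.wabs i.2) * (S.wabs i.2 ^ 2 * ‖x i‖ ^ 2))
        - 2 * (w (S.wabs i.2) * (conj (x i) * S.burgers x x i).re) := by
    intro i _
    have e : conj (x i) * S.truncRhs U μ R x i
        = -(conj (x i) * ∑ j ∈ S.ball R, S.couple U i j * x j)
          - conj (x i) * S.burgers x x i - ((μ * S.wabs i.2 ^ 2 * ‖x i‖ ^ 2 : ℝ) : ℂ) := by
      have := Complex.conj_mul' (x i)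
      rw [truncRhs]
      push_cast
      linear_combination -((μ : ℂ) * (S.wabs i.2 : ℂ) ^ 2) * this
    rw [e, Complex.sub_re, Complex.sub_re, Complex.neg_re, Complex.ofReal_re, Complex.re_ofReal_mul]
    ring
  rw [Finset.sum_congr rfl h1, Finset.sum_sub_distrib, Finset.sum_add_distrib, ← Finset.mul_sum,
    ← Finset.mul_sum, ← Finset.mul_sum, h]
  ring

lemma Galerkin.hasDerivWithinAt_weighted {S : Setting N} {U : ℝ → State N} {μ R T : ℝ}
    {x : ℝ → Idx N → ℂ}
    (hx : S.Galerkin U μ R T x) (hU : ∀ t, 0 ≤ t → U t ∈ S.nullA) (w : ℝ → ℝ) {t : ℝ}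
    (ht : t ∈ Icc 0 T) :
    HasDerivWithinAt (fun t => ∑ i ∈ S.ball R, w (S.wabs i.2) * ‖x t i‖ ^ 2)
      (-2 * μ * (∑ i ∈ S.ball R, w (S.wabs i.2) * (S.wabs i.2 ^ 2 * ‖x t i‖ ^ 2))
        - 2 * ∑ i ∈ S.ball R, w (S.wabs i.2) * (conj (x t i) * S.burgers (x t) (x t) i).re)
      (Icc 0 T) t := by
  rw [← S.weighted_energy_rhs (hU t ht.1)]
  exact HasDerivWithinAt.fun_sum fun i hi =>
    (hasDerivWithinAt_norm_sq (hx.deriv i hi t ht)).const_mul _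

lemma truncRhs_flip (U : State N) (μ R : ℝ) {x : Idx N → ℂ} (hx : IsReal x) {i : Idx N}
    (hi : i.2 ≠ 0) : S.truncRhs U μ R x i.flip = conj (S.truncRhs U μ R x i) := by
  rw [truncRhs, truncRhs, S.sum_couple_flip U hx hi, S.burgers_flip hx hx, hx]
  simp only [map_sub, map_neg, map_mul, Complex.conj_ofReal]
  simp [Idx.flip]

lemma field_eq_truncRhs (U : State N) (μ R : ℝ) (y : S.ball R → ℂ) (i : S.ball R) :
    (S.coupleField U y + S.selfField (S.ball R) μ y) i = S.truncRhs U μ R (extend y) i := by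
  rw [Pi.add_apply, coupleField, selfField, truncRhs, extend_of_mem y i.2,
    ← Finset.sum_coe_sort (S.ball R)]
  simp only [extend_of_mem y (Subtype.coe_prop _)]
  ring

/-- The solution of the cut-off system stays real. For real data its energy is nonincreasing,
because the cut-off only multiplies the energy derivative by a nonnegative factor. Hence it remains
in the ball of radius `M`, where the cut-off equals 1. -/
lemma exists_galerkin {U : ℝ → State N} (hU : ∀ t, 0 ≤ t → U t ∈ S.nullA)
    (hUc : ∀ n, ContinuousOn (fun t => (U t).hat n) (Ici 0)) {μ : ℝ} (hμ : 0 ≤ μ) (R : ℝ) {T : ℝ}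
    (hT : 0 ≤ T) {x₀ : Idx N → ℂ} (hx₀ : IsReal x₀) :
    ∃ x : ℝ → Idx N → ℂ, S.Galerkin U μ R T x ∧ ∀ i ∈ S.ball R, x 0 i = x₀ i := by
  set M : ℝ := √(∑ i ∈ S.ball R, ‖x₀ i‖ ^ 2) + 1 with hM
  have hM0 : 0 < M := by positivity
  obtain ⟨ψ, hψ0, hψ1, y, hy0, hy⟩ := S.exists_cutoff_solution hUc μ R hT M hM0 fun i => x₀ i
  have hyi : ∀ (i : S.ball R), ∀ t ∈ Icc 0 T, HasDerivWithinAt (fun t => y t i)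
      (ψ (S.realify (y t)) * S.truncRhs (U t) μ R (extend (S.realify (y t))) i) (Icc 0 T) t := by
    intro i t ht
    have := hasDerivWithinAt_pi.1 (hy t ht) i
    rw [Pi.smul_apply, field_eq_truncRhs, Complex.real_smul] at this
    exact this
  -- The field is evaluated at `realify (y t)`, so it respects the reality symmetry whatever y is.
  -- The defect of reality then has zero derivative and vanishes initially.
  have hflip : ∀ t ∈ Icc 0 T, ∀ i : S.ball R,
      conj (y t ⟨i.1.flip, S.flip_mem_ball.2 i.2⟩) = y t i := by
    intro t ht i
    set i' : S.ball R := ⟨i.1.flip, S.flip_mem_ball.2 i.2⟩ with hi'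
    have hd : ∀ t ∈ Icc 0 T, HasDerivWithinAt (fun t => conj (y t i') - y t i) 0 (Icc 0 T) t := by
      intro t ht
      have h1 := hyi i' t ht
      have h2 := hyi i t ht
      have h3 : HasDerivWithinAt (fun t => conj (y t i')) _ (Icc 0 T) t :=
        (Complex.conjCLE.toContinuousLinearMap.hasFDerivAt.comp_hasDerivWithinAt t h1)
      have h4 := h3.sub h2
      convert! h4 using 1
      have h5 : S.truncRhs (U t) μ R (extend (S.realify (y t))) i'
          = conj (S.truncRhs (U t) μ R (extend (S.realify (y t))) i) :=
        S.truncRhs_flip (U t) μ R (S.realify_isReal (y t)) (S.mem_ball.1 i.2).1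
      rw [h5]
      simp
    have hconst := constant_of_has_deriv_right_zero (f := fun t => conj (y t i') - y t i)
      (a := 0) (b := T) (fun r hr => (hd r hr).continuousWithinAt) (fun r hr =>
        ((hd r (Ico_subset_Icc_self hr)).mono_of_mem_nhdsWithin (Icc_mem_nhdsGE_of_mem hr)))
    have h6 := hconst t ht
    simp only [hy0, hi', hx₀ i.1, Complex.conj_conj, sub_self] at h6
    exact sub_eq_zero.1 h6
  have hreal : ∀ t ∈ Icc 0 T, S.realify (y t) = y t := by
    intro t ht
    ext i
    rw [realify, hflip t ht i]
    ring
  have hen : ∀ t ∈ Icc 0 T, HasDerivWithinAt (fun t => ∑ i : S.ball R, ‖y t i‖ ^ 2)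
      (∑ i : S.ball R, 2 * (conj (y t i) *
        (ψ (S.realify (y t)) * S.truncRhs (U t) μ R (extend (S.realify (y t))) i)).re)
      (Icc 0 T) t := fun t ht =>
    HasDerivWithinAt.fun_sum fun i _ => hasDerivWithinAt_norm_sq (hyi i t ht)
  have hle : ∀ t ∈ Icc 0 T, (∑ i : S.ball R, 2 * (conj (y t i) *
      (ψ (S.realify (y t)) * S.truncRhs (U t) μ R (extend (S.realify (y t))) i)).re) ≤ 0 := by
    intro t ht
    have hr := S.realify_isReal (y t)
    rw [hreal t ht] at hr ⊢
    have e1 : (∑ i : S.ball R, 2 * (conj (y t i) *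
        (ψ (y t) * S.truncRhs (U t) μ R (extend (y t)) i)).re)
        = ψ (y t) * ∑ i ∈ S.ball R, (fun _ => (1 : ℝ)) (S.wabs i.2) * (2 *
          (conj (extend (y t) i) * S.truncRhs (U t) μ R (extend (y t)) i).re) := by
      rw [← Finset.sum_coe_sort (S.ball R), Finset.mul_sum]
      refine Finset.sum_congr rfl fun i _ => ?_
      rw [extend_of_mem _ i.2, mul_left_comm, Complex.re_ofReal_mul]
      ring
    rw [e1, S.weighted_energy_rhs (hU t ht.1) μ R (fun _ => 1) (extend (y t))]
    have e2 := congrArg Complex.re (S.sum_conj_mul_burgers_eq_zero (A := S.ball R) hr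
      (fun i hi => extend_of_notMem _ hi))
    rw [Complex.re_sum, Complex.zero_re] at e2
    simp only [one_mul, e2]
    have e3 : 0 ≤ ∑ i ∈ S.ball R, S.wabs i.2 ^ 2 * ‖extend (y t) i‖ ^ 2 :=
      Finset.sum_nonneg fun i _ => by positivity
    have e4 := mul_nonneg (hψ0 (y t)) (mul_nonneg hμ e3)
    linarith
  have hbound : ∀ t ∈ Icc 0 T, ‖y t‖ ≤ M := by
    intro t ht
    have h1 := sub_le_integral_of_hasDerivWithinAt_Icc hen (φ := fun _ => 0)
      integrableOn_zero hle ht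
    rw [intervalIntegral.integral_zero] at h1
    simp only [hy0] at h1
    rw [Finset.sum_coe_sort (S.ball R) (fun i => ‖x₀ i‖ ^ 2)] at h1
    rw [pi_norm_le_iff_of_nonneg hM0.le]
    intro i
    have h2 : ‖y t i‖ ^ 2 ≤ ∑ i : S.ball R, ‖y t i‖ ^ 2 :=
      Finset.single_le_sum (f := fun i : S.ball R => ‖y t i‖ ^ 2) (fun _ _ => sq_nonneg _)
        (Finset.mem_univ i)
    have h3 : ‖y t i‖ ≤ √(∑ i ∈ S.ball R, ‖x₀ i‖ ^ 2) := by
      apply Real.le_sqrt_of_sq_le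
      linarith
    linarith
  refine ⟨fun t => extend (y t), ⟨fun t i hi => extend_of_notMem _ hi, fun t ht => ?_,
    fun i hi t ht => ?_⟩, fun i hi => ?_⟩
  · have := S.realify_isReal (y t)
    rwa [hreal t ht] at this
  · simp only [extend_of_mem _ hi]
    have := hyi ⟨i, hi⟩ t ht
    rw [hreal t ht, hψ1 _ (hbound t ht), Complex.ofReal_one, one_mul] at this
    exact this
  · simp only [extend_of_mem _ hi, hy0]

end Setting

/-! ### Differential inequalities -/

lemma exists_primitive {k : ℝ → ℝ} {T : ℝ} (hT : 0 ≤ T) (hk : ContinuousOn k (Icc 0 T)) :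
    ∃ K : ℝ → ℝ, (∀ t ∈ Icc 0 T, K t = ∫ r in (0 : ℝ)..t, k r) ∧
      ∀ t ∈ Icc 0 T, HasDerivWithinAt K (k t) (Icc 0 T) t := by
  -- The continuous extension beyond the interval gives a two-sided derivative of the primitive at
  -- the endpoints as well.
  set k' : ℝ → ℝ := IccExtend hT ((Icc 0 T).domRestrict k) with hk'
  have hc : Continuous k' := (continuousOn_iff_continuous_domRestrict.1 hk).Icc_extend'
  have heq : ∀ t ∈ Icc 0 T, k' t = k t := fun t ht => by
    rw [hk', IccExtend_of_mem hT _ ht]; rfl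
  refine ⟨fun t => ∫ r in (0 : ℝ)..t, k' r, fun t ht => ?_, fun t ht => ?_⟩
  · refine intervalIntegral.integral_congr fun r hr => heq r ?_
    rw [uIcc_of_le ht.1] at hr
    exact ⟨hr.1, hr.2.trans ht.2⟩
  · rw [← heq t ht]
    exact (hc.integral_hasStrictDerivAt 0 t).hasDerivAt.hasDerivWithinAt

lemma le_mul_exp_integral {u u' k : ℝ → ℝ} {T : ℝ} (hk : ContinuousOn k (Icc 0 T))
    (hd : ∀ t ∈ Icc 0 T, HasDerivWithinAt u (u' t) (Icc 0 T) t)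
    (hle : ∀ t ∈ Icc 0 T, u' t ≤ k t * u t) {t : ℝ} (ht : t ∈ Icc 0 T) :
    u t ≤ u 0 * Real.exp (∫ r in (0 : ℝ)..t, k r) := by
  have hT : 0 ≤ T := ht.1.trans ht.2
  obtain ⟨K, hK, hKd⟩ := exists_primitive hT hk
  have h1 : ∀ t ∈ Icc 0 T, HasDerivWithinAt (fun t => u t * Real.exp (-K t))
      (u' t * Real.exp (-K t) + u t * (Real.exp (-K t) * -k t)) (Icc 0 T) t := fun t ht =>
    (hd t ht).mul (hKd t ht).neg.exp
  have h2 := sub_le_integral_of_hasDerivWithinAt_Icc h1 (φ := fun _ => 0) integrableOn_zero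
    (fun t ht => by
      have := mul_le_mul_of_nonneg_right (hle t ht) (Real.exp_pos (-K t)).le
      linarith) ht
  rw [intervalIntegral.integral_zero, hK 0 (left_mem_Icc.2 hT), intervalIntegral.integral_same,
    neg_zero, Real.exp_zero, mul_one, sub_nonpos, Real.exp_neg, ← div_eq_mul_inv,
    div_le_iff₀ (Real.exp_pos _)] at h2
  rwa [← hK t ht]

/-- The conclusion bounds the majorant A + ∫ k y and not only y. In the Besov estimate this majorant
also controls the dissipation integral and the forcing integral. -/
lemma integral_gronwall {y k : ℝ → ℝ} {T A : ℝ} (hy : ContinuousOn y (Icc 0 T))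
    (hk : ContinuousOn k (Icc 0 T)) (hk0 : ∀ t ∈ Icc 0 T, 0 ≤ k t)
    (hle : ∀ t ∈ Icc 0 T, y t ≤ A + ∫ r in (0 : ℝ)..t, k r * y r) {t : ℝ} (ht : t ∈ Icc 0 T) :
    A + ∫ r in (0 : ℝ)..t, k r * y r ≤ A * Real.exp (∫ r in (0 : ℝ)..t, k r) := by
  have hT : 0 ≤ T := ht.1.trans ht.2
  obtain ⟨K, hK, hKd⟩ := exists_primitive hT (hk.mul hy)
  have h1 := le_mul_exp_integral (u := fun t => A + K t) hk
    (fun t ht => (hKd t ht).const_add A) (fun t ht => by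
      refine mul_le_mul_of_nonneg_left ?_ (hk0 t ht)
      rw [hK t ht]
      exact hle t ht) ht
  simp only [hK t ht, hK 0 (left_mem_Icc.2 hT), intervalIntegral.integral_same, add_zero] at h1
  exact h1

/-- Formally one divides the inequality for n² by 2n. Since n may vanish, the proof works with √(n²
+ ε²), which costs ε(1 + at), and lets ε tend to zero. -/
lemma sqrt_energy_le {n E' F : ℝ → ℝ} {T a : ℝ} (ha : 0 ≤ a) (hn0 : ∀ t ∈ Icc 0 T, 0 ≤ n t)
    (hn : ContinuousOn n (Icc 0 T)) (hF : ContinuousOn F (Icc 0 T)) (hF0 : ∀ t ∈ Icc 0 T, 0 ≤ F t)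
    (hd : ∀ t ∈ Icc 0 T, HasDerivWithinAt (fun t => n t ^ 2) (E' t) (Icc 0 T) t)
    (hle : ∀ t ∈ Icc 0 T, E' t ≤ -2 * a * n t ^ 2 + 2 * n t * F t) {t : ℝ} (ht : t ∈ Icc 0 T) :
    n t + a * ∫ r in (0 : ℝ)..t, n r ≤ n 0 + ∫ r in (0 : ℝ)..t, F r := by
  have hT : 0 ≤ T := ht.1.trans ht.2
  have hsub : Icc 0 t ⊆ Icc 0 T := Icc_subset_Icc_right ht.2
  have hni : IntervalIntegrable n volume 0 t := (hn.mono hsub).intervalIntegrable_of_Icc ht.1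
  have hFi : IntervalIntegrable F volume 0 t := (hF.mono hsub).intervalIntegrable_of_Icc ht.1
  have key : ∀ ε : ℝ, 0 < ε → n t + a * ∫ r in (0 : ℝ)..t, n r
      ≤ n 0 + (∫ r in (0 : ℝ)..t, F r) + ε * (1 + a * t) := by
    intro ε hε
    have hpos : ∀ t, 0 < n t ^ 2 + ε ^ 2 := fun t => by positivity
    have h1 : ∀ t ∈ Icc 0 T, HasDerivWithinAt (fun t => √(n t ^ 2 + ε ^ 2))
        (E' t / (2 * √(n t ^ 2 + ε ^ 2))) (Icc 0 T) t := fun t ht =>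
      ((hd t ht).add_const _).sqrt (hpos t).ne'
    have h2 := sub_le_integral_of_hasDerivWithinAt_Icc h1
      (φ := fun t => -a * n t + a * ε + F t)
      (((hn.const_mul (-a)).add continuousOn_const).add hF |>.integrableOn_Icc) (fun t ht => by
        have hs := Real.sqrt_pos.2 (hpos t)
        have hs2 := Real.sq_sqrt (hpos t).le
        set s := √(n t ^ 2 + ε ^ 2)
        have hns : n t ≤ s := Real.le_sqrt_of_sq_le (by nlinarith)
        have hεs : ε ≤ s := Real.le_sqrt_of_sq_le (by nlinarith [hn0 t ht])
        rw [div_le_iff₀ (by positivity)]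
        refine (hle t ht).trans ?_
        have hn' := hn0 t ht
        have hF' := hF0 t ht
        have e1 : n t * F t ≤ s * F t := by gcongr
        have e2 : (n t - ε) * s ≤ n t ^ 2 := by nlinarith
        nlinarith) ht
    rw [intervalIntegral.integral_add ((hni.const_mul _).add intervalIntegrable_const) hFi,
      intervalIntegral.integral_add (hni.const_mul _) intervalIntegrable_const,
      intervalIntegral.integral_const_mul, intervalIntegral.integral_const] at h2
    have h3 : n t ≤ √(n t ^ 2 + ε ^ 2) := Real.le_sqrt_of_sq_le (by nlinarith)
    have h4 : √(n 0 ^ 2 + ε ^ 2) ≤ n 0 + ε := by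
      rw [Real.sqrt_le_left (by have := hn0 0 (left_mem_Icc.2 hT); positivity)]
      nlinarith [hn0 0 (left_mem_Icc.2 hT)]
    rw [smul_eq_mul] at h2
    linarith
  refine le_of_forall_pos_le_add fun δ hδ => ?_
  have hat : 0 ≤ a * t := mul_nonneg ha ht.1
  have := key (δ / (1 + a * t)) (by positivity)
  rwa [div_mul_cancel₀ _ (by positivity)] at this

namespace Setting

variable {N : ℕ} (S : Setting N)

/-! ### Energy estimates for the truncated system -/

/-- The energy of the coordinates with frequency at most `R`. -/
def en (R : ℝ) (x : Idx N → ℂ) : ℝ := ∑ i ∈ S.ball R, ‖x i‖ ^ 2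

/-- The gradient energy of the coordinates with frequency at most `R`. -/
def gr (R : ℝ) (x : Idx N → ℂ) : ℝ := ∑ i ∈ S.ball R, S.wabs i.2 ^ 2 * ‖x i‖ ^ 2

lemma en_nonneg (R : ℝ) (x : Idx N → ℂ) : 0 ≤ S.en R x := Finset.sum_nonneg fun _ _ => by positivity

lemma gr_nonneg (R : ℝ) (x : Idx N → ℂ) : 0 ≤ S.gr R x := Finset.sum_nonneg fun _ _ => by positivity

variable {S} {U : ℝ → State N} {μ R T : ℝ} {x : ℝ → Idx N → ℂ}

lemma Galerkin.continuousOn (hx : S.Galerkin U μ R T x) (i : Idx N) :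
    ContinuousOn (fun t => x t i) (Icc 0 T) := by
  by_cases hi : i ∈ S.ball R
  · exact fun t ht => (hx.deriv i hi t ht).continuousWithinAt
  · simp only [hx.supp _ i hi]
    exact continuousOn_const

lemma Galerkin.continuousOn_weighted (hx : S.Galerkin U μ R T x) (w : Idx N → ℝ) (R' : ℝ) :
    ContinuousOn (fun t => ∑ i ∈ S.ball R', w i * ‖x t i‖ ^ 2) (Icc 0 T) :=
  continuousOn_finsetSum _ fun i _ => ((hx.continuousOn i).norm.pow 2).const_mul _

lemma Galerkin.continuousOn_gr (hx : S.Galerkin U μ R T x) (R' : ℝ) :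
    ContinuousOn (fun t => S.gr R' (x t)) (Icc 0 T) :=
  hx.continuousOn_weighted _ R'

lemma Galerkin.energy_le (hx : S.Galerkin U μ R T x) (hU : ∀ t, 0 ≤ t → U t ∈ S.nullA)
    {t : ℝ} (ht : t ∈ Icc 0 T) :
    S.en R (x t) + 2 * μ * ∫ r in (0 : ℝ)..t, S.gr R (x r) ≤ S.en R (x 0) := by
  have h1 : ∀ t ∈ Icc 0 T, HasDerivWithinAt (fun t => S.en R (x t))
      (-2 * μ * S.gr R (x t)) (Icc 0 T) t := by
    intro t ht
    have h := hx.hasDerivWithinAt_weighted hU (fun _ => 1) ht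
    have e2 := congrArg Complex.re (S.sum_conj_mul_burgers_eq_zero (A := S.ball R) (hx.real t ht)
      (hx.supp t))
    rw [Complex.re_sum, Complex.zero_re] at e2
    simp only [one_mul, e2, mul_zero, sub_zero] at h
    exact h
  have h2 := sub_le_integral_of_hasDerivWithinAt_Icc h1
    (((hx.continuousOn_gr R).const_mul (-2 * μ)).integrableOn_Icc) (fun t _ => le_rfl) ht
  rw [intervalIntegral.integral_const_mul] at h2
  linarith

end Setting

namespace Setting

variable {N : ℕ} (S : Setting N)

/-! ### Bounds for the three-wave interactions -/

/-- The derivative in the Burgers term is moved onto the test sequence w. What remains is a resonant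
convolution of an L² and an Ḣ¹ sequence, to which `exists_trilinear_le` applies with K a lower bound
for all nonzero wave numbers. -/
lemma exists_sum_mul_burgers_le : ∃ C : ℝ, 0 < C ∧ ∀ (w x y : Idx N → ℂ) (A : Finset (Idx N))
    (H W G : ℝ), 0 ≤ H → 0 ≤ W → 0 ≤ G → (∑ i ∈ A, S.wabs i.2 ^ 2 * ‖w i‖ ^ 2 ≤ H ^ 2) →
    (∀ s : Finset (Idx N), ∑ i ∈ s, ‖y i‖ ^ 2 ≤ W ^ 2) →
    (∀ s : Finset (Idx N), ∑ i ∈ s, S.wabs i.2 ^ 2 * ‖x i‖ ^ 2 ≤ G ^ 2) →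
    (Summable fun i => ‖x i‖ ^ 2) →
    ∑ i ∈ A, ‖w i‖ * ‖S.burgers x y i‖ ≤ C * H * W * G ∧
    ∑ i ∈ A, ‖w i‖ * ‖S.burgers y x i‖ ≤ C * H * W * G := by
  classical
  obtain ⟨C, hC, htri⟩ := S.exists_trilinear_le
  obtain ⟨K, hK, hKr⟩ := S.exists_wabs_ge
  refine ⟨(|S.gam| + 1) * (C * K ^ (-(1 / 4) : ℝ)), by positivity,
    fun w x y A H W G hH hW hG hw hy hx hxs => ?_⟩
  have hys : Summable fun i => ‖y i‖ ^ 2 := summable_of_sum_le (fun i => sq_nonneg _) hy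
  set h : Idx N → ℝ := fun i => if i ∈ A then S.wabs i.2 * ‖w i‖ else 0 with hh
  have hhb : ∀ s : Finset (Idx N), ∑ i ∈ s, h i ^ 2 ≤ H ^ 2 := by
    intro s
    refine le_trans ?_ hw
    have e : ∀ i, h i ^ 2 = if i ∈ A then S.wabs i.2 ^ 2 * ‖w i‖ ^ 2 else 0 := by
      intro i; simp only [hh]; split_ifs <;> ring
    simp only [e]
    rw [← Finset.sum_filter]
    refine Finset.sum_le_sum_of_subset_of_nonneg (fun i hi => (Finset.mem_filter.1 hi).2)
      fun i _ _ => by positivity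
  have key : ∑ i ∈ A, h i * S.conv (fun i => ‖y i‖) (fun i => ‖x i‖) i
      ≤ C * K ^ (-(1 / 4) : ℝ) * H * W * G :=
    S.sum_mul_conv_le hys hxs A fun P hP _ =>
      htri K hK h (fun i => ‖y i‖) (fun i => ‖x i‖) H W G hH hW hG hhb hy hx
        (fun i hi _ => hKr i.2 hi) P hP
  have e1 : ∀ (z z' : Idx N → ℂ), (∀ i, ‖S.burgers z z' i‖ ≤ |S.gam| *
      (S.wabs i.2 * S.conv (fun i => ‖y i‖) (fun i => ‖x i‖) i)) →
      ∑ i ∈ A, ‖w i‖ * ‖S.burgers z z' i‖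
        ≤ (|S.gam| + 1) * (C * K ^ (-(1 / 4) : ℝ)) * H * W * G := by
    intro z z' hz
    calc ∑ i ∈ A, ‖w i‖ * ‖S.burgers z z' i‖
        ≤ ∑ i ∈ A, |S.gam| * (h i * S.conv (fun i => ‖y i‖) (fun i => ‖x i‖) i) := by
          refine Finset.sum_le_sum fun i hi => ?_
          simp only [hh, if_pos hi]
          refine (mul_le_mul_of_nonneg_left (hz i) (norm_nonneg _)).trans (le_of_eq ?_)
          ring
      _ = |S.gam| * ∑ i ∈ A, h i * S.conv (fun i => ‖y i‖) (fun i => ‖x i‖) i := by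
          rw [Finset.mul_sum]
      _ ≤ (|S.gam| + 1) * (C * K ^ (-(1 / 4) : ℝ) * H * W * G) := by
          refine mul_le_mul (by linarith) key ?_ (by positivity)
          refine Finset.sum_nonneg fun i _ => mul_nonneg ?_
            (S.conv_nonneg (fun _ => norm_nonneg _) (fun _ => norm_nonneg _) _)
          simp only [hh]; split_ifs
          · exact mul_nonneg (S.wabs_nonneg _) (norm_nonneg _)
      _ = _ := by ring
  refine ⟨e1 x y fun i => ?_, e1 y x fun i => S.norm_burgers_le hys hxs i⟩
  rw [S.conv_comm]
  exact S.norm_burgers_le hxs hys i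

lemma wabs_mul_conv_le {f : Idx N → ℝ} (hf0 : ∀ i, 0 ≤ f i) (hf : Summable fun i => f i ^ 2)
    (hg : Summable fun i => (S.wabs i.2 * f i) ^ 2) (i : Idx N) :
    S.wabs i.2 * S.conv f f i ≤ 2 * S.conv (fun i => S.wabs i.2 * f i) f i := by
  have h1 : 2 * S.conv (fun i => S.wabs i.2 * f i) f i
      = S.conv (fun i => S.wabs i.2 * f i) f i + S.conv f (fun i => S.wabs i.2 * f i) i := by
    rw [S.conv_comm f]; ring
  rw [h1, conv, conv, conv, ← tsum_mul_left,
    ← (S.summable_conv hg hf i).tsum_add (S.summable_conv hf hg i)]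
  refine Summable.tsum_le_tsum (fun k => ?_) ((S.summable_conv hf hf i).mul_left _)
    ((S.summable_conv hg hf i).add (S.summable_conv hf hg i))
  split_ifs
  · have h2 : S.wabs i.2 ≤ S.wabs k + S.wabs (i.2 - k) := by
      have := S.wabs_add_le k (i.2 - k)
      rwa [add_sub_cancel] at this
    have h3 := mul_nonneg (hf0 (i.1, k)) (hf0 (i.1, i.2 - k))
    calc S.wabs i.2 * (f (i.1, k) * f (i.1, i.2 - k))
        ≤ (S.wabs k + S.wabs (i.2 - k)) * (f (i.1, k) * f (i.1, i.2 - k)) := by gcongr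
      _ = _ := by ring
  · simp

/-- Here the derivative goes onto an input through |m| ≤ |k| + |m - k|, and the Ḣ¹ norm is taken on
the output sequence. Outputs of size at least K then yield the decay K^{-1/4} that makes the
truncation error small. -/
lemma exists_sum_mul_burgers_tail_le : ∃ C : ℝ, 0 < C ∧ ∀ (K : ℝ), 0 < K →
    ∀ (x y : Idx N → ℂ) (A : Finset (Idx N)) (F G H : ℝ), 0 ≤ F → 0 ≤ G → 0 ≤ H →
    (∀ s : Finset (Idx N), ∑ i ∈ s, ‖x i‖ ^ 2 ≤ F ^ 2) →
    (∀ s : Finset (Idx N), ∑ i ∈ s, S.wabs i.2 ^ 2 * ‖x i‖ ^ 2 ≤ G ^ 2) →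
    (∑ i ∈ A, S.wabs i.2 ^ 2 * ‖y i‖ ^ 2 ≤ H ^ 2) → (∀ i ∈ A, K ≤ S.wabs i.2) →
    ∑ i ∈ A, ‖y i‖ * ‖S.burgers x x i‖ ≤ C * K ^ (-(1 / 4) : ℝ) * F * G * H := by
  classical
  obtain ⟨C, hC, htri⟩ := S.exists_trilinear_output_le
  refine ⟨(|S.gam| + 1) * (2 * C), by positivity,
    fun K hK x y A F G H hF hG hH hx hgx hy hA => ?_⟩
  have hxs : Summable fun i => ‖x i‖ ^ 2 := summable_of_sum_le (fun i => sq_nonneg _) hx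
  have hgx' : ∀ s : Finset (Idx N), ∑ i ∈ s, (S.wabs i.2 * ‖x i‖) ^ 2 ≤ G ^ 2 := by
    simpa only [mul_pow] using hgx
  have hgs : Summable fun i : Idx N => (S.wabs i.2 * ‖x i‖) ^ 2 :=
    summable_of_sum_le (fun i => sq_nonneg _) hgx'
  set g : Idx N → ℝ := fun i => if i ∈ A then ‖y i‖ else 0 with hg
  have hgb : ∀ s : Finset (Idx N), ∑ i ∈ s, S.wabs i.2 ^ 2 * g i ^ 2 ≤ H ^ 2 := by
    intro s
    refine le_trans ?_ hy
    have e : ∀ i, S.wabs i.2 ^ 2 * g i ^ 2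
        = if i ∈ A then S.wabs i.2 ^ 2 * ‖y i‖ ^ 2 else 0 := by
      intro i; simp only [hg]; split_ifs <;> ring
    simp only [e]
    rw [← Finset.sum_filter]
    refine Finset.sum_le_sum_of_subset_of_nonneg (fun i hi => (Finset.mem_filter.1 hi).2)
      fun i _ _ => by positivity
  have key : ∑ i ∈ A, g i * S.conv (fun i => S.wabs i.2 * ‖x i‖) (fun i => ‖x i‖) i
      ≤ C * K ^ (-(1 / 4) : ℝ) * G * F * H :=
    S.sum_mul_conv_le hgs hxs A fun P hP _ =>
      htri K hK (fun i => S.wabs i.2 * ‖x i‖) (fun i => ‖x i‖) g G F H hG hF hH hgx' hx hgb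
        (fun i _ hgi => by
          by_cases h : i ∈ A
          · exact hA i h
          · simp [hg, h] at hgi) P hP
  have hconv : ∀ i, 0 ≤ S.conv (fun i => S.wabs i.2 * ‖x i‖) (fun i => ‖x i‖) i := fun i =>
    S.conv_nonneg (fun i => mul_nonneg (S.wabs_nonneg _) (norm_nonneg _)) (fun i => norm_nonneg _) i
  calc ∑ i ∈ A, ‖y i‖ * ‖S.burgers x x i‖
      ≤ ∑ i ∈ A, |S.gam| * 2 * (g i *
          S.conv (fun i => S.wabs i.2 * ‖x i‖) (fun i => ‖x i‖) i) := by
        refine Finset.sum_le_sum fun i hi => ?_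
        simp only [hg, if_pos hi]
        have h1 := (S.norm_burgers_le hxs hxs i).trans (mul_le_mul_of_nonneg_left
          (S.wabs_mul_conv_le (fun i => norm_nonneg (x i)) hxs hgs i) (abs_nonneg S.gam))
        refine (mul_le_mul_of_nonneg_left h1 (norm_nonneg _)).trans (le_of_eq ?_)
        ring
    _ = |S.gam| * 2 * ∑ i ∈ A, g i *
          S.conv (fun i => S.wabs i.2 * ‖x i‖) (fun i => ‖x i‖) i := by rw [Finset.mul_sum]
    _ ≤ (|S.gam| + 1) * 2 * (C * K ^ (-(1 / 4) : ℝ) * G * F * H) := by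
        refine mul_le_mul (by linarith) key ?_ (by positivity)
        refine Finset.sum_nonneg fun i _ => mul_nonneg ?_ (hconv i)
        simp only [hg]; split_ifs
        · exact norm_nonneg _
    _ = _ := by ring

lemma sum_le_sum_ball {R : ℝ} {x : Idx N → ℂ} (hx : ∀ i, i ∉ S.ball R → x i = 0) {w : Idx N → ℝ}
    (hw : ∀ i, 0 ≤ w i) (s : Finset (Idx N)) :
    ∑ i ∈ s, w i * ‖x i‖ ^ 2 ≤ ∑ i ∈ S.ball R, w i * ‖x i‖ ^ 2 := by
  classical
  have h1 : ∑ i ∈ s, w i * ‖x i‖ ^ 2 = ∑ i ∈ s.filter (· ∈ S.ball R), w i * ‖x i‖ ^ 2 := by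
    rw [Finset.sum_filter]
    refine Finset.sum_congr rfl fun i _ => ?_
    split_ifs with h
    · rfl
    · simp [hx i h]
  rw [h1]
  exact Finset.sum_le_sum_of_subset_of_nonneg (fun i hi => (Finset.mem_filter.1 hi).2)
    fun i _ _ => mul_nonneg (hw i) (sq_nonneg _)

lemma sum_le_en {R : ℝ} {x : Idx N → ℂ} (hx : ∀ i, i ∉ S.ball R → x i = 0) (s : Finset (Idx N)) :
    ∑ i ∈ s, ‖x i‖ ^ 2 ≤ S.en R x := by
  simpa [en] using S.sum_le_sum_ball hx (w := fun _ => 1) (fun _ => zero_le_one) s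

lemma sum_le_gr {R : ℝ} {x : Idx N → ℂ} (hx : ∀ i, i ∉ S.ball R → x i = 0) (s : Finset (Idx N)) :
    ∑ i ∈ s, S.wabs i.2 ^ 2 * ‖x i‖ ^ 2 ≤ S.gr R x :=
  S.sum_le_sum_ball hx (w := fun i => S.wabs i.2 ^ 2) (fun _ => sq_nonneg _) s

lemma summable_of_supp {R : ℝ} {x : Idx N → ℂ} (hx : ∀ i, i ∉ S.ball R → x i = 0) :
    Summable fun i => ‖x i‖ ^ 2 :=
  summable_of_sum_le (fun _ => sq_nonneg _) (S.sum_le_en hx)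

lemma ball_mono {R R' : ℝ} (h : R ≤ R') {i : Idx N} (hi : i ∈ S.ball R) : i ∈ S.ball R' :=
  S.mem_ball.2 ⟨(S.mem_ball.1 hi).1, (S.mem_ball.1 hi).2.trans h⟩

end Setting

namespace Setting

variable {N : ℕ} (S : Setting N)

/-! ### Comparison of two truncations -/

lemma truncRhs_eq_of_le (U : State N) (μ : ℝ) {R R' : ℝ} (h : R ≤ R') (x : Idx N → ℂ) {i : Idx N}
    (hi : i ∈ S.ball R) : S.truncRhs U μ R' x i = S.truncRhs U μ R x i := by
  have hi' := S.mem_ball.1 hi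
  rw [truncRhs, truncRhs, ← S.tsum_couple_eq U x hi'.2, ← S.tsum_couple_eq U x (hi'.2.trans h)]

/-- Outside the smaller ball x vanishes and the coupling produces nothing, since it preserves |m|.
The Burgers output there is therefore the entire truncation error. -/
lemma truncRhs_eq_of_notMem (U : State N) (μ : ℝ) {R R' : ℝ} {x : Idx N → ℂ}
    (hx : ∀ i, i ∉ S.ball R → x i = 0) {i : Idx N} (hi : i ∉ S.ball R) :
    S.truncRhs U μ R' x i = -S.burgers x x i := by
  have h0 : ∑ j ∈ S.ball R', S.couple U i j * x j = 0 := by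
    refine Finset.sum_eq_zero fun j hj => ?_
    by_contra h
    have h1 := left_ne_zero_of_mul h
    have h2 : j ∈ S.ball R := by
      by_contra h2
      exact right_ne_zero_of_mul h (hx j h2)
    by_cases hi0 : i.2 = 0
    · have := S.couple_wabs h1
      rw [hi0, wabs_zero] at this
      exact (S.wabs_pos (S.mem_ball.1 h2).1).ne' this
    · exact hi (S.mem_ball.2 ⟨hi0, (S.couple_wabs h1).symm.trans_le (S.mem_ball.1 h2).2⟩)
  rw [truncRhs, h0, hx i hi]
  ring

lemma re_sum_conj_mul_truncRhs_sub {U : State N} (hU : U ∈ S.nullA) (μ R : ℝ) (x y : Idx N → ℂ) :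
    ∑ i ∈ S.ball R, (conj (y i - x i) * (S.truncRhs U μ R y i - S.truncRhs U μ R x i)).re
      = -μ * S.gr R (y - x)
        - ∑ i ∈ S.ball R, (conj (y i - x i) * (S.burgers y y i - S.burgers x x i)).re := by
  have h := S.re_sum_couple_eq_zero hU (A := S.ball R) (fun i hi => (S.mem_ball.1 hi).1)
    (fun _ => 1) (y - x)
  rw [Complex.re_sum] at h
  have h1 : ∀ i ∈ S.ball R,
      (conj (y i - x i) * (S.truncRhs U μ R y i - S.truncRhs U μ R x i)).re
      = -(((1 : ℝ) : ℂ) * (conj ((y - x) i) * ∑ j ∈ S.ball R, S.couple U i j * (y - x) j)).re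
        + -μ * (S.wabs i.2 ^ 2 * ‖(y - x) i‖ ^ 2)
        - (conj (y i - x i) * (S.burgers y y i - S.burgers x x i)).re := by
    intro i _
    have e0 : ∑ j ∈ S.ball R, S.couple U i j * (y - x) j
        = ∑ j ∈ S.ball R, S.couple U i j * y j - ∑ j ∈ S.ball R, S.couple U i j * x j := by
      rw [← Finset.sum_sub_distrib]
      refine Finset.sum_congr rfl fun j _ => ?_
      rw [Pi.sub_apply]; ring
    have e : conj (y i - x i) * (S.truncRhs U μ R y i - S.truncRhs U μ R x i)
        = -(((1 : ℝ) : ℂ) * (conj ((y - x) i) * ∑ j ∈ S.ball R, S.couple U i j * (y - x) j))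
          + ((-μ * (S.wabs i.2 ^ 2 * ‖(y - x) i‖ ^ 2) : ℝ) : ℂ)
          - conj (y i - x i) * (S.burgers y y i - S.burgers x x i) := by
      have := Complex.conj_mul' (y i - x i)
      rw [truncRhs, truncRhs, e0, Pi.sub_apply]
      push_cast
      linear_combination -((μ : ℂ) * (S.wabs i.2 : ℂ) ^ 2) * this
    rw [e, Complex.sub_re, Complex.add_re, Complex.neg_re, Complex.ofReal_re]
  rw [Finset.sum_congr rfl h1, Finset.sum_sub_distrib, Finset.sum_add_distrib, Finset.sum_neg_distrib,
    ← Finset.mul_sum, h]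
  simp only [gr]
  ring

lemma neg_re_conj_mul_le (z w : ℂ) : -(conj z * w).re ≤ ‖z‖ * ‖w‖ := by
  have := (Complex.abs_re_le_norm (conj z * w))
  rw [norm_mul, RCLike.norm_conj] at this
  exact (neg_le_abs _).trans this

/-- Completing the square: the viscous term 2μH² absorbs the gradient of the difference, and the
remainder has the form of a Gronwall weight times W². -/
lemma absorb_le {μ : ℝ} (hμ : 0 < μ) (C H W G : ℝ) :
    2 * (C * H * W * G) ≤ 2 * μ * H ^ 2 + C ^ 2 / μ * W ^ 2 * (G ^ 2 / 2) := by
  have h1 : 0 ≤ (2 * μ * H - C * W * G) ^ 2 / (2 * μ) := by positivity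
  have h2 : (2 * μ * H - C * W * G) ^ 2 / (2 * μ)
      = 2 * μ * H ^ 2 - 2 * (C * H * W * G) + C ^ 2 / μ * W ^ 2 * (G ^ 2 / 2) := by
    field_simp; ring
  linarith

-- The energy E of the difference satisfies E' ≤ κ(‖∇x‖² + ‖∇y‖²)(E + ε/κ). The truncation error
-- carries the same weight as the stability term, so it is added to E before Gronwall is applied. By
-- the two energy inequalities the weight has time integral at most κM²/μ for every T, and hence the
-- bound does not depend on T.
set_option maxHeartbeats 1000000 in
lemma exists_galerkin_sub_le : ∃ C₁ C₂ : ℝ, 0 < C₁ ∧ 0 < C₂ ∧ ∀ (U : ℝ → State N) (μ R R' T M : ℝ)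
    (x y : ℝ → Idx N → ℂ), (∀ t, 0 ≤ t → U t ∈ S.nullA) → 0 < μ → 0 < R → R ≤ R' → 0 ≤ M →
    S.Galerkin U μ R T x → S.Galerkin U μ R' T y → S.en R (x 0) ≤ M ^ 2 → S.en R' (y 0) ≤ M ^ 2 →
    ∀ t ∈ Icc 0 T, S.en R' (y t - x t)
      ≤ (S.en R' (y 0 - x 0) + C₁ * μ * M * R ^ (-(1 / 4) : ℝ)) * Real.exp (C₂ * M ^ 2 / μ ^ 2) := by
  classical
  obtain ⟨C, hC, hb⟩ := S.exists_sum_mul_burgers_le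
  obtain ⟨C', hC', htail⟩ := S.exists_sum_mul_burgers_tail_le
  refine ⟨C' / C ^ 2, C ^ 2, by positivity, by positivity,
    fun U μ R R' T M x y hU hμ hR hRR hM hx hy hx0 hy0 t ht => ?_⟩
  have hT : 0 ≤ T := ht.1.trans ht.2
  have hK : 0 < R ^ (-(1 / 4) : ℝ) := Real.rpow_pos_of_pos hR _
  set κ : ℝ := C ^ 2 / μ with hκ
  have hκ0 : 0 < κ := by positivity
  set ε : ℝ := C' * R ^ (-(1 / 4) : ℝ) * M with hε
  have hε0 : 0 ≤ ε := by positivity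
  have hsupp : ∀ t, ∀ i, i ∉ S.ball R' → (y t - x t) i = 0 := fun t i hi => by
    rw [Pi.sub_apply, hy.supp t i hi, hx.supp t i fun h => hi (S.ball_mono hRR h), sub_zero]
  have hxs' : ∀ t, ∀ i, i ∉ S.ball R' → x t i = 0 := fun t i hi =>
    hx.supp t i fun h => hi (S.ball_mono hRR h)
  -- Outside the ball of radius R the coordinates of x are identically zero, whereas the R'-field at
  -- x equals minus the Burgers term there. The last summand removes this discrepancy.
  set w' : ℝ → Idx N → ℂ := fun t i => S.truncRhs (U t) μ R' (y t) i
    - S.truncRhs (U t) μ R' (x t) i - (if i ∈ S.ball R then 0 else S.burgers (x t) (x t) i) with hw'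
  have hder : ∀ t ∈ Icc 0 T, HasDerivWithinAt (fun t => S.en R' (y t - x t))
      (∑ i ∈ S.ball R', 2 * (conj (y t i - x t i) * w' t i).re) (Icc 0 T) t := by
    intro t ht
    refine HasDerivWithinAt.fun_sum fun i hi => ?_
    refine hasDerivWithinAt_norm_sq (x := fun t => y t i - x t i) ?_
    by_cases hiR : i ∈ S.ball R
    · refine ((hy.deriv i hi t ht).sub (hx.deriv i hiR t ht)).congr_deriv ?_
      simp only [hw', if_pos hiR, sub_zero, S.truncRhs_eq_of_le (U t) μ hRR (x t) hiR]
    · have h0 : (fun t => y t i - x t i) = fun t => y t i := by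
        funext t; rw [hx.supp t i hiR, sub_zero]
      rw [h0]
      refine (hy.deriv i hi t ht).congr_deriv ?_
      simp only [hw', if_neg hiR, S.truncRhs_eq_of_notMem (U t) μ (hx.supp t) hiR]
      ring
  have hle : ∀ t ∈ Icc 0 T, (∑ i ∈ S.ball R', 2 * (conj (y t i - x t i) * w' t i).re)
      ≤ κ * (S.gr R (x t) + S.gr R' (y t)) * (S.en R' (y t - x t) + ε / κ) := by
    intro t ht
    have hexM : S.en R (x t) ≤ M ^ 2 := by
      have h1 := hx.energy_le hU ht
      have h2 : 0 ≤ ∫ r in (0 : ℝ)..t, S.gr R (x r) :=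
        intervalIntegral.integral_nonneg ht.1 fun r _ => S.gr_nonneg _ _
      nlinarith
    set H := √(S.gr R' (y t - x t)) with hH
    set W := √(S.en R' (y t - x t)) with hW
    set Gx := √(S.gr R (x t)) with hGx
    set Gy := √(S.gr R' (y t)) with hGy
    have hH2 : H ^ 2 = S.gr R' (y t - x t) := Real.sq_sqrt (S.gr_nonneg _ _)
    have hW2 : W ^ 2 = S.en R' (y t - x t) := Real.sq_sqrt (S.en_nonneg _ _)
    have hGx2 : Gx ^ 2 = S.gr R (x t) := Real.sq_sqrt (S.gr_nonneg _ _)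
    have hGy2 : Gy ^ 2 = S.gr R' (y t) := Real.sq_sqrt (S.gr_nonneg _ _)
    have hH0 : 0 ≤ H := Real.sqrt_nonneg _
    have hW0 : 0 ≤ W := Real.sqrt_nonneg _
    have hGx0 : 0 ≤ Gx := Real.sqrt_nonneg _
    have hGy0 : 0 ≤ Gy := Real.sqrt_nonneg _
    have hxs := S.summable_of_supp (hx.supp t)
    have hys := S.summable_of_supp (hy.supp t)
    have hws := S.summable_of_supp (hsupp t)
    have b1 := (hb (y t - x t) (y t) (y t - x t) (S.ball R') H W Gy hH0 hW0 hGy0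
      (le_of_eq hH2.symm) (by rw [hW2]; exact S.sum_le_en (hsupp t))
      (by rw [hGy2]; exact S.sum_le_gr (hy.supp t)) hys).1
    have b2 := (hb (y t - x t) (x t) (y t - x t) (S.ball R') H W Gx hH0 hW0 hGx0
      (le_of_eq hH2.symm) (by rw [hW2]; exact S.sum_le_en (hsupp t))
      (by rw [hGx2]; exact S.sum_le_gr (hx.supp t)) hxs).2
    have b3 := htail R hR (x t) (y t) (S.ball R' \ S.ball R) M Gx Gy hM hGx0 hGy0
      (fun s => (S.sum_le_en (hx.supp t) s).trans hexM)
      (by rw [hGx2]; exact S.sum_le_gr (hx.supp t))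
      (by rw [hGy2]; exact S.sum_le_gr (hy.supp t) _) (fun i hi => by
        rw [Finset.mem_sdiff, mem_ball, mem_ball] at hi
        by_contra h
        exact hi.2 ⟨hi.1.1, (not_le.1 h).le⟩)
    have e1 : (∑ i ∈ S.ball R', 2 * (conj (y t i - x t i) * w' t i).re)
        = 2 * (-μ * S.gr R' (y t - x t)
          - ∑ i ∈ S.ball R', (conj (y t i - x t i)
            * (S.burgers (y t) (y t) i - S.burgers (x t) (x t) i)).re)
          + 2 * ∑ i ∈ S.ball R' \ S.ball R, -(conj (y t i) * S.burgers (x t) (x t) i).re := by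
      rw [← S.re_sum_conj_mul_truncRhs_sub (hU t ht.1) μ R' (x t) (y t), ← Finset.mul_sum, ← mul_add]
      congr 1
      rw [Finset.sdiff_eq_filter, Finset.sum_filter, ← Finset.sum_add_distrib]
      refine Finset.sum_congr rfl fun i _ => ?_
      simp only [hw']
      by_cases hiR : i ∈ S.ball R
      · simp [hiR]
      · rw [if_neg hiR, if_pos hiR, hx.supp t i hiR, sub_zero, mul_sub, Complex.sub_re]
        ring
    have e2 : -∑ i ∈ S.ball R', (conj (y t i - x t i)
            * (S.burgers (y t) (y t) i - S.burgers (x t) (x t) i)).re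
        ≤ C * H * W * Gy + C * H * W * Gx := by
      refine le_trans ?_ (add_le_add b1 b2)
      rw [← Finset.sum_neg_distrib, ← Finset.sum_add_distrib]
      refine Finset.sum_le_sum fun i _ => ?_
      rw [S.burgers_sub_burgers hys hxs hws]
      refine (neg_re_conj_mul_le _ _).trans ?_
      rw [← mul_add]
      exact mul_le_mul_of_nonneg_left (norm_add_le _ _) (norm_nonneg _)
    have e3 : ∑ i ∈ S.ball R' \ S.ball R, -(conj (y t i) * S.burgers (x t) (x t) i).re
        ≤ ε * Gx * Gy := by
      refine le_trans (Finset.sum_le_sum fun i _ => neg_re_conj_mul_le _ _) (b3.trans (le_of_eq ?_))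
      rw [hε]
    have e4 : κ * (S.gr R (x t) + S.gr R' (y t)) * (S.en R' (y t - x t) + ε / κ)
        = (κ * W ^ 2 + ε) * (Gx ^ 2 + Gy ^ 2) := by
      rw [hW2, hGx2, hGy2]; field_simp
    have e5 : 2 * (C * H * W * Gy + C * H * W * Gx)
        ≤ 2 * μ * H ^ 2 + κ * W ^ 2 * (Gx ^ 2 + Gy ^ 2) := by
      have h1 := absorb_le hμ C H W (Gx + Gy)
      have h3 : κ * W ^ 2 * ((Gx + Gy) ^ 2 / 2) ≤ κ * W ^ 2 * (Gx ^ 2 + Gy ^ 2) := by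
        gcongr
        nlinarith [sq_nonneg (Gx - Gy)]
      rw [← hκ] at h1
      linarith only [h1, h3]
    have e6 : 2 * (ε * Gx * Gy) ≤ ε * (Gx ^ 2 + Gy ^ 2) := by
      nlinarith [mul_nonneg hε0 (sq_nonneg (Gx - Gy))]
    rw [e1, e4, ← hH2]
    clear_value κ ε w' H W Gx Gy
    linarith only [e2, e3, e5, e6]
  have hg := le_mul_exp_integral (k := fun t => κ * (S.gr R (x t) + S.gr R' (y t)))
    (((hx.continuousOn_gr R).add (hy.continuousOn_gr R')).const_mul κ)
    (fun t ht => (hder t ht).add_const (ε / κ)) hle ht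
  have hsub : Icc 0 t ⊆ Icc 0 T := Icc_subset_Icc_right ht.2
  rw [intervalIntegral.integral_const_mul, intervalIntegral.integral_add
    (((hx.continuousOn_gr R).mono hsub).intervalIntegrable_of_Icc ht.1)
    (((hy.continuousOn_gr R').mono hsub).intervalIntegrable_of_Icc ht.1)] at hg
  have ex := hx.energy_le hU ht
  have ey := hy.energy_le hU ht
  have nx := S.en_nonneg R (x t)
  have ny := S.en_nonneg R' (y t)
  have hexp : κ * ((∫ r in (0 : ℝ)..t, S.gr R (x r)) + ∫ r in (0 : ℝ)..t, S.gr R' (y r))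
      ≤ C ^ 2 * M ^ 2 / μ ^ 2 := by
    have : (∫ r in (0 : ℝ)..t, S.gr R (x r)) + (∫ r in (0 : ℝ)..t, S.gr R' (y r)) ≤ M ^ 2 / μ := by
      rw [le_div_iff₀ hμ]; linarith
    calc _ ≤ κ * (M ^ 2 / μ) := by gcongr
      _ = _ := by rw [hκ]; field_simp
  have hεκ : ε / κ = C' / C ^ 2 * μ * M * R ^ (-(1 / 4) : ℝ) := by
    rw [hε, hκ]; field_simp
  rw [hεκ] at hg
  refine le_trans (le_add_of_nonneg_right ?_) (hg.trans ?_)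
  · positivity
  · refine mul_le_mul_of_nonneg_left (Real.exp_le_exp.2 hexp) ?_
    have := S.en_nonneg R' (y 0 - x 0)
    positivity

end Setting

/-! ### Dyadic blocks of the acoustic coordinates -/

lemma DyadicCutoff.exists_bound (χ : DyadicCutoff) : ∃ M : ℝ, 0 < M ∧ ∀ r, |χ.φ r| ≤ M := by
  obtain ⟨M, hM⟩ := (isCompact_Icc (a := (-(12 / 5) : ℝ)) (b := 12 / 5)).exists_bound_of_continuousOn
    χ.smooth.continuous.continuousOn
  refine ⟨max M 1, by positivity, fun r => ?_⟩
  by_cases h : χ.φ r = 0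
  · rw [h, abs_zero]; positivity
  · have := χ.support_subset (Function.mem_support.2 h)
    exact (hM r ⟨(abs_le.1 this.2).1, (abs_le.1 this.2).2⟩).trans (le_max_left _ _)

lemma DyadicCutoff.bounds (χ : DyadicCutoff) {q : ℤ} {r : ℝ} (hr : 0 ≤ r)
    (h : χ.φ ((2 : ℝ) ^ (-q) * r) ≠ 0) : 5 / 6 * (2 : ℝ) ^ q ≤ r ∧ r ≤ 12 / 5 * (2 : ℝ) ^ q := by
  obtain ⟨h1, h2⟩ := χ.support_subset (Function.mem_support.2 h)
  have hq : (0 : ℝ) < (2 : ℝ) ^ q := by positivity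
  rw [zpow_neg, abs_of_nonneg (by positivity), inv_mul_eq_div] at h1 h2
  exact ⟨(le_div_iff₀ hq).1 h1, (div_le_iff₀ hq).1 h2⟩

lemma finite_zpow_mem_Icc {a b : ℝ} (ha : 0 < a) : {q : ℤ | a ≤ (2 : ℝ) ^ q ∧ (2 : ℝ) ^ q ≤ b}.Finite := by
  obtain ⟨n, hn⟩ := pow_unbounded_of_one_lt b (one_lt_two)
  obtain ⟨m, hm⟩ := pow_unbounded_of_one_lt a⁻¹ (one_lt_two)
  refine (Set.finite_Icc (-(m : ℤ)) n).subset fun q hq => ⟨?_, ?_⟩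
  · by_contra h
    have h1 : (2 : ℝ) ^ q ≤ 2 ^ (-(m : ℤ)) := zpow_le_zpow_right₀ one_le_two (not_le.1 h).le
    have h2 : (2 : ℝ) ^ (-(m : ℤ)) < a := by
      rw [zpow_neg, zpow_natCast]
      exact inv_lt_of_inv_lt₀ ha hm
    linarith [hq.1]
  · by_contra h
    have h1 : (2 : ℝ) ^ (n : ℤ) ≤ 2 ^ q := zpow_le_zpow_right₀ one_le_two (not_le.1 h).le
    rw [zpow_natCast] at h1
    linarith [hq.2]

lemma sqrt_sum_sq_sum_le {ι κ : Type*} (s : Finset ι) (Q : Finset κ) (a : κ → ι → ℝ) :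
    √(∑ i ∈ s, (∑ p ∈ Q, a p i) ^ 2) ≤ ∑ p ∈ Q, √(∑ i ∈ s, a p i ^ 2) := by
  have h := norm_sum_le Q fun p => (WithLp.toLp 2 fun i : s => a p i : EuclideanSpace ℝ s)
  simp only [EuclideanSpace.norm_eq, Real.norm_eq_abs, sq_abs, WithLp.ofLp_sum, Finset.sum_apply] at h
  rw [Finset.sum_coe_sort s fun i => (∑ p ∈ Q, a p i) ^ 2] at h
  refine h.trans (le_of_eq (Finset.sum_congr rfl fun p _ => ?_))
  rw [Finset.sum_coe_sort s fun i => a p i ^ 2]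

namespace Setting

variable {N : ℕ} (S : Setting N) (χ : DyadicCutoff)

/-- The symbol of the dyadic block `q` at the wave number of `n`. -/
def cut (q : ℤ) (n : Fin N → ℤ) : ℝ := χ.φ ((2 : ℝ) ^ (-q) * S.wabs n)

/-- The norm of the dyadic block `q` of a family of acoustic coordinates. -/
def bn (q : ℤ) (x : Idx N → ℂ) : ℝ :=
  √(∑ i ∈ S.ball (12 / 5 * (2 : ℝ) ^ q), S.cut χ q i.2 ^ 2 * ‖x i‖ ^ 2)

lemma bn_nonneg (q : ℤ) (x : Idx N → ℂ) : 0 ≤ S.bn χ q x := Real.sqrt_nonneg _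

variable {χ} in
lemma cut_bounds {q : ℤ} {n : Fin N → ℤ} (h : S.cut χ q n ≠ 0) :
    5 / 6 * (2 : ℝ) ^ q ≤ S.wabs n ∧ S.wabs n ≤ 12 / 5 * (2 : ℝ) ^ q :=
  χ.bounds (S.wabs_nonneg n) h

/-- Nonzero frequencies are bounded below, so a truncated field meets only finitely many dyadic
blocks. In the truncated estimates all sums over q are then finite. -/
lemma exists_levels (R : ℝ) :
    ∃ Q : Finset ℤ, ∀ q, q ∉ Q → ∀ i ∈ S.ball R, S.cut χ q i.2 = 0 := by
  obtain ⟨r, hr, hrn⟩ := S.exists_wabs_ge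
  -- A block that meets the ball satisfies 12/5 · 2^q ≥ r and 5/6 · 2^q ≤ R.
  refine ⟨(finite_zpow_mem_Icc (a := 5 / 12 * r) (b := 6 / 5 * R) (by positivity)).toFinset,
    fun q hq i hi => ?_⟩
  by_contra h
  obtain ⟨h1, h2⟩ := S.cut_bounds h
  have h3 := hrn i.2 (S.mem_ball.1 hi).1
  have h4 := (S.mem_ball.1 hi).2
  refine hq ((Set.Finite.mem_toFinset _).2 ⟨by linarith, by linarith⟩)

variable {χ} in
lemma one_le_sum_abs_cut {n : Fin N → ℤ} (hn : n ≠ 0) {Q : Finset ℤ}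
    (hQ : ∀ q, q ∉ Q → S.cut χ q n = 0) : 1 ≤ ∑ q ∈ Q, |S.cut χ q n| := by
  have h1 := χ.sum_eq_one (S.wabs n) (S.wabs_pos hn).ne'
  have h2 := h1.unique (hasSum_sum_of_ne_finset_zero (s := Q) hQ)
  refine h2.trans_le (Finset.sum_le_sum fun q _ => le_abs_self _)

lemma bn_sq {R : ℝ} {x : Idx N → ℂ} (hx : ∀ i, i ∉ S.ball R → x i = 0) (q : ℤ) :
    S.bn χ q x ^ 2 = ∑ i ∈ S.ball R, S.cut χ q i.2 ^ 2 * ‖x i‖ ^ 2 := by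
  classical
  rw [bn, Real.sq_sqrt (Finset.sum_nonneg fun _ _ => by positivity)]
  refine le_antisymm (S.sum_le_sum_ball hx (w := fun i => S.cut χ q i.2 ^ 2)
    (fun _ => sq_nonneg _) _) ?_
  rw [← Finset.sum_filter_add_sum_filter_not (S.ball R) (· ∈ S.ball (12 / 5 * (2 : ℝ) ^ q))]
  have h0 : ∑ i ∈ (S.ball R).filter (· ∉ S.ball (12 / 5 * (2 : ℝ) ^ q)),
      S.cut χ q i.2 ^ 2 * ‖x i‖ ^ 2 = 0 := by
    refine Finset.sum_eq_zero fun i hi => ?_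
    rw [Finset.mem_filter] at hi
    have : S.cut χ q i.2 = 0 := by
      by_contra h
      exact hi.2 (S.mem_ball.2 ⟨(S.mem_ball.1 hi.1).1, (S.cut_bounds h).2⟩)
    simp [this]
  rw [h0, add_zero]
  exact Finset.sum_le_sum_of_subset_of_nonneg (fun i hi => (Finset.mem_filter.1 hi).2)
    fun i _ _ => by positivity

lemma bn_eq_sqrt {R : ℝ} {x : Idx N → ℂ} (hx : ∀ i, i ∉ S.ball R → x i = 0) (q : ℤ) :
    S.bn χ q x = √(∑ i ∈ S.ball R, S.cut χ q i.2 ^ 2 * ‖x i‖ ^ 2) := by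
  rw [← S.bn_sq χ hx, Real.sqrt_sq (S.bn_nonneg χ q x)]

lemma bn_eq_zero {R : ℝ} {x : Idx N → ℂ} (hx : ∀ i, i ∉ S.ball R → x i = 0) {q : ℤ}
    (hq : ∀ i ∈ S.ball R, S.cut χ q i.2 = 0) : S.bn χ q x = 0 := by
  rw [S.bn_eq_sqrt χ hx, Finset.sum_eq_zero fun i hi => by rw [hq i hi]; ring, Real.sqrt_zero]

/-- High frequencies are controlled by the corresponding dyadic blocks. -/
lemma sum_high_le {R : ℝ} {x : Idx N → ℂ} (hx : ∀ i, i ∉ S.ball R → x i = 0) {Q : Finset ℤ}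
    (hQ : ∀ q, q ∉ Q → ∀ i ∈ S.ball R, S.cut χ q i.2 = 0) (q : ℤ) (s : Finset (Idx N)) :
    ∑ i ∈ s, (if 5 / 12 * (2 : ℝ) ^ q ≤ S.wabs i.2 then ‖x i‖ else 0) ^ 2
      ≤ (∑ p ∈ Q.filter (q - 2 ≤ ·), S.bn χ p x) ^ 2 := by
  classical
  set Q' := Q.filter (q - 2 ≤ ·) with hQ'
  have h1 : ∀ i ∈ S.ball R, (if 5 / 12 * (2 : ℝ) ^ q ≤ S.wabs i.2 then ‖x i‖ else 0)
      ≤ ∑ p ∈ Q', |S.cut χ p i.2| * ‖x i‖ := by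
    intro i hi
    rw [← Finset.sum_mul]
    split_ifs with h
    · refine le_mul_of_one_le_left (norm_nonneg _)
        (S.one_le_sum_abs_cut (S.mem_ball.1 hi).1 fun p hp => ?_)
      by_contra h0
      refine hp (Finset.mem_filter.2 ⟨?_, ?_⟩)
      · by_contra h'
        exact h0 (hQ p h' i hi)
      -- For p ≤ q - 3 the block p reaches only up to 12/5 · 2^p ≤ 3/10 · 2^q, which is below 5/12 ·
      -- 2^q.
      · have h2 := (S.cut_bounds h0).2
        by_contra h3
        have h4 : (2 : ℝ) ^ p ≤ (2 : ℝ) ^ (q - 3) := zpow_le_zpow_right₀ one_le_two (by omega)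
        rw [zpow_sub₀ two_ne_zero] at h4
        have hq : (0 : ℝ) < (2 : ℝ) ^ q := by positivity
        norm_num at h4
        linarith
    · positivity
  have h2 : ∑ i ∈ s, (if 5 / 12 * (2 : ℝ) ^ q ≤ S.wabs i.2 then ‖x i‖ else 0) ^ 2
      ≤ ∑ i ∈ S.ball R, (if 5 / 12 * (2 : ℝ) ^ q ≤ S.wabs i.2 then ‖x i‖ else 0) ^ 2 := by
    have := S.sum_le_sum_ball hx (w := fun i => if 5 / 12 * (2 : ℝ) ^ q ≤ S.wabs i.2 then 1 else 0)
      (fun i => by split_ifs <;> norm_num) s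
    simpa only [ite_pow, ite_mul, one_mul, zero_mul, ne_eq, OfNat.ofNat_ne_zero, not_false_eq_true,
      zero_pow] using this
  have h0 : ∀ i, 0 ≤ (if 5 / 12 * (2 : ℝ) ^ q ≤ S.wabs i.2 then ‖x i‖ else 0) := fun i => by
    split_ifs <;> positivity
  have h3 := sqrt_sum_sq_sum_le (S.ball R) Q' fun p i => |S.cut χ p i.2| * ‖x i‖
  simp only [mul_pow, sq_abs] at h3
  simp only [← S.bn_eq_sqrt χ hx] at h3
  rw [Real.sqrt_le_left (Finset.sum_nonneg fun p _ => S.bn_nonneg χ p x)] at h3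
  exact h2.trans ((Finset.sum_le_sum fun i hi => pow_le_pow_left₀ (h0 i) (h1 i hi) 2).trans h3)

/-- One of |k| and |m - k| is at least |m|/2, and the factor 2 accounts for either of them being the
large one. -/
lemma conv_le_of_wabs_ge {f : Idx N → ℝ} (hf0 : ∀ i, 0 ≤ f i) (hf : Summable fun i => f i ^ 2)
    {K : ℝ} {i : Idx N} (hi : 2 * K ≤ S.wabs i.2) :
    S.conv f f i ≤ 2 * S.conv (fun i => if K ≤ S.wabs i.2 then f i else 0) f i := by
  set g : Idx N → ℝ := fun i => if K ≤ S.wabs i.2 then f i else 0 with hg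
  have hg0 : ∀ i, 0 ≤ g i := fun i => by simp only [hg]; split_ifs; exacts [hf0 i, le_rfl]
  have hgf : ∀ i, g i ≤ f i := fun i => by simp only [hg]; split_ifs; exacts [le_rfl, hf0 i]
  have hgs : Summable fun i => g i ^ 2 :=
    Summable.of_nonneg_of_le (fun _ => sq_nonneg _)
      (fun i => pow_le_pow_left₀ (hg0 i) (hgf i) 2) hf
  have h1 : 2 * S.conv g f i = S.conv g f i + S.conv f g i := by rw [S.conv_comm f]; ring
  rw [h1, conv, conv, conv, ← (S.summable_conv hgs hf i).tsum_add (S.summable_conv hf hgs i)]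
  refine Summable.tsum_le_tsum (fun k => ?_) (S.summable_conv hf hf i)
    ((S.summable_conv hgs hf i).add (S.summable_conv hf hgs i))
  split_ifs
  · have h2 : S.wabs i.2 ≤ S.wabs k + S.wabs (i.2 - k) := by
      have := S.wabs_add_le k (i.2 - k)
      rwa [add_sub_cancel] at this
    by_cases hk : K ≤ S.wabs k
    · have : g (i.1, k) = f (i.1, k) := by simp only [hg]; rw [if_pos hk]
      rw [this]
      exact le_add_of_nonneg_right (mul_nonneg (hf0 _) (hg0 _))
    · have : g (i.1, i.2 - k) = f (i.1, i.2 - k) := by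
        simp only [hg]; rw [if_pos (by linarith)]
      rw [this]
      exact le_add_of_nonneg_left (mul_nonneg (hg0 _) (hf0 _))
  · simp

/-- An output in block q has |m| ≥ 5/6 · 2^q, so some input has size at least 5/12 · 2^q. That input
is measured in L² by the blocks p ≥ q - 2, the other one in Ḣ¹ by the gradient energy. The
derivative falls on the output, where it costs at most 12/5 · 2^q. -/
lemma exists_block_burgers_le : ∃ C : ℝ, 0 < C ∧ ∀ (R : ℝ) (x : Idx N → ℂ) (Q : Finset ℤ) (q : ℤ),
    (∀ i, i ∉ S.ball R → x i = 0) → (∀ q, q ∉ Q → ∀ i ∈ S.ball R, S.cut χ q i.2 = 0) →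
    ∑ i ∈ S.ball R, S.cut χ q i.2 ^ 2 * (‖x i‖ * ‖S.burgers x x i‖)
      ≤ C * S.bn χ q x * √(S.gr R x) * (2 : ℝ) ^ q * ∑ p ∈ Q.filter (q - 2 ≤ ·), S.bn χ p x := by
  classical
  obtain ⟨C, hC, htri⟩ := S.exists_trilinear_le
  obtain ⟨K, hK, hKr⟩ := S.exists_wabs_ge
  obtain ⟨M, hM, hMb⟩ := χ.exists_bound
  have hKp : 0 < K ^ (-(1 / 4) : ℝ) := Real.rpow_pos_of_pos hK _
  refine ⟨(|S.gam| + 1) * 2 * (C * K ^ (-(1 / 4) : ℝ) * (M * (12 / 5))), by positivity,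
    fun R x Q q hx hQ => ?_⟩
  set f : Idx N → ℝ := fun i => if 5 / 12 * (2 : ℝ) ^ q ≤ S.wabs i.2 then ‖x i‖ else 0 with hf
  set F := ∑ p ∈ Q.filter (q - 2 ≤ ·), S.bn χ p x with hF
  have hF0 : 0 ≤ F := Finset.sum_nonneg fun p _ => S.bn_nonneg χ p x
  have hfb : ∀ s : Finset (Idx N), ∑ i ∈ s, f i ^ 2 ≤ F ^ 2 := S.sum_high_le χ hx hQ q
  have hfs : Summable fun i => f i ^ 2 := summable_of_sum_le (fun _ => sq_nonneg _) hfb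
  have hxs := S.summable_of_supp hx
  set G := √(S.gr R x) with hG
  have hG2 : G ^ 2 = S.gr R x := Real.sq_sqrt (S.gr_nonneg _ _)
  set h : Idx N → ℝ := fun i => if i ∈ S.ball R then S.cut χ q i.2 ^ 2 * (S.wabs i.2 * ‖x i‖) else 0
    with hh
  have h0 : ∀ i, 0 ≤ h i := fun i => by
    have := S.wabs_nonneg i.2
    simp only [hh]; split_ifs <;> positivity
  set H := M * (12 / 5 * (2 : ℝ) ^ q) * S.bn χ q x with hH
  have hbn := S.bn_nonneg χ q x
  have hH0 : 0 ≤ H := by positivity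
  have hhb : ∀ s : Finset (Idx N), ∑ i ∈ s, h i ^ 2 ≤ H ^ 2 := by
    intro s
    have e1 : ∀ i, h i ^ 2 ≤ (M * (12 / 5 * (2 : ℝ) ^ q)) ^ 2 *
        (if i ∈ S.ball R then S.cut χ q i.2 ^ 2 * ‖x i‖ ^ 2 else 0) := by
      intro i
      simp only [hh]
      split_ifs with hi
      · by_cases hc : S.cut χ q i.2 = 0
        · simp [hc]
        · have e2 := (S.cut_bounds hc).2
          have e3 : S.cut χ q i.2 ^ 2 ≤ M ^ 2 := by
            rw [← sq_abs]
            exact pow_le_pow_left₀ (abs_nonneg _) (hMb _) 2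
          have e4 : S.wabs i.2 ^ 2 ≤ (12 / 5 * (2 : ℝ) ^ q) ^ 2 :=
            pow_le_pow_left₀ (S.wabs_nonneg _) e2 2
          calc (S.cut χ q i.2 ^ 2 * (S.wabs i.2 * ‖x i‖)) ^ 2
              = S.cut χ q i.2 ^ 2 * S.wabs i.2 ^ 2 * (S.cut χ q i.2 ^ 2 * ‖x i‖ ^ 2) := by ring
            _ ≤ M ^ 2 * (12 / 5 * (2 : ℝ) ^ q) ^ 2 * (S.cut χ q i.2 ^ 2 * ‖x i‖ ^ 2) := by gcongr
            _ = _ := by ring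
      · simp
    refine (Finset.sum_le_sum fun i _ => e1 i).trans ?_
    rw [← Finset.mul_sum, hH, mul_pow _ (S.bn χ q x), S.bn_sq χ hx, ← Finset.sum_filter]
    gcongr
    exact fun i hi => (Finset.mem_filter.1 hi).2
  have key : ∑ i ∈ S.ball R, h i * S.conv f (fun i => ‖x i‖) i
      ≤ C * K ^ (-(1 / 4) : ℝ) * H * F * G :=
    S.sum_mul_conv_le hfs hxs _ fun P hP _ =>
      htri K hK h f (fun i => ‖x i‖) H F G hH0 hF0 (Real.sqrt_nonneg _) hhb hfb
        (by rw [hG2]; exact S.sum_le_gr hx) (fun i hi _ => hKr i.2 hi) P hP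
  have hconv : ∀ i, 0 ≤ S.conv f (fun i => ‖x i‖) i := fun i =>
    S.conv_nonneg (fun i => by simp only [hf]; split_ifs <;> positivity) (fun i => norm_nonneg _) i
  calc ∑ i ∈ S.ball R, S.cut χ q i.2 ^ 2 * (‖x i‖ * ‖S.burgers x x i‖)
      ≤ ∑ i ∈ S.ball R, |S.gam| * 2 * (h i * S.conv f (fun i => ‖x i‖) i) := by
        refine Finset.sum_le_sum fun i hi => ?_
        by_cases hc : S.cut χ q i.2 = 0
        · rw [hc]
          have := mul_nonneg (h0 i) (hconv i)
          rw [zero_pow two_ne_zero, zero_mul]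
          positivity
        · have e1 : 2 * (5 / 12 * (2 : ℝ) ^ q) ≤ S.wabs i.2 := by
            have := (S.cut_bounds hc).1
            linarith
          have e2 := S.conv_le_of_wabs_ge (fun i => norm_nonneg (x i)) hxs e1
          have e3 := S.norm_burgers_le hxs hxs i
          simp only [hh, if_pos hi]
          calc S.cut χ q i.2 ^ 2 * (‖x i‖ * ‖S.burgers x x i‖)
              ≤ S.cut χ q i.2 ^ 2 * (‖x i‖ * (|S.gam| * (S.wabs i.2 *
                  (2 * S.conv f (fun i => ‖x i‖) i)))) := by
                have hw := S.wabs_nonneg i.2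
                refine mul_le_mul_of_nonneg_left (mul_le_mul_of_nonneg_left (e3.trans ?_)
                  (norm_nonneg _)) (sq_nonneg _)
                exact mul_le_mul_of_nonneg_left (mul_le_mul_of_nonneg_left e2 hw) (abs_nonneg _)
            _ = _ := by ring
    _ = |S.gam| * 2 * ∑ i ∈ S.ball R, h i * S.conv f (fun i => ‖x i‖) i := by
        rw [Finset.mul_sum]
    _ ≤ (|S.gam| + 1) * 2 * (C * K ^ (-(1 / 4) : ℝ) * H * F * G) := by
        refine mul_le_mul (by linarith) key ?_ (by positivity)
        exact Finset.sum_nonneg fun i _ => mul_nonneg (h0 i) (hconv i)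
    _ = _ := by rw [hH]; ring

end Setting

/-! ### Besov estimates for the truncated system -/

/-- The dyadic weight `2^{qs}`. -/
def wt (s : ℝ) (q : ℤ) : ℝ := (2 : ℝ) ^ ((q : ℝ) * s)

lemma wt_pos (s : ℝ) (q : ℤ) : 0 < wt s q := Real.rpow_pos_of_pos two_pos _

lemma wt_add_one (s : ℝ) (q : ℤ) : wt (s + 1) q = wt s q * (2 : ℝ) ^ q := by
  rw [wt, wt, mul_add, mul_one, Real.rpow_add two_pos, Real.rpow_intCast]

lemma wt_add_two (s : ℝ) (q : ℤ) : wt (s + 1) q = wt (s - 1) q * ((2 : ℝ) ^ q) ^ 2 := by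
  have h := wt_add_one (s - 1) q
  rw [sub_add_cancel] at h
  rw [wt_add_one, h]
  ring

/-- With j = p + 2 - q ≥ 0 the weight is 2^{2s} 2^{ps} 2^{-js}, and s ≥ 1 makes the last factor at
most 2^{-j}; the geometric series gives the constant 2. -/
lemma sum_wt_le {s : ℝ} (hs : 1 ≤ s) (Q : Finset ℤ) (p : ℤ) :
    ∑ q ∈ Q.filter (· - 2 ≤ p), wt s q ≤ 2 * (2 : ℝ) ^ (2 * s) * wt s p := by
  have h1 : ∀ q ∈ Q.filter (· - 2 ≤ p),
      wt s q ≤ (2 : ℝ) ^ (2 * s) * wt s p * (1 / 2 : ℝ) ^ (p + 2 - q).toNat := by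
    intro q hq
    have hq' := (Finset.mem_filter.1 hq).2
    obtain ⟨j, hj⟩ := Int.eq_ofNat_of_zero_le (show 0 ≤ p + 2 - q by omega)
    rw [hj, Int.toNat_natCast]
    have hqe : (q : ℝ) = p + 2 - j := by
      have : ((p + 2 - q : ℤ) : ℝ) = ((j : ℤ) : ℝ) := by rw [hj]
      push_cast at this
      linarith
    have h2 : wt s q = (2 : ℝ) ^ (2 * s) * wt s p * (2 : ℝ) ^ (-((j : ℝ) * s)) := by
      rw [wt, wt, ← Real.rpow_add two_pos, ← Real.rpow_add two_pos, hqe]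
      ring_nf
    have h3 : (2 : ℝ) ^ (-((j : ℝ) * s)) ≤ (1 / 2 : ℝ) ^ j := by
      rw [one_div, inv_pow, ← Real.rpow_natCast, ← Real.rpow_neg zero_le_two]
      refine Real.rpow_le_rpow_of_exponent_le one_le_two ?_
      nlinarith [Nat.cast_nonneg (α := ℝ) j]
    rw [h2]
    have := wt_pos s p
    gcongr
  refine (Finset.sum_le_sum h1).trans ?_
  rw [← Finset.mul_sum]
  have hinj : Set.InjOn (fun q : ℤ => (p + 2 - q).toNat) (Q.filter (· - 2 ≤ p)) := by
    intro q hq q' hq' h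
    have h1 := (Finset.mem_filter.1 hq).2
    have h2 := (Finset.mem_filter.1 hq').2
    simp only at h
    omega
  have h4 : ∑ q ∈ Q.filter (· - 2 ≤ p), (1 / 2 : ℝ) ^ (p + 2 - q).toNat ≤ 2 := by
    rw [← Finset.sum_image (f := fun j => (1 / 2 : ℝ) ^ j) hinj]
    exact (summable_geometric_two.sum_le_tsum _ fun j _ => by positivity).trans_eq
      tsum_geometric_two
  have := wt_pos s p
  calc _ ≤ (2 : ℝ) ^ (2 * s) * wt s p * 2 := by gcongr
    _ = _ := by ring

namespace Setting

variable {N : ℕ} (S : Setting N) (χ : DyadicCutoff)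

variable {S} in
lemma Galerkin.continuousOn_bn {U : ℝ → State N} {μ R T : ℝ} {x : ℝ → Idx N → ℂ}
    (hx : S.Galerkin U μ R T x) (q : ℤ) : ContinuousOn (fun t => S.bn χ q (x t)) (Icc 0 T) :=
  (hx.continuousOn_weighted _ _).sqrt

lemma sum_wt_mul_tail_le {s : ℝ} (hs : 1 ≤ s) (Q : Finset ℤ) {b : ℤ → ℝ} (hb : ∀ q, 0 ≤ b q) :
    ∑ q ∈ Q, wt s q * ∑ p ∈ Q.filter (q - 2 ≤ ·), b p
      ≤ 2 * (2 : ℝ) ^ (2 * s) * ∑ p ∈ Q, wt s p * b p := by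
  calc ∑ q ∈ Q, wt s q * ∑ p ∈ Q.filter (q - 2 ≤ ·), b p
      = ∑ p ∈ Q, (∑ q ∈ Q.filter (· - 2 ≤ p), wt s q) * b p := by
        simp only [Finset.mul_sum, Finset.sum_mul, Finset.sum_filter]
        rw [Finset.sum_comm]
        refine Finset.sum_congr rfl fun p _ => Finset.sum_congr rfl fun q _ => ?_
        split_ifs <;> first | rfl | simp
    _ ≤ ∑ p ∈ Q, (2 * (2 : ℝ) ^ (2 * s) * wt s p) * b p :=
        Finset.sum_le_sum fun p _ => mul_le_mul_of_nonneg_right (sum_wt_le hs Q p) (hb p)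
    _ = _ := by
        rw [Finset.mul_sum]
        exact Finset.sum_congr rfl fun p _ => by ring

/-- The weighted energy identity is used with the squared dyadic symbol. On its support |m| ≥ 5/6 ·
2^q, which explains the factor 25/36 in the damping. Passing from squares to norms with
`sqrt_energy_le` is what later allows summation in ℓ¹ over q. -/
lemma exists_galerkin_block_le : ∃ C : ℝ, 0 < C ∧ ∀ (U : ℝ → State N) (μ R T : ℝ)
    (x : ℝ → Idx N → ℂ) (Q : Finset ℤ) (q : ℤ), (∀ t, 0 ≤ t → U t ∈ S.nullA) → 0 < μ →
    S.Galerkin U μ R T x → (∀ q, q ∉ Q → ∀ i ∈ S.ball R, S.cut χ q i.2 = 0) → ∀ t ∈ Icc 0 T,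
    S.bn χ q (x t) + μ * (25 / 36) * ((2 : ℝ) ^ q) ^ 2 * ∫ r in (0 : ℝ)..t, S.bn χ q (x r)
      ≤ S.bn χ q (x 0) + ∫ r in (0 : ℝ)..t,
        C * √(S.gr R (x r)) * (2 : ℝ) ^ q * ∑ p ∈ Q.filter (q - 2 ≤ ·), S.bn χ p (x r) := by
  obtain ⟨C, hC, hb⟩ := S.exists_block_burgers_le χ
  refine ⟨C, hC, fun U μ R T x Q q hU hμ hx hQ t ht => ?_⟩
  refine sqrt_energy_le (n := fun t => S.bn χ q (x t)) (F := fun r => C * √(S.gr R (x r)) *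
    (2 : ℝ) ^ q * ∑ p ∈ Q.filter (q - 2 ≤ ·), S.bn χ p (x r)) (by positivity)
    (fun t _ => S.bn_nonneg χ q _) (hx.continuousOn_bn χ q)
    (((hx.continuousOn_gr R).sqrt.const_mul C |>.mul_const _).mul
      (continuousOn_finsetSum _ fun p _ => hx.continuousOn_bn χ p)) (fun t _ => ?_)
    (fun t ht => ?_) (fun t ht => ?_) ht
    (E' := fun t => -2 * μ * (∑ i ∈ S.ball R, χ.φ ((2 : ℝ) ^ (-q) * S.wabs i.2) ^ 2 *
          (S.wabs i.2 ^ 2 * ‖x t i‖ ^ 2))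
        - 2 * ∑ i ∈ S.ball R, χ.φ ((2 : ℝ) ^ (-q) * S.wabs i.2) ^ 2 *
          (conj (x t i) * S.burgers (x t) (x t) i).re)
  · have := Finset.sum_nonneg fun p (_ : p ∈ Q.filter (q - 2 ≤ ·)) => S.bn_nonneg χ p (x t)
    positivity
  · have h := hx.hasDerivWithinAt_weighted hU (fun r => χ.φ ((2 : ℝ) ^ (-q) * r) ^ 2) ht
    simp only [S.bn_sq χ (hx.supp _)]
    exact h
  · have h1 : μ * (25 / 36) * ((2 : ℝ) ^ q) ^ 2 * S.bn χ q (x t) ^ 2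
        ≤ μ * ∑ i ∈ S.ball R, χ.φ ((2 : ℝ) ^ (-q) * S.wabs i.2) ^ 2 *
          (S.wabs i.2 ^ 2 * ‖x t i‖ ^ 2) := by
      rw [mul_assoc, mul_assoc]
      gcongr
      rw [S.bn_sq χ (hx.supp t), ← mul_assoc, Finset.mul_sum]
      refine Finset.sum_le_sum fun i _ => ?_
      by_cases hc : S.cut χ q i.2 = 0
      · have hc' : χ.φ ((2 : ℝ) ^ (-q) * S.wabs i.2) = 0 := hc
        rw [hc, hc']
        simp
      · have h2 := pow_le_pow_left₀ (by positivity) (S.cut_bounds hc).1 2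
        calc _ = S.cut χ q i.2 ^ 2 * ((5 / 6 * (2 : ℝ) ^ q) ^ 2 * ‖x t i‖ ^ 2) := by ring
          _ ≤ S.cut χ q i.2 ^ 2 * (S.wabs i.2 ^ 2 * ‖x t i‖ ^ 2) := by gcongr
    have h2 : -∑ i ∈ S.ball R, χ.φ ((2 : ℝ) ^ (-q) * S.wabs i.2) ^ 2 *
          (conj (x t i) * S.burgers (x t) (x t) i).re
        ≤ C * S.bn χ q (x t) * √(S.gr R (x t)) * (2 : ℝ) ^ q *
          ∑ p ∈ Q.filter (q - 2 ≤ ·), S.bn χ p (x t) := by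
      refine le_trans ?_ (hb R (x t) Q q (hx.supp t) hQ)
      rw [← Finset.sum_neg_distrib]
      refine Finset.sum_le_sum fun i _ => ?_
      rw [← mul_neg]
      exact mul_le_mul_of_nonneg_left (neg_re_conj_mul_le _ _) (sq_nonneg _)
    linarith

/-- After summation with weights 2^{q(s-1)} the forcing is C'‖∇x‖ ∑ 2^{qs} n_q. Since 2^{qs} lies
halfway between the weights of B^{s-1} and B^{s+1}, Young's inequality splits it into a quarter of
the viscosity and a Gronwall term of weight (C'²/μ)‖∇x‖², whose time integral is at most C'²E/μ².
The sequence B bounds each block uniformly in time before summation and serves the norm of F^s. -/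
lemma exists_galerkin_besov_le {s : ℝ} (hs : 1 ≤ s) : ∃ C : ℝ, 0 < C ∧ ∀ (U : ℝ → State N)
    (μ R T E : ℝ) (x : ℝ → Idx N → ℂ) (Q : Finset ℤ), (∀ t, 0 ≤ t → U t ∈ S.nullA) → 0 < μ → 0 ≤ T →
    S.Galerkin U μ R T x → (∀ q, q ∉ Q → ∀ i ∈ S.ball R, S.cut χ q i.2 = 0) → S.en R (x 0) ≤ E →
    (∃ B : ℤ → ℝ, (∀ q, ∀ t ∈ Icc 0 T, S.bn χ q (x t) ≤ B q) ∧
      ∑ q ∈ Q, wt (s - 1) q * B q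
        ≤ 2 * ((∑ q ∈ Q, wt (s - 1) q * S.bn χ q (x 0)) * Real.exp (C / μ ^ 2 * E))) ∧
    ∀ t ∈ Icc 0 T, ∑ q ∈ Q, wt (s - 1) q * S.bn χ q (x t)
        + 1 / 4 * μ * ∫ r in (0 : ℝ)..t, ∑ q ∈ Q, wt (s + 1) q * S.bn χ q (x r)
      ≤ (∑ q ∈ Q, wt (s - 1) q * S.bn χ q (x 0)) * Real.exp (C / μ ^ 2 * E) := by
  obtain ⟨C, hC, hb⟩ := S.exists_galerkin_block_le χ
  set C' : ℝ := C * (2 * (2 : ℝ) ^ (2 * s)) with hC'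
  have hC'0 : 0 < C' := by have := Real.rpow_pos_of_pos two_pos (2 * s); positivity
  refine ⟨C' ^ 2, by positivity, fun U μ R T E x Q hU hμ hT hx hQ hE => ?_⟩
  set b : ℤ → ℝ → ℝ := fun q t => S.bn χ q (x t) with hbdef
  have hb0 : ∀ q t, 0 ≤ b q t := fun q t => S.bn_nonneg χ q _
  have hbc : ∀ q, ContinuousOn (b q) (Icc 0 T) := fun q => hx.continuousOn_bn χ q
  set Y : ℝ → ℝ := fun t => ∑ q ∈ Q, wt (s - 1) q * b q t with hY
  set Z : ℝ → ℝ := fun t => ∑ q ∈ Q, wt (s + 1) q * b q t with hZ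
  set F : ℤ → ℝ → ℝ := fun q r => C * √(S.gr R (x r)) * (2 : ℝ) ^ q *
    ∑ p ∈ Q.filter (q - 2 ≤ ·), b p r with hF
  have hFc : ∀ q, ContinuousOn (F q) (Icc 0 T) := fun q =>
    ((hx.continuousOn_gr R).sqrt.const_mul C |>.mul_const _).mul
      (continuousOn_finsetSum _ fun p _ => hbc p)
  have hF0 : ∀ q t, 0 ≤ F q t := fun q t => by
    have := Finset.sum_nonneg fun p (_ : p ∈ Q.filter (q - 2 ≤ ·)) => hb0 p t
    positivity
  have hYc : ContinuousOn Y (Icc 0 T) := continuousOn_finsetSum _ fun q _ => (hbc q).const_mul _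
  have hZc : ContinuousOn Z (Icc 0 T) := continuousOn_finsetSum _ fun q _ => (hbc q).const_mul _
  have hZ0 : ∀ t, 0 ≤ Z t := fun t =>
    Finset.sum_nonneg fun q _ => mul_nonneg (wt_pos _ _).le (hb0 q t)
  have hY0 : ∀ t, 0 ≤ Y t := fun t =>
    Finset.sum_nonneg fun q _ => mul_nonneg (wt_pos _ _).le (hb0 q t)
  set k : ℝ → ℝ := fun t => C' ^ 2 / μ * S.gr R (x t) with hk
  have hkc : ContinuousOn k (Icc 0 T) := (hx.continuousOn_gr R).const_mul _
  have hk0 : ∀ t, 0 ≤ k t := fun t => by have := S.gr_nonneg R (x t); positivity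
  have hint : ∀ {f : ℝ → ℝ} {t : ℝ}, ContinuousOn f (Icc 0 T) → t ∈ Icc 0 T →
      IntervalIntegrable f volume 0 t := fun hf ht =>
    (hf.mono (Icc_subset_Icc_right ht.2)).intervalIntegrable_of_Icc ht.1
  have hblock : ∀ q, ∀ t ∈ Icc 0 T, b q t + μ * (25 / 36) * ((2 : ℝ) ^ q) ^ 2 *
      ∫ r in (0 : ℝ)..t, b q r ≤ b q 0 + ∫ r in (0 : ℝ)..t, F q r := fun q t ht =>
    hb U μ R T x Q q hU hμ hx hQ t ht
  have hFsum : ∀ t, ∑ q ∈ Q, wt (s - 1) q * F q t ≤ μ / 4 * Z t + k t * Y t := by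
    intro t
    have e1 : ∑ q ∈ Q, wt (s - 1) q * F q t
        = C * √(S.gr R (x t)) * ∑ q ∈ Q, wt s q * ∑ p ∈ Q.filter (q - 2 ≤ ·), b p t := by
      rw [Finset.mul_sum]
      refine Finset.sum_congr rfl fun q _ => ?_
      have := wt_add_one (s - 1) q
      rw [sub_add_cancel] at this
      rw [this, hF]
      ring
    have e2 := sum_wt_mul_tail_le hs Q (b := fun p => b p t) fun p => hb0 p t
    have hg := Real.sqrt_nonneg (S.gr R (x t))
    rw [e1]
    refine (mul_le_mul_of_nonneg_left e2 (by positivity)).trans ?_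
    rw [hZ, hY]
    simp only [Finset.mul_sum]
    rw [← Finset.sum_add_distrib]
    refine Finset.sum_le_sum fun q _ => ?_
    have e3 := wt_add_one (s - 1) q
    rw [sub_add_cancel] at e3
    rw [wt_add_two, e3]
    have e4 : k t = C' ^ 2 / μ * √(S.gr R (x t)) ^ 2 := by
      rw [Real.sq_sqrt (S.gr_nonneg _ _)]
    rw [e4]
    set g := √(S.gr R (x t))
    have e5 : C' * g * (2 : ℝ) ^ q ≤ μ / 4 * ((2 : ℝ) ^ q) ^ 2 + C' ^ 2 / μ * g ^ 2 := by
      have h1 : 0 ≤ (μ / 2 * (2 : ℝ) ^ q - C' * g) ^ 2 / μ := by positivity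
      have h2 : (μ / 2 * (2 : ℝ) ^ q - C' * g) ^ 2 / μ
          = μ / 4 * ((2 : ℝ) ^ q) ^ 2 + C' ^ 2 / μ * g ^ 2 - C' * g * (2 : ℝ) ^ q := by
        field_simp; ring
      linarith
    have e6 := mul_le_mul_of_nonneg_right e5 (mul_nonneg (wt_pos (s - 1) q).le (hb0 q t))
    calc _ = C' * g * (2 : ℝ) ^ q * (wt (s - 1) q * b q t) := by rw [hC']; ring
      _ ≤ _ := e6
      _ = _ := by ring
  have hFint : ∀ t ∈ Icc 0 T, ∑ q ∈ Q, wt (s - 1) q * ∫ r in (0 : ℝ)..t, F q r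
      ≤ μ / 4 * (∫ r in (0 : ℝ)..t, Z r) + ∫ r in (0 : ℝ)..t, k r * Y r := by
    intro t ht
    rw [← intervalIntegral.integral_const_mul, ← intervalIntegral.integral_add
      (hint (hZc.const_mul _) ht) (hint (f := fun r => k r * Y r) (hkc.mul hYc) ht)]
    simp only [← intervalIntegral.integral_const_mul]
    rw [← intervalIntegral.integral_finsetSum fun q _ => hint ((hFc q).const_mul _) ht]
    exact intervalIntegral.integral_mono_on ht.1
      (hint (continuousOn_finsetSum _ fun q _ => (hFc q).const_mul _) ht)
      (hint ((hZc.const_mul _).add (hkc.mul hYc)) ht) fun r _ => hFsum r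
  -- The viscous coefficient that remains after Young's inequality is 25/36 - 1/4 = 4/9.
  have hmain : ∀ t ∈ Icc 0 T, Y t + 4 / 9 * μ * (∫ r in (0 : ℝ)..t, Z r)
      ≤ Y 0 + ∫ r in (0 : ℝ)..t, k r * Y r := by
    intro t ht
    have h1 := Finset.sum_le_sum fun q (_ : q ∈ Q) =>
      mul_le_mul_of_nonneg_left (hblock q t ht) (wt_pos (s - 1) q).le
    simp only [mul_add, Finset.sum_add_distrib] at h1
    have h2 : ∑ q ∈ Q, wt (s - 1) q * (μ * (25 / 36) * ((2 : ℝ) ^ q) ^ 2 *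
        ∫ r in (0 : ℝ)..t, b q r) = 25 / 36 * μ * ∫ r in (0 : ℝ)..t, Z r := by
      rw [hZ, intervalIntegral.integral_finsetSum fun q _ => hint ((hbc q).const_mul _) ht,
        Finset.mul_sum]
      refine Finset.sum_congr rfl fun q _ => ?_
      rw [intervalIntegral.integral_const_mul, wt_add_two]
      ring
    rw [h2] at h1
    have h3 := hFint t ht
    linarith only [h1, h3]
  have hgron : ∀ t ∈ Icc 0 T, Y 0 + ∫ r in (0 : ℝ)..t, k r * Y r
      ≤ Y 0 * Real.exp (C' ^ 2 / μ ^ 2 * E) := by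
    intro t ht
    refine (integral_gronwall hYc hkc (fun t _ => hk0 t) (fun t ht => ?_) ht).trans ?_
    · refine le_trans (le_add_of_nonneg_right ?_) (hmain t ht)
      exact mul_nonneg (by positivity) (intervalIntegral.integral_nonneg ht.1 fun r _ => hZ0 r)
    · refine mul_le_mul_of_nonneg_left (Real.exp_le_exp.2 ?_) (hY0 0)
      rw [hk, intervalIntegral.integral_const_mul]
      have h1 := hx.energy_le hU ht
      have h2 := S.en_nonneg R (x t)
      have h3 : 0 ≤ ∫ r in (0 : ℝ)..t, S.gr R (x r) :=
        intervalIntegral.integral_nonneg ht.1 fun r _ => S.gr_nonneg _ _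
      have h4 : (∫ r in (0 : ℝ)..t, S.gr R (x r)) ≤ E / μ := by
        rw [le_div_iff₀ hμ]; nlinarith
      calc _ ≤ C' ^ 2 / μ * (E / μ) := by gcongr
        _ = _ := by field_simp
  have hTT : T ∈ Icc 0 T := ⟨hT, le_rfl⟩
  -- Initial value plus total forcing bounds block q at every time. Summed, the forcing contributes
  -- (μ/4) ∫ Z besides the Gronwall majorant; as 1/4 < 4/9, this is at most another copy of the
  -- final bound, which gives the factor 2.
  refine ⟨⟨fun q => b q 0 + ∫ r in (0 : ℝ)..T, F q r, fun q t ht => ?_, ?_⟩, fun t ht => ?_⟩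
  · have h1 := hblock q t ht
    have h2 : 0 ≤ ∫ r in (0 : ℝ)..t, b q r :=
      intervalIntegral.integral_nonneg ht.1 fun r _ => hb0 q r
    have h3 : 0 ≤ μ * (25 / 36) * ((2 : ℝ) ^ q) ^ 2 * ∫ r in (0 : ℝ)..t, b q r := by positivity
    have h4 : (∫ r in (0 : ℝ)..t, F q r) ≤ ∫ r in (0 : ℝ)..T, F q r :=
      intervalIntegral.integral_mono_interval le_rfl ht.1 ht.2
        (Eventually.of_forall fun r => hF0 q r) (hint (hFc q) hTT)
    exact (le_add_of_nonneg_right h3).trans (h1.trans (by linarith))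
  · simp only [mul_add, Finset.sum_add_distrib]
    have h1 := hFint T hTT
    have h2 := hmain T hTT
    have h3 := hgron T hTT
    have h4 := hY0 T
    have h5 : 0 ≤ ∫ r in (0 : ℝ)..T, Z r := intervalIntegral.integral_nonneg hT fun r _ => hZ0 r
    have h6 : 0 ≤ μ * ∫ r in (0 : ℝ)..T, Z r := by positivity
    change Y 0 + _ ≤ 2 * (Y 0 * _)
    linarith
  · have h2 := hmain t ht
    have h3 := hgron t ht
    have h5 : 0 ≤ ∫ r in (0 : ℝ)..t, Z r := intervalIntegral.integral_nonneg ht.1 fun r _ => hZ0 r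
    have h6 : 0 ≤ μ * ∫ r in (0 : ℝ)..t, Z r := by positivity
    change Y t + 1 / 4 * μ * (∫ r in (0 : ℝ)..t, Z r) ≤ Y 0 * _
    linarith

end Setting

/-! ### Limits of approximate solutions -/

lemma tendsto_integral_of_bounded {g : ℕ → ℝ → ℝ} {f : ℝ → ℝ} {t C : ℝ} (ht : 0 ≤ t)
    (hc : ∀ᶠ n in atTop, ContinuousOn (g n) (Icc 0 t))
    (hb : ∀ᶠ n in atTop, ∀ r ∈ Icc 0 t, |g n r| ≤ C)
    (hl : ∀ r ∈ Icc 0 t, Tendsto (fun n => g n r) atTop (𝓝 (f r))) :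
    Tendsto (fun n => ∫ r in (0 : ℝ)..t, g n r) atTop (𝓝 (∫ r in (0 : ℝ)..t, f r)) := by
  refine intervalIntegral.tendsto_integral_filter_of_dominated_convergence (fun _ => C) ?_ ?_
    intervalIntegrable_const ?_
  · filter_upwards [hc] with n hn
    rw [uIoc_of_le ht]
    exact (hn.mono Ioc_subset_Icc_self).aestronglyMeasurable measurableSet_Ioc
  · filter_upwards [hb] with n hn
    refine Eventually.of_forall fun r hr => ?_
    rw [uIoc_of_le ht] at hr
    exact hn r (Ioc_subset_Icc_self hr)
  · refine Eventually.of_forall fun r hr => ?_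
    rw [uIoc_of_le ht] at hr
    exact hl r (Ioc_subset_Icc_self hr)

/-- The mean value inequality is applied to r ↦ y n r - r f(t). Near t its derivative g n r - f(t)
is at most ε, half from uniform convergence and half from continuity of f. The estimate is uniform
in n and survives the limit. -/
lemma hasDerivWithinAt_of_tendstoUniformlyOn {y g : ℕ → ℝ → ℂ} {x f : ℝ → ℂ} {T : ℝ}
    (hy : ∀ᶠ n in atTop, ∀ t ∈ Icc 0 T, HasDerivWithinAt (y n) (g n t) (Icc 0 T) t)
    (hg : ∀ᶠ n in atTop, ContinuousOn (g n) (Icc 0 T))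
    (hgf : TendstoUniformlyOn g f atTop (Icc 0 T))
    (hyx : ∀ t ∈ Icc 0 T, Tendsto (fun n => y n t) atTop (𝓝 (x t))) {t : ℝ} (ht : t ∈ Icc 0 T) :
    HasDerivWithinAt x (f t) (Icc 0 T) t := by
  have hf : ContinuousOn f (Icc 0 T) := hgf.continuousOn hg.frequently
  rw [hasDerivWithinAt_iff_isLittleO, Asymptotics.isLittleO_iff]
  intro ε hε
  obtain ⟨η, hη, hη'⟩ := Metric.continuousWithinAt_iff.1 (hf t ht) (ε / 2) (by positivity)
  have hmem : Icc 0 T ∩ Metric.ball t η ∈ 𝓝[Icc 0 T] t :=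
    inter_mem_nhdsWithin _ (Metric.ball_mem_nhds t hη)
  filter_upwards [hmem] with r hr
  have hlim : Tendsto (fun n => ‖y n r - y n t - (r - t) • f t‖) atTop
      (𝓝 ‖x r - x t - (r - t) • f t‖) :=
    (((hyx r hr.1).sub (hyx t ht)).sub_const _).norm
  refine le_of_tendsto hlim ?_
  filter_upwards [hy, Metric.tendstoUniformlyOn_iff.1 hgf (ε / 2) (by positivity)] with n hn1 hn2
  have hconv : Convex ℝ (Icc 0 T ∩ Metric.ball t η) := (convex_Icc 0 T).inter (convex_ball t η)
  have h1 := hconv.norm_image_sub_le_of_norm_hasDerivWithin_le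
    (f := fun r => y n r - r • f t) (f' := fun r => g n r - f t) (C := ε)
    (fun r hr => by
      have := ((hn1 r hr.1).mono inter_subset_left).sub
        (((hasDerivWithinAt_id r (Icc 0 T ∩ Metric.ball t η))).smul_const (f t))
      exact this.congr_deriv (by rw [one_smul]))
    (fun r hr => by
      have e1 := hn2 r hr.1
      have e2 := hη' hr.1 hr.2
      rw [dist_comm] at e1
      rw [← dist_eq_norm]
      exact (dist_triangle _ (f r) _).trans (by linarith)) ⟨ht, Metric.mem_ball_self hη⟩ hr
  calc ‖y n r - y n t - (r - t) • f t‖ = ‖y n r - r • f t - (y n t - t • f t)‖ := by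
        congr 1; rw [sub_smul]; ring
    _ ≤ _ := h1

namespace Setting

variable {N : ℕ} (S : Setting N)

lemma conv_le {f g : Idx N → ℝ} {F G : ℝ} (hF : 0 ≤ F) (hG : 0 ≤ G)
    (hf : ∀ s : Finset (Idx N), ∑ i ∈ s, f i ^ 2 ≤ F ^ 2)
    (hg : ∀ s : Finset (Idx N), ∑ i ∈ s, g i ^ 2 ≤ G ^ 2) (i : Idx N) : S.conv f g i ≤ F * G := by
  classical
  refine hasSum_le_of_sum_le (S.summable_conv (summable_of_sum_le (fun _ => sq_nonneg _) hf)
    (summable_of_sum_le (fun _ => sq_nonneg _) hg) i).hasSum fun s => ?_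
  rw [← Finset.sum_filter]
  set s' := s.filter (S.Res i.2)
  refine (Real.sum_mul_le_sqrt_mul_sqrt _ _ _).trans ?_
  have h1 := hf (s'.image fun k => ((i.1, k) : Idx N))
  have h2 := hg (s'.image fun k => ((i.1, i.2 - k) : Idx N))
  rw [Finset.sum_image fun k _ k' _ h => by simpa using h] at h1 h2
  exact mul_le_mul (Real.sqrt_le_iff.2 ⟨hF, h1⟩) (Real.sqrt_le_iff.2 ⟨hG, h2⟩)
    (Real.sqrt_nonneg _) hF

lemma norm_burgers_le_mul {x y : Idx N → ℂ} {F G : ℝ} (hF : 0 ≤ F) (hG : 0 ≤ G)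
    (hx : ∀ s : Finset (Idx N), ∑ i ∈ s, ‖x i‖ ^ 2 ≤ F ^ 2)
    (hy : ∀ s : Finset (Idx N), ∑ i ∈ s, ‖y i‖ ^ 2 ≤ G ^ 2) (i : Idx N) :
    ‖S.burgers x y i‖ ≤ |S.gam| * (S.wabs i.2 * (F * G)) := by
  refine (S.norm_burgers_le (summable_of_sum_le (fun _ => sq_nonneg _) hx)
    (summable_of_sum_le (fun _ => sq_nonneg _) hy) i).trans ?_
  exact mul_le_mul_of_nonneg_left (mul_le_mul_of_nonneg_left (S.conv_le hF hG hx hy i)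
    (S.wabs_nonneg _)) (abs_nonneg _)

lemma norm_burgers_sub_le {x y : Idx N → ℂ} {M δ : ℝ} (hM : 0 ≤ M) (hδ : 0 ≤ δ)
    (hx : ∀ s : Finset (Idx N), ∑ i ∈ s, ‖x i‖ ^ 2 ≤ M ^ 2)
    (hy : ∀ s : Finset (Idx N), ∑ i ∈ s, ‖y i‖ ^ 2 ≤ M ^ 2)
    (hw : ∀ s : Finset (Idx N), ∑ i ∈ s, ‖x i - y i‖ ^ 2 ≤ δ ^ 2) (i : Idx N) :
    ‖S.burgers x x i - S.burgers y y i‖ ≤ |S.gam| * (S.wabs i.2 * (2 * M * δ)) := by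
  have h := S.burgers_sub_burgers (summable_of_sum_le (fun _ => sq_nonneg _) hx)
    (summable_of_sum_le (fun _ => sq_nonneg _) hy) (summable_of_sum_le (fun _ => sq_nonneg _) hw) i
  rw [h]
  refine (norm_add_le _ _).trans ?_
  have h1 := S.norm_burgers_le_mul hM hδ hx hw i
  have h2 := S.norm_burgers_le_mul hδ hM hw hy i
  refine (add_le_add h1 h2).trans (le_of_eq ?_)
  ring

lemma continuousOn_burgers {R : ℝ} {x : ℝ → Idx N → ℂ} (hx : ∀ t, ∀ i, i ∉ S.ball R → x t i = 0)
    {I : Set ℝ} (hc : ∀ i, ContinuousOn (fun t => x t i) I) (i : Idx N) :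
    ContinuousOn (fun t => S.burgers (x t) (x t) i) I := by
  classical
  have h : ∀ t, S.burgers (x t) (x t) i
      = Complex.I * ((S.gam * (((i.1 : ℤ) : ℝ) * S.lam i.2) : ℝ) : ℂ)
        * ∑ k ∈ (S.ball R).image Prod.snd,
          if S.Res i.2 k then x t (i.1, k) * x t (i.1, i.2 - k) else 0 := by
    intro t
    rw [burgers, tsum_eq_sum]
    intro k hk
    have : x t (i.1, k) = 0 := hx t _ fun h => hk (Finset.mem_image_of_mem Prod.snd h)
    simp [this]
  simp only [h]
  refine continuousOn_const.mul (continuousOn_finsetSum _ fun k _ => ?_)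
  split_ifs
  · exact (hc _).mul (hc _)
  · exact continuousOn_const

variable {S} in
lemma Galerkin.mono {U : ℝ → State N} {μ R T T' : ℝ} {x : ℝ → Idx N → ℂ} (hx : S.Galerkin U μ R T' x)
    (h : T ≤ T') : S.Galerkin U μ R T x where
  supp := hx.supp
  real t ht := hx.real t ⟨ht.1, ht.2.trans h⟩
  deriv i hi t ht := (hx.deriv i hi t ⟨ht.1, ht.2.trans h⟩).mono (Icc_subset_Icc_right h)

variable {S} in
lemma Galerkin.continuousOn_truncRhs {U : ℝ → State N} {μ R T : ℝ} {x : ℝ → Idx N → ℂ}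
    (hx : S.Galerkin U μ R T x) (hUc : ∀ n, ContinuousOn (fun t => (U t).hat n) (Ici 0)) (i : Idx N) :
    ContinuousOn (fun t => S.truncRhs (U t) μ R (x t) i) (Icc 0 T) := by
  refine ((ContinuousOn.neg (continuousOn_finsetSum _ fun j _ => ?_)).sub
    (S.continuousOn_burgers hx.supp hx.continuousOn i)).sub ((hx.continuousOn i).const_mul _)
  exact ((S.continuousOn_couple hUc i j).mono Icc_subset_Ici_self).mul (hx.continuousOn j)

lemma exists_subset_ball (A : Finset (Idx N)) (hA : ∀ i ∈ A, i.2 ≠ 0) : ∃ R, A ⊆ S.ball R := by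
  refine ⟨∑ i ∈ A, S.wabs i.2, fun i hi => S.mem_ball.2 ⟨hA i hi, ?_⟩⟩
  exact Finset.single_le_sum (f := fun i : Idx N => S.wabs i.2) (fun i _ => S.wabs_nonneg _) hi

/-- A bound over all balls is a bound over all finite sets. -/
lemma sum_le_of_ball {x : Idx N → ℂ} (hx : ∀ i : Idx N, i.2 = 0 → x i = 0) {w : Idx N → ℝ}
    (hw : ∀ i, 0 ≤ w i) {E : ℝ} (hE : ∀ R, ∑ i ∈ S.ball R, w i * ‖x i‖ ^ 2 ≤ E)
    (A : Finset (Idx N)) : ∑ i ∈ A, w i * ‖x i‖ ^ 2 ≤ E := by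
  classical
  obtain ⟨R, hR⟩ := S.exists_subset_ball (A.filter fun i => i.2 ≠ 0)
    fun i hi => (Finset.mem_filter.1 hi).2
  refine le_trans (le_of_eq ?_) ((Finset.sum_le_sum_of_subset_of_nonneg hR
    fun i _ _ => mul_nonneg (hw i) (sq_nonneg _)).trans (hE R))
  rw [Finset.sum_filter]
  refine Finset.sum_congr rfl fun i _ => ?_
  split_ifs with h
  · rfl
  · simp [hx i (not_not.1 h)]

lemma sum_sq_le_of_en {x : Idx N → ℂ} (hx : ∀ i : Idx N, i.2 = 0 → x i = 0) {E : ℝ}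
    (hE : ∀ R, S.en R x ≤ E) (A : Finset (Idx N)) : ∑ i ∈ A, ‖x i‖ ^ 2 ≤ E := by
  have := S.sum_le_of_ball hx (w := fun _ => 1) (fun _ => zero_le_one) (E := E)
    (fun R => by simpa [en] using hE R) A
  simpa using this

lemma tendsto_en {x : Idx N → ℂ} (hx : ∀ i : Idx N, i.2 = 0 → x i = 0)
    (hs : Summable fun i => ‖x i‖ ^ 2) :
    Tendsto (fun n : ℕ => S.en (n + 1) x) atTop (𝓝 (∑' i, ‖x i‖ ^ 2)) := by
  classical
  have hle : ∀ R, S.en R x ≤ ∑' i, ‖x i‖ ^ 2 := fun R =>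
    hs.sum_le_tsum _ fun _ _ => sq_nonneg _
  refine tendsto_order.2 ⟨fun a ha => ?_, fun a ha => Eventually.of_forall fun n =>
    (hle _).trans_lt ha⟩
  by_contra hcon
  rw [not_eventually] at hcon
  refine absurd (hs.tsum_le_of_sum_le (S.sum_sq_le_of_en hx (E := a) fun R => ?_)) (not_le.2 ha)
  obtain ⟨n, hn, hn'⟩ := (frequently_atTop.1 hcon) ⌈R⌉₊
  refine le_trans ?_ (not_lt.1 hn')
  refine Finset.sum_le_sum_of_subset_of_nonneg (fun i hi => S.ball_mono ?_ hi)
    fun _ _ _ => sq_nonneg _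
  have h1 : R ≤ ⌈R⌉₊ := Nat.le_ceil R
  have h2 : (⌈R⌉₊ : ℝ) ≤ n := by exact_mod_cast hn
  linarith

end Setting

namespace Setting

variable {N : ℕ} (S : Setting N)

/-! ### The limit of the truncated solutions -/

/-- The data of a sequence of truncated solutions converging on bounded time intervals. -/
structure Approx (U : ℝ → State N) (μ E : ℝ) (x₀ : Idx N → ℂ) (y : ℕ → ℝ → Idx N → ℂ)
    (δ : ℕ → ℝ) (x : ℝ → Idx N → ℂ) : Prop where
  galerkin : ∀ n : ℕ, S.Galerkin U μ (n + 1) (n + 1) (y n)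
  init : ∀ n : ℕ, ∀ i ∈ S.ball (n + 1), y n 0 i = x₀ i
  en_init : ∀ n : ℕ, S.en (n + 1) (y n 0) ≤ E
  delta_nonneg : ∀ n, 0 ≤ δ n
  delta_tendsto : Tendsto δ atTop (𝓝 0)
  close : ∀ n : ℕ, ∀ t ∈ Icc (0 : ℝ) (n + 1), ∀ A : Finset (Idx N),
    ∑ i ∈ A, ‖x t i - y n t i‖ ^ 2 ≤ δ n ^ 2
  tendsto : ∀ t, 0 ≤ t → ∀ i, Tendsto (fun n => y n t i) atTop (𝓝 (x t i))

/-- The comparison of truncations makes the sequence Cauchy, with squared error composed of the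
initial energy beyond radius n + 1 and a term of order (n + 1)^{-1/4}. Because that comparison is
uniform in T, the time horizon can grow together with the cut-off radius. -/
lemma exists_approx {U : ℝ → State N} (hU : ∀ t, 0 ≤ t → U t ∈ S.nullA)
    (hUc : ∀ n, ContinuousOn (fun t => (U t).hat n) (Ici 0)) {μ : ℝ} (hμ : 0 < μ)
    {x₀ : Idx N → ℂ} (hx₀ : IsReal x₀) (hz : ∀ i : Idx N, i.2 = 0 → x₀ i = 0)
    (hs : Summable fun i => ‖x₀ i‖ ^ 2) :
    ∃ y δ x, S.Approx U μ (∑' i, ‖x₀ i‖ ^ 2) x₀ y δ x := by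
  classical
  set E := ∑' i, ‖x₀ i‖ ^ 2 with hE
  have hE0 : 0 ≤ E := tsum_nonneg fun _ => sq_nonneg _
  obtain ⟨C₁, C₂, hC₁, hC₂, hcmp⟩ := S.exists_galerkin_sub_le
  choose y hy hy0 using fun n : ℕ =>
    S.exists_galerkin hU hUc hμ.le ((n : ℝ) + 1) (T := (n : ℝ) + 1) (by positivity) hx₀
  have hen : ∀ n : ℕ, S.en (n + 1) (y n 0) = S.en (n + 1) x₀ := fun n =>
    Finset.sum_congr rfl fun i hi => by rw [hy0 n i hi]
  have henle : ∀ R, S.en R x₀ ≤ E := fun R => hs.sum_le_tsum _ fun _ _ => sq_nonneg _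
  set M := √E with hM
  have hM2 : M ^ 2 = E := Real.sq_sqrt hE0
  set d : ℕ → ℝ := fun n => (E - S.en (n + 1) x₀ + C₁ * μ * M * ((n : ℝ) + 1) ^ (-(1 / 4) : ℝ))
    * Real.exp (C₂ * M ^ 2 / μ ^ 2) with hd
  have hd0 : ∀ n, 0 ≤ d n := fun n => by
    have h1 := henle (n + 1)
    have h2 : (0 : ℝ) ≤ ((n : ℝ) + 1) ^ (-(1 / 4) : ℝ) := by positivity
    refine mul_nonneg (add_nonneg (sub_nonneg.2 h1) (by positivity)) (Real.exp_pos _).le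
  have hdt : Tendsto d atTop (𝓝 0) := by
    have h1 := (S.tendsto_en hz hs).const_sub E
    have h2 : Tendsto (fun n : ℕ => ((n : ℝ) + 1) ^ (-(1 / 4) : ℝ)) atTop (𝓝 0) :=
      (tendsto_rpow_neg_atTop (by norm_num : (0 : ℝ) < 1 / 4)).comp
        (tendsto_atTop_add_const_right _ _ tendsto_natCast_atTop_atTop)
    have h3 := (h1.add (h2.const_mul (C₁ * μ * M))).mul_const (Real.exp (C₂ * M ^ 2 / μ ^ 2))
    convert h3 using 2
    ring
  have hclose : ∀ n m : ℕ, n ≤ m → ∀ t ∈ Icc (0 : ℝ) (n + 1), ∀ A : Finset (Idx N),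
      ∑ i ∈ A, ‖y m t i - y n t i‖ ^ 2 ≤ d n := by
    intro n m hnm t ht A
    have hR : (n : ℝ) + 1 ≤ m + 1 := by
      have : (n : ℝ) ≤ m := by exact_mod_cast hnm
      linarith
    have h1 := hcmp U μ (n + 1) (m + 1) (n + 1) M (y n) (y m) hU hμ (by positivity) hR
      (Real.sqrt_nonneg _) (hy n) ((hy m).mono hR) (by rw [hM2, hen]; exact henle _)
      (by rw [hM2, hen]; exact henle _) t ht
    have hsupp : ∀ t, ∀ i, i ∉ S.ball ((m : ℝ) + 1) → (y m t - y n t) i = 0 := fun t i hi => by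
      rw [Pi.sub_apply, (hy m).supp t i hi, (hy n).supp t i fun h => hi (S.ball_mono hR h), sub_zero]
    refine (S.sum_le_en (hsupp t) A).trans (h1.trans ?_)
    refine mul_le_mul_of_nonneg_right (add_le_add_left ?_ _) (Real.exp_pos _).le
    -- The initial difference of the two truncations is the part of x₀ lying in the larger ball but
    -- outside the smaller one.
    have h2 : S.en (m + 1) (y m 0 - y n 0) + S.en (n + 1) x₀ = S.en (m + 1) x₀ := by
      have e1 : S.en (n + 1) x₀
          = ∑ i ∈ S.ball ((m : ℝ) + 1), if i ∈ S.ball ((n : ℝ) + 1) then ‖x₀ i‖ ^ 2 else 0 := by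
        rw [← Finset.sum_filter, en]
        refine Finset.sum_congr ?_ fun _ _ => rfl
        ext i
        rw [Finset.mem_filter]
        exact ⟨fun h => ⟨S.ball_mono hR h, h⟩, fun h => h.2⟩
      rw [e1, en, en, ← Finset.sum_add_distrib]
      refine Finset.sum_congr rfl fun i hi => ?_
      rw [Pi.sub_apply, hy0 m i hi]
      split_ifs with h
      · rw [hy0 n i h, sub_self, norm_zero]; ring
      · rw [(hy n).supp 0 i h, sub_zero, add_zero]
    linarith [henle (m + 1)]
  have hcauchy : ∀ t, 0 ≤ t → ∀ i, ∃ l, Tendsto (fun n => y n t i) atTop (𝓝 l) := by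
    intro t ht i
    refine cauchySeq_tendsto_of_complete (Metric.cauchySeq_iff'.2 fun ε hε => ?_)
    have h1 : ∀ᶠ n in atTop, d n < ε ^ 2 := hdt.eventually_lt_const (by positivity)
    have h2 : ∀ᶠ n : ℕ in atTop, t ≤ n := tendsto_natCast_atTop_atTop.eventually_ge_atTop t
    obtain ⟨n, hn1, hn2⟩ := (h1.and h2).exists
    refine ⟨n, fun m hm => ?_⟩
    have h3 := hclose n m hm t ⟨ht, by linarith⟩ {i}
    rw [Finset.sum_singleton] at h3
    rw [dist_eq_norm]
    exact lt_of_pow_lt_pow_left₀ 2 hε.le (h3.trans_lt hn1)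
  choose! x hx using hcauchy
  refine ⟨y, fun n => √(d n), x, hy, hy0, fun n => (hen n).trans_le (henle _),
    fun n => Real.sqrt_nonneg _, ?_, fun n t ht A => ?_, hx⟩
  · simpa using hdt.sqrt
  · rw [Real.sq_sqrt (hd0 n)]
    have h1 : Tendsto (fun m => ∑ i ∈ A, ‖y m t i - y n t i‖ ^ 2) atTop
        (𝓝 (∑ i ∈ A, ‖x t i - y n t i‖ ^ 2)) :=
      tendsto_finsetSum _ fun i _ => (((hx t ht.1 i).sub_const _).norm.pow 2)
    refine le_of_tendsto h1 ?_
    filter_upwards [eventually_ge_atTop n] with m hm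
    exact hclose n m hm t ht A

/-- The right-hand side of the averaged system in acoustic coordinates. -/
def rhs (U : State N) (μ : ℝ) (x : Idx N → ℂ) (i : Idx N) : ℂ :=
  -(∑' j, S.couple U i j * x j) - S.burgers x x i - ((μ * S.wabs i.2 ^ 2 : ℝ) : ℂ) * x i

lemma rhs_eq (U : State N) (μ : ℝ) (x : Idx N → ℂ) {R : ℝ} {i : Idx N} (hi : S.wabs i.2 ≤ R) :
    S.rhs U μ x i = S.truncRhs U μ R x i := by
  rw [rhs, truncRhs, S.tsum_couple_eq U x hi]

variable {S} {U : ℝ → State N} {μ E : ℝ} {x₀ : Idx N → ℂ} {y : ℕ → ℝ → Idx N → ℂ} {δ : ℕ → ℝ}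
  {x : ℝ → Idx N → ℂ}

lemma Approx.apply_zero (h : S.Approx U μ E x₀ y δ x) (hz : ∀ i : Idx N, i.2 = 0 → x₀ i = 0) :
    x 0 = x₀ := by
  funext i
  refine tendsto_nhds_unique (h.tendsto 0 le_rfl i) (tendsto_const_nhds.congr' ?_)
  filter_upwards [tendsto_natCast_atTop_atTop.eventually_ge_atTop (S.wabs i.2)] with n hn
  by_cases hi : i.2 = 0
  · rw [hz i hi, (h.galerkin n).supp 0 i fun h => (S.mem_ball.1 h).1 hi]
  · rw [h.init n i (S.mem_ball.2 ⟨hi, by linarith⟩)]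

lemma Approx.eq_zero (h : S.Approx U μ E x₀ y δ x) {t : ℝ} (ht : 0 ≤ t) {i : Idx N} (hi : i.2 = 0) :
    x t i = 0 := by
  refine tendsto_nhds_unique (h.tendsto t ht i) (tendsto_const_nhds.congr fun n => ?_)
  rw [(h.galerkin n).supp t i fun h => (S.mem_ball.1 h).1 hi]

lemma eventually_mem_Icc {t : ℝ} (ht : 0 ≤ t) : ∀ᶠ n : ℕ in atTop, t ∈ Icc (0 : ℝ) (n + 1) := by
  filter_upwards [tendsto_natCast_atTop_atTop.eventually_ge_atTop t] with n hn
  exact ⟨ht, by linarith⟩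

lemma Approx.isReal (h : S.Approx U μ E x₀ y δ x) {t : ℝ} (ht : 0 ≤ t) : IsReal (x t) := by
  intro i
  refine tendsto_nhds_unique (h.tendsto t ht i.flip)
    (((Complex.continuous_conj.tendsto _).comp (h.tendsto t ht i)).congr' ?_)
  filter_upwards [eventually_mem_Icc ht] with n hn
  exact ((h.galerkin n).real t hn i).symm

lemma Approx.sum_approx_le (h : S.Approx U μ E x₀ y δ x) (hU : ∀ t, 0 ≤ t → U t ∈ S.nullA)
    (hμ : 0 ≤ μ) (n : ℕ) {t : ℝ} (ht : t ∈ Icc (0 : ℝ) (n + 1)) (A : Finset (Idx N)) :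
    ∑ i ∈ A, ‖y n t i‖ ^ 2 ≤ E := by
  have h1 := (h.galerkin n).energy_le hU ht
  have h2 : 0 ≤ ∫ r in (0 : ℝ)..t, S.gr (n + 1) (y n r) :=
    intervalIntegral.integral_nonneg ht.1 fun r _ => S.gr_nonneg _ _
  have h3 : 0 ≤ 2 * μ * ∫ r in (0 : ℝ)..t, S.gr (n + 1) (y n r) := by positivity
  exact (S.sum_le_en ((h.galerkin n).supp t) A).trans (by linarith [h.en_init n])

lemma Approx.sum_le (h : S.Approx U μ E x₀ y δ x) (hU : ∀ t, 0 ≤ t → U t ∈ S.nullA)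
    (hμ : 0 ≤ μ) {t : ℝ} (ht : 0 ≤ t) (A : Finset (Idx N)) : ∑ i ∈ A, ‖x t i‖ ^ 2 ≤ E := by
  refine le_of_tendsto (tendsto_finsetSum A fun i _ => (h.tendsto t ht i).norm.pow 2) ?_
  filter_upwards [eventually_mem_Icc ht] with n hn
  exact h.sum_approx_le hU hμ n hn A

/-- For fixed R only finitely many coordinates are involved. They converge with uniform bounds, and
the truncated energies at larger radii dominate theirs. -/
lemma Approx.energy_le (h : S.Approx U μ E x₀ y δ x) (hU : ∀ t, 0 ≤ t → U t ∈ S.nullA)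
    (hμ : 0 ≤ μ) {t : ℝ} (ht : 0 ≤ t) (R : ℝ) :
    S.en R (x t) + 2 * μ * ∫ r in (0 : ℝ)..t, S.gr R (x r) ≤ E := by
  have h1 : Tendsto (fun n => S.en R (y n t)) atTop (𝓝 (S.en R (x t))) :=
    tendsto_finsetSum _ fun i _ => (h.tendsto t ht i).norm.pow 2
  have h2 : Tendsto (fun n => ∫ r in (0 : ℝ)..t, S.gr R (y n r)) atTop
      (𝓝 (∫ r in (0 : ℝ)..t, S.gr R (x r))) := by
    refine tendsto_integral_of_bounded (C := R ^ 2 * E) ht ?_ ?_ fun r hr =>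
      tendsto_finsetSum _ fun i _ => ((h.tendsto r hr.1 i).norm.pow 2).const_mul _
    · filter_upwards [eventually_mem_Icc ht] with n hn
      exact ((h.galerkin n).continuousOn_gr R).mono (Icc_subset_Icc_right hn.2)
    · filter_upwards [eventually_mem_Icc ht] with n hn r hr
      rw [abs_of_nonneg (S.gr_nonneg _ _)]
      have := h.sum_approx_le hU hμ n ⟨hr.1, hr.2.trans hn.2⟩ (S.ball R)
      refine le_trans ?_ (mul_le_mul_of_nonneg_left this (sq_nonneg R))
      rw [gr, Finset.mul_sum]
      refine Finset.sum_le_sum fun i hi => mul_le_mul_of_nonneg_right ?_ (sq_nonneg _)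
      exact pow_le_pow_left₀ (S.wabs_nonneg _) (S.mem_ball.1 hi).2 2
  refine le_of_tendsto (h1.add (h2.const_mul (2 * μ))) ?_
  filter_upwards [eventually_mem_Icc ht,
    tendsto_natCast_atTop_atTop.eventually_ge_atTop R] with n hn hR
  have h3 := (h.galerkin n).energy_le hU hn
  have h4 : ∀ r, S.gr R (y n r) ≤ S.gr (n + 1) (y n r) := fun r =>
    Finset.sum_le_sum_of_subset_of_nonneg (fun i hi => S.ball_mono (by linarith) hi)
      fun _ _ _ => by positivity
  have h5 : (∫ r in (0 : ℝ)..t, S.gr R (y n r)) ≤ ∫ r in (0 : ℝ)..t, S.gr (n + 1) (y n r) :=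
    intervalIntegral.integral_mono_on ht
      ((((h.galerkin n).continuousOn_gr R).mono (Icc_subset_Icc_right hn.2)).intervalIntegrable_of_Icc
        ht)
      ((((h.galerkin n).continuousOn_gr _).mono (Icc_subset_Icc_right hn.2)).intervalIntegrable_of_Icc
        ht) fun r _ => h4 r
  have h6 : S.en R (y n t) ≤ S.en (n + 1) (y n t) := S.sum_le_en ((h.galerkin n).supp t) _
  have h7 := mul_le_mul_of_nonneg_left h5 (by positivity : 0 ≤ 2 * μ)
  linarith [h.en_init n]

/-- At a fixed index the right-hand side is Lipschitz on bounded sets of ℓ²: the coupling sum is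
finite with coefficients bounded in time, the Burgers term is a bounded bilinear form, and viscosity
is a multiplication. So the equations converge uniformly in time at the rate δ n. -/
lemma Approx.hasDerivWithinAt (h : S.Approx U μ E x₀ y δ x) (hU : ∀ t, 0 ≤ t → U t ∈ S.nullA)
    (hUc : ∀ n, ContinuousOn (fun t => (U t).hat n) (Ici 0)) (hμ : 0 ≤ μ) {t : ℝ} (ht : 0 ≤ t)
    {i : Idx N} (hi : i.2 ≠ 0) :
    HasDerivWithinAt (fun t => x t i) (S.rhs (U t) μ (x t) i) (Ici 0) t := by
  have hE0 : 0 ≤ E := (S.en_nonneg _ _).trans (h.en_init 0)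
  -- The extra unit of time makes [0, T] a neighbourhood of t in [0, ∞).
  set T := t + 1 with hT
  have htT : t ∈ Icc 0 T := ⟨ht, by linarith⟩
  have hev : ∀ᶠ n : ℕ in atTop, T ≤ n + 1 ∧ S.wabs i.2 ≤ n + 1 := by
    filter_upwards [tendsto_natCast_atTop_atTop.eventually_ge_atTop (max T (S.wabs i.2))] with n hn
    exact ⟨by linarith [le_max_left T (S.wabs i.2)], by linarith [le_max_right T (S.wabs i.2)]⟩
  have hK : ∀ j, ∃ K, ∀ r ∈ Icc 0 T, ‖S.couple (U r) i j‖ ≤ K := fun j =>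
    isCompact_Icc.exists_bound_of_continuousOn
      ((S.continuousOn_couple hUc i j).mono Icc_subset_Ici_self)
  choose K hK using hK
  have hmain : HasDerivWithinAt (fun t => x t i) (S.rhs (U t) μ (x t) i) (Icc 0 T) t := by
    refine hasDerivWithinAt_of_tendstoUniformlyOn (y := fun n t => y n t i)
      (g := fun n t => S.truncRhs (U t) μ (n + 1) (y n t) i)
      (x := fun t => x t i) (f := fun t => S.rhs (U t) μ (x t) i) ?_ ?_ ?_
      (fun r hr => h.tendsto r hr.1 i) htT
    · filter_upwards [hev] with n hn r hr
      exact ((h.galerkin n).mono hn.1).deriv i (S.mem_ball.2 ⟨hi, hn.2⟩) r hr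
    · filter_upwards [hev] with n hn
      exact ((h.galerkin n).mono hn.1).continuousOn_truncRhs hUc i
    · set L : ℝ := (∑ j ∈ S.ball (S.wabs i.2), K j) + |S.gam| * (S.wabs i.2 * (2 * √E))
        + μ * S.wabs i.2 ^ 2 with hL
      have hbound : ∀ᶠ n : ℕ in atTop, ∀ r ∈ Icc 0 T,
          ‖S.rhs (U r) μ (x r) i - S.truncRhs (U r) μ (n + 1) (y n r) i‖ ≤ L * δ n := by
        filter_upwards [hev] with n hn r hr
        have hr' : r ∈ Icc (0 : ℝ) (n + 1) := ⟨hr.1, hr.2.trans hn.1⟩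
        have hc := h.close n r hr'
        have hci : ∀ j, ‖x r j - y n r j‖ ≤ δ n := fun j => by
          have := hc {j}
          rw [Finset.sum_singleton] at this
          exact le_of_sq_le_sq this (h.delta_nonneg n)
        have hsE : √E ^ 2 = E := Real.sq_sqrt hE0
        have hb := S.norm_burgers_sub_le (Real.sqrt_nonneg E) (h.delta_nonneg n)
          (by rw [hsE]; exact h.sum_le hU hμ hr.1) (by rw [hsE]; exact h.sum_approx_le hU hμ n hr')
          hc i
        rw [← S.rhs_eq (U r) μ (y n r) hn.2, S.rhs_eq _ _ _ le_rfl, S.rhs_eq _ _ _ le_rfl]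
        have e1 : S.truncRhs (U r) μ (S.wabs i.2) (x r) i - S.truncRhs (U r) μ (S.wabs i.2) (y n r) i
            = -(∑ j ∈ S.ball (S.wabs i.2), S.couple (U r) i j * (x r j - y n r j))
              - (S.burgers (x r) (x r) i - S.burgers (y n r) (y n r) i)
              - ((μ * S.wabs i.2 ^ 2 : ℝ) : ℂ) * (x r i - y n r i) := by
          simp only [truncRhs, mul_sub, Finset.sum_sub_distrib]
          ring
        have e2 : ‖∑ j ∈ S.ball (S.wabs i.2), S.couple (U r) i j * (x r j - y n r j)‖
            ≤ (∑ j ∈ S.ball (S.wabs i.2), K j) * δ n := by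
          rw [Finset.sum_mul]
          refine norm_sum_le_of_le _ fun j _ => ?_
          rw [norm_mul]
          exact mul_le_mul (hK j r hr) (hci j) (norm_nonneg _)
            ((norm_nonneg _).trans (hK j r hr))
        have e3 : ‖((μ * S.wabs i.2 ^ 2 : ℝ) : ℂ) * (x r i - y n r i)‖
            ≤ μ * S.wabs i.2 ^ 2 * δ n := by
          rw [norm_mul, Complex.norm_real, Real.norm_of_nonneg (by positivity)]
          exact mul_le_mul_of_nonneg_left (hci i) (by positivity)
        rw [e1]
        refine (norm_sub_le _ _).trans ((add_le_add ((norm_sub_le _ _).trans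
          (add_le_add ((norm_neg _).trans_le e2) hb)) e3).trans (le_of_eq ?_))
        rw [hL]; ring
      refine Metric.tendstoUniformlyOn_iff.2 fun ε hε => ?_
      have h0 : Tendsto (fun n => L * δ n) atTop (𝓝 0) := by
        simpa using h.delta_tendsto.const_mul L
      filter_upwards [hbound, h0.eventually_lt_const hε] with n hn1 hn2 r hr
      rw [dist_eq_norm]
      exact (hn1 r hr).trans_lt hn2
  refine hmain.mono_of_mem_nhdsWithin ?_
  refine mem_nhdsWithin.2 ⟨Iio T, isOpen_Iio, by simp [hT], fun r hr => ⟨hr.2, hr.1.le⟩⟩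

end Setting

/-! ### Besov bounds for the limit -/

namespace Setting

variable {N : ℕ} (S : Setting N) (χ : DyadicCutoff)

lemma bn_le_of_norm_le {x y : Idx N → ℂ} (h : ∀ i, ‖x i‖ ≤ ‖y i‖) (q : ℤ) :
    S.bn χ q x ≤ S.bn χ q y := by
  refine Real.sqrt_le_sqrt (Finset.sum_le_sum fun i _ => ?_)
  exact mul_le_mul_of_nonneg_left (pow_le_pow_left₀ (norm_nonneg _) (h i) 2) (sq_nonneg _)

lemma exists_bn_le : ∃ M : ℝ, 0 < M ∧ ∀ (q : ℤ) (x : Idx N → ℂ) (E : ℝ),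
    (∀ A : Finset (Idx N), ∑ i ∈ A, ‖x i‖ ^ 2 ≤ E) → S.bn χ q x ≤ M * √E := by
  obtain ⟨M, hM, hMb⟩ := χ.exists_bound
  refine ⟨M, hM, fun q x E hE => ?_⟩
  have h1 : M * √E = √(M ^ 2 * E) := by
    rw [Real.sqrt_mul (sq_nonneg M), Real.sqrt_sq hM.le]
  rw [h1]
  refine Real.sqrt_le_sqrt (le_trans ?_ (mul_le_mul_of_nonneg_left
    (hE (S.ball (12 / 5 * (2 : ℝ) ^ q))) (sq_nonneg M)))
  rw [Finset.mul_sum]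
  refine Finset.sum_le_sum fun i _ => mul_le_mul_of_nonneg_right ?_ (sq_nonneg _)
  rw [← sq_abs]
  exact pow_le_pow_left₀ (abs_nonneg _) (hMb _) 2

variable {S χ} {U : ℝ → State N} {μ E : ℝ} {x₀ : Idx N → ℂ} {y : ℕ → ℝ → Idx N → ℂ} {δ : ℕ → ℝ}
  {x : ℝ → Idx N → ℂ}

lemma Approx.tendsto_bn (h : S.Approx U μ E x₀ y δ x) (q : ℤ) {t : ℝ} (ht : 0 ≤ t) :
    Tendsto (fun n => S.bn χ q (y n t)) atTop (𝓝 (S.bn χ q (x t))) :=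
  (tendsto_finsetSum _ fun i _ => ((h.tendsto t ht i).norm.pow 2).const_mul _).sqrt

lemma Approx.norm_init_le (h : S.Approx U μ E x₀ y δ x) (n : ℕ) (i : Idx N) :
    ‖y n 0 i‖ ≤ ‖x₀ i‖ := by
  by_cases hi : i ∈ S.ball (n + 1)
  · rw [h.init n i hi]
  · rw [(h.galerkin n).supp 0 i hi, norm_zero]; positivity

-- For finitely many blocks both bounds pass to the limit, by pointwise and dominated convergence.
-- In the second one every block is evaluated at a time of its own, which encodes the sum over q of
-- the suprema in time.
variable (S χ) in
lemma exists_approx_besov_le {s : ℝ} (hs : 1 ≤ s) : ∃ C : ℝ, 0 < C ∧ ∀ (U : ℝ → State N) (μ E : ℝ)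
    (x₀ : Idx N → ℂ) (y : ℕ → ℝ → Idx N → ℂ) (δ : ℕ → ℝ) (x : ℝ → Idx N → ℂ) (B₀ : ℝ),
    (∀ t, 0 ≤ t → U t ∈ S.nullA) → 0 < μ → S.Approx U μ E x₀ y δ x →
    (∀ A : Finset ℤ, ∑ q ∈ A, wt (s - 1) q * S.bn χ q x₀ ≤ B₀) →
    (∀ t, 0 ≤ t → ∀ A : Finset ℤ, ∑ q ∈ A, wt (s - 1) q * S.bn χ q (x t)
        + 1 / 4 * μ * ∫ r in (0 : ℝ)..t, ∑ q ∈ A, wt (s + 1) q * S.bn χ q (x r)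
      ≤ B₀ * Real.exp (C / μ ^ 2 * E)) ∧
    ∀ τ : ℤ → ℝ, (∀ q, 0 ≤ τ q) → ∀ A : Finset ℤ,
      ∑ q ∈ A, wt (s - 1) q * S.bn χ q (x (τ q)) ≤ 2 * (B₀ * Real.exp (C / μ ^ 2 * E)) := by
  classical
  obtain ⟨C, hC, hg⟩ := S.exists_galerkin_besov_le χ hs
  obtain ⟨M, hM, hbM⟩ := S.exists_bn_le χ
  refine ⟨C, hC, fun U μ E x₀ y δ x B₀ hU hμ h hB => ?_⟩
  choose Q hQ using fun n : ℕ => S.exists_levels χ ((n : ℝ) + 1)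
  have hzero : ∀ n t, ∀ q ∉ Q n, S.bn χ q (y n t) = 0 := fun n t q hq =>
    S.bn_eq_zero χ ((h.galerkin n).supp t) (hQ n q hq)
  have hsum : ∀ (n : ℕ) (σ : ℝ) (b : ℤ → ℝ), (∀ q, 0 ≤ b q) → (∀ q ∉ Q n, b q = 0) →
      ∀ A : Finset ℤ, ∑ q ∈ A, wt σ q * b q ≤ ∑ q ∈ Q n, wt σ q * b q := by
    intro n σ b hb hb0 A
    have e1 : ∑ q ∈ A, wt σ q * b q = ∑ q ∈ A.filter (· ∈ Q n), wt σ q * b q := by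
      rw [Finset.sum_filter]
      refine Finset.sum_congr rfl fun q _ => ?_
      split_ifs with hq
      · rfl
      · rw [hb0 q hq, mul_zero]
    rw [e1]
    exact Finset.sum_le_sum_of_subset_of_nonneg (fun q hq => (Finset.mem_filter.1 hq).2)
      fun q _ _ => mul_nonneg (wt_pos _ _).le (hb q)
  have hinit : ∀ n : ℕ, (∑ q ∈ Q n, wt (s - 1) q * S.bn χ q (y n 0)) * Real.exp (C / μ ^ 2 * E)
      ≤ B₀ * Real.exp (C / μ ^ 2 * E) := fun n =>
    mul_le_mul_of_nonneg_right ((Finset.sum_le_sum fun q _ => mul_le_mul_of_nonneg_left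
      (S.bn_le_of_norm_le χ (h.norm_init_le n) q) (wt_pos _ _).le).trans (hB (Q n)))
      (Real.exp_pos _).le
  have hgn := fun n : ℕ => hg U μ (n + 1) (n + 1) E (y n) (Q n) hU hμ (by positivity) (h.galerkin n)
    (hQ n) (h.en_init n)
  refine ⟨fun t ht A => ?_, fun τ hτ A => ?_⟩
  · have h1 : Tendsto (fun n => ∑ q ∈ A, wt (s - 1) q * S.bn χ q (y n t)) atTop
        (𝓝 (∑ q ∈ A, wt (s - 1) q * S.bn χ q (x t))) :=
      tendsto_finsetSum _ fun q _ => (h.tendsto_bn q ht).const_mul _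
    have hcont : ∀ n : ℕ, t ∈ Icc (0 : ℝ) (n + 1) → ∀ A : Finset ℤ,
        ContinuousOn (fun r => ∑ q ∈ A, wt (s + 1) q * S.bn χ q (y n r)) (Icc 0 t) := fun n hn A =>
      continuousOn_finsetSum _ fun q _ => (((h.galerkin n).continuousOn_bn χ q).mono
        (Icc_subset_Icc_right hn.2)).const_mul _
    have h2 : Tendsto (fun n => ∫ r in (0 : ℝ)..t, ∑ q ∈ A, wt (s + 1) q * S.bn χ q (y n r)) atTop
        (𝓝 (∫ r in (0 : ℝ)..t, ∑ q ∈ A, wt (s + 1) q * S.bn χ q (x r))) := by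
      refine tendsto_integral_of_bounded (C := ∑ q ∈ A, wt (s + 1) q * (M * √E)) ht ?_ ?_
        fun r hr => tendsto_finsetSum _ fun q _ => (h.tendsto_bn q hr.1).const_mul _
      · filter_upwards [eventually_mem_Icc ht] with n hn
        exact hcont n hn A
      · filter_upwards [eventually_mem_Icc ht] with n hn r hr
        rw [abs_of_nonneg (Finset.sum_nonneg fun q _ =>
          mul_nonneg (wt_pos _ _).le (S.bn_nonneg χ q _))]
        exact Finset.sum_le_sum fun q _ => mul_le_mul_of_nonneg_left
          (hbM q _ E (h.sum_approx_le hU hμ.le n ⟨hr.1, hr.2.trans hn.2⟩)) (wt_pos _ _).le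
    refine le_of_tendsto (h1.add (h2.const_mul (1 / 4 * μ))) ?_
    filter_upwards [eventually_mem_Icc ht] with n hn
    refine le_trans ?_ (((hgn n).2 t hn).trans (hinit n))
    refine add_le_add (hsum n _ _ (fun q => S.bn_nonneg χ q _) (hzero n t) A)
      (mul_le_mul_of_nonneg_left ?_ (by positivity))
    exact intervalIntegral.integral_mono_on ht ((hcont n hn A).intervalIntegrable_of_Icc ht)
      ((hcont n hn (Q n)).intervalIntegrable_of_Icc ht) fun r _ =>
        hsum n _ _ (fun q => S.bn_nonneg χ q _) (hzero n r) A
  · have h1 : Tendsto (fun n => ∑ q ∈ A, wt (s - 1) q * S.bn χ q (y n (τ q))) atTop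
        (𝓝 (∑ q ∈ A, wt (s - 1) q * S.bn χ q (x (τ q)))) :=
      tendsto_finsetSum _ fun q _ => (h.tendsto_bn q (hτ q)).const_mul _
    refine le_of_tendsto h1 ?_
    have hall : ∀ᶠ n : ℕ in atTop, ∀ q ∈ A, τ q ∈ Icc (0 : ℝ) (n + 1) :=
      (Filter.eventually_all_finset A).2 fun q _ => eventually_mem_Icc (hτ q)
    filter_upwards [hall] with n hn
    obtain ⟨B, hB1, hB2⟩ := (hgn n).1
    -- For q outside A the time τ q may exceed the horizon n + 1, where B gives no control. Those
    -- blocks are replaced by zero.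
    refine (hsum n (s - 1) (fun q => if q ∈ A then S.bn χ q (y n (τ q)) else 0) (fun q => ?_)
      (fun q hq => ?_) A |>.trans_eq' ?_).trans ((Finset.sum_le_sum fun q _ => ?_).trans
        (hB2.trans (mul_le_mul_of_nonneg_left (hinit n) zero_le_two)))
    · split_ifs
      exacts [S.bn_nonneg χ q _, le_rfl]
    · rw [hzero n _ q hq, ite_self]
    · exact Finset.sum_congr rfl fun q hq => by rw [if_pos hq]
    · refine mul_le_mul_of_nonneg_left ?_ (wt_pos _ _).le
      split_ifs with hq
      · exact hB1 q _ (hn q hq)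
      · exact (S.bn_nonneg χ q _).trans (hB1 q 0 ⟨le_rfl, by positivity⟩)

end Setting

namespace Setting

variable {N : ℕ} (S : Setting N)

/-! ### Fields and their acoustic coordinates -/

lemma exists_hat_eq_of_summable_modeSq (X : (Fin N → ℤ) → Mode N)
    (hX : Summable fun n => S.modeSq (X n)) (hs : ∀ n, X (-n) = (X n).conj) :
    ∃ U : State N, ∀ n, U.hat n = X n := by
  have h1 := S.pr_pos
  have h2 := S.et_pos
  have h3 := S.rho_pos
  have h4 := S.theta_pos
  have hc : ∀ {a : ℝ} {f : (Fin N → ℤ) → ℝ}, 0 < a → (∀ n, 0 ≤ f n) →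
      (∀ n, a * f n ≤ S.modeSq (X n)) → Summable f := by
    intro a f ha hf hle
    refine (hX.mul_left a⁻¹).of_nonneg_of_le hf fun n => ?_
    rw [← div_eq_inv_mul, le_div_iff₀ ha, mul_comm]
    exact hle n
  have e1 : ∀ Y : Mode N, 0 ≤ S.pr / (S.rho * S.theta) * ‖Y.1‖ ^ 2 := fun Y => by positivity
  have e2 : ∀ Y : Mode N, 0 ≤ S.rho / S.theta * ∑ i, ‖Y.2.1 i‖ ^ 2 := fun Y => by positivity
  have e3 : ∀ Y : Mode N, 0 ≤ S.rho * S.et / S.theta ^ 2 * ‖Y.2.2‖ ^ 2 := fun Y => by positivity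
  refine State.exists_hat_eq X (hc (a := S.pr / (S.rho * S.theta)) (by positivity)
    (fun _ => sq_nonneg _) fun n => ?_) (fun i => hc (a := S.rho / S.theta) (by positivity)
    (fun _ => sq_nonneg _) fun n => ?_) (hc (a := S.rho * S.et / S.theta ^ 2) (by positivity)
    (fun _ => sq_nonneg _) fun n => ?_) hs
  · rw [modeSq]; linarith [e2 (X n), e3 (X n)]
  · have e4 : ‖(X n).2.1 i‖ ^ 2 ≤ ∑ i, ‖(X n).2.1 i‖ ^ 2 :=
      Finset.single_le_sum (f := fun i => ‖(X n).2.1 i‖ ^ 2) (fun _ _ => sq_nonneg _)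
        (Finset.mem_univ i)
    have e5 := mul_le_mul_of_nonneg_left e4 (by positivity : 0 ≤ S.rho / S.theta)
    rw [modeSq]; linarith [e1 (X n), e3 (X n)]
  · rw [modeSq]; linarith [e1 (X n), e2 (X n)]

lemma hasSum_innerH (V W : State N) :
    HasSum (fun n => S.vol * (S.pairing (V.hat n) (W.hat n)).re) (S.innerH V W) := by
  simp only [pairing_re_eq]
  exact (((hasSum_coeff_inner V.1 W.1).mul_left _).add
    ((hasSum_sum fun i _ => hasSum_coeff_inner (V.2.1 i) (W.2.1 i)).mul_left _) |>.add
    ((hasSum_coeff_inner V.2.2 W.2.2).mul_left _)).mul_left _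

lemma hasSum_normSq (V : State N) : HasSum (fun n => S.vol * S.modeSq (V.hat n)) (S.normSq V) := by
  have := S.hasSum_innerH V V
  rw [normSq]
  simpa only [pairing_self, Complex.ofReal_re] using this

/-- The acoustic coordinates of a field. -/
def crd (V : State N) (i : Idx N) : ℂ := if i.2 = 0 then 0 else S.coord V i.1 i.2

/-- The field `V` has no component in the kernel of the acoustic operator, and coordinates `x`. -/
structure Rep (V : State N) (x : Idx N → ℂ) : Prop where
  zero : V.hat 0 = 0
  hat : ∀ n, n ≠ 0 → V.hat n = ∑ γ : ℤˣ, x (γ, n) • S.eigvec γ n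
  vanish : ∀ i : Idx N, i.2 = 0 → x i = 0

variable {S}

lemma Rep.crd_eq {V : State N} {x : Idx N → ℂ} (h : S.Rep V x) : S.crd V = x := by
  funext i
  obtain ⟨γ, n⟩ := i
  rw [crd]
  split_ifs with hi
  · exact (h.vanish _ hi).symm
  · rw [coord, h.hat n hi]
    exact S.vol_pairing_sum hi (fun γ => x (γ, n)) γ

lemma Rep.vol_modeSq {V : State N} {x : Idx N → ℂ} (h : S.Rep V x) (n : Fin N → ℤ) :
    S.vol * S.modeSq (V.hat n) = ∑ γ : ℤˣ, ‖x (γ, n)‖ ^ 2 := by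
  by_cases hn : n = 0
  · subst hn
    rw [h.zero, Finset.sum_eq_zero fun γ _ => by rw [h.vanish (γ, 0) rfl]; simp]
    simp [modeSq]
  · rw [h.hat n hn]
    exact S.vol_modeSq_sum hn fun γ => x (γ, n)

lemma Rep.tsum_eq {V : State N} {x : Idx N → ℂ} (h : S.Rep V x) (f : (Fin N → ℤ) → ℝ)
    (hf : ∀ n, 0 ≤ f n) :
    ENNReal.ofReal S.vol * ∑' n, ENNReal.ofReal (f n * S.modeSq (V.hat n))
      = ∑' i : Idx N, ENNReal.ofReal (f i.2 * ‖x i‖ ^ 2) := by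
  rw [← ENNReal.tsum_mul_left, ENNReal.tsum_prod', ENNReal.tsum_comm]
  refine tsum_congr fun n => ?_
  rw [← ENNReal.ofReal_mul S.vol_pos.le, tsum_fintype, mul_left_comm, h.vol_modeSq, Finset.mul_sum,
    ENNReal.ofReal_sum_of_nonneg fun γ _ => mul_nonneg (hf n) (sq_nonneg _)]

lemma Rep.gradSq_eq {V : State N} {x : Idx N → ℂ} (h : S.Rep V x) :
    S.gradSq V = ∑' i : Idx N, ENNReal.ofReal (S.wabs i.2 ^ 2 * ‖x i‖ ^ 2) :=
  h.tsum_eq (fun n => S.wabs n ^ 2) fun _ => sq_nonneg _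

lemma Rep.ofReal_normSq {V : State N} {x : Idx N → ℂ} (h : S.Rep V x) :
    ENNReal.ofReal (S.normSq V) = ∑' i : Idx N, ENNReal.ofReal (‖x i‖ ^ 2) := by
  have h1 := h.tsum_eq (fun _ => 1) fun _ => zero_le_one
  simp only [one_mul] at h1
  rw [← h1, ← (S.hasSum_normSq V).tsum_eq, ENNReal.ofReal_tsum_of_nonneg
    (fun n => mul_nonneg S.vol_pos.le (S.modeSq_nonneg _)) (S.hasSum_normSq V).summable,
    ← ENNReal.tsum_mul_left]
  exact tsum_congr fun n => ENNReal.ofReal_mul S.vol_pos.le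

lemma Rep.hasSum_normSq {V : State N} {x : Idx N → ℂ} (h : S.Rep V x) :
    HasSum (fun i => ‖x i‖ ^ 2) (S.normSq V) := by
  have h1 := h.ofReal_normSq
  have hs : Summable fun i => ‖x i‖ ^ 2 := by
    have h2 : ∑' i : Idx N, ENNReal.ofReal (‖x i‖ ^ 2) ≠ ⊤ := by rw [← h1]; exact ENNReal.ofReal_ne_top
    have h3 := ENNReal.summable_toReal h2
    simpa only [ENNReal.toReal_ofReal (sq_nonneg _)] using h3
  have h0 : 0 ≤ S.normSq V :=
    (S.hasSum_normSq V).nonneg fun n => mul_nonneg S.vol_pos.le (S.modeSq_nonneg _)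
  rw [← ENNReal.ofReal_tsum_of_nonneg (fun _ => sq_nonneg _) hs,
    ENNReal.ofReal_eq_ofReal_iff h0 (tsum_nonneg fun _ => sq_nonneg _)] at h1
  rw [h1]
  exact hs.hasSum

lemma Rep.blockNorm_eq {V : State N} {x : Idx N → ℂ} (h : S.Rep V x) (χ : DyadicCutoff) (q : ℤ) :
    S.blockNorm χ q V = ENNReal.ofReal (S.bn χ q x) := by
  have h1 := h.tsum_eq (fun n => S.cut χ q n ^ 2) fun _ => sq_nonneg _
  rw [blockNorm]
  change (ENNReal.ofReal S.vol * ∑' n, ENNReal.ofReal (S.cut χ q n ^ 2 * S.modeSq (V.hat n)))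
    ^ (1 / 2 : ℝ) = _
  rw [h1, tsum_eq_sum (s := S.ball (12 / 5 * (2 : ℝ) ^ q)),
    ← ENNReal.ofReal_sum_of_nonneg fun i _ => by positivity,
    ENNReal.ofReal_rpow_of_nonneg (Finset.sum_nonneg fun i _ => by positivity) (by norm_num),
    ← Real.sqrt_eq_rpow, bn]
  intro i hi
  by_cases h0 : i.2 = 0
  · rw [h.vanish i h0]; simp
  · have : S.cut χ q i.2 = 0 := by
      by_contra hc
      exact hi (S.mem_ball.2 ⟨h0, (S.cut_bounds hc).2⟩)
    rw [this]; simp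

lemma Rep.meanNorm_eq {V : State N} {x : Idx N → ℂ} (h : S.Rep V x) : S.meanNorm V = 0 := by
  rw [meanNorm, h.zero]
  simp [modeSq]

lemma Rep.besov_eq {V : State N} {x : Idx N → ℂ} (h : S.Rep V x) (χ : DyadicCutoff) (s : ℝ) :
    S.besov χ s V = ∑' q : ℤ, ENNReal.ofReal (wt s q * S.bn χ q x) := by
  rw [besov, h.meanNorm_eq, zero_add]
  refine tsum_congr fun q => ?_
  rw [h.blockNorm_eq, ENNReal.ofReal_mul (wt_pos s q).le]
  rfl

lemma Rep.sub {V W : State N} {x y : Idx N → ℂ} (h : S.Rep V x) (h' : S.Rep W y) :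
    S.Rep (V - W) (x - y) where
  zero := by rw [State.hat_sub, h.zero, h'.zero, sub_zero]
  hat n hn := by
    rw [State.hat_sub, h.hat n hn, h'.hat n hn, ← Finset.sum_sub_distrib]
    exact Finset.sum_congr rfl fun γ _ => by rw [Pi.sub_apply, sub_smul]
  vanish i hi := by rw [Pi.sub_apply, h.vanish i hi, h'.vanish i hi, sub_zero]

lemma Rep.eq {V W : State N} {x : Idx N → ℂ} (h : S.Rep V x) (h' : S.Rep W x) : V = W := by
  refine State.ext_hat fun n => ?_
  by_cases hn : n = 0
  · rw [hn, h.zero, h'.zero]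
  · rw [h.hat n hn, h'.hat n hn]

lemma Rep.mem_nullAPerp {V : State N} {x : Idx N → ℂ} (h : S.Rep V x) : V ∈ S.nullAPerp := by
  refine ⟨h.zero, fun W hW => ?_⟩
  refine (S.hasSum_innerH V W).unique ?_
  convert hasSum_zero using 2 with n
  by_cases hn : n = 0
  · rw [hn, h.zero, pairing_zero_left]; simp
  · rw [h.hat n hn, sum_pairing_left, Finset.sum_eq_zero, Complex.zero_re, mul_zero]
    intro γ _
    rw [pairing_smul_left, ← pairing_conj_symm, (S.acoustic_eq_zero_iff hn _).1 (hW.2 n) γ, map_zero,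
      mul_zero]

variable (S)

lemma smul_conj (z : ℂ) (X : Mode N) : (z • X).conj = conj z • X.conj := by
  ext i <;> simp [Mode.conj]

lemma sum_conj {ι : Type*} (s : Finset ι) (X : ι → Mode N) :
    (∑ i ∈ s, X i).conj = ∑ i ∈ s, (X i).conj := by
  classical
  induction s using Finset.induction_on with
  | empty => ext i <;> simp [Mode.conj]
  | insert a s ha ih =>
    rw [Finset.sum_insert ha, Finset.sum_insert ha, ← ih]
    ext i <;> simp [Mode.conj]

lemma exists_rep {x : Idx N → ℂ} (hx : IsReal x) (hz : ∀ i : Idx N, i.2 = 0 → x i = 0)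
    (hs : Summable fun i => ‖x i‖ ^ 2) : ∃ V, S.Rep V x := by
  classical
  set X : (Fin N → ℤ) → Mode N := fun n => if n = 0 then 0 else ∑ γ : ℤˣ, x (γ, n) • S.eigvec γ n
    with hX
  have hmode : ∀ n, S.vol * S.modeSq (X n) = ∑ γ : ℤˣ, ‖x (γ, n)‖ ^ 2 := by
    intro n
    by_cases hn : n = 0
    · subst hn
      rw [Finset.sum_eq_zero fun γ _ => by rw [hz (γ, 0) rfl]; simp]
      simp [hX, modeSq]
    · simp only [hX, if_neg hn]
      exact S.vol_modeSq_sum hn fun γ => x (γ, n)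
  have hsum : Summable fun n => S.modeSq (X n) := by
    have h1 : Summable fun n => ∑ γ : ℤˣ, ‖x (γ, n)‖ ^ 2 :=
      summable_sum fun γ _ => hs.comp_injective (i := fun n => ((γ, n) : Idx N))
        fun n n' h => by simpa using h
    simp only [← hmode] at h1
    exact (summable_mul_left_iff S.vol_pos.ne').1 h1
  obtain ⟨V, hV⟩ := S.exists_hat_eq_of_summable_modeSq X hsum fun n => by
    by_cases hn : n = 0
    · subst hn; simp [hX, Mode.conj, Prod.ext_iff, funext_iff]
    · simp only [hX, neg_eq_zero, if_neg hn, sum_conj, smul_conj, eigvec_conj, S.eigvec_neg _ hn]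
      exact Finset.sum_congr rfl fun γ _ => by rw [← hx (γ, n)]; rfl
  exact ⟨V, by rw [hV]; simp [hX], fun n hn => by rw [hV]; simp [hX, hn], hz⟩

lemma isReal_crd (V : State N) : IsReal (S.crd V) := by
  intro i
  rw [crd, crd]
  by_cases hi : i.2 = 0
  · simp [Idx.flip, hi]
  · rw [if_neg hi, if_neg (by simpa [Idx.flip] using hi)]
    exact S.coord_neg V i.1 hi

/-- The parts of the amplitudes orthogonal to the eigenvectors are themselves the amplitudes of a
real L² field W in Null(𝒜). Orthogonality of V to W says that the sum of their squared norms
vanishes. -/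
lemma rep_crd {V : State N} (hV : V ∈ S.nullAPerp) : S.Rep V (S.crd V) := by
  classical
  have hv : ((S.vol : ℝ) : ℂ) ≠ 0 := by exact_mod_cast S.vol_pos.ne'
  set X : (Fin N → ℤ) → Mode N := fun n => if n = 0 then 0 else S.nullPart n (V.hat n) with hX
  have hself : ∀ n, S.pairing (V.hat n) (X n) = S.modeSq (X n) := by
    intro n
    by_cases hn : n = 0
    · simp [hX, hn, modeSq, pairing]
    · simp only [hX, if_neg hn]
      rw [← pairing_self]
      nth_rewrite 2 [nullPart]
      rw [pairing_sub_left, sum_pairing_left, Finset.sum_eq_zero, sub_zero]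
      intro γ _
      rw [pairing_smul_left, ← S.pairing_conj_symm (S.nullPart n (V.hat n)), S.pairing_nullPart hn,
        map_zero, mul_zero]
  have hle : ∀ n, S.modeSq (X n) ≤ S.modeSq (V.hat n) := by
    intro n
    by_cases hn : n = 0
    · have := S.modeSq_nonneg (V.hat n)
      simpa [hX, hn, modeSq] using S.modeSq_nonneg (V.hat 0)
    · simp only [hX, if_neg hn]
      have h1 := S.vol_modeSq_eq hn (V.hat n)
      have h2 : 0 ≤ ∑ α : ℤˣ, ‖(S.vol : ℂ) * S.pairing (V.hat n) (S.eigvec α n)‖ ^ 2 :=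
        Finset.sum_nonneg fun _ _ => sq_nonneg _
      exact le_of_mul_le_mul_left (by linarith) S.vol_pos
  have hsum : Summable fun n => S.modeSq (X n) :=
    ((summable_mul_left_iff S.vol_pos.ne').1 (S.hasSum_normSq V).summable).of_nonneg_of_le
      (fun n => S.modeSq_nonneg _) hle
  obtain ⟨W, hW⟩ := S.exists_hat_eq_of_summable_modeSq X hsum fun n => by
    by_cases hn : n = 0
    · subst hn; simp [hX, Mode.conj, Prod.ext_iff, funext_iff]
    · simp only [hX, neg_eq_zero, if_neg hn, nullPart, State.hat_neg]
      have e : ∀ γ : ℤˣ, ((S.vol : ℂ) * S.pairing (V.hat n).conj (S.eigvec γ (-n))) •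
          S.eigvec γ (-n) = (((S.vol : ℂ) * S.pairing (V.hat n) (S.eigvec γ n)) •
            S.eigvec γ n).conj := by
        intro γ
        rw [smul_conj, eigvec_conj, S.eigvec_neg γ hn, map_mul, Complex.conj_ofReal, ← pairing_conj,
          eigvec_conj]
      simp only [e, ← sum_conj]
      ext i <;> simp [Mode.conj]
  have hWn : W ∈ S.nullA := by
    refine ⟨by rw [hW]; simp [hX], fun n => ?_⟩
    by_cases hn : n = 0
    · rw [hn, hW]
      simp [hX, acoustic, dot, Prod.ext_iff, funext_iff]
    · refine (S.acoustic_eq_zero_iff hn _).2 fun γ => ?_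
      rw [hW]
      simp only [hX, if_neg hn]
      exact S.pairing_nullPart hn _ γ
  have h0 := S.hasSum_innerH V W
  rw [hV.2 W hWn] at h0
  simp only [hW, hself, Complex.ofReal_re] at h0
  have h1 := (hasSum_zero_iff_of_nonneg fun n =>
    mul_nonneg S.vol_pos.le (S.modeSq_nonneg (X n))).1 h0
  refine ⟨hV.1, fun n hn => ?_, fun i hi => by rw [crd, if_pos hi]⟩
  have h2 : S.nullPart n (V.hat n) = 0 := by
    have h3 : S.vol * S.modeSq (X n) = 0 := congrFun h1 n
    have h4 := S.modeSq_eq_zero ((mul_eq_zero.1 h3).resolve_left S.vol_pos.ne')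
    simpa [hX, hn] using h4
  rw [nullPart, sub_eq_zero] at h2
  simp only [crd, if_neg hn, coord]
  exact h2

end Setting

/-! ### Infinite sums and infinite time intervals -/

lemma tsum_ofReal_le {ι : Type*} {a : ι → ℝ} (ha : ∀ i, 0 ≤ a i) {K : ℝ}
    (h : ∀ A : Finset ι, ∑ i ∈ A, a i ≤ K) : ∑' i, ENNReal.ofReal (a i) ≤ ENNReal.ofReal K := by
  rw [ENNReal.tsum_eq_iSup_sum]
  refine iSup_le fun A => ?_
  rw [← ENNReal.ofReal_sum_of_nonneg fun i _ => ha i]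
  exact ENNReal.ofReal_le_ofReal (h A)

/-- The approximation argument gives estimates for finite sets of coordinates or blocks only.
Tonelli's theorem and the supremum over finite sets turn them into estimates for the full extended
norms. -/
lemma tsum_add_lintegral_le {ι : Type*} [Countable ι] {a : ι → ℝ} {b : ι → ℝ → ℝ} {t c K : ℝ}
    (ht : 0 ≤ t) (hc : 0 ≤ c) (ha : ∀ i, 0 ≤ a i) (hb : ∀ i r, 0 ≤ b i r)
    (hbc : ∀ i, ContinuousOn (b i) (Icc 0 t))
    (h : ∀ A : Finset ι, ∑ i ∈ A, a i + c * ∫ r in (0 : ℝ)..t, ∑ i ∈ A, b i r ≤ K) :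
    ∑' i, ENNReal.ofReal (a i) + ENNReal.ofReal c * ∫⁻ r in Ioc 0 t, ∑' i, ENNReal.ofReal (b i r)
      ≤ ENNReal.ofReal K := by
  have hint : ∀ i, IntervalIntegrable (b i) volume 0 t := fun i => (hbc i).intervalIntegrable_of_Icc ht
  have h1 : ∀ i, ∫⁻ r in Ioc 0 t, ENNReal.ofReal (b i r)
      = ENNReal.ofReal (∫ r in (0 : ℝ)..t, b i r) := fun i => by
    rw [intervalIntegral.integral_of_le ht, ofReal_integral_eq_lintegral_ofReal
      ((intervalIntegrable_iff_integrableOn_Ioc_of_le ht).1 (hint i))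
      (Eventually.of_forall fun r => hb i r)]
  rw [lintegral_tsum fun i => ((hbc i).mono Ioc_subset_Icc_self).aemeasurable measurableSet_Ioc
    |>.ennreal_ofReal]
  simp only [h1]
  rw [← ENNReal.tsum_mul_left, ← ENNReal.tsum_add]
  have h0 : ∀ i, 0 ≤ ∫ r in (0 : ℝ)..t, b i r := fun i =>
    intervalIntegral.integral_nonneg ht fun r _ => hb i r
  have h2 : ∀ i, ENNReal.ofReal (a i) + ENNReal.ofReal c * ENNReal.ofReal (∫ r in (0 : ℝ)..t, b i r)
      = ENNReal.ofReal (a i + c * ∫ r in (0 : ℝ)..t, b i r) := fun i => by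
    rw [← ENNReal.ofReal_mul hc, ← ENNReal.ofReal_add (ha i) (mul_nonneg hc (h0 i))]
  simp only [h2]
  refine tsum_ofReal_le (fun i => add_nonneg (ha i) (mul_nonneg hc (h0 i))) fun A => ?_
  refine le_trans (le_of_eq ?_) (h A)
  rw [Finset.sum_add_distrib, intervalIntegral.integral_finsetSum fun i _ => hint i, Finset.mul_sum]

lemma mul_lintegral_Ioi_le {f : ℝ → ℝ≥0∞} {c : ℝ} {K : ℝ≥0∞}
    (h : ∀ t, 0 ≤ t → ENNReal.ofReal c * ∫⁻ r in Ioc 0 t, f r ≤ K) :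
    ENNReal.ofReal c * ∫⁻ r in Ioi 0, f r ≤ K := by
  have hU : Ioi (0 : ℝ) = ⋃ n : ℕ, Ioc 0 (n : ℝ) := by
    ext r
    simp only [mem_Ioi, mem_iUnion, mem_Ioc]
    exact ⟨fun hr => ⟨⌈r⌉₊, hr, Nat.le_ceil r⟩, fun ⟨_, hr⟩ => hr.1⟩
  have hdir : Directed (· ⊆ ·) fun n : ℕ => Ioc (0 : ℝ) n :=
    Monotone.directed_le fun n m hnm => Ioc_subset_Ioc_right (by exact_mod_cast hnm)
  rw [hU, setLIntegral_iUnion_of_directed f hdir, ENNReal.mul_iSup]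
  exact iSup_le fun n => h n n.cast_nonneg

namespace Setting

variable {N : ℕ} (S : Setting N)

/-! ### The equation in acoustic coordinates -/

lemma q2r_crd (U V : State N) (γ : ℤˣ) (m : Fin N → ℤ) :
    S.q2r U V γ m = ∑' j, S.couple U (γ, m) j * S.crd V j := by
  rw [q2r_eq]
  refine tsum_congr fun j => ?_
  by_cases h : S.couple U (γ, m) j = 0
  · rw [h, zero_mul, zero_mul]
  · rw [crd, if_neg (S.couple_ne_zero h).1]

lemma q3r_crd (V : State N) (γ : ℤˣ) {m : Fin N → ℤ} (hm : m ≠ 0) :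
    S.q3r V V γ m = S.burgers (S.crd V) (S.crd V) (γ, m) := by
  classical
  rw [S.q3r_eq V V γ hm, burgers, burgers]
  congr 1
  refine tsum_congr fun k => ?_
  by_cases h : S.Res m k
  · simp only [crd, if_neg h.1, if_neg h.2.1]
  · simp [h]

variable {S} in
lemma solvesLS_of_rep {τ : Transport} {U V : ℝ → State N} {x : ℝ → Idx N → ℂ} {I : Set ℝ}
    (hr : ∀ t ∈ I, S.Rep (V t) (x t))
    (hd : ∀ i : Idx N, i.2 ≠ 0 → ∀ t ∈ I,
      HasDerivWithinAt (fun t => x t i) (S.rhs (U t) (S.muBar τ) (x t) i) I t) :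
    S.SolvesLS τ U I V := by
  intro n t ht
  by_cases hn : n = 0
  · subst hn
    rw [Q2rHat, Q3rHat, if_pos rfl, if_pos rfl, (hr t ht).zero]
    refine ((hasDerivWithinAt_const t I (0 : Mode N)).congr (fun r hr' => (hr r hr').zero)
      (hr t ht).zero).congr_deriv ?_
    simp
  · have h1 : HasDerivWithinAt (fun t => ∑ γ : ℤˣ, x t (γ, n) • S.eigvec γ n)
        (∑ γ : ℤˣ, S.rhs (U t) (S.muBar τ) (x t) (γ, n) • S.eigvec γ n) I t :=
      HasDerivWithinAt.fun_sum fun γ _ => (hd (γ, n) hn t ht).smul_const _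
    refine (h1.congr (fun r hr' => (hr r hr').hat n hn) ((hr t ht).hat n hn)).congr_deriv ?_
    rw [Q2rHat, Q3rHat, if_neg hn, if_neg hn, (hr t ht).hat n hn]
    simp only [S.q2r_crd, S.q3r_crd _ _ hn, (hr t ht).crd_eq]
    rw [Finset.smul_sum, ← Finset.sum_neg_distrib, ← Finset.sum_sub_distrib, ← Finset.sum_sub_distrib]
    refine Finset.sum_congr rfl fun γ _ => ?_
    rw [rhs, sub_smul, sub_smul, neg_smul, smul_smul]

/-- The linear form giving a coordinate of an amplitude. -/
def coordForm (γ : ℤˣ) (n : Fin N → ℤ) : Mode N →L[ℂ] ℂ :=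
  LinearMap.toContinuousLinearMap
    { toFun := fun X => S.vol * S.pairing X (S.eigvec γ n)
      map_add' := fun X Y => by rw [pairing_add_left, mul_add]
      map_smul' := fun z X => by
        rw [pairing_smul_left, RingHom.id_apply, smul_eq_mul, mul_left_comm] }

lemma coordForm_apply (γ : ℤˣ) (n : Fin N → ℤ) (X : Mode N) :
    S.coordForm γ n X = S.vol * S.pairing X (S.eigvec γ n) := rfl

variable {S} in
lemma SolvesLS.hasDerivWithinAt_crd {τ : Transport} {U V : ℝ → State N} {I : Set ℝ}
    (h : S.SolvesLS τ U I V) {i : Idx N} (hi : i.2 ≠ 0) {t : ℝ} (ht : t ∈ I) :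
    HasDerivWithinAt (fun t => S.crd (V t) i) (S.rhs (U t) (S.muBar τ) (S.crd (V t)) i) I t := by
  obtain ⟨γ, n⟩ := i
  have hi' : n ≠ 0 := hi
  have h1 := (((S.coordForm γ n).restrictScalars ℝ).hasFDerivAt.comp_hasDerivWithinAt t (h n t ht))
  have h2 : ∀ r, S.crd (V r) (γ, n) = S.coordForm γ n ((V r).hat n) := fun r => by
    rw [crd, if_neg hi]; rfl
  simp only [h2]
  refine h1.congr_deriv ?_
  change S.coordForm γ n _ = _
  rw [Q2rHat, Q3rHat, if_neg hi', if_neg hi', map_sub, map_sub, map_neg, map_smul, coordForm_apply,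
    coordForm_apply, S.vol_pairing_sum hi', S.vol_pairing_sum hi', q2r_crd, S.q3r_crd _ _ hi', rhs,
    smul_eq_mul, ← h2]

variable {S} in
-- The nonlinear terms see V only through its acoustic coordinates. Once these agree, every Fourier
-- coefficient of the difference solves z' = -μ̄|n|² z with z(0) = 0. This handles the mean and the
-- Null(𝒜) part, which are not assumed to vanish.
lemma SolvesLS.hat_eq {τ : Transport} {U V₁ V₂ : ℝ → State N} {T : ℝ}
    (h₁ : S.SolvesLS τ U (Icc 0 T) V₁) (h₂ : S.SolvesLS τ U (Icc 0 T) V₂) (h0 : V₁ 0 = V₂ 0)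
    (hc : ∀ t ∈ Icc 0 T, S.crd (V₁ t) = S.crd (V₂ t)) {t : ℝ} (ht : t ∈ Icc 0 T) : V₁ t = V₂ t := by
  refine State.ext_hat fun n => ?_
  set k := S.muBar τ * S.wabs n ^ 2 with hk
  have hd : ∀ r ∈ Icc 0 T, HasDerivWithinAt
      (fun r => Real.exp (k * r) • ((V₁ r).hat n - (V₂ r).hat n)) 0 (Icc 0 T) r := by
    intro r hr
    have hQ2 : S.Q2rHat (U r) (V₁ r) n = S.Q2rHat (U r) (V₂ r) n := by
      simp only [Q2rHat, q2r_crd, hc r hr]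
    have hQ3 : S.Q3rHat (V₁ r) (V₁ r) n = S.Q3rHat (V₂ r) (V₂ r) n := by
      rw [Q3rHat, Q3rHat]
      split_ifs with hn
      · rfl
      · simp only [S.q3r_crd _ _ hn, hc r hr]
    have e1 := (h₁ n r hr).sub (h₂ n r hr)
    have e2 : HasDerivWithinAt (fun r => Real.exp (k * r)) (Real.exp (k * r) * (k * 1)) (Icc 0 T) r :=
      ((hasDerivWithinAt_id r _).const_mul k).exp
    refine (e2.smul e1).congr_deriv ?_
    have e3 : ∀ X : Mode N, ((k : ℝ) : ℂ) • X = k • X := fun X => Complex.coe_smul k X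
    rw [hQ2, hQ3, ← hk, e3, e3, mul_one]
    simp only [Pi.sub_apply]
    module
  have hconst := constant_of_has_deriv_right_zero
    (f := fun r => Real.exp (k * r) • ((V₁ r).hat n - (V₂ r).hat n)) (a := 0) (b := T)
    (fun r hr => (hd r hr).continuousWithinAt) (fun r hr =>
      ((hd r (Ico_subset_Icc_self hr)).mono_of_mem_nhdsWithin (Icc_mem_nhdsGE_of_mem hr)))
  have h3 := hconst t ht
  simp only [h0, sub_self, smul_zero] at h3
  exact sub_eq_zero.1 ((smul_eq_zero.1 h3).resolve_left (Real.exp_pos _).ne')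

end Setting

namespace Setting

variable {N : ℕ} (S : Setting N) (χ : DyadicCutoff)

/-! ### Membership in the solution space -/

lemma bn_sub_le (q : ℤ) (x y : Idx N → ℂ) :
    S.bn χ q (x - y) ≤ 2 * (S.bn χ q x + S.bn χ q y) := by
  have hx := S.bn_nonneg χ q x
  have hy := S.bn_nonneg χ q y
  have hs : ∀ z : Idx N → ℂ, S.bn χ q z ^ 2
      = ∑ i ∈ S.ball (12 / 5 * (2 : ℝ) ^ q), S.cut χ q i.2 ^ 2 * ‖z i‖ ^ 2 := fun z =>
    Real.sq_sqrt (Finset.sum_nonneg fun _ _ => by positivity)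
  refine le_of_sq_le_sq ?_ (by positivity)
  have h1 : S.bn χ q (x - y) ^ 2 ≤ 2 * S.bn χ q x ^ 2 + 2 * S.bn χ q y ^ 2 := by
    rw [hs, hs, hs, Finset.mul_sum, Finset.mul_sum, ← Finset.sum_add_distrib]
    refine Finset.sum_le_sum fun i _ => ?_
    have h2 : ‖(x - y) i‖ ^ 2 ≤ (‖x i‖ + ‖y i‖) ^ 2 :=
      pow_le_pow_left₀ (norm_nonneg _) (norm_sub_le _ _) 2
    have h3 : ‖(x - y) i‖ ^ 2 ≤ 2 * ‖x i‖ ^ 2 + 2 * ‖y i‖ ^ 2 := by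
      nlinarith [sq_nonneg (‖x i‖ - ‖y i‖)]
    calc _ ≤ S.cut χ q i.2 ^ 2 * (2 * ‖x i‖ ^ 2 + 2 * ‖y i‖ ^ 2) := by gcongr
      _ = _ := by ring
  nlinarith [mul_nonneg hx hy]

variable {S χ} {V : ℝ → State N} {x : ℝ → Idx N → ℂ} {s K μ : ℝ}

lemma continuousOn_bn {I : Set ℝ} (hc : ∀ i, ContinuousOn (fun t => x t i) I) (q : ℤ) :
    ContinuousOn (fun t => S.bn χ q (x t)) I :=
  (continuousOn_finsetSum _ fun i _ => ((hc i).norm.pow 2).const_mul _).sqrt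

/-- The hypothesis allows a separate time for each block, so one may choose times that nearly attain
every supremum. -/
lemma exists_sup_bn_le (h : ∀ τ : ℤ → ℝ, (∀ q, 0 ≤ τ q) → ∀ A : Finset ℤ,
      ∑ q ∈ A, wt s q * S.bn χ q (x (τ q)) ≤ K) :
    ∃ B : ℤ → ℝ, (∀ q, ∀ t, 0 ≤ t → S.bn χ q (x t) ≤ B q) ∧ ∀ A : Finset ℤ,
      ∑ q ∈ A, wt s q * B q ≤ K := by
  have hbdd : ∀ q, BddAbove (range fun t : Ici (0 : ℝ) => S.bn χ q (x t)) := fun q => by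
    refine ⟨K / wt s q, ?_⟩
    rintro _ ⟨t, rfl⟩
    have := h (fun _ => t) (fun _ => t.2) {q}
    rw [Finset.sum_singleton] at this
    rw [le_div_iff₀ (wt_pos s q), mul_comm]
    exact this
  refine ⟨fun q => ⨆ t : Ici (0 : ℝ), S.bn χ q (x t), fun q t ht => le_ciSup (hbdd q) ⟨t, ht⟩,
    fun A => ?_⟩
  refine le_of_forall_pos_le_add fun ε hε => ?_
  -- After multiplication by the weights these errors are equal, and over A they add up to less than
  -- ε.
  have hw : ∀ q, 0 < ε / ((A.card + 1) * wt s q) := fun q => by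
    have := wt_pos s q
    positivity
  choose τ hτ using fun q => exists_lt_of_lt_ciSup (sub_lt_self
    (⨆ t : Ici (0 : ℝ), S.bn χ q (x t)) (hw q))
  calc ∑ q ∈ A, wt s q * ⨆ t : Ici (0 : ℝ), S.bn χ q (x t)
      ≤ ∑ q ∈ A, (wt s q * S.bn χ q (x (τ q)) + ε / (A.card + 1)) := by
        refine Finset.sum_le_sum fun q _ => ?_
        have h1 : wt s q * (ε / ((A.card + 1) * wt s q)) = ε / (A.card + 1) := by
          have := (wt_pos s q).ne'
          field_simp
        rw [← h1, ← mul_add]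
        have := hτ q
        exact mul_le_mul_of_nonneg_left (by linarith) (wt_pos s q).le
    _ ≤ K + ε := by
        rw [Finset.sum_add_distrib, Finset.sum_const, nsmul_eq_mul]
        refine add_le_add (h (fun q => τ q) (fun q => (τ q).2) A) ?_
        rw [← mul_div_assoc, div_le_iff₀ (by positivity)]
        nlinarith

lemma besov_bound_of_rep (hr : ∀ t, 0 ≤ t → S.Rep (V t) (x t))
    (hc : ∀ i, ContinuousOn (fun t => x t i) (Ici 0)) (hμ : 0 ≤ μ)
    (hb : ∀ t, 0 ≤ t → ∀ A : Finset ℤ, ∑ q ∈ A, wt (s - 1) q * S.bn χ q (x t)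
        + μ * ∫ r in (0 : ℝ)..t, ∑ q ∈ A, wt (s + 1) q * S.bn χ q (x r) ≤ K)
    {t : ℝ} (ht : 0 ≤ t) :
    S.besov χ (s - 1) (V t) + ENNReal.ofReal μ * ∫⁻ r in Ioc 0 t, S.besov χ (s + 1) (V r)
      ≤ ENNReal.ofReal K := by
  have h1 : ∫⁻ r in Ioc 0 t, S.besov χ (s + 1) (V r)
      = ∫⁻ r in Ioc 0 t, ∑' q : ℤ, ENNReal.ofReal (wt (s + 1) q * S.bn χ q (x r)) :=
    setLIntegral_congr_fun measurableSet_Ioc fun r hr' => (hr r hr'.1.le).besov_eq χ (s + 1)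
  rw [h1, (hr t ht).besov_eq]
  exact tsum_add_lintegral_le ht hμ (fun q => mul_nonneg (wt_pos _ _).le (S.bn_nonneg χ q _))
    (fun q r => mul_nonneg (wt_pos _ _).le (S.bn_nonneg χ q _))
    (fun q => ((continuousOn_bn hc q).mono Icc_subset_Ici_self).const_mul _) (hb t ht)

/-- Each block is continuous in time, as a finite sum of continuous coordinates. The summable bounds
B q on the suprema dominate the series over q, which gives continuity with values in B^{s-1}. -/
lemma memF_of_rep (hr : ∀ t, 0 ≤ t → S.Rep (V t) (x t))
    (hc : ∀ i, ContinuousOn (fun t => x t i) (Ici 0)) (hμ : 0 < μ)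
    (hb : ∀ t, 0 ≤ t → ∀ A : Finset ℤ, ∑ q ∈ A, wt (s - 1) q * S.bn χ q (x t)
        + μ * ∫ r in (0 : ℝ)..t, ∑ q ∈ A, wt (s + 1) q * S.bn χ q (x r) ≤ K)
    (htilde : ∀ τ : ℤ → ℝ, (∀ q, 0 ≤ τ q) → ∀ A : Finset ℤ,
      ∑ q ∈ A, wt (s - 1) q * S.bn χ q (x (τ q)) ≤ 2 * K) : S.MemF χ s V := by
  obtain ⟨B, hB, hBs⟩ := exists_sup_bn_le htilde
  have hB0 : ∀ q, 0 ≤ B q := fun q => (S.bn_nonneg χ q _).trans (hB q 0 le_rfl)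
  have hsum : Summable fun q => wt (s - 1) q * B q :=
    summable_of_sum_le (fun q => mul_nonneg (wt_pos _ _).le (hB0 q)) hBs
  refine ⟨fun t ht => ?_, fun t₀ ht₀ => ?_, ?_, ?_⟩
  · exact ((le_add_right le_rfl).trans (besov_bound_of_rep hr hc hμ.le hb ht)).trans_lt
      ENNReal.ofReal_lt_top |>.ne
  · have h1 : Tendsto (fun t => ∑' q : ℤ, wt (s - 1) q * S.bn χ q (x t - x t₀)) (𝓝[Ici 0] t₀)
        (𝓝 (∑' _ : ℤ, 0)) := by
      refine tendsto_tsum_of_dominated_convergence (hsum.mul_left 4) (fun q => ?_) ?_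
      · have h2 : Tendsto (fun t => S.bn χ q (x t - x t₀)) (𝓝[Ici 0] t₀)
            (𝓝 (S.bn χ q (x t₀ - x t₀))) :=
          continuousOn_bn (x := fun t => x t - x t₀) (fun i => (hc i).sub continuousOn_const) q t₀ ht₀
        have h3 : S.bn χ q (x t₀ - x t₀) = 0 := by simp [bn]
        rw [h3] at h2
        simpa using h2.const_mul (wt (s - 1) q)
      · filter_upwards [self_mem_nhdsWithin] with t ht q
        rw [Real.norm_of_nonneg (mul_nonneg (wt_pos _ _).le (S.bn_nonneg χ q _)), mul_left_comm]
        refine mul_le_mul_of_nonneg_left ?_ (wt_pos _ _).le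
        have := S.bn_sub_le χ q (x t) (x t₀)
        linarith [hB q t ht, hB q t₀ ht₀]
    rw [tsum_zero] at h1
    have h2 := ENNReal.tendsto_ofReal h1
    rw [ENNReal.ofReal_zero] at h2
    refine h2.congr' ?_
    filter_upwards [self_mem_nhdsWithin] with t ht
    rw [((hr t ht).sub (hr t₀ ht₀)).besov_eq, ENNReal.ofReal_tsum_of_nonneg
      (fun q => mul_nonneg (wt_pos _ _).le (S.bn_nonneg χ q _))]
    refine (hsum.mul_left 4).of_nonneg_of_le
      (fun q => mul_nonneg (wt_pos _ _).le (S.bn_nonneg χ q _)) fun q => ?_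
    rw [mul_left_comm]
    refine mul_le_mul_of_nonneg_left ?_ (wt_pos _ _).le
    have := S.bn_sub_le χ q (x t) (x t₀)
    linarith [hB q t ht, hB q t₀ ht₀]
  · have h1 : (⨆ t ∈ Ici (0 : ℝ), S.meanNorm (V t)) = 0 := by
      refine le_antisymm (iSup₂_le fun t ht => ?_) bot_le
      rw [(hr t ht).meanNorm_eq]
    rw [h1, zero_add]
    refine ((ENNReal.tsum_le_tsum fun q => ?_).trans
      (tsum_ofReal_le (fun q => mul_nonneg (wt_pos (s - 1) q).le (hB0 q)) hBs)).trans_lt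
      ENNReal.ofReal_lt_top |>.ne
    rw [ENNReal.ofReal_mul (wt_pos _ _).le]
    refine mul_le_mul_right (iSup₂_le fun t ht => ?_) _
    rw [(hr t ht).blockNorm_eq]
    exact ENNReal.ofReal_le_ofReal (hB q t ht)
  · have h1 := mul_lintegral_Ioi_le (c := μ) (f := fun r => S.besov χ (s + 1) (V r)) fun t ht =>
      (le_add_left le_rfl).trans (besov_bound_of_rep hr hc hμ.le hb ht)
    intro htop
    rw [htop, ENNReal.mul_top (by simpa using hμ)] at h1
    exact absurd h1 (not_le.2 ENNReal.ofReal_lt_top)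

lemma energy_bound_of_rep {E : ℝ} (hr : ∀ t, 0 ≤ t → S.Rep (V t) (x t))
    (hc : ∀ i, ContinuousOn (fun t => x t i) (Ici 0)) (hμ : 0 ≤ μ)
    (hb : ∀ t, 0 ≤ t → ∀ R, S.en R (x t) + μ * ∫ r in (0 : ℝ)..t, S.gr R (x r) ≤ E)
    {t : ℝ} (ht : 0 ≤ t) :
    ENNReal.ofReal (S.normSq (V t)) + ENNReal.ofReal μ * ∫⁻ r in Ioc 0 t, S.gradSq (V r)
      ≤ ENNReal.ofReal E := by
  classical
  have h1 : ∫⁻ r in Ioc 0 t, S.gradSq (V r)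
      = ∫⁻ r in Ioc 0 t, ∑' i : Idx N, ENNReal.ofReal (S.wabs i.2 ^ 2 * ‖x r i‖ ^ 2) :=
    setLIntegral_congr_fun measurableSet_Ioc fun r hr' => (hr r hr'.1.le).gradSq_eq
  rw [h1, (hr t ht).ofReal_normSq]
  have hcont : ∀ i : Idx N, ContinuousOn (fun r => S.wabs i.2 ^ 2 * ‖x r i‖ ^ 2) (Icc 0 t) := fun i =>
    (((hc i).mono Icc_subset_Ici_self).norm.pow 2).const_mul _
  refine tsum_add_lintegral_le ht hμ (fun i => sq_nonneg _) (fun i r => by positivity) hcont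
    fun A => ?_
  obtain ⟨R, hR⟩ := S.exists_subset_ball (A.filter fun i => i.2 ≠ 0)
    fun i hi => (Finset.mem_filter.1 hi).2
  have hsum : ∀ w : Idx N → ℝ, (∀ i, 0 ≤ w i) → ∀ r, 0 ≤ r →
      ∑ i ∈ A, w i * ‖x r i‖ ^ 2 ≤ ∑ i ∈ S.ball R, w i * ‖x r i‖ ^ 2 := by
    intro w hw r hr'
    refine le_trans (le_of_eq ?_) (Finset.sum_le_sum_of_subset_of_nonneg hR
      fun i _ _ => mul_nonneg (hw i) (sq_nonneg _))
    rw [Finset.sum_filter]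
    refine Finset.sum_congr rfl fun i _ => ?_
    split_ifs with h
    · rfl
    · simp [(hr r hr').vanish i (not_not.1 h)]
  refine le_trans (add_le_add ?_ (mul_le_mul_of_nonneg_left ?_ hμ)) (hb t ht R)
  · simpa [en] using hsum (fun _ => 1) (fun _ => zero_le_one) t ht
  · exact intervalIntegral.integral_mono_on ht
      ((continuousOn_finsetSum _ fun i _ => hcont i).intervalIntegrable_of_Icc ht)
      ((continuousOn_finsetSum _ fun i _ => hcont i).intervalIntegrable_of_Icc ht)
      fun r hr' => hsum (fun i => S.wabs i.2 ^ 2) (fun _ => sq_nonneg _) r hr'.1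

end Setting

/-! ### Uniqueness in the energy class -/

/-- A Gronwall argument with an integrable weight, for functions without regularity in time. -/
lemma eq_zero_of_forall_le_integral {D γ : ℝ → ℝ} {T M κ : ℝ} (hκ : 0 < κ)
    (hγ : IntegrableOn γ (Icc 0 T)) (hD0 : ∀ t ∈ Icc 0 T, 0 ≤ D t) (hDM : ∀ t ∈ Icc 0 T, D t ≤ M)
    (h0 : D 0 = 0)
    (h : ∀ a t₁ m : ℝ, 0 ≤ a → a ≤ t₁ → t₁ ≤ T → (∀ r ∈ Icc 0 a, D r = 0) →
      (∀ r ∈ Icc 0 t₁, D r ≤ m) → ∀ t ∈ Icc a t₁, D t ≤ κ * m * ∫ r in a..t, γ r) :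
    ∀ t ∈ Icc 0 T, D t = 0 := by
  intro t ht
  have hT : 0 ≤ T := ht.1.trans ht.2
  have hcont : ContinuousOn (fun t => ∫ r in (0 : ℝ)..t, γ r) (Icc 0 T) := by
    have := intervalIntegral.continuousOn_primitive_interval (f := γ) (a := 0) (b := T) (μ := volume)
      (by rwa [uIcc_of_le hT])
    rwa [uIcc_of_le hT] at this
  -- On intervals shorter than δ the weight integrates to less than 1/(2κ), so the supremum m of D
  -- up to the end of such an interval satisfies m ≤ m/2. Vanishing then propagates in steps of
  -- length δ/2. Working with suprema requires neither continuity nor measurability of D.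
  obtain ⟨δ, hδ, hδ'⟩ := Metric.uniformContinuousOn_iff.1
    (isCompact_Icc.uniformContinuousOn_of_continuous hcont) (1 / (2 * κ)) (by positivity)
  have hint : ∀ a b, a ∈ Icc 0 T → b ∈ Icc 0 T → IntervalIntegrable γ volume a b := fun a b ha hb =>
    (hγ.mono_set (fun r hr => ⟨(le_min ha.1 hb.1).trans hr.1,
      hr.2.trans (max_le ha.2 hb.2)⟩)).intervalIntegrable
  have key : ∀ n : ℕ, ∀ r ∈ Icc 0 T, r ≤ n * (δ / 2) → D r = 0 := by
    intro n
    induction n with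
    | zero =>
      intro r hr hr'
      have : r = 0 := le_antisymm (by simpa using hr') hr.1
      rw [this, h0]
    | succ n ih =>
      set a := min ((n : ℝ) * (δ / 2)) T with ha
      set t₁ := min (((n + 1 : ℕ) : ℝ) * (δ / 2)) T with ht₁
      have ha0 : 0 ≤ a := le_min (by positivity) hT
      have haT : a ≤ T := min_le_right _ _
      have hat : a ≤ t₁ := min_le_min_right _ (by push_cast; nlinarith)
      have ht₁T : t₁ ≤ T := min_le_right _ _
      have hta : t₁ ≤ a + δ / 2 := by
        rcases le_total ((n : ℝ) * (δ / 2)) T with h' | h'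
        · rw [ha, min_eq_left h']
          refine (min_le_left _ _).trans (le_of_eq ?_)
          push_cast; ring
        · rw [ha, min_eq_right h']
          linarith
      have hz : ∀ r ∈ Icc 0 a, D r = 0 := fun r hr =>
        ih r ⟨hr.1, hr.2.trans haT⟩ (hr.2.trans (min_le_left _ _))
      have hbdd : BddAbove (D '' Icc 0 t₁) := by
        refine ⟨M, ?_⟩
        rintro _ ⟨r, hr, rfl⟩
        exact hDM r ⟨hr.1, hr.2.trans ht₁T⟩
      set m := sSup (D '' Icc 0 t₁) with hm
      have hle : ∀ r ∈ Icc 0 t₁, D r ≤ m := fun r hr => le_csSup hbdd (mem_image_of_mem D hr)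
      have hm0 : 0 ≤ m := (hD0 0 ⟨le_rfl, hT⟩).trans (hle 0 ⟨le_rfl, ha0.trans hat⟩)
      have hhalf : ∀ r ∈ Icc 0 t₁, D r ≤ m / 2 := by
        intro r hr
        rcases le_total r a with hra | hra
        · rw [hz r ⟨hr.1, hra⟩]; positivity
        · refine (h a t₁ m ha0 hat ht₁T hz hle r ⟨hra, hr.2⟩).trans ?_
          have haI : a ∈ Icc 0 T := ⟨ha0, haT⟩
          have hrI : r ∈ Icc 0 T := ⟨hr.1, hr.2.trans ht₁T⟩
          have hdist : dist r a < δ := by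
            rw [Real.dist_eq, abs_of_nonneg (by linarith)]
            linarith [hr.2]
          have h1 := hδ' r hrI a haI hdist
          rw [Real.dist_eq, intervalIntegral.integral_interval_sub_left
            (hint 0 r ⟨le_rfl, hT⟩ hrI) (hint 0 a ⟨le_rfl, hT⟩ haI)] at h1
          have h2 := (le_abs_self _).trans h1.le
          calc κ * m * ∫ r in a..r, γ r ≤ κ * m * (1 / (2 * κ)) := by gcongr
            _ = m / 2 := by field_simp
      have hmle : m ≤ m / 2 := csSup_le ⟨_, mem_image_of_mem D ⟨le_rfl, ha0.trans hat⟩⟩ (by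
        rintro _ ⟨r, hr, rfl⟩
        exact hhalf r hr)
      intro r hr hr'
      have hrt : r ∈ Icc 0 t₁ := ⟨hr.1, le_min hr' hr.2⟩
      exact le_antisymm ((hhalf r hrt).trans (by linarith)) (hD0 r hr)
  obtain ⟨n, hn⟩ := exists_nat_ge (t / (δ / 2))
  exact key n t ht ((div_le_iff₀ (by positivity)).1 hn)

namespace Setting

variable {N : ℕ} (S : Setting N)

/-- The growth of the energy of the difference of two solutions. -/
lemma exists_re_sum_sub_le : ∃ C : ℝ, 0 < C ∧ ∀ (U : State N) (μ R m G : ℝ) (x y : Idx N → ℂ),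
    U ∈ S.nullA → 0 < μ → 0 ≤ m → 0 ≤ G → (Summable fun i => ‖x i‖ ^ 2) → (Summable fun i => ‖y i‖ ^ 2) →
    (∀ A : Finset (Idx N), ∑ i ∈ A, ‖(x - y) i‖ ^ 2 ≤ m) →
    (∀ A : Finset (Idx N), ∑ i ∈ A, S.wabs i.2 ^ 2 * ‖x i‖ ^ 2 ≤ G) →
    (∀ A : Finset (Idx N), ∑ i ∈ A, S.wabs i.2 ^ 2 * ‖y i‖ ^ 2 ≤ G) →
    ∑ i ∈ S.ball R, 2 * (conj (x i - y i) * (S.truncRhs U μ R x i - S.truncRhs U μ R y i)).re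
      ≤ C / μ * m * G := by
  obtain ⟨C, hC, hb⟩ := S.exists_sum_mul_burgers_le
  refine ⟨2 * C ^ 2, by positivity, fun U μ R m G x y hU hμ hm hG hxs hys hw hx hy => ?_⟩
  rw [← Finset.mul_sum, S.re_sum_conj_mul_truncRhs_sub hU]
  set H := √(S.gr R (x - y)) with hH
  have hH2 : H ^ 2 = S.gr R (x - y) := Real.sq_sqrt (S.gr_nonneg _ _)
  have hm2 : √m ^ 2 = m := Real.sq_sqrt hm
  have hG2 : √G ^ 2 = G := Real.sq_sqrt hG
  have hws : Summable fun i => ‖(x - y) i‖ ^ 2 := summable_of_sum_le (fun _ => sq_nonneg _) hw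
  have b1 := (hb (x - y) x (x - y) (S.ball R) H √m √G (Real.sqrt_nonneg _) (Real.sqrt_nonneg _)
    (Real.sqrt_nonneg _) (le_of_eq hH2.symm) (by rw [hm2]; exact hw) (by rw [hG2]; exact hx) hxs).1
  have b2 := (hb (x - y) y (x - y) (S.ball R) H √m √G (Real.sqrt_nonneg _) (Real.sqrt_nonneg _)
    (Real.sqrt_nonneg _) (le_of_eq hH2.symm) (by rw [hm2]; exact hw) (by rw [hG2]; exact hy) hys).2
  have e2 : -∑ i ∈ S.ball R, (conj (x i - y i) * (S.burgers x x i - S.burgers y y i)).re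
      ≤ C * H * √m * √G + C * H * √m * √G := by
    refine le_trans ?_ (add_le_add b1 b2)
    rw [← Finset.sum_neg_distrib, ← Finset.sum_add_distrib]
    refine Finset.sum_le_sum fun i _ => ?_
    rw [S.burgers_sub_burgers hxs hys hws]
    refine (neg_re_conj_mul_le _ _).trans ?_
    rw [← mul_add]
    exact mul_le_mul_of_nonneg_left (norm_add_le _ _) (norm_nonneg _)
  have e3 := absorb_le hμ C H √m (2 * √G)
  have e4 : C ^ 2 / μ * √m ^ 2 * ((2 * √G) ^ 2 / 2) = 2 * C ^ 2 / μ * m * G := by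
    rw [mul_pow, hm2, hG2]; ring
  rw [e4] at e3
  rw [← hH2]
  linarith

/-- A crude bound on the growth of the energy of the difference of two solutions. -/
lemma re_sum_sub_le_crude {U : State N} (hU : U ∈ S.nullA) {μ R M : ℝ} (hμ : 0 ≤ μ) (hM : 0 ≤ M)
    {x y : Idx N → ℂ} (hx : ∀ A : Finset (Idx N), ∑ i ∈ A, ‖x i‖ ^ 2 ≤ M ^ 2)
    (hy : ∀ A : Finset (Idx N), ∑ i ∈ A, ‖y i‖ ^ 2 ≤ M ^ 2) :
    ∑ i ∈ S.ball R, 2 * (conj (x i - y i) * (S.truncRhs U μ R x i - S.truncRhs U μ R y i)).re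
      ≤ 2 * ∑ i ∈ S.ball R, (2 * M) * (2 * (|S.gam| * (S.wabs i.2 * (M * M)))) := by
  rw [← Finset.mul_sum, S.re_sum_conj_mul_truncRhs_sub hU]
  refine mul_le_mul_of_nonneg_left ?_ zero_le_two
  have h1 := mul_nonneg hμ (S.gr_nonneg R (x - y))
  have h2 : -∑ i ∈ S.ball R, (conj (x i - y i) * (S.burgers x x i - S.burgers y y i)).re
      ≤ ∑ i ∈ S.ball R, (2 * M) * (2 * (|S.gam| * (S.wabs i.2 * (M * M)))) := by
    rw [← Finset.sum_neg_distrib]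
    refine Finset.sum_le_sum fun i _ => (neg_re_conj_mul_le _ _).trans ?_
    have hxi : ∀ z : Idx N → ℂ, (∀ A : Finset (Idx N), ∑ i ∈ A, ‖z i‖ ^ 2 ≤ M ^ 2) → ‖z i‖ ≤ M :=
      fun z hz => le_of_sq_le_sq (by simpa using hz {i}) hM
    refine mul_le_mul ((norm_sub_le _ _).trans (by linarith [hxi x hx, hxi y hy])) ?_
      (norm_nonneg _) (by positivity)
    refine (norm_sub_le _ _).trans ?_
    linarith [S.norm_burgers_le_mul hM hM hx hx i, S.norm_burgers_le_mul hM hM hy hy i]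
  linarith

/-- The full energy of the difference need not be differentiable, but the energy below frequency R
is a finite sum, and the coupling closes on the ball. Its derivative is at most (C/μ) m g(t), with m
a bound for the full difference and with C independent of R. Letting R grow gives the hypothesis of
`eq_zero_of_forall_le_integral`. -/
lemma coord_unique {U : ℝ → State N} {μ T M : ℝ} (hU : ∀ t, 0 ≤ t → U t ∈ S.nullA) (hμ : 0 < μ)
    (hM : 0 ≤ M) {x y : ℝ → Idx N → ℂ} {g : ℝ → ℝ≥0∞}
    (hxz : ∀ t, ∀ i : Idx N, i.2 = 0 → x t i = 0) (hyz : ∀ t, ∀ i : Idx N, i.2 = 0 → y t i = 0)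
    (hx : ∀ i : Idx N, i.2 ≠ 0 → ∀ t ∈ Icc 0 T,
      HasDerivWithinAt (fun t => x t i) (S.rhs (U t) μ (x t) i) (Icc 0 T) t)
    (hy : ∀ i : Idx N, i.2 ≠ 0 → ∀ t ∈ Icc 0 T,
      HasDerivWithinAt (fun t => y t i) (S.rhs (U t) μ (y t) i) (Icc 0 T) t)
    (hxM : ∀ t ∈ Icc 0 T, ∀ A : Finset (Idx N), ∑ i ∈ A, ‖x t i‖ ^ 2 ≤ M ^ 2)
    (hyM : ∀ t ∈ Icc 0 T, ∀ A : Finset (Idx N), ∑ i ∈ A, ‖y t i‖ ^ 2 ≤ M ^ 2)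
    (hgm : AEMeasurable g (volume.restrict (Icc 0 T))) (hgi : ∫⁻ t in Icc 0 T, g t ≠ ⊤)
    (hxg : ∀ t ∈ Icc 0 T, ∀ A : Finset (Idx N),
      ENNReal.ofReal (∑ i ∈ A, S.wabs i.2 ^ 2 * ‖x t i‖ ^ 2) ≤ g t)
    (hyg : ∀ t ∈ Icc 0 T, ∀ A : Finset (Idx N),
      ENNReal.ofReal (∑ i ∈ A, S.wabs i.2 ^ 2 * ‖y t i‖ ^ 2) ≤ g t)
    (h0 : x 0 = y 0) : ∀ t ∈ Icc 0 T, x t = y t := by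
  obtain ⟨C, hC, hb⟩ := S.exists_re_sum_sub_le
  set κ : ℝ := C / μ with hκ
  set γ : ℝ → ℝ := fun t => (g t).toReal with hγ
  have hγi : IntegrableOn γ (Icc 0 T) := integrable_toReal_of_lintegral_ne_top hgm hgi
  have hgtop : ∀ᵐ t ∂(volume.restrict (Icc 0 T)), g t ≠ ⊤ := by
    filter_upwards [ae_lt_top' hgm hgi] with t ht using ht.ne
  have hsx : ∀ t ∈ Icc 0 T, Summable fun i => ‖x t i‖ ^ 2 := fun t ht =>
    summable_of_sum_le (fun _ => sq_nonneg _) (hxM t ht)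
  have hsy : ∀ t ∈ Icc 0 T, Summable fun i => ‖y t i‖ ^ 2 := fun t ht =>
    summable_of_sum_le (fun _ => sq_nonneg _) (hyM t ht)
  have hwM : ∀ t ∈ Icc 0 T, ∀ A : Finset (Idx N), ∑ i ∈ A, ‖(x t - y t) i‖ ^ 2 ≤ 4 * M ^ 2 := by
    intro t ht A
    have h1 : ∑ i ∈ A, ‖(x t - y t) i‖ ^ 2 ≤ ∑ i ∈ A, (2 * ‖x t i‖ ^ 2 + 2 * ‖y t i‖ ^ 2) := by
      refine Finset.sum_le_sum fun i _ => ?_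
      have h2 : ‖(x t - y t) i‖ ^ 2 ≤ (‖x t i‖ + ‖y t i‖) ^ 2 :=
        pow_le_pow_left₀ (norm_nonneg _) (norm_sub_le _ _) 2
      nlinarith [sq_nonneg (‖x t i‖ - ‖y t i‖)]
    rw [Finset.sum_add_distrib, ← Finset.mul_sum, ← Finset.mul_sum] at h1
    linarith [hxM t ht A, hyM t ht A]
  have hsw : ∀ t ∈ Icc 0 T, Summable fun i => ‖(x t - y t) i‖ ^ 2 := fun t ht =>
    summable_of_sum_le (fun _ => sq_nonneg _) (hwM t ht)
  set D : ℝ → ℝ := fun t => ∑' i, ‖(x t - y t) i‖ ^ 2 with hD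
  have hDzero : ∀ t ∈ Icc 0 T, D t = 0 → x t = y t := by
    intro t ht h
    have hs := (hsw t ht).hasSum
    rw [show ∑' i, ‖(x t - y t) i‖ ^ 2 = 0 from h] at hs
    have h1 := (hasSum_zero_iff_of_nonneg fun i => sq_nonneg ‖(x t - y t) i‖).1 hs
    funext i
    have h2 : ‖(x t - y t) i‖ ^ 2 = 0 := congrFun h1 i
    exact sub_eq_zero.1 (norm_eq_zero.1 (pow_eq_zero_iff two_ne_zero |>.1 h2))
  suffices h : ∀ t ∈ Icc 0 T, D t = 0 from fun t ht => hDzero t ht (h t ht)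
  refine eq_zero_of_forall_le_integral (M := 4 * M ^ 2) (κ := κ) (by positivity) hγi
    (fun t _ => tsum_nonneg fun _ => sq_nonneg _)
    (fun t ht => (hsw t ht).tsum_le_of_sum_le (hwM t ht)) (by simp [hD, h0]) ?_
  intro a t₁ m ha hat ht₁T hz hle t ht
  have ht₁0 : 0 ≤ t₁ := ha.trans hat
  have hsub : Icc 0 t₁ ⊆ Icc 0 T := Icc_subset_Icc_right ht₁T
  have htI : t ∈ Icc 0 t₁ := ⟨ha.trans ht.1, ht.2⟩
  have hm0 : 0 ≤ m := (tsum_nonneg fun _ => sq_nonneg _).trans (hle 0 ⟨le_rfl, ht₁0⟩)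
  refine (hsw t (hsub htI)).tsum_le_of_sum_le (S.sum_sq_le_of_en (fun i hi => by
    rw [Pi.sub_apply, hxz t i hi, hyz t i hi, sub_zero]) fun R => ?_)
  set L : ℝ := 2 * ∑ i ∈ S.ball R, (2 * M) * (2 * (|S.gam| * (S.wabs i.2 * (M * M)))) with hL
  -- The majorant has to hold at every time. Before a the solutions coincide; on the null set where
  -- g is infinite, the crude bound L, which may depend on R, stands in without changing the
  -- integral.
  set φ : ℝ → ℝ := fun r => if r ≤ a then 0 else if g r = ⊤ then L else κ * m * γ r with hφ
  have hae : ∀ᵐ r ∂(volume.restrict (Icc 0 T)), φ r = (Ioi a).indicator (fun r => κ * m * γ r) r := by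
    filter_upwards [hgtop] with r hr
    simp only [hφ, indicator, mem_Ioi]
    by_cases hra : r ≤ a
    · rw [if_pos hra, if_neg (not_lt.2 hra)]
    · rw [if_neg hra, if_pos (not_le.1 hra), if_neg hr]
  have hφi : IntegrableOn φ (Icc 0 T) :=
    (((hγi.const_mul (κ * m)).indicator measurableSet_Ioi).congr
      (hae.mono fun r hr => hr.symm))
  have hd : ∀ r ∈ Icc 0 t₁, HasDerivWithinAt (fun r => S.en R (x r - y r))
      (∑ i ∈ S.ball R, 2 * (conj (x r i - y r i) *
        (S.truncRhs (U r) μ R (x r) i - S.truncRhs (U r) μ R (y r) i)).re) (Icc 0 t₁) r := by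
    intro r hr
    refine HasDerivWithinAt.fun_sum fun i hi => ?_
    refine hasDerivWithinAt_norm_sq (x := fun r => x r i - y r i) ?_
    have hi' := S.mem_ball.1 hi
    rw [← S.rhs_eq _ _ _ hi'.2, ← S.rhs_eq _ _ _ hi'.2]
    exact ((hx i hi'.1 r (hsub hr)).sub (hy i hi'.1 r (hsub hr))).mono hsub
  have hbound : ∀ r ∈ Icc 0 t₁, (∑ i ∈ S.ball R, 2 * (conj (x r i - y r i) *
        (S.truncRhs (U r) μ R (x r) i - S.truncRhs (U r) μ R (y r) i)).re) ≤ φ r := by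
    intro r hr
    simp only [hφ]
    split_ifs with hra hgr
    · rw [hDzero r (hsub hr) (hz r ⟨hr.1, hra⟩)]
      simp
    · exact S.re_sum_sub_le_crude (hU r hr.1) hμ.le hM (hxM r (hsub hr)) (hyM r (hsub hr))
    · have hG : ∀ z : ℝ → Idx N → ℂ, (∀ t ∈ Icc 0 T, ∀ A : Finset (Idx N),
          ENNReal.ofReal (∑ i ∈ A, S.wabs i.2 ^ 2 * ‖z t i‖ ^ 2) ≤ g t) → ∀ A : Finset (Idx N),
          ∑ i ∈ A, S.wabs i.2 ^ 2 * ‖z r i‖ ^ 2 ≤ γ r := fun z hz A =>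
        (ENNReal.ofReal_le_iff_le_toReal hgr).1 (hz r (hsub hr) A)
      exact hb (U r) μ R m (γ r) (x r) (y r) (hU r hr.1) hμ hm0 ENNReal.toReal_nonneg
        (hsx r (hsub hr)) (hsy r (hsub hr))
        (fun A => ((hsw r (hsub hr)).sum_le_tsum A fun _ _ => sq_nonneg _).trans (hle r hr))
        (hG x hxg) (hG y hyg)
  have hmain := sub_le_integral_of_hasDerivWithinAt_Icc hd (hφi.mono_set hsub) hbound htI
  have hen0 : S.en R (x 0 - y 0) = 0 := by rw [h0, sub_self]; simp [en]
  rw [hen0, sub_zero] at hmain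
  refine hmain.trans (le_of_eq ?_)
  have htT : t ∈ Icc 0 T := hsub htI
  rw [intervalIntegral.integral_of_le htI.1, intervalIntegral.integral_of_le ht.1]
  have hres : volume.restrict (Ioc 0 t) ≤ volume.restrict (Icc 0 T) :=
    Measure.restrict_mono
      (show Ioc 0 t ⊆ Icc 0 T from fun r hr => ⟨hr.1.le, hr.2.trans htT.2⟩) le_rfl
  rw [integral_congr_ae (ae_mono hres hae), integral_indicator measurableSet_Ioi,
    Measure.restrict_restrict measurableSet_Ioi, integral_const_mul]
  congr 3
  ext r
  simp only [mem_inter_iff, mem_Ioi, mem_Ioc]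
  exact ⟨fun h => ⟨h.1, h.2.2⟩, fun h => ⟨h.1, ha.trans_lt h.1, h.2⟩⟩

end Setting

namespace Setting

variable {N : ℕ} (S : Setting N) (χ : DyadicCutoff)

/-! ### Comparison of norms -/

lemma tsum_crd_le (V : State N) (f : (Fin N → ℤ) → ℝ) (hf : ∀ n, 0 ≤ f n) :
    ∑' i : Idx N, ENNReal.ofReal (f i.2 * ‖S.crd V i‖ ^ 2)
      ≤ ENNReal.ofReal S.vol * ∑' n, ENNReal.ofReal (f n * S.modeSq (V.hat n)) := by
  rw [← ENNReal.tsum_mul_left, ENNReal.tsum_prod', ENNReal.tsum_comm]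
  refine ENNReal.tsum_le_tsum fun n => ?_
  rw [← ENNReal.ofReal_mul S.vol_pos.le, tsum_fintype, mul_left_comm,
    ← ENNReal.ofReal_sum_of_nonneg fun γ _ => mul_nonneg (hf n) (sq_nonneg _), ← Finset.mul_sum]
  refine ENNReal.ofReal_le_ofReal (mul_le_mul_of_nonneg_left ?_ (hf n))
  by_cases hn : n = 0
  · simp only [crd, if_pos hn]
    have := mul_nonneg S.vol_pos.le (S.modeSq_nonneg (V.hat n))
    simpa using this
  · simp only [crd, if_neg hn]
    exact S.sq_coord_le hn V

lemma ofReal_normSq (V : State N) :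
    ENNReal.ofReal (S.normSq V)
      = ENNReal.ofReal S.vol * ∑' n, ENNReal.ofReal (S.modeSq (V.hat n)) := by
  rw [← (S.hasSum_normSq V).tsum_eq, ENNReal.ofReal_tsum_of_nonneg
    (fun n => mul_nonneg S.vol_pos.le (S.modeSq_nonneg _)) (S.hasSum_normSq V).summable,
    ← ENNReal.tsum_mul_left]
  exact tsum_congr fun n => ENNReal.ofReal_mul S.vol_pos.le

lemma normSq_nonneg (V : State N) : 0 ≤ S.normSq V :=
  (S.hasSum_normSq V).nonneg fun _ => mul_nonneg S.vol_pos.le (S.modeSq_nonneg _)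

lemma sum_crd_le_normSq (V : State N) (A : Finset (Idx N)) :
    ∑ i ∈ A, ‖S.crd V i‖ ^ 2 ≤ S.normSq V := by
  rw [← ENNReal.ofReal_le_ofReal_iff (S.normSq_nonneg V), ofReal_normSq,
    ENNReal.ofReal_sum_of_nonneg fun _ _ => sq_nonneg _]
  have := S.tsum_crd_le V (fun _ => 1) fun _ => zero_le_one
  simp only [one_mul] at this
  exact (ENNReal.sum_le_tsum A).trans this

lemma sum_crd_le_gradSq (V : State N) (A : Finset (Idx N)) :
    ENNReal.ofReal (∑ i ∈ A, S.wabs i.2 ^ 2 * ‖S.crd V i‖ ^ 2) ≤ S.gradSq V := by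
  rw [ENNReal.ofReal_sum_of_nonneg fun _ _ => by positivity]
  exact (ENNReal.sum_le_tsum A).trans (S.tsum_crd_le V (fun n => S.wabs n ^ 2) fun _ => sq_nonneg _)

lemma continuous_modeSq : Continuous S.modeSq := by
  unfold modeSq
  fun_prop

lemma continuous_normSq : Continuous S.normSq := by
  unfold normSq innerH
  fun_prop

/-- The topology of `State N` comes from a maximum of component norms. Control of the maximum norm
by the weighted L² norm turns continuity in B^{s-1} into continuity in `State N`. -/
lemma exists_sq_norm_le : ∃ K : ℝ, ∀ W : State N, ‖W‖ ^ 2 ≤ K * S.normSq W := by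
  have h1 := S.pr_pos
  have h2 := S.et_pos
  have h3 := S.rho_pos
  have h4 := S.theta_pos
  have h5 := S.vol_pos
  set a := S.vol * (S.pr / (S.rho * S.theta)) with ha
  set b := S.vol * (S.rho / S.theta) with hb
  set d := S.vol * (S.rho * S.et / S.theta ^ 2) with hd
  have ha0 : 0 < a := by positivity
  have hb0 : 0 < b := by positivity
  have hd0 : 0 < d := by positivity
  refine ⟨a⁻¹ + b⁻¹ + d⁻¹, fun W => ?_⟩
  have hW : S.normSq W = a * ‖W.1‖ ^ 2 + b * ∑ i, ‖W.2.1 i‖ ^ 2 + d * ‖W.2.2‖ ^ 2 := by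
    simp only [normSq, innerH, real_inner_self_eq_norm_sq]
    ring
  have h0 := S.normSq_nonneg W
  have e1 : 0 ≤ a * ‖W.1‖ ^ 2 := by positivity
  have e2 : 0 ≤ b * ∑ i, ‖W.2.1 i‖ ^ 2 := by positivity
  have e3 : 0 ≤ d * ‖W.2.2‖ ^ 2 := by positivity
  have hle : ∀ {k z : ℝ}, 0 < k → k * z ^ 2 ≤ S.normSq W → k⁻¹ ≤ a⁻¹ + b⁻¹ + d⁻¹ →
      z ≤ √((a⁻¹ + b⁻¹ + d⁻¹) * S.normSq W) := by
    intro k z hk hz hk'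
    refine Real.le_sqrt_of_sq_le ?_
    have : z ^ 2 ≤ k⁻¹ * S.normSq W := by
      rw [← div_eq_inv_mul, le_div_iff₀ hk, mul_comm]; exact hz
    exact this.trans (mul_le_mul_of_nonneg_right hk' h0)
  have i1 : 0 < a⁻¹ := by positivity
  have i2 : 0 < b⁻¹ := by positivity
  have i3 : 0 < d⁻¹ := by positivity
  have hnorm : ‖W‖ ≤ √((a⁻¹ + b⁻¹ + d⁻¹) * S.normSq W) := by
    refine max_le (hle ha0 (by linarith) (by linarith)) (max_le ?_
      (hle hd0 (by linarith) (by linarith)))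
    refine (pi_norm_le_iff_of_nonneg (Real.sqrt_nonneg _)).2 fun i => hle hb0 ?_ (by linarith)
    have e4 : ‖W.2.1 i‖ ^ 2 ≤ ∑ i, ‖W.2.1 i‖ ^ 2 :=
      Finset.single_le_sum (f := fun i => ‖W.2.1 i‖ ^ 2) (fun _ _ => sq_nonneg _) (Finset.mem_univ i)
    have e5 := mul_le_mul_of_nonneg_left e4 hb0.le
    linarith
  calc ‖W‖ ^ 2 ≤ √((a⁻¹ + b⁻¹ + d⁻¹) * S.normSq W) ^ 2 := pow_le_pow_left₀ (norm_nonneg _) hnorm 2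
    _ = _ := Real.sq_sqrt (by positivity)

/-- Since 12/5 · 1/4 < 5/6, only neighbouring blocks overlap. If block p is active at n, then only p
- 1, p, p + 1 can be, and Cauchy–Schwarz on the partition of unity gives the factor 3. -/
lemma one_le_tsum_cut_sq {n : Fin N → ℤ} (hn : n ≠ 0) :
    1 ≤ 3 * ∑' q : ℤ, ENNReal.ofReal (S.cut χ q n ^ 2) := by
  have hpos := S.wabs_pos hn
  have hsum := χ.sum_eq_one (S.wabs n) hpos.ne'
  obtain ⟨p, hp⟩ : ∃ p, S.cut χ p n ≠ 0 := by
    by_contra! h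
    have : HasSum (fun q : ℤ => χ.φ ((2 : ℝ) ^ (-q) * S.wabs n)) 0 := by
      convert hasSum_zero using 2 with q
      exact h q
    exact zero_ne_one (this.unique hsum)
  obtain ⟨hp1, hp2⟩ := S.cut_bounds hp
  have hQ : ∀ q, q ∉ Finset.Icc (p - 1) (p + 1) → S.cut χ q n = 0 := by
    intro q hq
    by_contra hc
    obtain ⟨hq1, hq2⟩ := S.cut_bounds hc
    rw [Finset.mem_Icc, not_and_or, not_le, not_le] at hq
    have hpp : (0 : ℝ) < (2 : ℝ) ^ p := by positivity
    have hqp : (0 : ℝ) < (2 : ℝ) ^ q := by positivity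
    rcases hq with hq | hq
    · have h1 : (2 : ℝ) ^ q ≤ (2 : ℝ) ^ (p - 2) := zpow_le_zpow_right₀ one_le_two (by omega)
      rw [zpow_sub₀ two_ne_zero] at h1
      norm_num at h1
      linarith
    · have h1 : (2 : ℝ) ^ p ≤ (2 : ℝ) ^ (q - 2) := zpow_le_zpow_right₀ one_le_two (by omega)
      rw [zpow_sub₀ two_ne_zero] at h1
      norm_num at h1
      linarith
  have h1 : (1 : ℝ) ≤ 3 * ∑ q ∈ Finset.Icc (p - 1) (p + 1), S.cut χ q n ^ 2 := by
    have h2 := hsum.unique (hasSum_sum_of_ne_finset_zero hQ)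
    have h3 := sq_sum_le_card_mul_sum_sq (s := Finset.Icc (p - 1) (p + 1)) (f := fun q => S.cut χ q n)
    have h4 : (Finset.Icc (p - 1) (p + 1)).card = 3 := by
      rw [Int.card_Icc]; omega
    rw [h4] at h3
    change (∑ q ∈ Finset.Icc (p - 1) (p + 1), χ.φ ((2 : ℝ) ^ (-q) * S.wabs n)) ^ 2 ≤ _ at h3
    rw [← h2] at h3
    push_cast at h3
    linarith
  calc (1 : ℝ≥0∞) = ENNReal.ofReal 1 := ENNReal.ofReal_one.symm
    _ ≤ ENNReal.ofReal (3 * ∑ q ∈ Finset.Icc (p - 1) (p + 1), S.cut χ q n ^ 2) :=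
        ENNReal.ofReal_le_ofReal h1
    _ = 3 * ∑ q ∈ Finset.Icc (p - 1) (p + 1), ENNReal.ofReal (S.cut χ q n ^ 2) := by
        rw [ENNReal.ofReal_mul (by norm_num), ENNReal.ofReal_sum_of_nonneg fun _ _ => sq_nonneg _]
        norm_num
    _ ≤ _ := mul_le_mul_right (ENNReal.sum_le_tsum _) _

lemma blockNorm_sq (q : ℤ) (V : State N) : S.blockNorm χ q V ^ 2
    = ENNReal.ofReal S.vol * ∑' n, ENNReal.ofReal (S.cut χ q n ^ 2 * S.modeSq (V.hat n)) := by
  rw [blockNorm, ← ENNReal.rpow_natCast, ← ENNReal.rpow_mul,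
    show (1 / 2 : ℝ) * ((2 : ℕ) : ℝ) = 1 by norm_num, ENNReal.rpow_one]
  rfl

lemma tsum_le_tsum_blockNorm_sq (V : State N) (f : (Fin N → ℤ) → ℝ) (F : ℤ → ℝ)
    (hF : ∀ q, 0 ≤ F q) (hfF : ∀ q n, S.cut χ q n ≠ 0 → f n ≤ F q) :
    ENNReal.ofReal S.vol * ∑' n, (if n = 0 then 0 else ENNReal.ofReal (f n * S.modeSq (V.hat n)))
      ≤ 3 * ∑' q : ℤ, ENNReal.ofReal (F q) * S.blockNorm χ q V ^ 2 := by
  have h1 : ∀ n, (if n = 0 then 0 else ENNReal.ofReal (f n * S.modeSq (V.hat n)))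
      ≤ 3 * ∑' q : ℤ, ENNReal.ofReal (F q) * ENNReal.ofReal (S.cut χ q n ^ 2 * S.modeSq (V.hat n)) := by
    intro n
    split_ifs with hn
    · exact bot_le
    · calc ENNReal.ofReal (f n * S.modeSq (V.hat n))
          ≤ (3 * ∑' q : ℤ, ENNReal.ofReal (S.cut χ q n ^ 2)) *
            ENNReal.ofReal (f n * S.modeSq (V.hat n)) :=
            le_mul_of_one_le_left' (S.one_le_tsum_cut_sq χ hn)
        _ = 3 * ∑' q : ℤ, ENNReal.ofReal (S.cut χ q n ^ 2) *
            ENNReal.ofReal (f n * S.modeSq (V.hat n)) := by rw [mul_assoc, ENNReal.tsum_mul_right]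
        _ ≤ _ := by
            refine mul_le_mul_right (ENNReal.tsum_le_tsum fun q => ?_) _
            rw [← ENNReal.ofReal_mul (sq_nonneg _), ← ENNReal.ofReal_mul (hF q)]
            refine ENNReal.ofReal_le_ofReal ?_
            by_cases hc : S.cut χ q n = 0
            · simp [hc]
            · have h2 := hfF q n hc
              have h3 := S.modeSq_nonneg (V.hat n)
              calc _ = f n * (S.cut χ q n ^ 2 * S.modeSq (V.hat n)) := by ring
                _ ≤ _ := by gcongr
  refine (mul_le_mul_right (ENNReal.tsum_le_tsum h1) _).trans (le_of_eq ?_)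
  rw [ENNReal.tsum_mul_left, ENNReal.tsum_comm, mul_left_comm, ← ENNReal.tsum_mul_left]
  congr 1
  refine tsum_congr fun q => ?_
  rw [ENNReal.tsum_mul_left, blockNorm_sq, mul_left_comm]

lemma tsum_mul_le_mul_tsum {ι : Type*} (a b : ι → ℝ≥0∞) :
    ∑' i, a i * b i ≤ (∑' i, a i) * ∑' i, b i := by
  rw [← ENNReal.tsum_mul_right]
  exact ENNReal.tsum_le_tsum fun i => mul_le_mul_right (ENNReal.le_tsum i) _

/-- Blocks below the smallest nonzero wave number are empty, and on the remaining ones 2^{qs} is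
bounded below because s ≥ 0. -/
lemma exists_blockNorm_le {s : ℝ} (hs : 0 ≤ s) : ∃ K : ℝ, 0 < K ∧ ∀ (q : ℤ) (V : State N),
    S.blockNorm χ q V ≤ ENNReal.ofReal K * (ENNReal.ofReal (wt s q) * S.blockNorm χ q V) := by
  obtain ⟨r, hr, hrn⟩ := S.exists_wabs_ge
  refine ⟨((5 / 12 * r) ^ s)⁻¹, by positivity, fun q V => ?_⟩
  by_cases h : 5 / 12 * r ≤ (2 : ℝ) ^ q
  · rw [← mul_assoc, ← ENNReal.ofReal_mul (by positivity)]
    refine le_mul_of_one_le_left' ?_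
    rw [← ENNReal.ofReal_one]
    refine ENNReal.ofReal_le_ofReal ?_
    rw [← div_eq_inv_mul, one_le_div (by positivity), wt, Real.rpow_mul zero_le_two,
      Real.rpow_intCast]
    exact Real.rpow_le_rpow (by positivity) h hs
  · have h0 : S.blockNorm χ q V ^ 2 = 0 := by
      rw [blockNorm_sq, ENNReal.tsum_eq_zero.2, mul_zero]
      intro n
      have hc : S.cut χ q n = 0 := by
        by_contra hc
        obtain ⟨h1, h2⟩ := S.cut_bounds hc
        have hq : (0 : ℝ) < (2 : ℝ) ^ q := by positivity
        by_cases hn : n = 0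
        · rw [hn, wabs_zero] at h1
          linarith
        · linarith [hrn n hn]
      simp [hc]
    rw [pow_eq_zero_iff two_ne_zero] at h0
    rw [h0]
    exact bot_le

lemma exists_normSq_le_besov {s : ℝ} (hs : 0 ≤ s) : ∃ K : ℝ, ∀ V : State N,
    ENNReal.ofReal (S.normSq V) ≤ ENNReal.ofReal K * S.besov χ s V ^ 2 := by
  classical
  obtain ⟨K, hK, hKb⟩ := S.exists_blockNorm_le χ hs
  refine ⟨S.vol + 3 * K ^ 2, fun V => ?_⟩
  have hb1 : S.meanNorm V ≤ S.besov χ s V := le_add_right le_rfl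
  have hb2 : ∑' q : ℤ, ENNReal.ofReal (wt s q) * S.blockNorm χ q V ≤ S.besov χ s V :=
    le_add_left le_rfl
  have h1 : ∑' n, ENNReal.ofReal (S.modeSq (V.hat n)) = ENNReal.ofReal (S.modeSq (V.hat 0))
      + ∑' n, (if n = 0 then 0 else ENNReal.ofReal (1 * S.modeSq (V.hat n))) := by
    rw [ENNReal.tsum_eq_add_tsum_ite 0]
    simp only [one_mul]
    exact congrArg _ (tsum_congr fun n => by split_ifs <;> rfl)
  have h2 : ENNReal.ofReal (S.modeSq (V.hat 0)) = S.meanNorm V ^ 2 := by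
    rw [meanNorm, ← ENNReal.ofReal_pow (Real.sqrt_nonneg _), Real.sq_sqrt (S.modeSq_nonneg _)]
  have h3 : ∑' q : ℤ, ENNReal.ofReal 1 * S.blockNorm χ q V ^ 2
      ≤ ENNReal.ofReal K ^ 2 * S.besov χ s V ^ 2 := by
    calc ∑' q : ℤ, ENNReal.ofReal 1 * S.blockNorm χ q V ^ 2
        = ∑' q : ℤ, S.blockNorm χ q V * S.blockNorm χ q V := by
          simp only [ENNReal.ofReal_one, one_mul, sq]
      _ ≤ (∑' q : ℤ, S.blockNorm χ q V) * ∑' q : ℤ, S.blockNorm χ q V := tsum_mul_le_mul_tsum _ _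
      _ = (∑' q : ℤ, S.blockNorm χ q V) ^ 2 := (sq _).symm
      _ ≤ (ENNReal.ofReal K * S.besov χ s V) ^ 2 := by
          gcongr
          refine (ENNReal.tsum_le_tsum fun q => hKb q V).trans ?_
          rw [ENNReal.tsum_mul_left]
          gcongr
      _ = _ := mul_pow _ _ _
  rw [ofReal_normSq, h1, mul_add, h2, ENNReal.ofReal_add S.vol_pos.le (by positivity), add_mul,
    ENNReal.ofReal_mul (by norm_num), ENNReal.ofReal_pow hK.le, mul_assoc (ENNReal.ofReal 3)]
  refine add_le_add (by gcongr) ((S.tsum_le_tsum_blockNorm_sq χ V (fun _ => 1) (fun _ => 1)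
    (fun _ => zero_le_one) fun _ _ _ => le_rfl).trans ?_)
  have : ENNReal.ofReal 3 = 3 := by norm_num
  rw [this]
  gcongr

/-- The key identity is 4^q (2^{q(s-1)})² = 2^{q(s-1)} 2^{q(s+1)}. The missing weights 2^{q(s-1)}
are inserted at the cost of a constant, as s ≥ 1, and a sum of products is at most the product of
the sums. -/
lemma exists_gradSq_le_besov {s : ℝ} (hs : 1 ≤ s) : ∃ K : ℝ, ∀ V : State N,
    S.gradSq V ≤ ENNReal.ofReal K * (S.besov χ (s - 1) V * S.besov χ (s + 1) V) := by
  classical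
  obtain ⟨K, hK, hKb⟩ := S.exists_blockNorm_le χ (sub_nonneg.2 hs)
  refine ⟨3 * ((12 / 5) ^ 2 * K ^ 2), fun V => ?_⟩
  have h1 : ∀ n, ENNReal.ofReal (S.wabs n ^ 2 * S.modeSq (V.hat n))
      = if n = 0 then 0 else ENNReal.ofReal (S.wabs n ^ 2 * S.modeSq (V.hat n)) := by
    intro n
    split_ifs with hn
    · rw [hn, wabs_zero]; simp
    · rfl
  rw [gradSq, tsum_congr h1]
  refine (S.tsum_le_tsum_blockNorm_sq χ V (fun n => S.wabs n ^ 2)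
    (fun q => (12 / 5 * (2 : ℝ) ^ q) ^ 2) (fun _ => sq_nonneg _)
    fun q n hc => pow_le_pow_left₀ (S.wabs_nonneg n) (S.cut_bounds hc).2 2).trans ?_
  have hb : ∀ σ, ∑' q : ℤ, ENNReal.ofReal (wt σ q) * S.blockNorm χ q V ≤ S.besov χ σ V := fun σ =>
    le_add_left le_rfl
  have h2 : ∀ q : ℤ, ENNReal.ofReal ((12 / 5 * (2 : ℝ) ^ q) ^ 2) * S.blockNorm χ q V ^ 2
      ≤ ENNReal.ofReal ((12 / 5) ^ 2 * K ^ 2) * ((ENNReal.ofReal (wt (s - 1) q) * S.blockNorm χ q V)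
        * (ENNReal.ofReal (wt (s + 1) q) * S.blockNorm χ q V)) := by
    intro q
    have h3 : S.blockNorm χ q V ^ 2 ≤ (ENNReal.ofReal K * (ENNReal.ofReal (wt (s - 1) q) *
        S.blockNorm χ q V)) ^ 2 := by gcongr; exact hKb q V
    calc ENNReal.ofReal ((12 / 5 * (2 : ℝ) ^ q) ^ 2) * S.blockNorm χ q V ^ 2
        ≤ ENNReal.ofReal ((12 / 5 * (2 : ℝ) ^ q) ^ 2) * (ENNReal.ofReal K *
          (ENNReal.ofReal (wt (s - 1) q) * S.blockNorm χ q V)) ^ 2 := by gcongr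
      _ = _ := by
        rw [wt_add_two, ENNReal.ofReal_mul (wt_pos _ _).le, mul_pow (12 / 5 : ℝ),
          ENNReal.ofReal_mul (by positivity), ENNReal.ofReal_mul (by positivity),
          ENNReal.ofReal_pow hK.le]
        ring
  have h4 : ENNReal.ofReal 3 = 3 := by norm_num
  rw [ENNReal.ofReal_mul (by norm_num), h4, mul_assoc]
  refine mul_le_mul_right ((ENNReal.tsum_le_tsum h2).trans ?_) _
  rw [ENNReal.tsum_mul_left]
  refine mul_le_mul_right ((tsum_mul_le_mul_tsum _ _).trans ?_) _
  exact mul_le_mul' (hb _) (hb _)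

variable {S χ}

/-- A uniform bound in B^{s-1} times integrability in B^{s+1} gives L²(0,T; H¹) by
`exists_gradSq_le_besov`. Continuity follows because B^{s-1} embeds in L² for s ≥ 1. -/
lemma MemF.memEnergy {s : ℝ} (hs : 1 ≤ s) {V : ℝ → State N} (h : S.MemF χ s V) (T : ℝ) :
    S.MemEnergy T V := by
  obtain ⟨K₁, hK₁⟩ := S.exists_normSq_le_besov χ (sub_nonneg.2 hs)
  obtain ⟨K₂, hK₂⟩ := S.exists_sq_norm_le
  obtain ⟨K₃, hK₃⟩ := S.exists_gradSq_le_besov χ hs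
  refine ⟨fun t₀ ht₀ => ?_, ?_⟩
  · have h1 := (h.continuous t₀ ht₀.1).mono_left
      (nhdsWithin_mono t₀ (show Icc 0 T ⊆ Ici 0 from Icc_subset_Ici_self))
    have h2 : Tendsto (fun t => ENNReal.ofReal K₁ * S.besov χ (s - 1) (V t - V t₀) ^ 2)
        (𝓝[Icc 0 T] t₀) (𝓝 0) := by
      have := ENNReal.Tendsto.const_mul (a := ENNReal.ofReal K₁) (ENNReal.Tendsto.pow (n := 2) h1) (Or.inr ENNReal.ofReal_ne_top)
      simpa using this
    have h3 : Tendsto (fun t => ENNReal.ofReal (S.normSq (V t - V t₀))) (𝓝[Icc 0 T] t₀) (𝓝 0) :=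
      tendsto_of_tendsto_of_tendsto_of_le_of_le tendsto_const_nhds h2 (fun _ => bot_le)
        fun t => hK₁ _
    have h4 : Tendsto (fun t => S.normSq (V t - V t₀)) (𝓝[Icc 0 T] t₀) (𝓝 0) := by
      have := (ENNReal.tendsto_toReal ENNReal.zero_ne_top).comp h3
      simpa only [Function.comp_def, ENNReal.toReal_ofReal (S.normSq_nonneg _),
        ENNReal.toReal_zero] using this
    have h5 : Tendsto (fun t => ‖V t - V t₀‖ ^ 2) (𝓝[Icc 0 T] t₀) (𝓝 0) := by
      refine squeeze_zero (fun _ => sq_nonneg _) (fun t => hK₂ (V t - V t₀)) ?_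
      simpa using h4.const_mul K₂
    have h6 : Tendsto (fun t => ‖V t - V t₀‖) (𝓝[Icc 0 T] t₀) (𝓝 0) := by
      have := h5.sqrt
      simpa using this
    exact tendsto_iff_norm_sub_tendsto_zero.2 h6
  · set L : ℝ≥0∞ := (⨆ t ∈ Ici (0 : ℝ), S.meanNorm (V t))
      + ∑' q : ℤ, ENNReal.ofReal ((2 : ℝ) ^ ((q : ℝ) * (s - 1))) *
        (⨆ t ∈ Ici (0 : ℝ), S.blockNorm χ q (V t)) with hL
    have h1 : ∀ t, 0 ≤ t → S.besov χ (s - 1) (V t) ≤ L := by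
      intro t ht
      refine add_le_add (le_iSup₂ (f := fun t (_ : t ∈ Ici (0 : ℝ)) => S.meanNorm (V t)) t ht)
        (ENNReal.tsum_le_tsum fun q => mul_le_mul_right ?_ _)
      exact le_iSup₂ (f := fun t (_ : t ∈ Ici (0 : ℝ)) => S.blockNorm χ q (V t)) t ht
    have h2 : ∫⁻ t in Ioc 0 T, S.gradSq (V t)
        ≤ ENNReal.ofReal K₃ * L * ∫⁻ t in Ioi 0, S.besov χ (s + 1) (V t) := by
      rw [← lintegral_const_mul' _ _ (ENNReal.mul_ne_top ENNReal.ofReal_ne_top h.tilde)]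
      refine (setLIntegral_mono' measurableSet_Ioc fun t ht => ?_).trans
        (lintegral_mono_set Ioc_subset_Ioi_self)
      refine (hK₃ (V t)).trans ?_
      rw [mul_assoc]
      exact mul_le_mul_right (mul_le_mul_left (h1 t ht.1.le) _) _
    exact ne_top_of_le_ne_top (ENNReal.mul_ne_top (ENNReal.mul_ne_top ENNReal.ofReal_ne_top h.tilde)
      h.integrable) h2

lemma MemEnergy.aemeasurable_gradSq {V : ℝ → State N} {T : ℝ}
    (hc : ∀ n, ContinuousOn (fun t => (V t).hat n) (Icc 0 T)) :
    AEMeasurable (fun t => S.gradSq (V t)) (volume.restrict (Icc 0 T)) := by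
  simp only [gradSq]
  refine AEMeasurable.const_mul (AEMeasurable.tsum fun n => ?_) _
  exact ((S.continuous_modeSq.comp_continuousOn (hc n)).const_mul _).aemeasurable
    measurableSet_Icc |>.ennreal_ofReal

lemma SolvesLS.eq_of_memEnergy {τ : Transport} {U V₁ V₂ : ℝ → State N} {T : ℝ}
    (hU : ∀ t, 0 ≤ t → U t ∈ S.nullA) (hμ : 0 < S.muBar τ)
    (hV₁ : S.MemEnergy T V₁) (hV₂ : S.MemEnergy T V₂)
    (h₁ : S.SolvesLS τ U (Icc 0 T) V₁) (h₂ : S.SolvesLS τ U (Icc 0 T) V₂) (h0 : V₁ 0 = V₂ 0) :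
    ∀ t ∈ Icc 0 T, V₁ t = V₂ t := by
  obtain ⟨M₁, hM₁⟩ := isCompact_Icc.exists_bound_of_continuousOn
    (S.continuous_normSq.comp_continuousOn hV₁.continuous)
  obtain ⟨M₂, hM₂⟩ := isCompact_Icc.exists_bound_of_continuousOn
    (S.continuous_normSq.comp_continuousOn hV₂.continuous)
  set M := √(max (max M₁ M₂) 0) with hM
  have hM2 : M ^ 2 = max (max M₁ M₂) 0 := Real.sq_sqrt (le_max_right _ _)
  have hcrd : ∀ t ∈ Icc 0 T, S.crd (V₁ t) = S.crd (V₂ t) := by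
    refine S.coord_unique (M := M) (g := fun t => S.gradSq (V₁ t) + S.gradSq (V₂ t)) hU hμ
      (Real.sqrt_nonneg _) (fun t i hi => if_pos hi) (fun t i hi => if_pos hi)
      (fun i hi t ht => h₁.hasDerivWithinAt_crd hi ht) (fun i hi t ht => h₂.hasDerivWithinAt_crd hi ht)
      (fun t ht A => ?_) (fun t ht A => ?_)
      ((MemEnergy.aemeasurable_gradSq fun n t ht => (h₁ n t ht).continuousWithinAt).add
        (MemEnergy.aemeasurable_gradSq fun n t ht => (h₂ n t ht).continuousWithinAt)) ?_
      (fun t _ A => (S.sum_crd_le_gradSq _ A).trans (le_add_right le_rfl))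
      (fun t _ A => (S.sum_crd_le_gradSq _ A).trans (le_add_left le_rfl)) (by simp only [h0])
    · rw [hM2]
      exact (S.sum_crd_le_normSq _ A).trans (((le_abs_self _).trans (hM₁ t ht)).trans
        ((le_max_left _ _).trans (le_max_left _ _)))
    · rw [hM2]
      exact (S.sum_crd_le_normSq _ A).trans (((le_abs_self _).trans (hM₂ t ht)).trans
        ((le_max_right _ _).trans (le_max_left _ _)))
    · rw [lintegral_add_left' (MemEnergy.aemeasurable_gradSq
        fun n t ht => (h₁ n t ht).continuousWithinAt), ← setLIntegral_congr Ioc_ae_eq_Icc,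
        ← setLIntegral_congr Ioc_ae_eq_Icc]
      exact ENNReal.add_ne_top.2 ⟨hV₁.integrable, hV₂.integrable⟩
  exact fun t ht => h₁.hat_eq h₂ h0 hcrd ht

end Setting

/-! ### Uniqueness in F^s and assembly of the theorem -/

namespace Setting

variable {N : ℕ} {S : Setting N} {χ : DyadicCutoff}

lemma Rep.exists_sum_bn_le {s : ℝ} {V : State N} {x : Idx N → ℂ} (h : S.Rep V x)
    (hV : S.besov χ s V ≠ ⊤) : ∃ B : ℝ, 0 ≤ B ∧ S.besov χ s V = ENNReal.ofReal B ∧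
      ∀ A : Finset ℤ, ∑ q ∈ A, wt s q * S.bn χ q x ≤ B := by
  have h0 : ∀ q, 0 ≤ wt s q * S.bn χ q x := fun q => mul_nonneg (wt_pos s q).le (S.bn_nonneg χ q x)
  rw [h.besov_eq χ s] at hV
  have hs : Summable fun q => wt s q * S.bn χ q x := by
    have := ENNReal.summable_toReal hV
    simpa only [ENNReal.toReal_ofReal (h0 _)] using this
  exact ⟨∑' q, wt s q * S.bn χ q x, tsum_nonneg h0,
    by rw [h.besov_eq χ s, ENNReal.ofReal_tsum_of_nonneg h0 hs],
    fun A => hs.sum_le_tsum A fun q _ => h0 q⟩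

lemma SolvesLS.mono {τ : Transport} {U V : ℝ → State N} {I J : Set ℝ}
    (h : S.SolvesLS τ U I V) (hJ : J ⊆ I) : S.SolvesLS τ U J V :=
  fun n t ht => (h n t (hJ ht)).mono hJ

lemma MemF.eq_of_solvesLS {τ : Transport} {U V W : ℝ → State N} {s : ℝ} (hs : 1 ≤ s)
    (hU : ∀ t, 0 ≤ t → U t ∈ S.nullA) (hμ : 0 < S.muBar τ) (hV : S.MemF χ s V)
    (hW : S.MemF χ s W) (h₁ : S.SolvesLS τ U (Ici 0) V) (h₂ : S.SolvesLS τ U (Ici 0) W)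
    (h0 : V 0 = W 0) {t : ℝ} (ht : 0 ≤ t) : V t = W t :=
  SolvesLS.eq_of_memEnergy hU hμ (hV.memEnergy hs t) (hW.memEnergy hs t)
    (h₁.mono Icc_subset_Ici_self) (h₂.mono Icc_subset_Ici_self) h0 t (right_mem_Icc.2 ht)

end Setting
end LowMach

end

theorem theorem8p1 (χ : LowMach.DyadicCutoff) (N : ℕ) (hN : 2 ≤ N) (s : ℝ) (hs : 1 ≤ s) :
    ∃ c : ℝ, 0 < c ∧ ∀ S : LowMach.Setting N, ∃ C : ℝ, 0 < C ∧
      ∀ (τ : LowMach.Transport) (U : ℝ → LowMach.State N), S.SolvesINSF τ U → S.MemF χ s U →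
      ∀ Vin : LowMach.State N, S.besov χ (s - 1) Vin ≠ ⊤ → Vin ∈ S.nullAPerp →
        -- existence in `F^s`, together with the estimates
        (∃ V : ℝ → LowMach.State N,
          S.MemF χ s V ∧ V 0 = Vin ∧ S.SolvesLS τ U (Ici 0) V ∧
          (∀ t, 0 ≤ t → V t ∈ S.nullAPerp) ∧
          -- uniqueness in `F^s`
          (∀ W : ℝ → LowMach.State N, S.MemF χ s W → W 0 = Vin → S.SolvesLS τ U (Ici 0) W →
            ∀ t, 0 ≤ t → W t = V t) ∧
          -- the energy estimate, for finite times and on the whole half-line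
          (∀ t, 0 ≤ t →
            ENNReal.ofReal (S.normSq (V t))
              + ENNReal.ofReal (2 * S.muBar τ) * ∫⁻ r in Ioc 0 t, S.gradSq (V r)
            ≤ ENNReal.ofReal (S.normSq Vin)) ∧
          ENNReal.ofReal (2 * S.muBar τ) * ∫⁻ r in Ioi 0, S.gradSq (V r)
            ≤ ENNReal.ofReal (S.normSq Vin) ∧
          -- the Besov estimate, for finite times and on the whole half-line
          (∀ t, 0 ≤ t →
            S.besov χ (s - 1) (V t)
              + ENNReal.ofReal (c * S.muBar τ) * ∫⁻ r in Ioc 0 t, S.besov χ (s + 1) (V r)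
            ≤ ENNReal.ofReal (Real.exp (C / S.muBar τ ^ 2 * S.normSq Vin))
              * S.besov χ (s - 1) Vin) ∧
          ENNReal.ofReal (c * S.muBar τ) * ∫⁻ r in Ioi 0, S.besov χ (s + 1) (V r)
            ≤ ENNReal.ofReal (Real.exp (C / S.muBar τ ^ 2 * S.normSq Vin))
              * S.besov χ (s - 1) Vin) ∧
        -- uniqueness in `C([0,T]; L²) ∩ L²(0,T; H¹)`
        (∀ T : ℝ, 0 < T → ∀ V₁ V₂ : ℝ → LowMach.State N,
          S.MemEnergy T V₁ → S.MemEnergy T V₂ →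
          S.SolvesLS τ U (Icc 0 T) V₁ → S.SolvesLS τ U (Icc 0 T) V₂ →
          V₁ 0 = V₂ 0 → ∀ t ∈ Icc 0 T, V₁ t = V₂ t) := by
  -- The constant c is the fraction of the viscosity kept in the Besov estimate. The constant C is
  -- fixed before the transport coefficients, the field 𝒰 and the initial value are introduced.
  refine ⟨1 / 4, by norm_num, fun S => ?_⟩
  obtain ⟨C, hC, hbesov⟩ := S.exists_approx_besov_le χ hs
  refine ⟨C, hC, fun τ U hINSF hUF Vin hin hVin => ?_⟩
  have hμ := S.muBar_pos hN τ
  have hU := hINSF.mem_null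
  refine ⟨?_, fun T _ V₁ V₂ hV₁ hV₂ h₁ h₂ h0 => LowMach.Setting.SolvesLS.eq_of_memEnergy hU hμ hV₁ hV₂ h₁ h₂ h0⟩
  have hUc : ∀ n, ContinuousOn (fun t => (U t).hat n) (Ici 0) := fun n t ht =>
    (hINSF.equation n t ht).continuousWithinAt
  have hrep := S.rep_crd hVin
  have hsq := hrep.hasSum_normSq
  obtain ⟨y, δ, x, hx⟩ := S.exists_approx hU hUc hμ (S.isReal_crd Vin) hrep.vanish
    hsq.summable
  rw [hsq.tsum_eq] at hx
  obtain ⟨B, hB0, hBesov, hB⟩ := hrep.exists_sum_bn_le hin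
  obtain ⟨hb, htilde⟩ := hbesov U _ _ _ y δ x B hU hμ hx hB
  have hV : ∀ t, 0 ≤ t → ∃ V, S.Rep V (x t) := fun t ht =>
    S.exists_rep (hx.isReal ht) (fun i hi => hx.eq_zero ht hi)
      (summable_of_sum_le (fun _ => sq_nonneg _) (hx.sum_le hU hμ.le ht))
  choose! V hVr using hV
  have hc : ∀ i, ContinuousOn (fun t => x t i) (Ici 0) := by
    intro i
    by_cases hi : i.2 = 0
    · exact continuousOn_const.congr fun t ht => hx.eq_zero ht hi
    · exact fun t ht => (hx.hasDerivWithinAt hU hUc hμ.le ht hi).continuousWithinAt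
  have hμ4 : 0 < 1 / 4 * S.muBar τ := by positivity
  have hV0 : V 0 = Vin := by
    have := hVr 0 le_rfl
    -- The limit starts at the acoustic coordinates of `Vin`, and a field in Null(𝒜)^⊥ is determined
    -- by its coordinates.
    rw [hx.apply_zero hrep.vanish] at this
    exact this.eq hrep
  have hF : S.MemF χ s V := LowMach.Setting.memF_of_rep hVr hc hμ4 hb htilde
  have hLS : S.SolvesLS τ U (Ici 0) V := LowMach.Setting.solvesLS_of_rep hVr
    fun i hi t ht => hx.hasDerivWithinAt hU hUc hμ.le ht hi
  have henergy : ∀ t, 0 ≤ t → ENNReal.ofReal (S.normSq (V t))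
      + ENNReal.ofReal (2 * S.muBar τ) * ∫⁻ r in Ioc 0 t, S.gradSq (V r)
      ≤ ENNReal.ofReal (S.normSq Vin) := fun t ht =>
    LowMach.Setting.energy_bound_of_rep hVr hc (by positivity)
      (fun t ht R => hx.energy_le hU hμ.le ht R) ht
  have hbound : ∀ t, 0 ≤ t → S.besov χ (s - 1) (V t)
      + ENNReal.ofReal (1 / 4 * S.muBar τ) * ∫⁻ r in Ioc 0 t, S.besov χ (s + 1) (V r)
      ≤ ENNReal.ofReal (Real.exp (C / S.muBar τ ^ 2 * S.normSq Vin)) * S.besov χ (s - 1) Vin := by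
    intro t ht
    rw [hBesov, ← ENNReal.ofReal_mul (Real.exp_pos _).le, mul_comm (Real.exp _)]
    exact LowMach.Setting.besov_bound_of_rep hVr hc hμ4.le hb ht
  exact ⟨V, hF, hV0, hLS, fun t ht => (hVr t ht).mem_nullAPerp,
    fun W hWF hW0 hW t ht => LowMach.Setting.MemF.eq_of_solvesLS hs hU hμ hWF hF hW hLS
      (hW0.trans hV0.symm) ht,
    henergy, LowMach.mul_lintegral_Ioi_le fun t ht => (le_add_left le_rfl).trans (henergy t ht),
    hbound, LowMach.mul_lintegral_Ioi_le fun t ht => (le_add_left le_rfl).trans (hbound t ht)⟩
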